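/- Fix integers $n>1$ and $d>0$. **The 2-category $\mathcal S(n,d)^*$.** Let $\Lambda(n,d)=\{\lambda\in\mathbb Z_{\ge0}^n:\sum\lambda_i=d\}$, $\alpha_i=(0,\dots,1,-1,\dots,0)$ (with $1$ in place $i$) and $\bar\lambda_i=\lambda_i-\lambda_{i+1}$ for $1\le i\le n-1$. Objects of $\mathcal S(n,d)^*$ are weights; 1-morphisms are finite formal direct sums of shifted signed sequences $\mathcal E_{\pm i_1}\cdots\mathcal E_{\pm i_m}1_\lambda\{t\}$ (from $\lambda$ to $\lambda\pm\alpha_{i_1}\pm\cdots\pm\alpha_{i_m}$); 2-morphisms are matrices of $\mathbb Q$-linear combinations (of arbitrary degree) of string diagrams generated by dots on strands, crossings of two upward or two downward strands, and right and left cups and caps, modulo isotopy of distant generators, the ideal of all diagrams with a region labelled outside $\Lambda(n,d)$, and the local relations of $\mathcal U(\mathfrak{gl}_n)$: biadjointness; cyclicity of dots and crossings; bubbles of negative degree vanish; a bubble of degree $0$ in a region $\lambda$ equals $(-1)^{\lambda_{i+1}}$ (clockwise) resp. $(-1)^{\lambda_{i+1}-1}$ (counterclockwise); the infinite Grassmannian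 relation (product of the two bubble series equal to $-1$), which defines the bubbles with negative labels; the curl (reduction to bubbles) relations and the decompositions of $\mathcal E_i\mathcal E_{-i}$ and $\mathcal E_{-i}\mathcal E_i$; the nilHecke relations; and for $i\ne j$ the usual Khovanov–Lauda relations, with the double crossing of $i,j$ equal to $(i-j)(\text{dot on }i-\text{dot on }j)$ when $|i-j|=1$. The 2-category $\mathbf{Bim}^*$ has commutative graded $\mathbb Q$-algebras as objects, graded bimodules as 1-morphisms (composed by tensor product), and finite sums of homogeneous bimodule maps of arbitrary degree as 2-morphisms. **Claim.** There is an additive 2-functor $\mathcal F_{Bim}\colon\mathcal S(n,d)^*\to\mathbf{Bim}^*$ (a pseudofunctor, with coherence isomorphisms of degree $0$) with the following values. Write $k_i=\lambda_1+\cdots+\lambda_i$, and call $z_{k_{i-1}+1},\dots,z_{k_i}$ the $i$-th block of $\lambda$; all $z_j$ have degree $2$. 1. *Objects.* $\lambda\mapsto R^\lambda=\mathbb Q[z_1,\dots,z_d]^{S_{\lambda_1}\times\cdots\times S_{\lambda_n}}$ for $\lambda\in\Lambda(n,d)$, and the zero ring otherwise. 2. *1-morphisms.* $1_\lambda\{t\}\mapsto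 R^\lambda\{t\}$; $\mathcal E_{\pm i}1_\lambda\{t\}$ is sent to the bimodule of the corresponding ladder MOY diagram, i.e. to the $(R^{\lambda\pm\alpha_i},R^\lambda)$-bimodule of polynomials invariant under $(S_\lambda)\cap (S_{\lambda\pm\alpha_i})$, shifted by $\{t+1+k_{i-1}+k_i-k_{i+1}\}$ for $+$ and by $\{t+1-k_i\}$ for $-$; composites go to tensor products and direct sums to direct sums. The thin edge of $\mathcal E_{+i}1_\lambda$ carries the variable $z_{k_i+1}$, that of $\mathcal E_{-i}1_\lambda$ the variable $z_{k_i}$. 3. *2-morphisms.* Put $\partial_{xy}(p)=(p-p|_{x\leftrightarrow y})/(x-y)$. The generators, with $\mu$ the label of the region on their right, act as follows (identity strands act as identity tensor factors). A dot multiplies by the variable of its thin edge. For a polynomial $Q(x_0,x_1)$ in the variables of the left and right thin edges, the upward crossing $\mathcal E_i\mathcal E_j\to\mathcal E_j\mathcal E_i$ sends $Q$ to $\partial_{x_0x_1}Q$ if $i=j$, to $Q(x_1,x_0)(x_1-x_0)$ if $i=j+1$, and to $Q(x_1,x_0)$ otherwise; the downward crossing $\mathcal E_{-i}\mathcal E_{-j}\to\mathcal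 E_{-j}\mathcal E_{-i}$ sends $Q$ to $-\partial_{x_0x_1}Q$ if $i=j$, to $Q(x_1,x_0)(x_0-x_1)$ if $j=i+1$, and to $Q(x_1,x_0)$ otherwise. The right cup $1_\mu\to\mathcal E_{-i}\mathcal E_i1_\mu$ is $m\mapsto\sum_{\ell=0}^{\mu_i}(-1)^\ell e_\ell\otimes x^{\mu_i-\ell}\otimes m$ with $e_\ell$ in the $i$-th block of $\mu$; the left cup $1_\mu\to\mathcal E_i\mathcal E_{-i}1_\mu$ is $m\mapsto\sum_{\ell=0}^{\mu_{i+1}}(-1)^\ell y^\ell\otimes e_{\mu_{i+1}-\ell}\otimes m$ with $e$ in the $(i+1)$-st block, where $x$, $y$ are the variables of the thin edge of $\mathcal E_i$. The left cap $\mathcal E_{-i}\mathcal E_i1_\mu\to1_\mu$ sends $b\otimes c$ to $\partial_{u_1x}\cdots\partial_{u_rx}(bc)$, where $x$ is the first variable of the $(i+1)$-st block of $\mu$ and $u_1,\dots,u_r$ are the others; the right cap $\mathcal E_i\mathcal E_{-i}1_\mu\to1_\mu$ sends $b\otimes c$ to $\partial_{xu_1}\cdots\partial_{xu_r}(bc)$,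 where $x$ is the last variable of the $i$-th block of $\mu$ and the $u$'s are the others. 4. *Sideways crossings.* For $i\ne j$, the sideways crossings $\mathcal E_j\mathcal E_{-i}1_\mu\to\mathcal E_{-i}\mathcal E_j1_\mu$ and $\mathcal E_{-j}\mathcal E_i1_\mu\to\mathcal E_i\mathcal E_{-j}1_\mu$ send $x^a\otimes x^b$ to $x^b\otimes x^a$; for $i=j$ the same holds if $a+b<\mu_i$, respectively $a+b<\mu_{i+1}$. 5. *Degrees.* A diagram of degree $k$ from the sequence $w$ to the sequence $w'$ is sent to a bimodule map that is homogeneous of degree $k+c(w')-c(w)$, where $c(w)$ is the sum, over the letters $\pm i$ of $w$, of $\pm k_{i-1}$ of the region to the right of the letter. 6. *Bubbles.* In a region $\mu$ with $a=\mu_i$, $b=\mu_{i+1}$, the (real or fake) dotted bubbles of colour $i$ with label $r\in\mathbb Z$ act as multiplication by the following symmetric polynomials: the clockwise one by $(-1)^{b}\sum_{l=0}^{m}(-1)^le_l(\text{block }i+1)\,h_{m-l}(\text{block }i)$ with $m=b-a+r+1$, the counterclockwise one by $(-1)^{b+1}\sum_{l=0}^{m}(-1)^le_l(\text{block }i)\,h_{m-l}(\text{block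 }i+1)$ with $m=a-b+r+1$ (and by $0$ if $m<0$). 7. *Factorization.* Let $\mathcal U(\mathfrak{sl}_n)^*$ be Khovanov and Lauda's 2-category with regions labelled by $\mathbb Z^{n-1}$, whose relations are obtained from those of $\mathcal U(\mathfrak{gl}_n)$ by multiplying left caps by $(-1)^{\lambda_{i+1}+1}$ and left cups by $(-1)^{\lambda_{i+1}}$, $\lambda$ being the $\mathfrak{gl}_n$-label of the region on the right of the cap or cup. There is a 2-functor $\Psi_{n,d}\colon\mathcal U(\mathfrak{sl}_n)^*\to\mathcal S(n,d)^*$ that sends a weight $\bar\mu$ to the $\lambda\in\mathbb Z^n$ with $\lambda_i-\lambda_{i+1}=\bar\mu_i$ and $\sum\lambda_i=d$ (and to a zero object if $\lambda$ does not exist or $\lambda\notin\Lambda(n,d)$), and a diagram to the same diagram times these signs. There is a 2-functor $\Gamma^G_d\colon\mathcal U(\mathfrak{sl}_n)^*\to\mathbf{Bim}^*$ that agrees with $\mathcal F_{Bim}\circ\Psi_{n,d}$ on objects and 1-morphisms and is given on the generating 2-morphisms by Khovanov and Lauda's formulas: dots multiply by $x$; the upward $ii$-crossing sends $x^a\otimes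 x^b$ to $\sum_{f<a}x^{a+b-1-f}\otimes x^f-\sum_{g<b}x^{a+b-1-g}\otimes x^g$, the downward one to the negative of this; the crossings for $i\neq j$ are as in 3; the right and left cups are $\sum_\ell(-1)^{\mu_i-\ell}e_{\mu_i-\ell}\otimes x^\ell$ and $\sum_\ell(-1)^{\mu_{i+1}-\ell}x^\ell\otimes e_{\mu_{i+1}-\ell}$; the right and left caps send $x^a\otimes x^b$ to $h_{a+b+1-\mu_i}(\text{block }i)$ and $h_{a+b+1-\mu_{i+1}}(\text{block }i+1)$ (zero for negative index). On all 2-morphisms $\Gamma^G_d=\mathcal F_{Bim}\circ\Psi_{n,d}$. -/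

import Mathlib

set_option linter.all false

namespace Schur

open CategoryTheory

/-! ### Diagrams -/

/-- A letter of a signed sequence: `(true, i)` stands for `+i` and `(false, i)` for `-i`.
The index set `I = {1, …, n-1}` is `Fin (n - 1)`. -/
abbrev Letter (n : ℕ) := Bool × Fin (n - 1)

/-- A signed sequence, i.e. the 1-morphism `𝓔_{a₁} 𝓔_{a₂} ⋯ 𝓔_{aₘ}` (source weight on the right). -/
abbrev SSeq (n : ℕ) := List (Letter n)

/-- The upward letter `+i`. -/
abbrev up {n : ℕ} (i : Fin (n - 1)) : Letter n := (true, i)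

/-- The downward letter `-i`. -/
abbrev dn {n : ℕ} (i : Fin (n - 1)) : Letter n := (false, i)

/-- Generating 2-morphisms: dots, crossings of two equally oriented strands (the bottom strands are
coloured `i`, `j` from left to right), and the right/left pointing cups and caps. -/
inductive Gen (n : ℕ) where
  | dot (a : Letter n)
  | cross (b : Bool) (i j : Fin (n - 1))
  | rcup (i : Fin (n - 1))
  | lcup (i : Fin (n - 1))
  | rcap (i : Fin (n - 1))
  | lcap (i : Fin (n - 1))

/-- Bottom boundary of a generator. -/
def Gen.src {n : ℕ} : Gen n → SSeq n
  | .dot a => [a]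
  | .cross b i j => [(b, i), (b, j)]
  | .rcup _ => []
  | .lcup _ => []
  | .rcap i => [up i, dn i]
  | .lcap i => [dn i, up i]

/-- Top boundary of a generator. -/
def Gen.tgt {n : ℕ} : Gen n → SSeq n
  | .dot a => [a]
  | .cross b i j => [(b, j), (b, i)]
  | .rcup i => [dn i, up i]
  | .lcup i => [up i, dn i]
  | .rcap _ => []
  | .lcap _ => []

/-- A horizontal slice of a diagram: one generator with identity strands `left` and `right`. -/
structure Layer (n : ℕ) where
  left : SSeq n
  gen : Gen n
  right : SSeq n

/-- Formal linear combinations of stacks of layers; the product `x * y` is the vertical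
composite with `x` at the bottom and `y` on top. -/
abbrev Alg (n : ℕ) := FreeAlgebra ℚ (Layer n)

/-- A single layer. -/
def lay {n : ℕ} (u : SSeq n) (g : Gen n) (v : SSeq n) : Alg n := FreeAlgebra.ι ℚ ⟨u, g, v⟩

/-- Put the identity strands `u` to the left and `v` to the right of a diagram. -/
def whisk {n : ℕ} (u v : SSeq n) : Alg n →ₐ[ℚ] Alg n :=
  FreeAlgebra.lift ℚ fun l => lay (u ++ l.left) l.gen (l.right ++ v)

@[simp] theorem whisk_lay {n : ℕ} (u v a : SSeq n) (g : Gen n) (b : SSeq n) :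
    whisk u v (lay a g b) = lay (u ++ a) g (b ++ v) := by simp [whisk, lay]

theorem whisk_whisk {n : ℕ} (u v a b : SSeq n) (x : Alg n) :
    whisk u v (whisk a b x) = whisk (u ++ a) (b ++ v) x := by
  have : (whisk u v).comp (whisk a b) = whisk (u ++ a) (b ++ v) := by
    ext l; simp [whisk, lay]
  exact DFunLike.congr_fun this x

theorem whisk_nil {n : ℕ} (x : Alg n) : whisk [] [] x = x := by
  have : whisk (n := n) [] [] = AlgHom.id ℚ _ := by ext l; simp [whisk, lay]
  exact DFunLike.congr_fun this x

/-- The bilinear form `i · j`. -/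
def cartan {n : ℕ} (i j : Fin (n - 1)) : ℤ :=
  if i = j then 2 else if i.val + 1 = j.val ∨ j.val + 1 = i.val then -1 else 0

/-- Data for a 2-category of diagrams: region labels `W` with `root i` the weight of `𝓔_{+i}`,
the function `bar lam i = λ̄_i`, local relations `rel lam s t x` (`x = 0` as a combination of
diagrams from `s` to `t` whose rightmost region is `lam`), and the region labels which are
set equal to zero. -/
structure Pres (n : ℕ) where
  W : Type
  [grp : AddCommGroup W]
  root : Fin (n - 1) → W
  bar : W → Fin (n - 1) → ℤ
  rel : W → SSeq n → SSeq n → Alg n → Prop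
  dead : W → Prop

attribute [instance] Pres.grp

section Pres

variable {n : ℕ} (P : Pres n)

/-- The weight `i_Λ` of a signed sequence. -/
def Pres.wt {n : ℕ} (P : Pres n) : SSeq n → P.W
  | [] => 0
  | (b, i) :: w => (if b then P.root i else - P.root i) + Pres.wt P w

@[simp] theorem Pres.wt_append (u v : SSeq n) : P.wt (u ++ v) = P.wt u + P.wt v := by
  induction u with
  | nil => simp [Pres.wt]
  | cons a u ih => obtain ⟨b, i⟩ := a; simp [Pres.wt, ih, add_assoc]

/-- The degree of a generator whose right region is labelled `mu`. -/
def Pres.gdeg (mu : P.W) : Gen n → ℤ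
  | .dot _ => 2
  | .cross _ i j => - cartan i j
  | .rcup i => 1 + P.bar mu i
  | .lcup i => 1 - P.bar mu i
  | .rcap i => 1 - P.bar mu i
  | .lcap i => 1 + P.bar mu i

/-- `x` is a diagram of degree `k` from `w` to `w'` with rightmost region `lam`. -/
inductive IsDiag (lam : P.W) : SSeq n → SSeq n → ℤ → Alg n → Prop
  | id (w : SSeq n) : IsDiag lam w w 0 1
  | cons (u : SSeq n) (g : Gen n) (v : SSeq n) {w : SSeq n} {k : ℤ} {x : Alg n}
      (h : IsDiag lam (u ++ g.tgt ++ v) w k x) :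
      IsDiag lam (u ++ g.src ++ v) w (P.gdeg (lam + P.wt v) g + k) (lay u g v * x)

/-- Linear combinations of diagrams from `w` to `w'`, of all degrees. -/
def Pres.dia (lam : P.W) (w w' : SSeq n) : Submodule ℚ (Alg n) :=
  Submodule.span ℚ {x | ∃ k, IsDiag P lam w w' k x}

/-- Local relations: those of the presentation, and the height exchange of distant generators. -/
inductive LocalRel (mu : P.W) : SSeq n → SSeq n → Alg n → Prop
  | rel {s t : SSeq n} {r : Alg n} (h : P.rel mu s t r) (hd : r ∈ P.dia mu s t) : LocalRel mu s t r
  | exchange (g : Gen n) (v : SSeq n) (g' : Gen n) :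
      LocalRel mu (g.src ++ v ++ g'.src) (g.tgt ++ v ++ g'.tgt)
        (lay [] g (v ++ g'.src) * lay (g.tgt ++ v) g' [] -
          lay (g.src ++ v) g' [] * lay [] g (v ++ g'.tgt))

/-- The slice `y` meets a region whose label is set to zero. -/
def Pres.DeadWord (lam : P.W) (y : SSeq n) : Prop := ∃ u v, y = u ++ v ∧ P.dead (lam + P.wt v)

/-- The relations between diagrams from `w` to `w'`: the 2-sided (for both compositions) ideal
generated by the local relations and by all diagrams that contain a dead region. -/
def Pres.ker (lam : P.W) (w w' : SSeq n) : Submodule ℚ (Alg n) :=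
  Submodule.span ℚ
    ({x | ∃ (u s t v : SSeq n) (a r b : Alg n), a ∈ P.dia lam w (u ++ s ++ v) ∧
        LocalRel P (lam + P.wt v) s t r ∧ b ∈ P.dia lam (u ++ t ++ v) w' ∧
        x = a * whisk u v r * b} ∪
      {x | ∃ (y : SSeq n) (a b : Alg n), P.DeadWord lam y ∧ a ∈ P.dia lam w y ∧
        b ∈ P.dia lam y w' ∧ x = a * b})

/-- The space of 2-morphisms (of all degrees) between two signed sequences. -/
def Hom2 (lam : P.W) (w w' : SSeq n) : Type :=
  P.dia lam w w' ⧸ (P.ker lam w w').comap (P.dia lam w w').subtype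

instance (lam : P.W) (w w' : SSeq n) : AddCommGroup (Hom2 P lam w w') :=
  inferInstanceAs (AddCommGroup (_ ⧸ _))

instance (lam : P.W) (w w' : SSeq n) : Module ℚ (Hom2 P lam w w') :=
  inferInstanceAs (Module ℚ (_ ⧸ _))

/-- The class of a combination of diagrams. -/
def Hom2.mk (lam : P.W) {w w' : SSeq n} : P.dia lam w w' →ₗ[ℚ] Hom2 P lam w w' :=
  Submodule.mkQ _

variable {P}

theorem IsDiag.comp {lam : P.W} {w w' w'' : SSeq n} {k l : ℤ} {x y : Alg n}
    (hx : IsDiag P lam w w' k x) (hy : IsDiag P lam w' w'' l y) :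
    IsDiag P lam w w'' (k + l) (x * y) := by
  induction hx with
  | id w => simpa using hy
  | cons u g v h ih =>
    rw [mul_assoc, add_assoc]
    exact .cons u g v (ih hy)

theorem IsDiag.whisk {lam lam' : P.W} {w w' : SSeq n} {k : ℤ} {x : Alg n} (a b : SSeq n)
    (hb : lam' + P.wt b = lam) (hx : IsDiag P lam w w' k x) :
    IsDiag P lam' (a ++ w ++ b) (a ++ w' ++ b) k (whisk a b x) := by
  induction hx with
  | id w => simpa using IsDiag.id _
  | cons u g v h ih =>
    have := IsDiag.cons (P := P) (lam := lam') (a ++ u) g (v ++ b) (w := a ++ _ ++ b)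
      (by simpa using ih)
    rw [map_mul, whisk_lay]
    simpa [← hb, add_assoc, add_comm (P.wt v)] using this

theorem one_mem_dia (lam : P.W) {w w' : SSeq n} (h : w = w') : (1 : Alg n) ∈ P.dia lam w w' := by
  subst h; exact Submodule.subset_span ⟨0, .id w⟩

theorem mul_mem_dia {lam : P.W} {w w' w'' : SSeq n} {x y : Alg n} (hx : x ∈ P.dia lam w w')
    (hy : y ∈ P.dia lam w' w'') : x * y ∈ P.dia lam w w'' := by
  induction hx using Submodule.span_induction with
  | mem x hx =>
    induction hy using Submodule.span_induction with
    | mem y hy =>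
      obtain ⟨k, hx⟩ := hx; obtain ⟨l, hy⟩ := hy
      exact Submodule.subset_span ⟨_, hx.comp hy⟩
    | zero => simp
    | add y z _ _ h1 h2 => rw [mul_add]; exact add_mem h1 h2
    | smul c y _ h => rw [mul_smul_comm]; exact Submodule.smul_mem _ _ h
  | zero => simp
  | add y z _ _ h1 h2 => rw [add_mul]; exact add_mem h1 h2
  | smul c y _ h => rw [smul_mul_assoc]; exact Submodule.smul_mem _ _ h

theorem whisk_mem_dia {lam lam' : P.W} {w w' : SSeq n} {x : Alg n} (a b : SSeq n)
    (hb : lam' + P.wt b = lam) (hx : x ∈ P.dia lam w w') :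
    whisk a b x ∈ P.dia lam' (a ++ w ++ b) (a ++ w' ++ b) := by
  induction hx using Submodule.span_induction with
  | mem x hx => obtain ⟨k, hx⟩ := hx; exact Submodule.subset_span ⟨k, hx.whisk a b hb⟩
  | zero => simp
  | add y z _ _ h1 h2 => rw [map_add]; exact add_mem h1 h2
  | smul c y _ h => rw [map_smul]; exact Submodule.smul_mem _ _ h

theorem mul_mem_ker_left {lam : P.W} {w w' w'' : SSeq n} {x y : Alg n} (hx : x ∈ P.dia lam w w')
    (hy : y ∈ P.ker lam w' w'') : x * y ∈ P.ker lam w w'' := by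
  induction hy using Submodule.span_induction with
  | mem y hy =>
    rcases hy with ⟨u, s, t, v, a, r, b, ha, hr, hb, rfl⟩ | ⟨y, a, b, hy, ha, hb, rfl⟩
    · exact Submodule.subset_span (Or.inl ⟨u, s, t, v, x * a, r, b, mul_mem_dia hx ha, hr, hb,
        by simp only [mul_assoc]⟩)
    · exact Submodule.subset_span (Or.inr ⟨y, x * a, b, hy, mul_mem_dia hx ha, hb,
        by simp only [mul_assoc]⟩)
  | zero => simp
  | add y z _ _ h1 h2 => rw [mul_add]; exact add_mem h1 h2
  | smul c y _ h => rw [mul_smul_comm]; exact Submodule.smul_mem _ _ h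

theorem mul_mem_ker_right {lam : P.W} {w w' w'' : SSeq n} {x y : Alg n}
    (hx : x ∈ P.ker lam w w') (hy : y ∈ P.dia lam w' w'') : x * y ∈ P.ker lam w w'' := by
  induction hx using Submodule.span_induction with
  | mem x hx =>
    rcases hx with ⟨u, s, t, v, a, r, b, ha, hr, hb, rfl⟩ | ⟨z, a, b, hz, ha, hb, rfl⟩
    · exact Submodule.subset_span (Or.inl ⟨u, s, t, v, a, r, b * y, ha, hr, mul_mem_dia hb hy,
        by simp only [mul_assoc]⟩)
    · exact Submodule.subset_span (Or.inr ⟨z, a, b * y, hz, ha, mul_mem_dia hb hy,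
        by simp only [mul_assoc]⟩)
  | zero => simp
  | add y z _ _ h1 h2 => rw [add_mul]; exact add_mem h1 h2
  | smul c y _ h => rw [smul_mul_assoc]; exact Submodule.smul_mem _ _ h

theorem whisk_mem_ker {lam lam' : P.W} {w w' : SSeq n} {x : Alg n} (a b : SSeq n)
    (hb : lam' + P.wt b = lam) (hx : x ∈ P.ker lam w w') :
    whisk a b x ∈ P.ker lam' (a ++ w ++ b) (a ++ w' ++ b) := by
  induction hx using Submodule.span_induction with
  | mem x hx =>
    rcases hx with ⟨u, s, t, v, c, r, d, hc, hr, hd, rfl⟩ | ⟨z, c, d, ⟨u, v, rfl, hz⟩, hc, hd, rfl⟩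
    · refine Submodule.subset_span (Or.inl ⟨a ++ u, s, t, v ++ b, whisk a b c, r, whisk a b d,
        ?_, ?_, ?_, ?_⟩)
      · simpa using whisk_mem_dia a b hb hc
      · simpa [← hb, add_assoc, add_comm (P.wt v)] using hr
      · simpa using whisk_mem_dia a b hb hd
      · simp [whisk_whisk]
    · refine Submodule.subset_span (Or.inr ⟨a ++ (u ++ v) ++ b, whisk a b c, whisk a b d,
        ⟨a ++ u, v ++ b, by simp, ?_⟩, whisk_mem_dia a b hb hc, whisk_mem_dia a b hb hd, by simp⟩)
      simpa [← hb, add_assoc, add_comm (P.wt v)] using hz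
  | zero => simp
  | add y z _ _ h1 h2 => rw [map_add]; exact add_mem h1 h2
  | smul c y _ h => rw [map_smul]; exact Submodule.smul_mem _ _ h

/-- Height exchange of two generators, in context. -/
theorem lay_exchange (lam : P.W) (u : SSeq n) (g : Gen n) (v : SSeq n) (g' : Gen n) (z : SSeq n) :
    lay u g (v ++ g'.src ++ z) * lay (u ++ g.tgt ++ v) g' z -
      lay (u ++ g.src ++ v) g' z * lay u g (v ++ g'.tgt ++ z) ∈
      P.ker lam (u ++ g.src ++ v ++ g'.src ++ z) (u ++ g.tgt ++ v ++ g'.tgt ++ z) := by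
  refine Submodule.subset_span (Or.inl ⟨u, g.src ++ v ++ g'.src, g.tgt ++ v ++ g'.tgt, z, 1, _, 1,
    one_mem_dia _ (by simp), .exchange g v g', one_mem_dia _ (by simp), ?_⟩)
  simp

theorem layer_mem_dia (lam : P.W) (u : SSeq n) (g : Gen n) (v : SSeq n) :
    lay u g v ∈ P.dia lam (u ++ g.src ++ v) (u ++ g.tgt ++ v) :=
  Submodule.subset_span ⟨_, by simpa using IsDiag.cons u g v (.id _)⟩

/-- Height exchange of two diagrams placed side by side. -/
theorem exchange_mem_ker {lam mu : P.W} {w₁ w₁' w₂ w₂' : SSeq n} {x y : Alg n}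
    (hx : x ∈ P.dia mu w₁ w₁') (hy : y ∈ P.dia lam w₂ w₂')
    (h' : lam + P.wt w₂' = mu) :
    whisk [] w₂ x * whisk w₁' [] y - whisk w₁ [] y * whisk [] w₂' x ∈
      P.ker lam (w₁ ++ w₂) (w₁' ++ w₂') := by
  have hL : ∀ (g : Gen n) (u v : SSeq n) (w w' : SSeq n) (k : ℤ) (y : Alg n),
      IsDiag P lam w w' k y → lay u g (v ++ w) * whisk (u ++ g.tgt ++ v) [] y -
        whisk (u ++ g.src ++ v) [] y * lay u g (v ++ w') ∈
        P.ker lam (u ++ g.src ++ v ++ w) (u ++ g.tgt ++ v ++ w') := by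
    intro g u v w w' k y hy
    induction hy with
    | id w => simp
    | cons a g' b hy ih =>
      rename_i w' k y
      have e1 := mul_mem_ker_right (lay_exchange lam u g (v ++ a) g' b)
        (y := whisk (u ++ g.tgt ++ v) [] y) (w'' := u ++ g.tgt ++ v ++ w') (by
          have := whisk_mem_dia (lam' := lam) (u ++ g.tgt ++ v) [] (by simp [Pres.wt])
            (Submodule.subset_span ⟨k, hy⟩ : y ∈ P.dia lam _ _)
          simpa using this)
      have e2 := mul_mem_ker_left (w := u ++ g.src ++ v ++ a ++ g'.src ++ b)
        (by simpa using layer_mem_dia lam (u ++ g.src ++ v ++ a) g' b) (by simpa using ih)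
      have := add_mem (by simpa using e1) e2
      convert this using 1
      · simp
      · simp [sub_mul, mul_sub, mul_assoc]
  induction hy using Submodule.span_induction with
  | mem y hy =>
    obtain ⟨l, hy⟩ := hy
    induction hx using Submodule.span_induction with
    | mem x hx =>
      obtain ⟨k, hx⟩ := hx
      induction hx with
      | id w => simp
      | cons u g v hx ih =>
        rename_i w k x
        have e0 := hL g u v _ _ _ _ hy
        have e1 := mul_mem_ker_right (w'' := w ++ w₂') (y := whisk [] w₂' x) e0 (by
          have := whisk_mem_dia [] w₂' h' (Submodule.subset_span ⟨k, hx⟩ : x ∈ P.dia mu _ _)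
          simpa using this)
        have e2 := mul_mem_ker_left (w := u ++ g.src ++ v ++ w₂) (x := lay u g (v ++ w₂))
          (by simpa using layer_mem_dia lam u g (v ++ w₂)) (by simpa using ih)
        have := add_mem e2 e1
        convert this using 1
        simp [sub_mul, mul_sub, mul_assoc]
    | zero => simp
    | add x z _ _ h1 h2 =>
      rw [map_add, map_add, add_mul, mul_add, add_sub_add_comm]; exact add_mem h1 h2
    | smul c x _ h =>
      rw [map_smul, map_smul, smul_mul_assoc, mul_smul_comm, ← smul_sub]
      exact Submodule.smul_mem _ _ h
  | zero => simp
  | add y z _ _ h1 h2 =>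
    rw [map_add, map_add, add_mul, mul_add, add_sub_add_comm]; exact add_mem h1 h2
  | smul c x _ h =>
    rw [map_smul, map_smul, smul_mul_assoc, mul_smul_comm, ← smul_sub]
    exact Submodule.smul_mem _ _ h

/-- The identity 2-morphism, between two equal words. -/
def Hom2.one (lam : P.W) {w w' : SSeq n} (h : w = w') : Hom2 P lam w w' :=
  Hom2.mk P lam ⟨1, one_mem_dia lam h⟩

/-- Vertical composition. -/
def Hom2.comp {lam : P.W} {w w' w'' : SSeq n} (x : Hom2 P lam w w') (y : Hom2 P lam w' w'') :
    Hom2 P lam w w'' :=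
  Quotient.map₂ (sa := Submodule.quotientRel _) (sb := Submodule.quotientRel _)
    (sc := Submodule.quotientRel _) (fun a b => ⟨a.1 * b.1, mul_mem_dia a.2 b.2⟩) (by
    intro a a' ha b b' hb
    refine (Submodule.quotientRel_def _).2 ?_
    have ha := (Submodule.quotientRel_def _).1 ha
    have hb := (Submodule.quotientRel_def _).1 hb
    have := add_mem (mul_mem_ker_right ha b.2) (mul_mem_ker_left a'.2 hb)
    simpa [sub_mul, mul_sub] using this) x y

/-- Horizontal composition with the identities of `a` (on the left) and `b` (on the right). -/
def Hom2.whisk {lam lam' : P.W} {w w' : SSeq n} (a b : SSeq n) (hb : lam' + P.wt b = lam)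
    (x : Hom2 P lam w w') {v v' : SSeq n} (hv : a ++ w ++ b = v) (hv' : a ++ w' ++ b = v') :
    Hom2 P lam' v v' :=
  Quotient.map (sa := Submodule.quotientRel _) (sb := Submodule.quotientRel _)
    (fun x => ⟨Schur.whisk a b x.1, by subst hv hv'; exact whisk_mem_dia a b hb x.2⟩) (by
    intro x x' hx
    refine (Submodule.quotientRel_def _).2 ?_
    have hx := (Submodule.quotientRel_def _).1 hx
    subst hv hv'
    simpa using whisk_mem_ker a b hb hx) x

theorem Hom2.ind {lam : P.W} {w w' : SSeq n} {C : Hom2 P lam w w' → Prop}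
    (h : ∀ x, C (Hom2.mk P lam x)) (x : Hom2 P lam w w') : C x :=
  Quotient.inductionOn' x h

theorem Hom2.mk_eq {lam : P.W} {w w' : SSeq n} {x y : P.dia lam w w'} (h : x.1 = y.1) :
    Hom2.mk P lam x = Hom2.mk P lam y := congrArg _ (Subtype.ext h)

theorem Hom2.mk_eq' {lam : P.W} {w w' : SSeq n} {x y : P.dia lam w w'}
    (h : x.1 - y.1 ∈ P.ker lam w w') : Hom2.mk P lam x = Hom2.mk P lam y :=
  (Submodule.Quotient.eq _).2 h

variable (P)

/-- The objects of the 2-category of diagrams: region labels. -/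
structure Obj where
  wt : P.W

/-- A 1-morphism `𝓔_w 1_a {shift}` from `a` to `b = a + w_Λ`. -/
structure OneMor (a b : Obj P) where
  word : SSeq n
  shift : ℤ
  eq : a.wt + P.wt word = b.wt

variable {P}

instance (a b : Obj P) : Category (OneMor P a b) where
  Hom f g := Hom2 P a.wt f.word g.word
  id f := Hom2.one _ rfl
  comp x y := Hom2.comp x y
  id_comp x := by
    induction x using Hom2.ind; exact Hom2.mk_eq (one_mul _)
  comp_id x := by
    induction x using Hom2.ind; exact Hom2.mk_eq (mul_one _)
  assoc x y z := by
    induction x using Hom2.ind; induction y using Hom2.ind; induction z using Hom2.ind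
    exact Hom2.mk_eq (mul_assoc _ _ _)

instance (a b : Obj P) : Preadditive (OneMor P a b) where
  homGroup f g := inferInstanceAs (AddCommGroup (Hom2 P a.wt f.word g.word))
  add_comp f g h x y z := by
    induction x using Hom2.ind; induction y using Hom2.ind; induction z using Hom2.ind
    exact Hom2.mk_eq (add_mul _ _ _)
  comp_add f g h x y z := by
    induction x using Hom2.ind; induction y using Hom2.ind; induction z using Hom2.ind
    exact Hom2.mk_eq (mul_add _ _ _)

instance : CategoryStruct (Obj P) where
  Hom a b := OneMor P a b
  id a := ⟨[], 0, by simp [Pres.wt]⟩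
  comp f g := ⟨g.word ++ f.word, g.shift + f.shift, by
    rw [P.wt_append, add_comm (P.wt g.word), ← add_assoc, f.eq, g.eq]⟩

/-- The isomorphism between 1-morphisms with the same word. -/
def wordIso {a b : Obj P} {f g : OneMor P a b} (h : f.word = g.word) : f ≅ g where
  hom := Hom2.one _ h
  inv := Hom2.one _ h.symm
  hom_inv_id := Hom2.mk_eq (one_mul _)
  inv_hom_id := Hom2.mk_eq (one_mul _)

/-- The 2-category of diagrams. Its 1-morphisms are the shifted signed sequences, its
2-morphisms all linear combinations of diagrams, of arbitrary degree, modulo relations. -/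
instance : Bicategory (Obj P) where
  homCategory a b := inferInstanceAs (Category (OneMor P a b))
  whiskerLeft {a b c} f {g h} η := Hom2.whisk [] f.word f.eq η rfl rfl
  whiskerRight {a b c} {f g} η h :=
    Hom2.whisk h.word [] (by simp [Pres.wt]) η (List.append_nil _) (List.append_nil _)
  associator f g h := wordIso (List.append_assoc _ _ _).symm
  leftUnitor f := wordIso (List.append_nil _)
  rightUnitor f := wordIso rfl
  whiskerLeft_id f g := Hom2.mk_eq (map_one _)
  whiskerLeft_comp f _ _ _ x y := by
    induction x using Hom2.ind; induction y using Hom2.ind; exact Hom2.mk_eq (map_mul _ _ _)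
  id_whiskerLeft x := by
    induction x using Hom2.ind; refine Hom2.mk_eq ?_
    exact (whisk_nil _).trans (by simp)
  comp_whiskerLeft f g _ _ x := by
    induction x using Hom2.ind; refine Hom2.mk_eq ?_
    exact (whisk_whisk [] f.word [] g.word _).symm.trans ((one_mul _).trans (mul_one _)).symm
  id_whiskerRight f g := Hom2.mk_eq (map_one _)
  comp_whiskerRight x y _ := by
    induction x using Hom2.ind; induction y using Hom2.ind; exact Hom2.mk_eq (map_mul _ _ _)
  whiskerRight_id x := by
    induction x using Hom2.ind; refine Hom2.mk_eq ?_
    exact (whisk_nil _).trans (by simp)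
  whiskerRight_comp x g h := by
    induction x using Hom2.ind; refine Hom2.mk_eq ?_
    exact (whisk_whisk h.word [] g.word [] _).symm.trans ((one_mul _).trans (mul_one _)).symm
  whisker_assoc f _ _ x h := by
    induction x using Hom2.ind; refine Hom2.mk_eq ?_
    refine Eq.trans ?_ ((one_mul _).trans (mul_one _)).symm
    refine (whisk_whisk _ _ _ _ _).trans (Eq.trans ?_ (whisk_whisk _ _ _ _ _).symm)
    simp only [List.append_nil, List.nil_append]
  whisker_exchange {a b c f g h i} x y := by
    induction x using Hom2.ind with | h x => ?_
    induction y using Hom2.ind with | h y => ?_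
    exact Hom2.mk_eq' (exchange_mem_ker y.2 x.2 g.eq)
  pentagon f g h i := Hom2.mk_eq (by simp)
  triangle f g := Hom2.mk_eq (by simp)

end Pres

end Schur


namespace Schur

open CategoryTheory Bicategory

/-! ### Formal finite direct sums of 1-morphisms -/

/-- A bicategory whose categories of 1-morphisms are preadditive, with additive whiskering. -/
class AdditiveBicategory (B : Type*) [Bicategory B] where
  [preadd : ∀ a b : B, Preadditive (a ⟶ b)]
  add_whiskerRight : ∀ {a b c : B} {f g : a ⟶ b} (η θ : f ⟶ g) (h : b ⟶ c),
    (η + θ) ▷ h = η ▷ h + θ ▷ h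
  whiskerLeft_add : ∀ {a b c : B} (f : a ⟶ b) {g h : b ⟶ c} (η θ : g ⟶ h),
    f ◁ (η + θ) = f ◁ η + f ◁ θ

attribute [instance] AdditiveBicategory.preadd

/-- The additive envelope of `B`: the same objects, 1-morphisms are finite families (formal direct
sums) of 1-morphisms of `B`, and 2-morphisms are matrices of 2-morphisms of `B`. -/
structure AddEnv (B : Type*) where
  obj : B

namespace AddEnv

universe w v u

variable {B : Type u} [Bicategory.{w, v} B] [AdditiveBicategory B]

/-- Horizontal composition. -/
def hc {a b c : B} {f f' : a ⟶ b} {g g' : b ⟶ c} (α : f ⟶ f') (β : g ⟶ g') : f ≫ g ⟶ f' ≫ g' :=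
  α ▷ g ≫ f' ◁ β

theorem hc_comp {a b c : B} {f f' f'' : a ⟶ b} {g g' g'' : b ⟶ c} (α : f ⟶ f') (β : g ⟶ g')
    (α' : f' ⟶ f'') (β' : g' ⟶ g'') : hc (α ≫ α') (β ≫ β') = hc α β ≫ hc α' β' := by
  simp [hc, whisker_exchange_assoc]

theorem hc_id {a b c : B} (f : a ⟶ b) (g : b ⟶ c) : hc (𝟙 f) (𝟙 g) = 𝟙 (f ≫ g) := by simp [hc]

/-- Horizontal composition as a biadditive map. -/
def hcHom {a b c : B} (f f' : a ⟶ b) (g g' : b ⟶ c) :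
    (f ⟶ f') →+ (g ⟶ g') →+ (f ≫ g ⟶ f' ≫ g') :=
  AddMonoidHom.mk' (fun α => AddMonoidHom.mk' (fun β => hc α β) (by
    intro x y; simp [hc, AdditiveBicategory.whiskerLeft_add])) (by
    intro x y; ext β; simp [hc, AdditiveBicategory.add_whiskerRight])

theorem hc_sum {a b c : B} {f f' : a ⟶ b} {g g' : b ⟶ c} {ι κ : Type*} (s : Finset ι)
    (t : Finset κ) (α : ι → (f ⟶ f')) (β : κ → (g ⟶ g')) :
    hc (∑ i ∈ s, α i) (∑ j ∈ t, β j) = ∑ i ∈ s, ∑ j ∈ t, hc (α i) (β j) := by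
  change hcHom f f' g g' _ _ = _
  simp only [map_sum, AddMonoidHom.finsetSum_apply]
  rw [Finset.sum_comm]; rfl

theorem hc_zero_left {a b c : B} {f f' : a ⟶ b} {g g' : b ⟶ c} (β : g ⟶ g') :
    hc (0 : f ⟶ f') β = 0 := by
  change hcHom f f' g g' _ _ = _; simp

theorem hc_zero_right {a b c : B} {f f' : a ⟶ b} {g g' : b ⟶ c} (α : f ⟶ f') :
    hc α (0 : g ⟶ g') = 0 := by
  change hcHom f f' g g' _ _ = _; simp

noncomputable section

/-- An entry of a matrix of 2-morphisms. -/
def ent {a b : B} {F G : Mat_ (a ⟶ b)} (A : F ⟶ G) (i : F.ι) (j : G.ι) : F.X i ⟶ G.X j := A i j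

/-- The matrix with given entries. -/
def ofEnt {a b : B} {F G : Mat_ (a ⟶ b)} (A : ∀ i j, F.X i ⟶ G.X j) : F ⟶ G := A

@[simp] theorem ent_ofEnt {a b : B} {F G : Mat_ (a ⟶ b)} (A : ∀ i j, F.X i ⟶ G.X j) (i : F.ι)
    (j : G.ι) : ent (ofEnt A) i j = A i j := rfl

theorem ent_ext {a b : B} {F G : Mat_ (a ⟶ b)} {A A' : F ⟶ G} (h : ∀ i j, ent A i j = ent A' i j) :
    A = A' := Mat_.hom_ext _ _ h

theorem ent_comp {a b : B} {F G H : Mat_ (a ⟶ b)} (A : F ⟶ G) (A' : G ⟶ H) (i : F.ι) (k : H.ι) :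
    ent (A ≫ A') i k = ∑ j, ent A i j ≫ ent A' j k := rfl

/-- Composition of formal direct sums. -/
abbrev comp1 {a b c : B} (F : Mat_ (a ⟶ b)) (G : Mat_ (b ⟶ c)) : Mat_ (a ⟶ c) where
  ι := F.ι × G.ι
  X p := F.X p.1 ≫ G.X p.2

/-- Horizontal composition of matrices. -/
def hcM {a b c : B} {F F' : Mat_ (a ⟶ b)} {G G' : Mat_ (b ⟶ c)} (A : F ⟶ F') (A' : G ⟶ G') :
    comp1 F G ⟶ comp1 F' G' := ofEnt fun p q => hc (ent A p.1 q.1) (ent A' p.2 q.2)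

theorem hcM_comp {a b c : B} {F F' F'' : Mat_ (a ⟶ b)} {G G' G'' : Mat_ (b ⟶ c)} (A : F ⟶ F')
    (A' : G ⟶ G') (C : F' ⟶ F'') (C' : G' ⟶ G'') :
    hcM (A ≫ C) (A' ≫ C') = hcM A A' ≫ hcM C C' := by
  refine ent_ext fun p q => ?_
  rw [ent_comp, hcM, ent_ofEnt, ent_comp, ent_comp, hc_sum, Fintype.sum_prod_type]
  refine Finset.sum_congr rfl fun i _ => Finset.sum_congr rfl fun j _ => ?_
  exact hc_comp _ _ _ _

/-- `A` is a generalized permutation matrix with entries `φ i` at `(i, e i)`. -/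
def IsPerm {a b : B} {F G : Mat_ (a ⟶ b)} (A : F ⟶ G) (e : F.ι → G.ι)
    (φ : ∀ i, F.X i ⟶ G.X (e i)) : Prop :=
  (∀ i, ent A i (e i) = φ i) ∧ ∀ i j, e i ≠ j → ent A i j = 0

open scoped Classical in
/-- The matrix with entries `φ i` at `(i, e i)`. -/
def perm {a b : B} {F G : Mat_ (a ⟶ b)} (e : F.ι → G.ι) (φ : ∀ i, F.X i ⟶ G.X (e i)) : F ⟶ G :=
  ofEnt fun i j => if h : e i = j then φ i ≫ eqToHom (congrArg G.X h) else 0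

theorem isPerm_perm {a b : B} {F G : Mat_ (a ⟶ b)} (e : F.ι → G.ι)
    (φ : ∀ i, F.X i ⟶ G.X (e i)) : IsPerm (perm e φ) e φ :=
  ⟨fun i => by simp [perm], fun i j h => by simp [perm, h]⟩

theorem isPerm_id {a b : B} (F : Mat_ (a ⟶ b)) : IsPerm (𝟙 F) (fun i => i) (fun i => 𝟙 (F.X i)) :=
  ⟨fun i => Mat_.id_apply_self _ _, fun _ _ h => Mat_.id_apply_of_ne _ _ _ h⟩

theorem IsPerm.ext {a b : B} {F G : Mat_ (a ⟶ b)} {A A' : F ⟶ G} {e : F.ι → G.ι}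
    {φ φ' : ∀ i, F.X i ⟶ G.X (e i)} (h : IsPerm A e φ) (h' : IsPerm A' e φ')
    (hφ : ∀ i, φ i = φ' i) : A = A' := by
  refine ent_ext fun i j => ?_
  by_cases hj : e i = j
  · subst hj; rw [h.1, h'.1, hφ]
  · rw [h.2 i j hj, h'.2 i j hj]

theorem IsPerm.ent_comp {a b : B} {F G H : Mat_ (a ⟶ b)} {A : F ⟶ G} {e : F.ι → G.ι}
    {φ : ∀ i, F.X i ⟶ G.X (e i)} (h : IsPerm A e φ) (A' : G ⟶ H) (i : F.ι) (k : H.ι) :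
    ent (A ≫ A') i k = φ i ≫ ent A' (e i) k := by
  rw [AddEnv.ent_comp, Finset.sum_eq_single (e i), h.1]
  · intro j _ hj; rw [h.2 _ _ hj.symm, Limits.zero_comp]
  · simp

theorem IsPerm.comp_ent {a b : B} {F G H : Mat_ (a ⟶ b)} {A : G ⟶ H} {e : G.ι → H.ι}
    {φ : ∀ i, G.X i ⟶ H.X (e i)} (h : IsPerm A e φ) (he : Function.Injective e) (A' : F ⟶ G)
    (i : F.ι) (k : G.ι) : ent (A' ≫ A) i (e k) = ent A' i k ≫ φ k := by
  rw [AddEnv.ent_comp, Finset.sum_eq_single k, h.1]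
  · intro j _ hj; rw [h.2 _ _ fun h' => hj (he h'), Limits.comp_zero]
  · simp

theorem IsPerm.comp {a b : B} {F G H : Mat_ (a ⟶ b)} {A : F ⟶ G} {e : F.ι → G.ι}
    {φ : ∀ i, F.X i ⟶ G.X (e i)} (h : IsPerm A e φ) {A' : G ⟶ H} {e' : G.ι → H.ι}
    {φ' : ∀ i, G.X i ⟶ H.X (e' i)} (h' : IsPerm A' e' φ') :
    IsPerm (A ≫ A') (fun i => e' (e i)) fun i => φ i ≫ φ' (e i) :=
  ⟨fun i => by rw [h.ent_comp, h'.1], fun i j hj => by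
    rw [h.ent_comp, h'.2 _ _ hj, Limits.comp_zero]⟩

theorem IsPerm.hcM {a b c : B} {F F' : Mat_ (a ⟶ b)} {G G' : Mat_ (b ⟶ c)} {A : F ⟶ F'}
    {e : F.ι → F'.ι} {φ : ∀ i, F.X i ⟶ F'.X (e i)} (h : IsPerm A e φ) {A' : G ⟶ G'}
    {e' : G.ι → G'.ι} {φ' : ∀ i, G.X i ⟶ G'.X (e' i)} (h' : IsPerm A' e' φ') :
    IsPerm (hcM A A') (fun p => (e p.1, e' p.2)) fun p => hc (φ p.1) (φ' p.2) := by
  refine ⟨fun i => ?_, fun i j hj => ?_⟩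
  · rw [AddEnv.hcM, ent_ofEnt, h.1, h'.1]
  · rw [AddEnv.hcM, ent_ofEnt]
    by_cases h1 : e i.1 = j.1
    · rw [h'.2 _ _ fun h2 => hj (Prod.ext h1 h2), hc_zero_right]
    · rw [h.2 _ _ h1, hc_zero_left]

theorem hcM_id {a b c : B} (F : Mat_ (a ⟶ b)) (G : Mat_ (b ⟶ c)) :
    hcM (𝟙 F) (𝟙 G) = 𝟙 (comp1 F G) :=
  ((isPerm_id F).hcM (isPerm_id G)).ext (isPerm_id (comp1 F G)) fun _ => hc_id _ _

/-- The associator, permuting the index sets. -/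
def assoc {a b c d : B} (F : Mat_ (a ⟶ b)) (G : Mat_ (b ⟶ c)) (H : Mat_ (c ⟶ d)) :
    comp1 (comp1 F G) H ≅ comp1 F (comp1 G H) where
  hom := perm (fun p => (p.1.1, (p.1.2, p.2))) fun p => (α_ (F.X p.1.1) (G.X p.1.2) (H.X p.2)).hom
  inv := perm (fun p => ((p.1, p.2.1), p.2.2)) fun p => (α_ (F.X p.1) (G.X p.2.1) (H.X p.2.2)).inv
  hom_inv_id := ((isPerm_perm _ _).comp (isPerm_perm _ _)).ext (isPerm_id _) fun _ => by simp
  inv_hom_id := ((isPerm_perm _ _).comp (isPerm_perm _ _)).ext (isPerm_id _) fun _ => by simp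

/-- The identity 1-morphism, a family with one member. -/
abbrev one1 (a : B) : Mat_ (a ⟶ a) where
  ι := Unit
  X _ := 𝟙 a

/-- The left unitor. -/
def lunit {a b : B} (F : Mat_ (a ⟶ b)) : comp1 (one1 a) F ≅ F where
  hom := perm (fun p => p.2) fun p => (λ_ (F.X p.2)).hom
  inv := perm (fun p => ((), p)) fun p => (λ_ (F.X p)).inv
  hom_inv_id := ((isPerm_perm _ _).comp (isPerm_perm _ _)).ext (isPerm_id _) fun _ => by simp
  inv_hom_id := ((isPerm_perm _ _).comp (isPerm_perm _ _)).ext (isPerm_id _) fun _ => by simp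

/-- The right unitor. -/
def runit {a b : B} (F : Mat_ (a ⟶ b)) : comp1 F (one1 b) ≅ F where
  hom := perm (fun p => p.1) fun p => (ρ_ (F.X p.1)).hom
  inv := perm (fun p => (p, ())) fun p => (ρ_ (F.X p)).inv
  hom_inv_id := ((isPerm_perm _ _).comp (isPerm_perm _ _)).ext (isPerm_id _) fun _ => by simp
  inv_hom_id := ((isPerm_perm _ _).comp (isPerm_perm _ _)).ext (isPerm_id _) fun _ => by simp

theorem hc_assoc {a b c d : B} {f f' : a ⟶ b} {g g' : b ⟶ c} {h h' : c ⟶ d} (x : f ⟶ f')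
    (y : g ⟶ g') (z : h ⟶ h') : hc (hc x y) z ≫ (α_ f' g' h').hom =
      (α_ f g h).hom ≫ hc x (hc y z) := by
  simp [hc]

theorem assoc_nat {a b c d : B} {F F' : Mat_ (a ⟶ b)} {G G' : Mat_ (b ⟶ c)} {H H' : Mat_ (c ⟶ d)}
    (x : F ⟶ F') (y : G ⟶ G') (z : H ⟶ H') :
    hcM (hcM x y) z ≫ (assoc F' G' H').hom = (assoc F G H).hom ≫ hcM x (hcM y z) := by
  refine ent_ext fun p q => ?_
  refine Eq.trans ?_ ((isPerm_perm _ _).ent_comp _ _ _).symm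
  refine ((isPerm_perm (F := comp1 (comp1 F' G') H') (G := comp1 F' (comp1 G' H')) _ _).comp_ent
    (fun p q h => ?_) _ p ((q.1, q.2.1), q.2.2)).trans ?_
  · simp only [Prod.mk.injEq] at h
    exact Prod.ext (Prod.ext h.1 h.2.1) h.2.2
  · exact hc_assoc _ _ _

theorem lunit_nat {a b : B} {F F' : Mat_ (a ⟶ b)} (x : F ⟶ F') :
    hcM (𝟙 (one1 a)) x ≫ (lunit F').hom = (lunit F).hom ≫ x := by
  refine ent_ext fun p q => ?_
  refine Eq.trans ?_ ((isPerm_perm _ _).ent_comp _ _ _).symm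
  refine ((isPerm_perm (F := comp1 (one1 a) F') (G := F') _ _).comp_ent
    (fun p q h => Prod.ext rfl h) _ p ((), q)).trans ?_
  have : ent (𝟙 (one1 a)) p.1 () = 𝟙 (𝟙 a) := (isPerm_id (one1 a)).1 ()
  simp [hcM, hc, this]

theorem runit_nat {a b : B} {F F' : Mat_ (a ⟶ b)} (x : F ⟶ F') :
    hcM x (𝟙 (one1 b)) ≫ (runit F').hom = (runit F).hom ≫ x := by
  refine ent_ext fun p q => ?_
  refine Eq.trans ?_ ((isPerm_perm _ _).ent_comp _ _ _).symm
  refine ((isPerm_perm (F := comp1 F' (one1 b)) (G := F') _ _).comp_ent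
    (fun p q h => Prod.ext h rfl) _ p (q, ())).trans ?_
  have : ent (𝟙 (one1 b)) p.2 () = 𝟙 (𝟙 b) := (isPerm_id (one1 b)).1 ()
  simp [hcM, hc, this]

theorem pent {a b c d e : B} (F : Mat_ (a ⟶ b)) (G : Mat_ (b ⟶ c)) (H : Mat_ (c ⟶ d))
    (I : Mat_ (d ⟶ e)) :
    hcM (assoc F G H).hom (𝟙 I) ≫ (assoc F (comp1 G H) I).hom ≫ hcM (𝟙 F) (assoc G H I).hom =
      (assoc (comp1 F G) H I).hom ≫ (assoc F G (comp1 H I)).hom := by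
  refine IsPerm.ext (((isPerm_perm _ _).hcM (isPerm_id _)).comp ((isPerm_perm _ _).comp
    ((isPerm_id _).hcM (isPerm_perm _ _)))) ((isPerm_perm _ _).comp (isPerm_perm _ _)) fun p => ?_
  simp [hc]

theorem tri {a b c : B} (F : Mat_ (a ⟶ b)) (G : Mat_ (b ⟶ c)) :
    (assoc F (one1 b) G).hom ≫ hcM (𝟙 F) (lunit G).hom = hcM (runit F).hom (𝟙 G) := by
  refine IsPerm.ext ((isPerm_perm _ _).comp ((isPerm_id _).hcM (isPerm_perm _ _)))
    ((isPerm_perm _ _).hcM (isPerm_id _)) fun p => ?_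
  simp [hc]

/-- Left whiskering of matrices. -/
def wl {a b c : B} (F : Mat_ (a ⟶ b)) {G H : Mat_ (b ⟶ c)} (x : G ⟶ H) : comp1 F G ⟶ comp1 F H :=
  hcM (𝟙 F) x

/-- Right whiskering of matrices. -/
def wr {a b c : B} {F G : Mat_ (a ⟶ b)} (x : F ⟶ G) (H : Mat_ (b ⟶ c)) : comp1 F H ⟶ comp1 G H :=
  hcM x (𝟙 H)

theorem wl_comp {a b c : B} (F : Mat_ (a ⟶ b)) {G H K : Mat_ (b ⟶ c)} (x : G ⟶ H) (y : H ⟶ K) :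
    wl F (x ≫ y) = wl F x ≫ wl F y := by
  rw [wl, wl, wl, ← hcM_comp, Category.comp_id]

theorem wr_comp {a b c : B} {F G K : Mat_ (a ⟶ b)} (x : F ⟶ G) (y : G ⟶ K) (H : Mat_ (b ⟶ c)) :
    wr (x ≫ y) H = wr x H ≫ wr y H := by
  rw [wr, wr, wr, ← hcM_comp, Category.comp_id]

theorem wlr {a b c : B} {F G : Mat_ (a ⟶ b)} {H K : Mat_ (b ⟶ c)} (x : F ⟶ G) (y : H ⟶ K) :
    wl F y ≫ wr x K = wr x H ≫ wl G y := by
  rw [wl, wr, wr, wl, ← hcM_comp, ← hcM_comp]; simp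

end

noncomputable instance : CategoryStruct (AddEnv B) where
  Hom a b := Mat_ (a.obj ⟶ b.obj)
  id a := one1 a.obj
  comp F G := comp1 F G

noncomputable instance : Bicategory (AddEnv B) where
  homCategory a b := inferInstanceAs (Category (Mat_ (a.obj ⟶ b.obj)))
  whiskerLeft {_ _ _} F {_ _} x := wl F x
  whiskerRight x H := wr x H
  associator F G H := assoc F G H
  leftUnitor F := lunit F
  rightUnitor F := runit F
  whiskerLeft_id F G := hcM_id _ _
  whiskerLeft_comp F _ _ _ x y := wl_comp _ _ _
  id_whiskerLeft x :=
    ((Iso.eq_comp_inv _).2 (lunit_nat x)).trans (Category.assoc _ _ _)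
  comp_whiskerLeft {a b c d} F G _ _ x := by
    have := assoc_nat (𝟙 (show Mat_ (a.obj ⟶ b.obj) from F)) (𝟙 (show Mat_ (b.obj ⟶ c.obj) from G)) x
    rw [hcM_id] at this
    exact ((Iso.eq_comp_inv _).2 this).trans (Category.assoc _ _ _)
  id_whiskerRight F G := hcM_id _ _
  comp_whiskerRight x y H := wr_comp _ _ _
  whiskerRight_id x :=
    ((Iso.eq_comp_inv _).2 (runit_nat x)).trans (Category.assoc _ _ _)
  whiskerRight_comp {a b c d} _ _ x G H := by
    have := assoc_nat x (𝟙 (show Mat_ (b.obj ⟶ c.obj) from G)) (𝟙 (show Mat_ (c.obj ⟶ d.obj) from H))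
    rw [hcM_id] at this
    exact (Iso.eq_inv_comp _).2 this.symm
  whisker_assoc {a b c d} F _ _ x H := by
    have := assoc_nat (𝟙 (show Mat_ (a.obj ⟶ b.obj) from F)) x (𝟙 (show Mat_ (c.obj ⟶ d.obj) from H))
    exact ((Iso.eq_comp_inv _).2 this).trans (Category.assoc _ _ _)
  whisker_exchange x y := wlr x y
  pentagon F G H I := pent F G H I
  triangle F G := tri F G

noncomputable instance : AdditiveBicategory (AddEnv B) where
  preadd a b := inferInstanceAs (Preadditive (Mat_ (a.obj ⟶ b.obj)))
  add_whiskerRight {_ _ _ _ _} _ _ _ := ent_ext (B := B) fun _ _ =>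
    (DFunLike.congr_fun (map_add (hcHom _ _ _ _) _ _) _)
  whiskerLeft_add {_ _ _} _ {_ _} _ _ := ent_ext (B := B) fun _ _ => map_add (hcHom _ _ _ _ _) _ _

end AddEnv

instance {n : ℕ} {P : Pres n} : AdditiveBicategory (Obj P) where
  preadd a b := inferInstanceAs (Preadditive (OneMor P a b))
  add_whiskerRight x y h := by
    induction x using Hom2.ind; induction y using Hom2.ind; exact Hom2.mk_eq (map_add _ _ _)
  whiskerLeft_add f _ _ x y := by
    induction x using Hom2.ind; induction y using Hom2.ind; exact Hom2.mk_eq (map_add _ _ _)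

end Schur

namespace Schur

open CategoryTheory TensorProduct

/-! ### Graded bimodules -/

/-- A commutative `ℤ`-graded `ℚ`-algebra. -/
structure GAlg where
  carrier : Type
  [ring : CommRing carrier]
  [alg : Algebra ℚ carrier]
  gr : ℤ → Submodule ℚ carrier
  graded : SetLike.GradedMonoid gr
  internal : DirectSum.IsInternal gr

attribute [instance] GAlg.ring GAlg.alg

instance : CoeSort GAlg Type := ⟨GAlg.carrier⟩

/-- A `ℤ`-graded `(B, A)`-bimodule: `B` acts on the left through `l` and `A` acts on the right
through `r` (as `A` is commutative, a right action is an algebra homomorphism to the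
endomorphisms). It is a 1-morphism from `A` to `B`. -/
structure GBim (A B : GAlg) where
  carrier : Type
  [grp : AddCommGroup carrier]
  [mod : Module ℚ carrier]
  l : B →ₐ[ℚ] Module.End ℚ carrier
  r : A →ₐ[ℚ] Module.End ℚ carrier
  comm : ∀ b a x, l b (r a x) = r a (l b x)
  gr : ℤ → Submodule ℚ carrier
  internal : DirectSum.IsInternal gr
  l_mem : ∀ {i j b x}, b ∈ B.gr i → x ∈ gr j → l b x ∈ gr (i + j)
  r_mem : ∀ {i j a x}, a ∈ A.gr i → x ∈ gr j → r a x ∈ gr (i + j)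

attribute [instance] GBim.grp GBim.mod

instance (A B : GAlg) : CoeSort (GBim A B) Type := ⟨GBim.carrier⟩

/-- The bimodule maps of degree `k`. -/
def homDeg {A B : GAlg} (M N : GBim A B) (k : ℤ) : Submodule ℚ (M →ₗ[ℚ] N) where
  carrier := {f | (∀ b x, f (M.l b x) = N.l b (f x)) ∧ (∀ a x, f (M.r a x) = N.r a (f x)) ∧
    ∀ i x, x ∈ M.gr i → f x ∈ N.gr (i + k)}
  zero_mem' := by simp
  add_mem' := by
    rintro f g ⟨h1, h2, h3⟩ ⟨h1', h2', h3'⟩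
    exact ⟨fun b x => by simp [h1, h1'], fun b x => by simp [h2, h2'],
      fun i x hx => add_mem (h3 i x hx) (h3' i x hx)⟩
  smul_mem' := by
    rintro c f ⟨h1, h2, h3⟩
    exact ⟨fun b x => by simp [h1], fun b x => by simp [h2],
      fun i x hx => Submodule.smul_mem _ _ (h3 i x hx)⟩

/-- The bimodule maps of all degrees: finite sums of homogeneous bimodule maps. -/
def bhom {A B : GAlg} (M N : GBim A B) : Submodule ℚ (M →ₗ[ℚ] N) := ⨆ k, homDeg M N k

theorem homDeg_le {A B : GAlg} {M N : GBim A B} (k : ℤ) : homDeg M N k ≤ bhom M N :=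
  le_iSup (homDeg M N) k

theorem bhom_map {A B A' B' : GAlg} {M N : GBim A B} {M' N' : GBim A' B'}
    (Φ : (M →ₗ[ℚ] N) → (M' →ₗ[ℚ] N')) (h0 : Φ 0 = 0) (ha : ∀ f g, f ∈ bhom M N → g ∈ bhom M N → 
      Φ (f + g) = Φ f + Φ g) (hk : ∀ k f, f ∈ homDeg M N k → Φ f ∈ bhom M' N') {f : M →ₗ[ℚ] N}
    (hf : f ∈ bhom M N) : Φ f ∈ bhom M' N' := by
  induction hf using Submodule.iSup_induction' with
  | mem k f hf => exact hk k f hf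
  | zero => rw [h0]; exact zero_mem _
  | add f g hf hg h1 h2 => rw [ha f g hf hg]; exact add_mem h1 h2

theorem bhom_l {A B : GAlg} {M N : GBim A B} {f : M →ₗ[ℚ] N} (hf : f ∈ bhom M N) (b : B) (x : M) :
    f (M.l b x) = N.l b (f x) := by
  induction hf using Submodule.iSup_induction' with
  | mem k f hf => exact hf.1 b x
  | zero => simp
  | add f g hf hg h1 h2 => simp [h1, h2]

theorem bhom_r {A B : GAlg} {M N : GBim A B} {f : M →ₗ[ℚ] N} (hf : f ∈ bhom M N) (b : A) (x : M) :
    f (M.r b x) = N.r b (f x) := by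
  induction hf using Submodule.iSup_induction' with
  | mem k f hf => exact hf.2.1 b x
  | zero => simp
  | add f g hf hg h1 h2 => simp [h1, h2]

theorem comp_mem_homDeg {A B : GAlg} {M N K : GBim A B} {k l : ℤ} {f : M →ₗ[ℚ] N} {g : N →ₗ[ℚ] K}
    (hf : f ∈ homDeg M N k) (hg : g ∈ homDeg N K l) : g ∘ₗ f ∈ homDeg M K (k + l) :=
  ⟨fun b x => by simp [hf.1, hg.1], fun b x => by simp [hf.2.1, hg.2.1], fun i x hx => by
    rw [← add_assoc]; exact hg.2.2 _ _ (hf.2.2 i x hx)⟩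

theorem comp_mem_bhom {A B : GAlg} {M N K : GBim A B} {f : M →ₗ[ℚ] N} {g : N →ₗ[ℚ] K}
    (hf : f ∈ bhom M N) (hg : g ∈ bhom N K) : g ∘ₗ f ∈ bhom M K := by
  refine bhom_map (fun f => g ∘ₗ f) (LinearMap.comp_zero _) (fun f f' _ _ => LinearMap.comp_add _ _ _)
    (fun k f hf => ?_) hf
  exact bhom_map (fun g => g ∘ₗ f) (LinearMap.zero_comp _) (fun g g' _ _ => LinearMap.add_comp _ _ _)
    (fun l g hg => homDeg_le _ (comp_mem_homDeg hf hg)) hg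

instance (A B : GAlg) : Category (GBim A B) where
  Hom M N := bhom M N
  id M := ⟨LinearMap.id, homDeg_le 0 ⟨fun _ _ => rfl, fun _ _ => rfl, fun i x hx => by simpa using hx⟩⟩
  comp f g := ⟨g.1 ∘ₗ f.1, comp_mem_bhom f.2 g.2⟩

instance (A B : GAlg) : Preadditive (GBim A B) where
  homGroup M N := inferInstanceAs (AddCommGroup (bhom M N))
  add_comp _ _ _ _ _ _ := Subtype.ext (LinearMap.comp_add _ _ _)
  comp_add _ _ _ _ _ _ := Subtype.ext (LinearMap.add_comp _ _ _)

/-- The underlying linear map of a 2-morphism. -/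
def GBim.fn {A B : GAlg} {M N : GBim A B} (f : M ⟶ N) : M →ₗ[ℚ] N := f.1

theorem fn_ext {A B : GAlg} {M N : GBim A B} {f g : M ⟶ N} (h : GBim.fn f = GBim.fn g) : f = g :=
  Subtype.ext h

/-- An isomorphism of graded bimodules. -/
def mkIso {A B : GAlg} {M N : GBim A B} (f : M →ₗ[ℚ] N) (g : N →ₗ[ℚ] M)
    (hf : f ∈ homDeg M N 0) (hg : g ∈ homDeg N M 0) (h : g ∘ₗ f = LinearMap.id)
    (h' : f ∘ₗ g = LinearMap.id) : M ≅ N where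
  hom := ⟨f, homDeg_le 0 hf⟩
  inv := ⟨g, homDeg_le 0 hg⟩
  hom_inv_id := Subtype.ext h
  inv_hom_id := Subtype.ext h'

/-- A criterion for a family of subspaces to be a grading. -/
theorem isInternal_iff {V : Type} [AddCommGroup V] [Module ℚ V] (gr : ℤ → Submodule ℚ V) :
    DirectSum.IsInternal gr ↔ (⨆ k, gr k = ⊤) ∧
      ∃ φ : Module.End ℚ V, ∀ k, ∀ x ∈ gr k, φ x = (2 : ℚ) ^ k • x := by
  constructor
  · intro h
    refine ⟨h.submodule_iSup_eq_top, ?_⟩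
    let e := LinearEquiv.ofBijective (DirectSum.coeLinearMap gr) h
    refine ⟨(DirectSum.toModule ℚ ℤ V fun k => (2 : ℚ) ^ k • (gr k).subtype) ∘ₗ e.symm.toLinearMap,
      fun k x hx => ?_⟩
    have : e.symm x = DirectSum.lof ℚ ℤ (fun k => gr k) k ⟨x, hx⟩ := by
      rw [LinearEquiv.symm_apply_eq]; exact (DirectSum.coeLinearMap_lof gr k ⟨x, hx⟩).symm
    simp [this]
  · rintro ⟨h, φ, hφ⟩
    refine DirectSum.isInternal_submodule_of_iSupIndep_of_iSup_eq_top ?_ h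
    have h1 := (Module.End.eigenspaces_iSupIndep φ).comp (f := fun k : ℤ => (2 : ℚ) ^ k)
      (zpow_right_injective₀ (by norm_num) (by norm_num))
    exact h1.mono fun k x hx => Module.End.mem_eigenspace_iff.2 (hφ k x hx)

section Tensor

variable {A B C : GAlg} (f : GBim A B) (g : GBim B C)

/-- The relations `x b ⊗ y = x ⊗ b y`. -/
def tensRel : Submodule ℚ (g ⊗[ℚ] f) :=
  Submodule.span ℚ {z | ∃ (b : B) (x : g) (y : f), z = g.r b x ⊗ₜ y - x ⊗ₜ f.l b y}

/-- The vector space `g ⊗_B f`. -/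
def TensCarrier : Type := (g ⊗[ℚ] f) ⧸ tensRel f g

instance : AddCommGroup (TensCarrier f g) := inferInstanceAs (AddCommGroup (_ ⧸ _))

instance : Module ℚ (TensCarrier f g) := inferInstanceAs (Module ℚ (_ ⧸ _))

variable {f g}

/-- The pure tensor `x ⊗ y`. -/
def pt (x : g) (y : f) : TensCarrier f g := Submodule.Quotient.mk (x ⊗ₜ y)

theorem pt_bal (b : B) (x : g) (y : f) : pt (g.r b x) y = pt x (f.l b y) :=
  (Submodule.Quotient.eq _).2 (Submodule.subset_span ⟨b, x, y, rfl⟩)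

theorem pt_add_left (x x' : g) (y : f) : pt (x + x') y = pt x y + pt x' y := by
  rw [pt, TensorProduct.add_tmul]; rfl

theorem pt_add_right (x : g) (y y' : f) : pt x (y + y') = pt x y + pt x y' := by
  rw [pt, TensorProduct.tmul_add]; rfl

theorem pt_smul_left (c : ℚ) (x : g) (y : f) : pt (c • x) y = c • pt x y := by
  rw [pt, ← TensorProduct.smul_tmul']; rfl

theorem pt_smul_right (c : ℚ) (x : g) (y : f) : pt x (c • y) = c • pt x y := by
  rw [pt, TensorProduct.tmul_smul]; rfl

/-- `pt` as a bilinear map. -/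
def ptL (f : GBim A B) (g : GBim B C) : g →ₗ[ℚ] f →ₗ[ℚ] TensCarrier f g :=
  LinearMap.mk₂ ℚ pt pt_add_left pt_smul_left pt_add_right pt_smul_right

/-- Linear maps out of `g ⊗_B f`. -/
def liftT {V : Type*} [AddCommGroup V] [Module ℚ V] (β : g →ₗ[ℚ] f →ₗ[ℚ] V)
    (h : ∀ (b : B) x y, β (g.r b x) y = β x (f.l b y)) : TensCarrier f g →ₗ[ℚ] V :=
  Submodule.liftQ _ (TensorProduct.lift β) (by
    rw [tensRel, Submodule.span_le]
    rintro _ ⟨b, x, y, rfl⟩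
    simp [h])

@[simp] theorem liftT_pt {V : Type*} [AddCommGroup V] [Module ℚ V] (β : g →ₗ[ℚ] f →ₗ[ℚ] V)
    (h : ∀ (b : B) x y, β (g.r b x) y = β x (f.l b y)) (x : g) (y : f) :
    liftT β h (pt x y) = β x y := by
  rw [liftT, pt]; exact (Submodule.liftQ_apply _ _ _).trans (TensorProduct.lift.tmul _ _)

theorem tens_ind {p : TensCarrier f g → Prop} (h0 : p 0) (h : ∀ x y, p (pt x y))
    (ha : ∀ s t, p s → p t → p (s + t)) (t : TensCarrier f g) : p t := by
  induction t using Submodule.Quotient.induction_on with | H t => ?_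
  induction t using TensorProduct.induction_on with
  | zero => exact h0
  | tmul x y => exact h x y
  | add s t h1 h2 => exact ha _ _ h1 h2

theorem tens_ext {V : Type*} [AddCommGroup V] [Module ℚ V] {φ ψ : TensCarrier f g →ₗ[ℚ] V}
    (h : ∀ x y, φ (pt x y) = ψ (pt x y)) : φ = ψ := by
  ext t
  induction t using tens_ind with
  | h0 => simp
  | h x y => exact h x y
  | ha s t h1 h2 => simp [h1, h2]

/-- The tensor product of two balanced maps. -/
def mapT {A' B' C' : GAlg} {f' : GBim A' B'} {g' : GBim B' C'} (φ : g →ₗ[ℚ] g') (ψ : f →ₗ[ℚ] f')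
    (h : ∀ (b : B) x y, pt (φ (g.r b x)) (ψ y) = pt (φ x) (ψ (f.l b y))) :
    TensCarrier f g →ₗ[ℚ] TensCarrier f' g' :=
  liftT ((ptL f' g').compl₁₂ φ ψ) h

@[simp] theorem mapT_pt {A' B' C' : GAlg} {f' : GBim A' B'} {g' : GBim B' C'} (φ : g →ₗ[ℚ] g')
    (ψ : f →ₗ[ℚ] f') (h : ∀ (b : B) x y, pt (φ (g.r b x)) (ψ y) = pt (φ x) (ψ (f.l b y))) (x : g)
    (y : f) : mapT φ ψ h (pt x y) = pt (φ x) (ψ y) := (liftT_pt _ h x y).trans rfl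

variable (f g)

/-- The left action on `g ⊗_B f`. -/
def tensL : C →ₐ[ℚ] Module.End ℚ (TensCarrier f g) :=
  AlgHom.ofLinearMap
    { toFun := fun c => mapT (g.l c) LinearMap.id (by intro b x y; rw [g.comm, pt_bal]; rfl)
      map_add' := fun c d => tens_ext fun x y => by simp [pt_add_left]
      map_smul' := fun c d => tens_ext fun x y => by simp [pt_smul_left] }
    (tens_ext fun x y => by simp) (fun c d => tens_ext fun x y => by simp)

/-- The right action on `g ⊗_B f`. -/
def tensR : A →ₐ[ℚ] Module.End ℚ (TensCarrier f g) :=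
  AlgHom.ofLinearMap
    { toFun := fun c => mapT LinearMap.id (f.r c) (by intro b x y; rw [← f.comm]; exact pt_bal _ _ _)
      map_add' := fun c d => tens_ext fun x y => by simp [pt_add_right]
      map_smul' := fun c d => tens_ext fun x y => by simp [pt_smul_right] }
    (tens_ext fun x y => by simp) (fun c d => tens_ext fun x y => by simp)

@[simp] theorem tensL_pt (c : C) (x : g) (y : f) : tensL f g c (pt x y) = pt (g.l c x) y := by
  simp [tensL]

@[simp] theorem tensR_pt (c : A) (x : g) (y : f) : tensR f g c (pt x y) = pt x (f.r c y) := by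
  simp [tensR]

/-- The grading of `g ⊗_B f`. -/
def tensGr (k : ℤ) : Submodule ℚ (TensCarrier f g) :=
  Submodule.span ℚ {z | ∃ i j x y, i + j = k ∧ x ∈ g.gr i ∧ y ∈ f.gr j ∧ z = pt x y}

variable {f g}

theorem pt_mem {i j k : ℤ} {x : g} {y : f} (hx : x ∈ g.gr i) (hy : y ∈ f.gr j) (h : i + j = k) :
    pt x y ∈ tensGr f g k := Submodule.subset_span ⟨i, j, x, y, h, hx, hy, rfl⟩

theorem tensGr_map {V : Type*} [AddCommGroup V] [Module ℚ V] {φ : TensCarrier f g →ₗ[ℚ] V} {k : ℤ}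
    {W : Submodule ℚ V} (h : ∀ i j x y, i + j = k → x ∈ g.gr i → y ∈ f.gr j → φ (pt x y) ∈ W)
    {t : TensCarrier f g} (ht : t ∈ tensGr f g k) : φ t ∈ W := by
  have : tensGr f g k ≤ W.comap φ := by
    rw [tensGr, Submodule.span_le]
    rintro _ ⟨i, j, x, y, h', hx, hy, rfl⟩
    exact h i j x y h' hx hy
  exact this ht

theorem gr_ext {V W : Type*} [AddCommGroup V] [Module ℚ V] [AddCommGroup W] [Module ℚ W]
    {gr : ℤ → Submodule ℚ V} (h : ⨆ k, gr k = ⊤) {φ ψ : V →ₗ[ℚ] W}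
    (h' : ∀ k, ∀ x ∈ gr k, φ x = ψ x) : φ = ψ := by
  have : (⊤ : Submodule ℚ V) ≤ LinearMap.eqLocus φ ψ := by
    rw [← h]; exact iSup_le fun k x hx => h' k x hx
  ext x; exact this trivial

variable (f g) in
theorem tens_internal : DirectSum.IsInternal (tensGr f g) := by
  obtain ⟨hf, φ, hφ⟩ := (isInternal_iff _).1 f.internal
  obtain ⟨hg, ψ, hψ⟩ := (isInternal_iff _).1 g.internal
  obtain ⟨hB, χ, hχ⟩ := (isInternal_iff _).1 B.internal
  have h2 : (2 : ℚ) ≠ 0 := by norm_num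
  have e1 : ∀ b y, φ (f.l b y) = f.l (χ b) (φ y) := by
    have : f.l.toLinearMap.compr₂ φ = f.l.toLinearMap.compl₁₂ χ φ :=
      gr_ext hB fun k b hb => gr_ext hf fun j y hy => by
        simp [hφ j y hy, hφ _ _ (f.l_mem hb hy), hχ k b hb, zpow_add₀ h2, smul_smul, mul_comm]
    exact fun b y => DFunLike.congr_fun (DFunLike.congr_fun this b) y
  have e2 : ∀ b y, ψ (g.r b y) = g.r (χ b) (ψ y) := by
    have : g.r.toLinearMap.compr₂ ψ = g.r.toLinearMap.compl₁₂ χ ψ :=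
      gr_ext hB fun k b hb => gr_ext hg fun j y hy => by
        simp [hψ j y hy, hψ _ _ (g.r_mem hb hy), hχ k b hb, zpow_add₀ h2, smul_smul, mul_comm]
    exact fun b y => DFunLike.congr_fun (DFunLike.congr_fun this b) y
  refine (isInternal_iff _).2 ⟨?_, mapT ψ φ (by intro b x y; rw [e1, e2, pt_bal]), ?_⟩
  · rw [eq_top_iff]
    have : (ptL f g).compr₂ (⨆ k, tensGr f g k).mkQ = 0 :=
      gr_ext hg fun k x hx => gr_ext hf fun j y hy => by
        refine (Submodule.Quotient.mk_eq_zero _).2 ?_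
        exact Submodule.mem_iSup_of_mem (k + j) (pt_mem hx hy rfl)
    intro t _
    induction t using tens_ind with
    | h0 => exact zero_mem _
    | h x y =>
      exact (Submodule.Quotient.mk_eq_zero _).1 (DFunLike.congr_fun (DFunLike.congr_fun this x) y)
    | ha s t h1 h2 => exact add_mem (h1 trivial) (h2 trivial)
  · intro k t ht
    have := tensGr_map (φ := mapT ψ φ (by intro b x y; rw [e1, e2, pt_bal]) -
      (2 : ℚ) ^ k • LinearMap.id) (W := ⊥) (k := k) (by
        intro i j x y h hx hy
        simp [hφ j y hy, hψ i x hx, pt_smul_left, pt_smul_right, smul_smul, ← h, zpow_add₀ h2,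
          sub_eq_zero, mul_comm]) ht
    simpa [sub_eq_zero] using this

variable (f g)

/-- The tensor product `g ⊗_B f` of graded bimodules, the composite of 1-morphisms. -/
def tens : GBim A C where
  carrier := TensCarrier f g
  l := tensL f g
  r := tensR f g
  comm b a t := by
    induction t using tens_ind with
    | h0 => simp
    | h x y => simp
    | ha s t h1 h2 => simp [h1, h2]
  gr := tensGr f g
  internal := tens_internal f g
  l_mem {i j b t} hb ht := tensGr_map (fun i' j' x y h hx hy => by
    rw [tensL_pt]; exact pt_mem (g.l_mem hb hx) hy (by omega)) ht
  r_mem {i j b t} hb ht := tensGr_map (fun i' j' x y h hx hy => by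
    rw [tensR_pt]; exact pt_mem hx (f.r_mem hb hy) (by omega)) ht

end Tensor

/-- The identity bimodule. -/
def idBim (A : GAlg) : GBim A A where
  carrier := A
  l := Algebra.lmul ℚ A
  r := Algebra.lmul ℚ A
  comm b a x := mul_left_comm _ _ _
  gr := A.gr
  internal := A.internal
  l_mem hb hx := A.graded.mul_mem hb hx
  r_mem hb hx := A.graded.mul_mem hb hx

section Structure

variable {A B C D : GAlg}

section

variable {f : GBim A B} {g : GBim B C}

/-- The pure tensor `x ⊗ y`, as an element of the composite bimodule. -/
def tp (x : g) (y : f) : tens f g := pt x y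

/-- `tp` as a bilinear map. -/
def tpL (f : GBim A B) (g : GBim B C) : g →ₗ[ℚ] f →ₗ[ℚ] tens f g := ptL f g

@[simp] theorem tpL_apply (x : g) (y : f) : tpL f g x y = tp x y := rfl

theorem tp_add_left (x x' : g) (y : f) : tp (x + x') y = tp x y + tp x' y := pt_add_left _ _ _

theorem tp_add_right (x : g) (y y' : f) : tp x (y + y') = tp x y + tp x y' := pt_add_right _ _ _

theorem tp_smul_left (c : ℚ) (x : g) (y : f) : tp (c • x) y = c • tp x y := pt_smul_left _ _ _

theorem tp_smul_right (c : ℚ) (x : g) (y : f) : tp x (c • y) = c • tp x y := pt_smul_right _ _ _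

theorem tp_bal (b : B) (x : g) (y : f) : tp (g.r b x) y = tp x (f.l b y) := pt_bal _ _ _

@[simp] theorem tens_l (c : C) (x : g) (y : f) : (tens f g).l c (tp x y) = tp (g.l c x) y :=
  tensL_pt f g c x y

@[simp] theorem tens_r (c : A) (x : g) (y : f) : (tens f g).r c (tp x y) = tp x (f.r c y) :=
  tensR_pt f g c x y

/-- Linear maps out of a tensor product. -/
def tlift {V : Type*} [AddCommGroup V] [Module ℚ V] (β : g →ₗ[ℚ] f →ₗ[ℚ] V)
    (h : ∀ (b : B) x y, β (g.r b x) y = β x (f.l b y)) : tens f g →ₗ[ℚ] V := liftT β h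

@[simp] theorem tlift_tp {V : Type*} [AddCommGroup V] [Module ℚ V] (β : g →ₗ[ℚ] f →ₗ[ℚ] V)
    (h : ∀ (b : B) x y, β (g.r b x) y = β x (f.l b y)) (x : g) (y : f) :
    tlift β h (tp x y) = β x y := liftT_pt β h x y

theorem tp_ext {V : Type*} [AddCommGroup V] [Module ℚ V] {φ ψ : tens f g →ₗ[ℚ] V}
    (h : ∀ x y, φ (tp x y) = ψ (tp x y)) : φ = ψ := tens_ext h

theorem tp_mem {i j k : ℤ} {x : g} {y : f} (hx : x ∈ g.gr i) (hy : y ∈ f.gr j) (h : i + j = k) :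
    tp x y ∈ (tens f g).gr k := pt_mem hx hy h

theorem tgr_map {V : Type*} [AddCommGroup V] [Module ℚ V] (φ : tens f g →ₗ[ℚ] V) {k : ℤ}
    {W : Submodule ℚ V} (h : ∀ i j x y, i + j = k → x ∈ g.gr i → y ∈ f.gr j → φ (tp x y) ∈ W)
    {t : tens f g} (ht : t ∈ (tens f g).gr k) : φ t ∈ W := tensGr_map h ht

theorem mem_homDeg_tens {M : GBim A C} {k : ℤ} (φ : tens f g →ₗ[ℚ] M)
    (hl : ∀ c x y, φ (tp (g.l c x) y) = M.l c (φ (tp x y)))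
    (hr : ∀ a x y, φ (tp x (f.r a y)) = M.r a (φ (tp x y)))
    (hd : ∀ i j x y, x ∈ g.gr i → y ∈ f.gr j → φ (tp x y) ∈ M.gr (i + j + k)) :
    φ ∈ homDeg (tens f g) M k := by
  refine ⟨fun c t => ?_, fun a t => ?_, fun i t ht => ?_⟩
  · exact DFunLike.congr_fun (f := φ ∘ₗ (tens f g).l c) (g := M.l c ∘ₗ φ)
      (tp_ext fun x y => by simp [hl]) t
  · exact DFunLike.congr_fun (f := φ ∘ₗ (tens f g).r a) (g := M.r a ∘ₗ φ)
      (tp_ext fun x y => by simp [hr]) t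
  · exact tgr_map φ (fun i' j' x y e hx hy => e ▸ hd i' j' x y hx hy) ht

end

/-- Tensoring a map of the left factor. -/
def tmL {g g' : GBim B C} (f : GBim A B) (φ : g →ₗ[ℚ] g')
    (h : ∀ (b : B) x, φ (g.r b x) = g'.r b (φ x)) : tens f g →ₗ[ℚ] tens f g' :=
  tlift (tpL f g' ∘ₗ φ) (by intro b x y; simp [h, tp_bal])

/-- Tensoring a map of the right factor. -/
def tmR {f f' : GBim A B} (φ : f →ₗ[ℚ] f') (g : GBim B C)
    (h : ∀ (b : B) x, φ (f.l b x) = f'.l b (φ x)) : tens f g →ₗ[ℚ] tens f' g :=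
  tlift ((tpL f' g).compl₂ φ) (by intro b x y; simp [h, tp_bal])

@[simp] theorem tmL_tp {g g' : GBim B C} (f : GBim A B) (φ : g →ₗ[ℚ] g')
    (h : ∀ (b : B) x, φ (g.r b x) = g'.r b (φ x)) (x : g) (y : f) :
    tmL f φ h (tp x y) = tp (φ x) y :=
  tlift_tp (tpL f g' ∘ₗ φ) (by intro b x y; simp [h, tp_bal]) x y

@[simp] theorem tmR_tp {f f' : GBim A B} (φ : f →ₗ[ℚ] f') (g : GBim B C)
    (h : ∀ (b : B) x, φ (f.l b x) = f'.l b (φ x)) (x : g) (y : f) :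
    tmR φ g h (tp x y) = tp x (φ y) :=
  tlift_tp ((tpL f' g).compl₂ φ) (by intro b x y; simp [h, tp_bal]) x y

theorem tmL_mem {g g' : GBim B C} (f : GBim A B) {φ : g →ₗ[ℚ] g'} (hφ : φ ∈ bhom g g') :
    tmL f φ (bhom_r hφ) ∈ bhom (tens f g) (tens f g') := by
  induction hφ using Submodule.iSup_induction' with
  | mem k φ hφ =>
    refine homDeg_le k (mem_homDeg_tens _ (fun c x y => ?_) (fun a x y => ?_)
      fun i j x y hx hy => ?_)
    · simp [hφ.1]
    · simp
    · rw [tmL_tp]; exact tp_mem (hφ.2.2 _ _ hx) hy (by omega)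
  | zero =>
    have : tmL f (0 : g →ₗ[ℚ] g') (fun b x => by simp) = 0 :=
      tp_ext fun x y => by rw [tmL_tp, ← tpL_apply]; simp
    rw [this]; exact zero_mem _
  | add φ ψ hφ hψ h1 h2 =>
    have : tmL f (φ + ψ) (bhom_r (add_mem hφ hψ)) = tmL f φ (bhom_r hφ) + tmL f ψ (bhom_r hψ) :=
      tp_ext fun x y => by simp [tp_add_left]
    rw [this]; exact add_mem h1 h2

theorem tmR_mem {f f' : GBim A B} {φ : f →ₗ[ℚ] f'} (g : GBim B C) (hφ : φ ∈ bhom f f') :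
    tmR φ g (bhom_l hφ) ∈ bhom (tens f g) (tens f' g) := by
  induction hφ using Submodule.iSup_induction' with
  | mem k φ hφ =>
    refine homDeg_le k (mem_homDeg_tens _ (fun c x y => ?_) (fun a x y => ?_)
      fun i j x y hx hy => ?_)
    · simp
    · simp [hφ.2.1]
    · rw [tmR_tp]; exact tp_mem hx (hφ.2.2 _ _ hy) (by omega)
  | zero =>
    have : tmR (0 : f →ₗ[ℚ] f') g (fun b x => by simp) = 0 :=
      tp_ext fun x y => by rw [tmR_tp, ← tpL_apply]; exact map_zero _
    rw [this]; exact zero_mem _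
  | add φ ψ hφ hψ h1 h2 =>
    have : tmR (φ + ψ) g (bhom_l (add_mem hφ hψ)) = tmR φ g (bhom_l hφ) + tmR ψ g (bhom_l hψ) :=
      tp_ext fun x y => by simp [tp_add_right]
    rw [this]; exact add_mem h1 h2

/-- The 2-morphism with a given underlying linear map. -/
def mkHom {M N : GBim A B} (φ : M →ₗ[ℚ] N) (h : φ ∈ bhom M N) : M ⟶ N := ⟨φ, h⟩

open GBim (fn)

@[simp] theorem fn_mkHom {M N : GBim A B} (φ : M →ₗ[ℚ] N) (h : φ ∈ bhom M N) :
    fn (mkHom φ h) = φ := rfl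

@[simp] theorem fn_comp {M N K : GBim A B} (φ : M ⟶ N) (ψ : N ⟶ K) :
    fn (φ ≫ ψ) = fn ψ ∘ₗ fn φ := rfl

@[simp] theorem fn_id (M : GBim A B) : fn (𝟙 M) = LinearMap.id := rfl

@[simp] theorem fn_add {M N : GBim A B} (φ ψ : M ⟶ N) : fn (φ + ψ) = fn φ + fn ψ := rfl

theorem fn_mem {M N : GBim A B} (φ : M ⟶ N) : fn φ ∈ bhom M N := φ.2

/-- Whiskering a map of the left factor. -/
def wL {g g' : GBim B C} (f : GBim A B) (φ : g ⟶ g') : tens f g ⟶ tens f g' :=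
  mkHom (tmL f (fn φ) (bhom_r (fn_mem φ))) (tmL_mem f (fn_mem φ))

/-- Whiskering a map of the right factor. -/
def wR {f f' : GBim A B} (φ : f ⟶ f') (g : GBim B C) : tens f g ⟶ tens f' g :=
  mkHom (tmR (fn φ) g (bhom_l (fn_mem φ))) (tmR_mem g (fn_mem φ))

@[simp] theorem wL_tp {g g' : GBim B C} (f : GBim A B) (φ : g ⟶ g') (x : g) (y : f) :
    fn (wL f φ) (tp x y) = tp (fn φ x) y :=
  tmL_tp f (fn φ) (bhom_r (fn_mem φ)) x y

@[simp] theorem wR_tp {f f' : GBim A B} (φ : f ⟶ f') (g : GBim B C) (x : g) (y : f) :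
    fn (wR φ g) (tp x y) = tp x (fn φ y) :=
  tmR_tp (fn φ) g (bhom_l (fn_mem φ)) x y

theorem fn_tp_ext {f : GBim A B} {g : GBim B C} {M : GBim A C} {φ ψ : tens f g ⟶ M}
    (h : ∀ x y, fn φ (tp x y) = fn ψ (tp x y)) : φ = ψ := fn_ext (tp_ext h)

theorem tp_ext3 {f : GBim A B} {g : GBim B C} {h : GBim C D} {V : Type*} [AddCommGroup V]
    [Module ℚ V] {φ ψ : tens (tens f g) h →ₗ[ℚ] V}
    (H : ∀ (z : h) (y : g) (x : f), φ (tp z (tp y x)) = ψ (tp z (tp y x))) : φ = ψ := by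
  refine tp_ext fun z t => ?_
  exact DFunLike.congr_fun (f := φ ∘ₗ tpL (tens f g) h z) (g := ψ ∘ₗ tpL (tens f g) h z)
    (tp_ext fun y x => H z y x) t

theorem tp_ext3' {f : GBim A B} {g : GBim B C} {h : GBim C D} {V : Type*} [AddCommGroup V]
    [Module ℚ V] {φ ψ : tens f (tens g h) →ₗ[ℚ] V}
    (H : ∀ (z : h) (y : g) (x : f), φ (tp (tp z y) x) = ψ (tp (tp z y) x)) : φ = ψ := by
  refine tp_ext fun t x => ?_
  exact DFunLike.congr_fun (f := φ ∘ₗ (tpL f (tens g h)).flip x)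
    (g := ψ ∘ₗ (tpL f (tens g h)).flip x) (tp_ext fun z y => H z y x) t

section

variable (f : GBim A B) (g : GBim B C) (h : GBim C D)

theorem assocBal (z : h) (b : B) (y : g) (x : f) : (tpL f (tens g h) ∘ₗ tpL g h z) (g.r b y) x =
    (tpL f (tens g h) ∘ₗ tpL g h z) y (f.l b x) := by simp [← tp_bal]

/-- `y ⊗ x ↦ (z ⊗ y) ⊗ x`. -/
def assocAux (z : h) : tens f g →ₗ[ℚ] tens f (tens g h) :=
  tlift (tpL f (tens g h) ∘ₗ tpL g h z) (assocBal f g h z)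

@[simp] theorem assocAux_tp (z : h) (y : g) (x : f) :
    assocAux f g h z (tp y x) = tp (tp z y) x :=
  tlift_tp (tpL f (tens g h) ∘ₗ tpL g h z) (assocBal f g h z) y x

/-- `assocAux` as a linear map. -/
def assocAuxL : h →ₗ[ℚ] tens f g →ₗ[ℚ] tens f (tens g h) where
  toFun z := assocAux f g h z
  map_add' z z' := tp_ext fun y x => by simp [tp_add_left]
  map_smul' c z := tp_ext fun y x => by simp [tp_smul_left]

theorem assocBal2 (c : C) (z : h) (t : tens f g) : assocAuxL f g h (h.r c z) t =
    assocAuxL f g h z ((tens f g).l c t) :=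
  DFunLike.congr_fun (f := assocAux f g h (h.r c z))
    (g := assocAux f g h z ∘ₗ (tens f g).l c) (tp_ext fun y x => by simp [tp_bal]) t

/-- `z ⊗ (y ⊗ x) ↦ (z ⊗ y) ⊗ x`. -/
def assocFun : tens (tens f g) h →ₗ[ℚ] tens f (tens g h) :=
  tlift (assocAuxL f g h) (assocBal2 f g h)

@[simp] theorem assocFun_tp (z : h) (y : g) (x : f) :
    assocFun f g h (tp z (tp y x)) = tp (tp z y) x :=
  (tlift_tp (assocAuxL f g h) (assocBal2 f g h) z (tp y x)).trans (assocAux_tp f g h z y x)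

theorem assocBal' (x : f) (c : C) (z : h) (y : g) :
    (tpL (tens f g) h).compl₂ ((tpL f g).flip x) (h.r c z) y =
      (tpL (tens f g) h).compl₂ ((tpL f g).flip x) z (g.l c y) := by simp [tp_bal]

/-- `z ⊗ y ↦ z ⊗ (y ⊗ x)`. -/
def assocAux' (x : f) : tens g h →ₗ[ℚ] tens (tens f g) h :=
  tlift ((tpL (tens f g) h).compl₂ ((tpL f g).flip x)) (assocBal' f g h x)

@[simp] theorem assocAux'_tp (z : h) (y : g) (x : f) :
    assocAux' f g h x (tp z y) = tp z (tp y x) :=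
  tlift_tp ((tpL (tens f g) h).compl₂ ((tpL f g).flip x)) (assocBal' f g h x) z y

/-- `assocAux'` as a linear map. -/
def assocAuxL' : f →ₗ[ℚ] tens g h →ₗ[ℚ] tens (tens f g) h where
  toFun x := assocAux' f g h x
  map_add' z z' := tp_ext fun y x => by simp [tp_add_right]
  map_smul' c z := tp_ext fun y x => by simp [tp_smul_right]

theorem assocBal2' (b : B) (t : tens g h) (x : f) :
    (assocAuxL' f g h).flip ((tens g h).r b t) x = (assocAuxL' f g h).flip t (f.l b x) :=
  DFunLike.congr_fun (f := assocAux' f g h x ∘ₗ (tens g h).r b) (g := assocAux' f g h (f.l b x))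
    (tp_ext fun z y => by simp [tp_bal]) t

/-- `(z ⊗ y) ⊗ x ↦ z ⊗ (y ⊗ x)`. -/
def assocInv : tens f (tens g h) →ₗ[ℚ] tens (tens f g) h :=
  tlift (assocAuxL' f g h).flip (assocBal2' f g h)

@[simp] theorem assocInv_tp (z : h) (y : g) (x : f) :
    assocInv f g h (tp (tp z y) x) = tp z (tp y x) :=
  (tlift_tp (assocAuxL' f g h).flip (assocBal2' f g h) (tp z y) x).trans (assocAux'_tp f g h z y x)

theorem assocFun_mem : assocFun f g h ∈ homDeg (tens (tens f g) h) (tens f (tens g h)) 0 := by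
  refine mem_homDeg_tens _ (fun c z t => ?_) (fun a z t => ?_) fun i j z t hz ht => ?_
  · exact DFunLike.congr_fun (f := assocFun f g h ∘ₗ tpL (tens f g) h (h.l c z))
      (g := (tens f (tens g h)).l c ∘ₗ assocFun f g h ∘ₗ tpL (tens f g) h z)
      (tp_ext fun y x => by simp) t
  · exact DFunLike.congr_fun (f := assocFun f g h ∘ₗ tpL (tens f g) h z ∘ₗ (tens f g).r a)
      (g := (tens f (tens g h)).r a ∘ₗ assocFun f g h ∘ₗ tpL (tens f g) h z)
      (tp_ext fun y x => by simp) t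
  · refine tgr_map (assocFun f g h ∘ₗ tpL (tens f g) h z) (fun i' j' y x e hy hx => ?_) ht
    simp only [LinearMap.comp_apply, tpL_apply, assocFun_tp]
    exact tp_mem (tp_mem hz hy rfl) hx (by omega)

theorem assocInv_mem : assocInv f g h ∈ homDeg (tens f (tens g h)) (tens (tens f g) h) 0 := by
  refine mem_homDeg_tens _ (fun c t x => ?_) (fun a t x => ?_) fun i j t x ht hx => ?_
  · exact DFunLike.congr_fun
      (f := assocInv f g h ∘ₗ (tpL f (tens g h)).flip x ∘ₗ (tens g h).l c)
      (g := (tens (tens f g) h).l c ∘ₗ assocInv f g h ∘ₗ (tpL f (tens g h)).flip x)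
      (tp_ext fun z y => by simp) t
  · exact DFunLike.congr_fun
      (f := assocInv f g h ∘ₗ (tpL f (tens g h)).flip (f.r a x))
      (g := (tens (tens f g) h).r a ∘ₗ assocInv f g h ∘ₗ (tpL f (tens g h)).flip x)
      (tp_ext fun z y => by simp) t
  · refine tgr_map (assocInv f g h ∘ₗ (tpL f (tens g h)).flip x) (fun i' j' z y e hz hy => ?_) ht
    simp only [LinearMap.comp_apply, LinearMap.flip_apply, tpL_apply, assocInv_tp]
    exact tp_mem hz (tp_mem hy hx rfl) (by omega)

/-- The associator. -/
def assocB : tens (tens f g) h ≅ tens f (tens g h) :=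
  mkIso (assocFun f g h) (assocInv f g h) (assocFun_mem f g h) (assocInv_mem f g h)
    (tp_ext3 fun z y x => by simp) (tp_ext3' fun z y x => by simp)

@[simp] theorem assocB_hom (z : h) (y : g) (x : f) :
    fn (assocB f g h).hom (tp z (tp y x)) = tp (tp z y) x := assocFun_tp f g h z y x

@[simp] theorem assocB_inv (z : h) (y : g) (x : f) :
    fn (assocB f g h).inv (tp (tp z y) x) = tp z (tp y x) := assocInv_tp f g h z y x

@[simp] theorem idBim_l (a : A) (x : A) : (idBim A).l a x = (a * x : A) := rfl

@[simp] theorem idBim_r (a : A) (x : A) : (idBim A).r a x = (a * x : A) := rfl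

/-- The unit element of the identity bimodule. -/
def idOne (A : GAlg) : idBim A := (1 : A)

theorem idOne_mem (A : GAlg) : idOne A ∈ (idBim A).gr 0 := A.graded.one_mem

theorem idBim_eq_l (a : idBim A) : (idBim A).l (show A from a) (idOne A) = a := mul_one (M := A) _

theorem idBim_eq_r (a : idBim A) : (idBim A).r (show A from a) (idOne A) = a := mul_one (M := A) _

/-- `y ⊗ a ↦ y a`. -/
def lunitFun : tens (idBim A) f →ₗ[ℚ] f :=
  tlift (f := idBim A) (LinearMap.flip f.r.toLinearMap) (fun b x y => by
    change f.r (show A from y) (f.r b x) = f.r (b * (show A from y)) x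
    rw [mul_comm, map_mul]; rfl)

theorem lunitFun_tp (y : f) (a : idBim A) : lunitFun f (tp y a) = f.r (show A from a) y :=
  tlift_tp _ _ _ _

/-- The left unitor. -/
def lunitB : tens (idBim A) f ≅ f :=
  mkIso (lunitFun f) ((tpL (idBim A) f).flip (idOne A))
    (mem_homDeg_tens _ (fun c x y => by simp only [lunitFun_tp]; exact (f.comm _ _ _).symm)
      (fun a x y => by
        simp only [lunitFun_tp]
        exact congrFun (congrArg DFunLike.coe (map_mul f.r a (show A from y))) x)
      (fun i j x y hx hy => by
        rw [lunitFun_tp]; have := f.r_mem (a := (show A from y)) hy hx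
        rwa [add_zero, add_comm]))
    ⟨fun b x => by simp, fun a x => by
      simp only [LinearMap.flip_apply, tpL_apply, tp_bal, tens_r]; congr 1, fun i x hx => by
      simpa using tp_mem hx (idOne_mem A) rfl⟩
    (tp_ext fun x y => by
      simp only [LinearMap.comp_apply, lunitFun_tp, LinearMap.flip_apply, tpL_apply]
      refine (tp_bal (f := idBim A) (show A from y) x (idOne A)).trans ?_
      rw [idBim_eq_l]; rfl)
    (by ext x; simp [lunitFun_tp]; exact congrFun (congrArg DFunLike.coe (map_one f.r)) x)

/-- `b ⊗ y ↦ b y`. -/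
def runitFun : tens f (idBim B) →ₗ[ℚ] f :=
  tlift (g := idBim B) f.l.toLinearMap (fun b x y => by
    change f.l (b * (show B from x)) y = f.l (show B from x) (f.l b y)
    rw [mul_comm, map_mul]; rfl)

theorem runitFun_tp (b : idBim B) (y : f) : runitFun f (tp b y) = f.l (show B from b) y :=
  tlift_tp _ _ _ _

/-- The right unitor. -/
def runitB : tens f (idBim B) ≅ f :=
  mkIso (runitFun f) (tpL f (idBim B) (idOne B))
    (mem_homDeg_tens _ (fun a x y => by
        simp only [runitFun_tp]
        exact congrFun (congrArg DFunLike.coe (map_mul f.l a (show B from x))) y)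
      (fun c x y => by simp only [runitFun_tp]; exact f.comm _ _ _)
      (fun i j x y hx hy => by
        rw [runitFun_tp]; have := f.l_mem (b := (show B from x)) hx hy
        rwa [add_zero]))
    ⟨fun b x => by
      simp only [tpL_apply, ← tp_bal, tens_l]; congr 1, fun a x => by simp, fun i x hx => by
      simpa using tp_mem (idOne_mem B) hx rfl⟩
    (tp_ext fun x y => by
      simp only [LinearMap.comp_apply, runitFun_tp, tpL_apply]
      refine (tp_bal (g := idBim B) (show B from x) (idOne B) y).symm.trans ?_
      rw [idBim_eq_r]; rfl)
    (by ext x; simp [runitFun_tp]; exact congrFun (congrArg DFunLike.coe (map_one f.l)) x)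

theorem lunitB_hom (y : f) (a : idBim A) : fn (lunitB f).hom (tp y a) = f.r (show A from a) y :=
  lunitFun_tp _ _ _

theorem runitB_hom (y : f) (a : idBim B) : fn (runitB f).hom (tp a y) = f.l (show B from a) y :=
  runitFun_tp _ _ _

end

theorem wL_comp (f : GBim A B) {g g' g'' : GBim B C} (φ : g ⟶ g') (ψ : g' ⟶ g'') :
    wL f (φ ≫ ψ) = wL f φ ≫ wL f ψ := fn_tp_ext fun x y => by simp

theorem wR_comp {f f' f'' : GBim A B} (φ : f ⟶ f') (ψ : f' ⟶ f'') (g : GBim B C) :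
    wR (φ ≫ ψ) g = wR φ g ≫ wR ψ g := fn_tp_ext fun x y => by simp

theorem wL_add (f : GBim A B) {g g' : GBim B C} (φ ψ : g ⟶ g') :
    wL f (φ + ψ) = wL f φ + wL f ψ := fn_tp_ext fun x y => by simp [tp_add_left]

theorem wR_add {f f' : GBim A B} (φ ψ : f ⟶ f') (g : GBim B C) :
    wR (φ + ψ) g = wR φ g + wR ψ g := fn_tp_ext fun x y => by simp [tp_add_right]

theorem wL_lunit {f g : GBim A B} (φ : f ⟶ g) :
    wL (idBim A) φ ≫ (lunitB g).hom = (lunitB f).hom ≫ φ := fn_tp_ext fun x y => by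
  simp [lunitB_hom]; exact (bhom_r (fn_mem φ) _ _).symm

theorem wR_runit {f g : GBim A B} (φ : f ⟶ g) :
    wR φ (idBim B) ≫ (runitB g).hom = (runitB f).hom ≫ φ := fn_tp_ext fun x y => by
  simp [runitB_hom]; exact (bhom_l (fn_mem φ) _ _).symm

theorem wL_assoc (f : GBim A B) (g : GBim B C) {h h' : GBim C D} (φ : h ⟶ h') :
    wL (tens f g) φ ≫ (assocB f g h').hom = (assocB f g h).hom ≫ wL f (wL g φ) :=
  fn_ext (tp_ext3 fun z y x => by simp)

theorem wR_assoc {f f' : GBim A B} (φ : f ⟶ f') (g : GBim B C) (h : GBim C D) :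
    (assocB f g h).hom ≫ wR φ (tens g h) = wR (wR φ g) h ≫ (assocB f' g h).hom :=
  fn_ext (tp_ext3 fun z y x => by simp)

theorem wLR_assoc (f : GBim A B) {g g' : GBim B C} (φ : g ⟶ g') (h : GBim C D) :
    wR (wL f φ) h ≫ (assocB f g' h).hom = (assocB f g h).hom ≫ wL f (wR φ h) :=
  fn_ext (tp_ext3 fun z y x => by simp)

theorem wLR {f f' : GBim A B} {g g' : GBim B C} (φ : f ⟶ f') (ψ : g ⟶ g') :
    wL f ψ ≫ wR φ g' = wR φ g ≫ wL f' ψ := fn_tp_ext fun x y => by simp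

theorem pentB {E : GAlg} (f : GBim A B) (g : GBim B C) (h : GBim C D) (i : GBim D E) :
    wR (assocB f g h).hom i ≫ (assocB f (tens g h) i).hom ≫ wL f (assocB g h i).hom =
      (assocB (tens f g) h i).hom ≫ (assocB f g (tens h i)).hom := by
  refine fn_tp_ext fun w t => ?_
  exact DFunLike.congr_fun
    (f := fn (wR (assocB f g h).hom i ≫ (assocB f (tens g h) i).hom ≫ wL f (assocB g h i).hom) ∘ₗ
      tpL (tens (tens f g) h) i w)
    (g := fn ((assocB (tens f g) h i).hom ≫ (assocB f g (tens h i)).hom) ∘ₗ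
      tpL (tens (tens f g) h) i w) (tp_ext3 fun z y x => by simp) t

theorem triB (f : GBim A B) (g : GBim B C) :
    (assocB f (idBim B) g).hom ≫ wL f (lunitB g).hom = wR (runitB f).hom g :=
  fn_ext (tp_ext3 fun z y x => by
    simp [lunitB_hom, runitB_hom]; exact tp_bal _ _ _)

end Structure

open GBim (fn)

instance : CategoryStruct GAlg where
  Hom A B := GBim A B
  id A := idBim A
  comp f g := tens f g

/-- The bicategory `Bim^*`: objects are graded commutative algebras, 1-morphisms are
graded bimodules, and 2-morphisms are bimodule maps of all degrees. -/
instance : Bicategory GAlg where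
  homCategory A B := inferInstanceAs (Category (GBim A B))
  whiskerLeft {_ _ _} f {_ _} φ := wL f φ
  whiskerRight φ h := wR φ h
  associator f g h := assocB f g h
  leftUnitor f := lunitB f
  rightUnitor f := runitB f
  whiskerLeft_id _ _ := fn_tp_ext fun _ _ => wL_tp _ _ _ _
  whiskerLeft_comp f _ _ _ φ ψ := wL_comp f φ ψ
  id_whiskerLeft φ := ((Iso.eq_comp_inv (lunitB _)).2 (wL_lunit φ)).trans (Category.assoc _ _ _)
  comp_whiskerLeft f g _ _ φ :=
    ((Iso.eq_comp_inv (assocB _ _ _)).2 (wL_assoc f g φ)).trans (Category.assoc _ _ _)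
  id_whiskerRight _ _ := fn_tp_ext fun _ _ => wR_tp _ _ _ _
  comp_whiskerRight φ ψ h := wR_comp φ ψ h
  whiskerRight_id φ := ((Iso.eq_comp_inv (runitB _)).2 (wR_runit φ)).trans (Category.assoc _ _ _)
  whiskerRight_comp φ g h := (Iso.eq_inv_comp (assocB _ _ _)).2 (wR_assoc φ g h)
  whisker_assoc f _ _ φ h :=
    ((Iso.eq_comp_inv (assocB _ _ _)).2 (wLR_assoc f φ h)).trans (Category.assoc _ _ _)
  whisker_exchange φ ψ := wLR φ ψ
  pentagon f g h i := pentB f g h i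
  triangle f g := triB f g

instance : AdditiveBicategory GAlg where
  preadd A B := inferInstanceAs (Preadditive (GBim A B))
  add_whiskerRight φ ψ h := wR_add φ ψ h
  whiskerLeft_add f _ _ φ ψ := wL_add f φ ψ

/-- The shifted bimodule `M{t}`, with `M{t}_k = M_{k - t}`. -/
def GBim.sh {A B : GAlg} (M : GBim A B) (t : ℤ) : GBim A B where
  carrier := M
  l := M.l
  r := M.r
  comm := M.comm
  gr k := M.gr (k - t)
  internal := by
    have h := M.internal
    have h1 := h.submodule_iSupIndep.comp (sub_left_injective (b := t))
    refine DirectSum.isInternal_submodule_of_iSupIndep_of_iSup_eq_top h1 ?_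
    rw [← h.submodule_iSup_eq_top]
    exact (Equiv.subRight t).iSup_comp (g := M.gr)
  l_mem {i j b x} hb hx := by
    have := M.l_mem hb hx
    rwa [← add_sub_assoc] at this
  r_mem {i j b x} hb hx := by
    have := M.r_mem hb hx
    rwa [← add_sub_assoc] at this

/-- The diagonal action on a product. -/
def piEnd {R : Type} [CommRing R] [Algebra ℚ R] {ι : Type} {V : ι → Type}
    [∀ i, AddCommGroup (V i)] [∀ i, Module ℚ (V i)] (l : ∀ i, R →ₐ[ℚ] Module.End ℚ (V i)) :
    R →ₐ[ℚ] Module.End ℚ (∀ i, V i) :=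
  AlgHom.ofLinearMap
    { toFun := fun b => LinearMap.pi fun i => l i b ∘ₗ LinearMap.proj i
      map_add' := fun b c => by ext x i; simp
      map_smul' := fun b c => by ext x i; simp }
    (by ext x i; simp) (fun b c => by ext x i; simp)

@[simp] theorem piEnd_apply {R : Type} [CommRing R] [Algebra ℚ R] {ι : Type} {V : ι → Type}
    [∀ i, AddCommGroup (V i)] [∀ i, Module ℚ (V i)] (l : ∀ i, R →ₐ[ℚ] Module.End ℚ (V i)) (b : R)
    (x : ∀ i, V i) (i : ι) : piEnd l b x i = l i b (x i) := rfl

theorem pi_internal {ι : Type} [Fintype ι] {V : ι → Type} [∀ i, AddCommGroup (V i)]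
    [∀ i, Module ℚ (V i)] (gr : ∀ i, ℤ → Submodule ℚ (V i))
    (h : ∀ i, DirectSum.IsInternal (gr i)) :
    DirectSum.IsInternal fun k => Submodule.pi Set.univ fun i => gr i k := by
  classical
  choose h1 φ hφ using fun i => (isInternal_iff _).1 (h i)
  refine (isInternal_iff _).2 ⟨?_, LinearMap.pi fun i => φ i ∘ₗ LinearMap.proj i, ?_⟩
  · rw [eq_top_iff]
    intro x _
    have hx : x = ∑ i, LinearMap.single ℚ V i (x i) := by
      ext j; simp [Finset.sum_apply]
    rw [hx]
    refine sum_mem fun i _ => ?_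
    have : (⊤ : Submodule ℚ (V i)) ≤ (⨆ k, Submodule.pi Set.univ fun i => gr i k).comap
        (LinearMap.single ℚ V i) := by
      rw [← h1 i]
      refine iSup_le fun k y hy => ?_
      refine Submodule.mem_iSup_of_mem k ?_
      intro j _
      by_cases hj : j = i
      · subst hj; simpa using hy
      · simp [hj]
    exact this trivial
  · intro k x hx
    ext i
    simpa using hφ i k (x i) (hx i trivial)

/-- The direct sum of a finite family of graded bimodules. -/
def dirSum {A B : GAlg} {ι : Type} [Fintype ι] (M : ι → GBim A B) : GBim A B where
  carrier := ∀ i, M i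
  l := piEnd fun i => (M i).l
  r := piEnd fun i => (M i).r
  comm b a x := funext fun i => (M i).comm b a (x i)
  gr k := Submodule.pi Set.univ fun i => (M i).gr k
  internal := pi_internal _ fun i => (M i).internal
  l_mem hb hx := fun i _ => (M i).l_mem hb (hx i trivial)
  r_mem hb hx := fun i _ => (M i).r_mem hb (hx i trivial)

/-- A graded algebra `S` with degree preserving homomorphisms `B → S ← A`, as a `(B, A)`-bimodule. -/
def algBim {A B S : GAlg} (φ : B →ₐ[ℚ] S) (ψ : A →ₐ[ℚ] S) (hφ : ∀ {i b}, b ∈ B.gr i → φ b ∈ S.gr i)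
    (hψ : ∀ {i a}, a ∈ A.gr i → ψ a ∈ S.gr i) : GBim A B where
  carrier := S
  l := (Algebra.lmul ℚ S).comp φ
  r := (Algebra.lmul ℚ S).comp ψ
  comm _ _ _ := mul_left_comm _ _ _
  gr := S.gr
  internal := S.internal
  l_mem hb hx := S.graded.mul_mem (hφ hb) hx
  r_mem hb hx := S.graded.mul_mem (hψ hb) hx

end Schur

namespace Schur

noncomputable section

/-! ### The 2-categories `S(n,d)` and `U(sl_n)` -/

/-- The entry `λ_{i+1}` of a `gl_n`-weight (entries are numbered from `0` here); zero out of range. -/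
def en {n : ℕ} (lam : Fin n → ℤ) (i : ℕ) : ℤ := if h : i < n then lam ⟨i, h⟩ else 0

/-- The weight `(0, …, 1, -1, …, 0)`. -/
def glRoot {n : ℕ} (i : Fin (n - 1)) : Fin n → ℤ :=
  fun l => if l.val = i.val then 1 else if l.val = i.val + 1 then -1 else 0

/-- `λ̄_i = λ_i - λ_{i+1}`. -/
def glBar {n : ℕ} (lam : Fin n → ℤ) (i : Fin (n - 1)) : ℤ := en lam i.val - en lam (i.val + 1)

/-- The sign `(-1)^k`. -/
def sg (k : ℤ) : ℚ := if Even k then 1 else -1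

section Bubbles

variable {n : ℕ}

/-- `k` dots on the strand `a`, with identity strands `u` and `v` around it. -/
def dots (u : SSeq n) (a : Letter n) (v : SSeq n) (k : ℕ) : Alg n := lay u (.dot a) v ^ k

/-- The clockwise bubble with `r` dots. -/
def cwReal (i : Fin (n - 1)) (r : ℕ) : Alg n :=
  lay [] (.lcup i) [] * dots [] (up i) [dn i] r * lay [] (.rcap i) []

/-- The counterclockwise bubble with `r` dots. -/
def ccReal (i : Fin (n - 1)) (r : ℕ) : Alg n :=
  lay [] (.rcup i) [] * dots [dn i] (up i) [] r * lay [] (.lcap i) []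

/-- The clockwise bubble of degree `2m`, i.e. with label `λ̄_i - 1 + m`; if the label is negative,
this is the fake bubble, determined by the infinite Grassmannian relation. -/
def cwBub (lam : Fin n → ℤ) (i : Fin (n - 1)) (m : ℕ) : Alg n :=
  if 0 ≤ glBar lam i - 1 + m then cwReal i (glBar lam i - 1 + m).toNat
  else if m = 0 then algebraMap ℚ _ (sg (en lam (i.val + 1)))
  else sg (en lam (i.val + 1)) •
    ∑ j : Fin m, cwBub lam i j.val * ccReal i (- glBar lam i - 1 + m - j.val).toNat
termination_by m
decreasing_by exact j.isLt

/-- The counterclockwise bubble of degree `2m`, i.e. with label `-λ̄_i - 1 + m`; if the label is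
negative, this is the fake bubble, determined by the infinite Grassmannian relation. -/
def ccBub (lam : Fin n → ℤ) (i : Fin (n - 1)) (m : ℕ) : Alg n :=
  if 0 ≤ - glBar lam i - 1 + m then ccReal i (- glBar lam i - 1 + m).toNat
  else if m = 0 then algebraMap ℚ _ (- sg (en lam (i.val + 1)))
  else (- sg (en lam (i.val + 1))) •
    ∑ j : Fin m, ccBub lam i j.val * cwReal i (glBar lam i - 1 + m - j.val).toNat
termination_by m
decreasing_by exact j.isLt

/-- The clockwise bubble with label `r ∈ ℤ`, in a region labelled `lam`. -/
def cw (lam : Fin n → ℤ) (i : Fin (n - 1)) (r : ℤ) : Alg n :=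
  if 0 ≤ r then cwReal i r.toNat
  else if 0 ≤ r - glBar lam i + 1 then cwBub lam i (r - glBar lam i + 1).toNat else 0

/-- The counterclockwise bubble with label `r ∈ ℤ`, in a region labelled `lam`. -/
def cc (lam : Fin n → ℤ) (i : Fin (n - 1)) (r : ℤ) : Alg n :=
  if 0 ≤ r then ccReal i r.toNat
  else if 0 ≤ r + glBar lam i + 1 then ccBub lam i (r + glBar lam i + 1).toNat else 0

/-- The crossing of two upward strands. -/
abbrev crU (i j : Fin (n - 1)) : Gen n := .cross true i j

/-- The sideways crossing from `𝓔_j 𝓔_{-i}` to `𝓔_{-i} 𝓔_j`. -/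
def crossL (j i : Fin (n - 1)) : Alg n :=
  lay [] (.rcup i) [up j, dn i] * lay [dn i] (crU i j) [dn i] * lay [dn i, up j] (.rcap i) []

/-- The sideways crossing from `𝓔_{-j} 𝓔_i` to `𝓔_i 𝓔_{-j}`. -/
def crossR (j i : Fin (n - 1)) : Alg n :=
  lay [dn j, up i] (.lcup j) [] * lay [dn j] (crU i j) [dn j] * lay [] (.lcap j) [up i, dn j]

end Bubbles

/-- The relations of `U(gl_n)`: `RelGL lam s t x` means that `x = 0` is imposed on diagrams from
`s` to `t` with rightmost region `lam`. -/
inductive RelGL {n : ℕ} (lam : Fin n → ℤ) : SSeq n → SSeq n → Alg n → Prop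
  -- biadjointness
  | biadj1 (i) : RelGL lam [up i] [up i] (lay [up i] (.rcup i) [] * lay [] (.rcap i) [up i] - 1)
  | biadj2 (i) : RelGL lam [dn i] [dn i] (lay [dn i] (.lcup i) [] * lay [] (.lcap i) [dn i] - 1)
  | biadj3 (i) : RelGL lam [up i] [up i] (lay [] (.lcup i) [up i] * lay [up i] (.lcap i) [] - 1)
  | biadj4 (i) : RelGL lam [dn i] [dn i] (lay [] (.rcup i) [dn i] * lay [dn i] (.rcap i) [] - 1)
  -- cyclicity of dots and crossings
  | cycDot1 (i) : RelGL lam [dn i] [dn i] (lay [dn i] (.lcup i) [] *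
      lay [dn i] (.dot (up i)) [dn i] * lay [] (.lcap i) [dn i] - lay [] (.dot (dn i)) [])
  | cycDot2 (i) : RelGL lam [dn i] [dn i] (lay [] (.rcup i) [dn i] *
      lay [dn i] (.dot (up i)) [dn i] * lay [dn i] (.rcap i) [] - lay [] (.dot (dn i)) [])
  | cycCross1 (i j) : RelGL lam [dn j, dn i] [dn i, dn j] (lay [] (.cross false j i) [] -
      lay [dn j, dn i] (.lcup j) [] * lay [dn j, dn i, up j] (.lcup i) [dn j] *
        lay [dn j, dn i] (crU j i) [dn i, dn j] * lay [dn j] (.lcap i) [up j, dn i, dn j] *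
        lay [] (.lcap j) [dn i, dn j])
  | cycCross2 (i j) : RelGL lam [dn j, dn i] [dn i, dn j] (lay [] (.cross false j i) [] -
      lay [] (.rcup i) [dn j, dn i] * lay [dn i] (.rcup j) [up i, dn j, dn i] *
        lay [dn i, dn j] (crU j i) [dn j, dn i] * lay [dn i, dn j, up i] (.rcap j) [dn i] *
        lay [dn i, dn j] (.rcap i) [])
  -- bubbles
  | posCw (i) (r : ℕ) (h : (r : ℤ) < glBar lam i - 1) : RelGL lam [] [] (cwReal i r)
  | posCc (i) (r : ℕ) (h : (r : ℤ) < - glBar lam i - 1) : RelGL lam [] [] (ccReal i r)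
  | zeroCw (i) (h : 1 ≤ glBar lam i) : RelGL lam [] []
      (cwReal i (glBar lam i - 1).toNat - algebraMap ℚ _ (sg (en lam (i.val + 1))))
  | zeroCc (i) (h : glBar lam i ≤ -1) : RelGL lam [] []
      (ccReal i (- glBar lam i - 1).toNat - algebraMap ℚ _ (sg (en lam (i.val + 1) - 1)))
  | grass (i) (m : ℕ) : RelGL lam [] []
      (∑ j ∈ Finset.range (m + 1), ccBub lam i j * cwBub lam i (m - j) + if m = 0 then 1 else 0)
  -- reduction to bubbles
  | curlR (i) : RelGL lam [up i] [up i] (lay [up i] (.lcup i) [] * lay [] (crU i i) [dn i] *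
      lay [up i] (.rcap i) [] +
      ∑ f ∈ Finset.range (1 - glBar lam i).toNat, whisk [up i] [] (cw lam i (glBar lam i - 1 + f)) *
        dots [] (up i) [] (- glBar lam i - f).toNat)
  | curlL (i) (mu : Fin n → ℤ) (hmu : mu = lam + glRoot i) : RelGL lam [up i] [up i]
      (lay [] (.rcup i) [up i] * lay [dn i] (crU i i) [] * lay [] (.lcap i) [up i] -
      ∑ g ∈ Finset.range (glBar mu i + 1).toNat,
        whisk [] [up i] (cc mu i (- glBar mu i - 1 + g)) * dots [] (up i) [] (glBar mu i - g).toNat)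
  | decEF (i) : RelGL lam [up i, dn i] [up i, dn i] (1 - crossL i i * crossR i i +
      ∑ f ∈ Finset.range (glBar lam i).toNat, ∑ g ∈ Finset.range (f + 1),
        dots [] (up i) [dn i] (f - g) * lay [] (.rcap i) [] * cc lam i (- glBar lam i - 1 + g) *
        lay [] (.lcup i) [] * dots [] (up i) [dn i] (glBar lam i - 1 - f).toNat)
  | decFE (i) : RelGL lam [dn i, up i] [dn i, up i] (1 - crossR i i * crossL i i +
      ∑ f ∈ Finset.range (- glBar lam i).toNat, ∑ g ∈ Finset.range (f + 1),
        dots [dn i] (up i) [] (f - g) * lay [] (.lcap i) [] * cw lam i (glBar lam i - 1 + g) *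
        lay [] (.rcup i) [] * dots [dn i] (up i) [] (- glBar lam i - 1 - f).toNat)
  -- nilHecke relations
  | nil (i) : RelGL lam [up i, up i] [up i, up i] (lay [] (crU i i) [] * lay [] (crU i i) [])
  | nilDot1 (i) : RelGL lam [up i, up i] [up i, up i]
      (1 - lay [] (.dot (up i)) [up i] * lay [] (crU i i) [] +
        lay [] (crU i i) [] * lay [up i] (.dot (up i)) [])
  | nilDot2 (i) : RelGL lam [up i, up i] [up i, up i]
      (1 - lay [] (crU i i) [] * lay [] (.dot (up i)) [up i] +
        lay [up i] (.dot (up i)) [] * lay [] (crU i i) [])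
  -- different colours
  | sideLR (i j) (h : i ≠ j) :
      RelGL lam [up i, dn j] [up i, dn j] (crossL i j * crossR j i - 1)
  | sideRL (i j) (h : i ≠ j) :
      RelGL lam [dn i, up j] [dn i, up j] (crossR i j * crossL j i - 1)
  | far (i j) (h : cartan i j = 0) :
      RelGL lam [up i, up j] [up i, up j] (lay [] (crU i j) [] * lay [] (crU j i) [] - 1)
  | near (i j) (h : cartan i j = -1) : RelGL lam [up i, up j] [up i, up j]
      (lay [] (crU i j) [] * lay [] (crU j i) [] -
        ((i.val : ℚ) - j.val) • (lay [] (.dot (up i)) [up j] - lay [up i] (.dot (up j)) []))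
  | slide1 (i j) (h : i ≠ j) : RelGL lam [up i, up j] [up j, up i]
      (lay [] (crU i j) [] * lay [up j] (.dot (up i)) [] -
        lay [] (.dot (up i)) [up j] * lay [] (crU i j) [])
  | slide2 (i j) (h : i ≠ j) : RelGL lam [up i, up j] [up j, up i]
      (lay [] (crU i j) [] * lay [] (.dot (up j)) [up i] -
        lay [up i] (.dot (up j)) [] * lay [] (crU i j) [])
  | triple (i j k) (h : ¬ (i = k ∧ cartan i j = -1)) :
      RelGL lam [up i, up j, up k] [up k, up j, up i]
      (lay [] (crU i j) [up k] * lay [up j] (crU i k) [] * lay [] (crU j k) [up i] -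
        lay [up i] (crU j k) [] * lay [] (crU i k) [up j] * lay [up k] (crU i j) [])
  | tripleIJI (i j) (h : cartan i j = -1) : RelGL lam [up i, up j, up i] [up i, up j, up i]
      (lay [] (crU i j) [up i] * lay [up j] (crU i i) [] * lay [] (crU j i) [up i] -
        lay [up i] (crU j i) [] * lay [] (crU i i) [up j] * lay [up i] (crU i j) [] -
        algebraMap ℚ _ ((i.val : ℚ) - j.val))

/-- `λ ∈ Λ(n,d)`. -/
def Good {n : ℕ} (d : ℕ) (lam : Fin n → ℤ) : Prop := (∀ i, 0 ≤ lam i) ∧ ∑ i, lam i = d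

/-- The 2-category `S(n,d)`: the quotient of `U(gl_n)` by the ideal generated by the diagrams with
a region labelled outside `Λ(n,d)`. -/
abbrev presS (n d : ℕ) : Pres n where
  W := Fin n → ℤ
  root := glRoot
  bar := glBar
  rel := RelGL
  dead := fun lam => ¬ Good d lam

/-- The sign in the comparison of the two sign conventions: it is nontrivial on left caps and left
cups only; `lam` is the rightmost region. -/
def layerSign {n : ℕ} (lam : Fin n → ℤ) (l : Layer n) : ℚ :=
  match l.gen with
  | .lcap i => sg (en (lam + (presS n 0).wt l.right) (i.val + 1) + 1)
  | .lcup i => sg (en (lam + (presS n 0).wt l.right) (i.val + 1))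
  | _ => 1

/-- The change of sign conventions. -/
def twist {n : ℕ} (lam : Fin n → ℤ) : Alg n →ₐ[ℚ] Alg n :=
  FreeAlgebra.lift ℚ fun l => layerSign lam l • FreeAlgebra.ι ℚ l

/-- The 2-category `U(sl_n)` with the (corrected) signs of Khovanov and Lauda: its regions are
labelled by `sl_n`-weights, and its relations correspond to those of `U(gl_n)` under the change
of sign conventions. -/
abbrev presSL (n : ℕ) : Pres n where
  W := Fin (n - 1) → ℤ
  root := cartan
  bar := fun mu i => mu i
  rel := fun mu s t x => ∃ (lam : Fin n → ℤ) (y : Alg n), (∀ i, glBar lam i = mu i) ∧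
    RelGL lam s t y ∧ x = twist lam y
  dead := fun _ => False

open scoped Classical in
/-- The class of `x`, if `x` is a combination of diagrams from `w` to `w'` (and `0` otherwise). -/
def Hom2.cls {n : ℕ} (P : Pres n) (lam : P.W) (w w' : SSeq n) (x : Alg n) : Hom2 P lam w w' :=
  if h : x ∈ P.dia lam w w' then Hom2.mk P lam ⟨x, h⟩ else 0

/-- The `gl_n`-weight assigned to an `sl_n`-weight: the lift `λ` of `mu` with
`d ≤ λ_1 + ⋯ + λ_n < d + n`. If `mu` has a lift with sum `d`, this is it; otherwise (or if that lift
has a negative entry) the value lies outside `Λ(n,d)`. -/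
def psiObj (n d : ℕ) (mu : Fin (n - 1) → ℤ) : Fin n → ℤ := fun j =>
  (∑ k : Fin (n - 1), if j.val ≤ k.val then mu k else 0) -
    (∑ k : Fin (n - 1), (k.val + 1 : ℤ) * mu k - d) / n

end

end Schur

namespace Schur

open CategoryTheory MvPolynomial

noncomputable section

/-! ### Rings of partially symmetric polynomials -/

section Rings

variable {n : ℕ} (d : ℕ)

/-- The polynomials in `z_1, …, z_d` (numbered from `0` here). -/
abbrev Poly := MvPolynomial (Fin d) ℚ

/-- `k_i = λ_1 + ⋯ + λ_i`. -/
def kk (lam : Fin n → ℤ) (i : ℕ) : ℤ := ∑ l : Fin n, if l.val < i then lam l else 0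

/-- The permutations in `S_{λ_1} × ⋯ × S_{λ_n}`, i.e. those preserving all `{1, …, k_i}`. -/
def Young (lam : Fin n → ℤ) (σ : Equiv.Perm (Fin d)) : Prop :=
  ∀ (i : ℕ) (j : Fin d), ((σ j).val : ℤ) < kk lam i ↔ (j.val : ℤ) < kk lam i

/-- The algebra of polynomials invariant under the permutations in `G`, if `P` holds, and the zero
algebra if `P` does not hold. -/
def InvSub (P : Prop) (G : Equiv.Perm (Fin d) → Prop) : Subalgebra ℚ (PLift P → Poly d) where
  carrier := {f | ∀ h σ, G σ → rename σ (f h) = f h}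
  mul_mem' hf hg := fun h σ hσ => by simp [hf h σ hσ, hg h σ hσ]
  add_mem' hf hg := fun h σ hσ => by simp [hf h σ hσ, hg h σ hσ]
  algebraMap_mem' r := fun h σ hσ => by simp [Pi.algebraMap_apply, algebraMap_eq]

variable {d}

/-- The grading: every variable has degree `2`. -/
def invGr (P : Prop) (G : Equiv.Perm (Fin d) → Prop) (k : ℤ) : Submodule ℚ (InvSub d P G) where
  carrier := {f | ∀ h, IsWeightedHomogeneous (fun _ => (2 : ℤ)) (f.1 h) k}
  zero_mem' := fun _ => isWeightedHomogeneous_zero _ _ _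
  add_mem' hf hg := fun h => (hf h).add (hg h)
  smul_mem' c f hf := fun h => (weightedHomogeneousSubmodule ℚ (fun _ => (2 : ℤ)) k).smul_mem c (hf h)

theorem rename_comp (σ : Equiv.Perm (Fin d)) (p : Poly d) (j : ℕ) :
    rename σ (homogeneousComponent j p) = homogeneousComponent j (rename σ p) := by
  conv_rhs => rw [← sum_homogeneousComponent p]
  rw [map_sum, map_sum]
  have h : ∀ i, homogeneousComponent j (rename σ (homogeneousComponent i p)) =
      if i = j then rename σ (homogeneousComponent i p) else 0 := by
    intro i
    have := (homogeneousComponent_isHomogeneous i p).rename_isHomogeneous (f := σ)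
    rw [homogeneousComponent_of_mem this]
    simp [eq_comm]
  simp only [h]
  by_cases hj : j < p.totalDegree + 1
  · rw [Finset.sum_ite_eq' , if_pos (Finset.mem_range.2 hj)]
  · rw [Finset.sum_ite_eq' , if_neg (by simpa using hj)]
    rw [homogeneousComponent_eq_zero _ _ (by omega), map_zero]

/-- A homogeneous component of an invariant. -/
def invComp {P : Prop} {G : Equiv.Perm (Fin d) → Prop} (j : ℕ) (f : InvSub d P G) : InvSub d P G :=
  ⟨fun h => homogeneousComponent j (f.1 h), fun h σ hσ => by rw [rename_comp, f.2 h σ hσ]⟩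

theorem invComp_mem {P : Prop} {G : Equiv.Perm (Fin d) → Prop} (j : ℕ) (f : InvSub d P G) :
    invComp j f ∈ invGr P G (2 * j) := by
  intro h m hm
  have := homogeneousComponent_isHomogeneous j (f.1 h) hm
  rw [← this]
  simp [Finsupp.weight_apply, Finsupp.sum, Finset.sum_mul, mul_comm, Finset.mul_sum]

theorem isInternal_of_injective {V W : Type} [AddCommGroup V] [Module ℚ V] [AddCommGroup W]
    [Module ℚ W] (j : W →ₗ[ℚ] V) (hj : Function.Injective j) (gr : ℤ → Submodule ℚ V)
    (h : DirectSum.IsInternal gr) (gr' : ℤ → Submodule ℚ W) (hgr : ∀ k, gr' k ≤ (gr k).comap j)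
    (ht : ⨆ k, gr' k = ⊤) : DirectSum.IsInternal gr' := by
  refine DirectSum.isInternal_submodule_of_iSupIndep_of_iSup_eq_top (fun k => ?_) ht
  rw [Submodule.disjoint_def]
  intro x hx hx'
  apply hj
  rw [map_zero]
  refine (Submodule.disjoint_def.1 (h.submodule_iSupIndep k)) (j x) (hgr k hx) ?_
  have : (⨆ i, ⨆ (_ : i ≠ k), gr' i) ≤ (⨆ i, ⨆ (_ : i ≠ k), gr i).comap j :=
    iSup₂_le fun i hi => (hgr i).trans (Submodule.comap_mono (le_iSup₂_of_le i hi le_rfl))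
  exact this hx'

theorem inv_internal (P : Prop) (G : Equiv.Perm (Fin d) → Prop) :
    DirectSum.IsInternal (invGr P G) := by
  classical
  have h0 : DirectSum.IsInternal (weightedHomogeneousSubmodule ℚ (fun _ : Fin d => (2 : ℤ))) :=
    (weightedDecomposition ℚ (fun _ : Fin d => (2 : ℤ))).isInternal
  refine isInternal_of_injective (InvSub d P G).val.toLinearMap Subtype.val_injective _
    (pi_internal (ι := PLift P) (V := fun _ => Poly d) _ fun _ => h0) _ (fun k f hf h _ => hf h) ?_
  rw [eq_top_iff]
  intro f _
  by_cases hP : P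
  · have hf : f = ∑ j ∈ Finset.range ((f.1 ⟨hP⟩).totalDegree + 1), invComp j f := by
      apply Subtype.ext
      funext h
      rw [AddSubmonoidClass.coe_finset_sum, Finset.sum_apply]
      exact (sum_homogeneousComponent _).symm
    rw [hf]
    exact sum_mem fun j _ => Submodule.mem_iSup_of_mem _ (invComp_mem j f)
  · have hf : f = 0 := Subtype.ext (funext fun h => (hP h.down).elim)
    rw [hf]; exact zero_mem _

/-- `InvSub` as a graded algebra. -/
def invAlg (P : Prop) (G : Equiv.Perm (Fin d) → Prop) : GAlg where
  carrier := InvSub d P G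
  gr := invGr P G
  graded :=
    { one_mem := fun _ => isWeightedHomogeneous_one _ _
      mul_mem := fun _ _ _ _ hf hg h => (hf h).mul (hg h) }
  internal := inv_internal P G

/-- The inclusion of invariants. -/
def invMap {P P' : Prop} {G G' : Equiv.Perm (Fin d) → Prop} (hP : P' → P) (hG : ∀ σ, G' σ → G σ) :
    InvSub d P G →ₐ[ℚ] InvSub d P' G' where
  toFun f := ⟨fun h => f.1 ⟨hP h.down⟩, fun h σ hσ => f.2 _ σ (hG σ hσ)⟩
  map_one' := rfl
  map_mul' _ _ := rfl
  map_zero' := rfl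
  map_add' _ _ := rfl
  commutes' _ := rfl

variable (d)

/-- The ring of an object: `ℚ[z_1, …, z_d]^{S_{λ_1} × ⋯ × S_{λ_n}}` for `λ ∈ Λ(n,d)`, and the zero
ring for all other `λ`. -/
def ringR (lam : Fin n → ℤ) : GAlg := invAlg (d := d) (Good d lam) (Young d lam)

/-- The polynomials invariant under both `S_λ` and `S_μ`. -/
def ringB (lam mu : Fin n → ℤ) : GAlg :=
  invAlg (d := d) (Good d lam ∧ Good d mu) fun σ => Young d lam σ ∧ Young d mu σ

/-- `ringB lam mu` as a bimodule over `ringR mu` (on the left) and `ringR lam` (on the right). For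
`μ = λ` this is the regular bimodule. For `μ = λ ± i_Λ` with `λ, μ ∈ Λ(n,d)` it consists of the
polynomials invariant under `⋯ × S_{λ_i} × S_1 × S_{λ_{i+1} - 1} × ⋯`, respectively
`⋯ × S_{λ_i - 1} × S_1 × S_{λ_{i+1}} × ⋯`: this is the bimodule of the ladder shaped MOY diagram
that splits off a strand of thickness one from one edge and merges it into a neighbouring one. -/
def bimB (lam mu : Fin n → ℤ) : GBim (ringR d lam) (ringR d mu) :=
  algBim (A := ringR d lam) (B := ringR d mu) (S := ringB d lam mu)
    (invMap And.right fun _ => And.right) (invMap And.left fun _ => And.left)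
    (fun hb h => hb _) (fun ha h => ha _)

variable {d}

open scoped Classical in
/-- The element of the bimodule given by a polynomial (and `0` if it is not invariant). -/
def ofB {lam mu : Fin n → ℤ} (p : Poly d) : bimB d lam mu :=
  if h : ∀ σ, Young d lam σ ∧ Young d mu σ → rename σ p = p then
    (⟨fun _ => p, fun _ σ hσ => h σ hσ⟩ : InvSub d _ _) else (0 : InvSub d _ _)

open scoped Classical in
/-- The element of `ringR` given by a polynomial (and `0` if it is not invariant). -/
def ofR {lam : Fin n → ℤ} (p : Poly d) : ringR d lam :=
  if h : ∀ σ, Young d lam σ → rename σ p = p then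
    (⟨fun _ => p, fun _ σ hσ => h σ hσ⟩ : InvSub d _ _) else (0 : InvSub d _ _)

open scoped Classical in
/-- The polynomial underlying an element of the bimodule (`0` if the bimodule is zero). -/
def toP {lam mu : Fin n → ℤ} (b : bimB d lam mu) : Poly d :=
  if h : Good d lam ∧ Good d mu then (show InvSub d _ _ from b).1 ⟨h⟩ else 0

/-! ### The values on 1-morphisms -/

variable (d)

/-- The degree shift of `𝓔_a 1_λ`. -/
def letterShift (lam : Fin n → ℤ) : Letter n → ℤ
  | (true, i) => 1 + kk lam i.val + kk lam (i.val + 1) - kk lam (i.val + 2)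
  | (false, i) => 1 - kk lam (i.val + 1)

/-- The bimodule of a signed sequence `w`, from `λ` to `μ = λ + w_Λ`: the tensor product of the
shifted bimodules of its letters. -/
def bimW (lam : Fin n → ℤ) : (mu : Fin n → ℤ) → SSeq n → GBim (ringR d lam) (ringR d mu)
  | mu, [] => bimB d lam mu
  | mu, a :: w => tens (bimW lam (lam + (presS n d).wt w) w)
      ((bimB d (lam + (presS n d).wt w) mu).sh (letterShift (lam + (presS n d).wt w) a))

/-- The assignment of bimodules to objects and 1-morphisms, for a 2-category of diagrams whose region
labels are interpreted as `gl_n`-weights by `e`: a formal direct sum of shifted signed sequences is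
sent to the direct sum of the shifted bimodules. -/
def repPre {n : ℕ} (P : Pres n) (d : ℕ) (e : P.W → Fin n → ℤ) :
    Prefunctor (AddEnv (Obj P)) GAlg where
  obj a := ringR d (e a.obj.wt)
  map {a b} F := dirSum fun i : F.ι =>
    (bimW d (e a.obj.wt) (e b.obj.wt) (F.X i).word).sh (F.X i).shift

/-- The 2-functor `F_Bim` on objects and 1-morphisms. -/
abbrev fbim (n d : ℕ) : Prefunctor (AddEnv (Obj (presS n d))) GAlg := repPre (presS n d) d id

/-- Khovanov and Lauda's 2-functor on objects and 1-morphisms. -/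
abbrev gam (n d : ℕ) : Prefunctor (AddEnv (Obj (presSL n))) GAlg :=
  repPre (presSL n) d (psiObj n d)

theorem sum_tele (f : ℕ → ℤ) (m j : ℕ) (hj : j ≤ m) :
    ∑ k : Fin m, (if j ≤ k.val then f k.val - f (k.val + 1) else 0) = f j - f m := by
  rw [Fin.sum_univ_eq_sum_range (fun k => if j ≤ k then f k - f (k + 1) else 0) m]
  induction m, hj using Nat.le_induction with
  | base => rw [Finset.sum_eq_zero]; simp; intro k hk; rw [if_neg]; simpa using hk
  | succ m hm ih => rw [Finset.sum_range_succ, ih, if_pos hm]; ring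

theorem sum_tele2 (f : ℕ → ℤ) (m : ℕ) :
    ∑ k : Fin m, (k.val + 1 : ℤ) * (f k.val - f (k.val + 1)) =
      ∑ k : Fin (m + 1), f k.val - (m + 1) * f m := by
  rw [Fin.sum_univ_eq_sum_range (fun k => ((k : ℤ) + 1) * (f k - f (k + 1))) m,
    Fin.sum_univ_eq_sum_range f (m + 1)]
  induction m with
  | zero => simp
  | succ m ih => rw [Finset.sum_range_succ, ih, Finset.sum_range_succ _ (m + 1)]; push_cast; ring

theorem psiObj_add (n d : ℕ) (mu : Fin (n - 1) → ℤ) (lam : Fin n → ℤ) (h : ∑ i, lam i = 0) :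
    psiObj n d (mu + glBar lam) = psiObj n d mu + lam := by
  funext j
  obtain _ | m := n
  · exact j.elim0
  have hj : j.val ≤ m := by omega
  have e1 := sum_tele (en lam) m j.val hj
  have e2 := sum_tele2 (en lam) m
  have e3 : ∑ k : Fin (m + 1), en lam k.val = 0 := by
    rw [← h]; exact Finset.sum_congr rfl fun k _ => dif_pos k.isLt
  have e4 : en lam j.val = lam j := dif_pos j.isLt
  have s1 : (∑ k : Fin m, if j.val ≤ k.val then mu k + (en lam k.val - en lam (k.val + 1)) else 0) =
      (∑ k : Fin m, if j.val ≤ k.val then mu k else 0) +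
        ∑ k : Fin m, if j.val ≤ k.val then en lam k.val - en lam (k.val + 1) else 0 := by
    rw [← Finset.sum_add_distrib]
    exact Finset.sum_congr rfl fun k _ => by split_ifs <;> simp
  have s2 : (∑ k : Fin m, (k.val + 1 : ℤ) * (mu k + (en lam k.val - en lam (k.val + 1)))) =
      (∑ k : Fin m, (k.val + 1 : ℤ) * mu k) +
        ∑ k : Fin m, (k.val + 1 : ℤ) * (en lam k.val - en lam (k.val + 1)) := by
    rw [← Finset.sum_add_distrib]
    exact Finset.sum_congr rfl fun k _ => by ring
  rw [e1, e4] at s1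
  rw [e2, e3] at s2
  have hdiv : ∀ A : ℤ, (A + (0 - (m + 1) * en lam m) - d) / ((m + 1 : ℕ) : ℤ) =
      (A - d) / ((m + 1 : ℕ) : ℤ) - en lam m := by
    intro A
    have : A + (0 - (m + 1) * en lam m) - d = (A - d) + ((m + 1 : ℕ) : ℤ) * (- en lam m) := by
      push_cast; ring
    rw [this, Int.add_mul_ediv_left _ _ (by positivity)]; ring
  change (∑ k : Fin m, if j.val ≤ k.val then mu k + (en lam k.val - en lam (k.val + 1)) else 0) -
    ((∑ k : Fin m, (k.val + 1 : ℤ) * (mu k + (en lam k.val - en lam (k.val + 1)))) - d) /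
      ((m + 1 : ℕ) : ℤ) = ((∑ k : Fin m, if j.val ≤ k.val then mu k else 0) -
    ((∑ k : Fin m, (k.val + 1 : ℤ) * mu k) - d) / ((m + 1 : ℕ) : ℤ)) + lam j
  rw [s1, s2, hdiv]; ring

theorem glBar_add {n : ℕ} (lam mu : Fin n → ℤ) : glBar (lam + mu) = glBar lam + glBar mu := by
  funext i
  have : ∀ k, en (lam + mu) k = en lam k + en mu k := by intro k; unfold en; split_ifs <;> simp
  simp only [glBar, Pi.add_apply, this]; ring

theorem glBar_root {n : ℕ} (i : Fin (n - 1)) : glBar (glRoot i) = cartan i := by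
  funext k
  have hi := i.isLt
  have hk := k.isLt
  have h1 : k.val < n := by omega
  have h2 : k.val + 1 < n := by omega
  simp only [glBar, en, glRoot, cartan, h1, h2, dif_pos, Fin.ext_iff]
  split_ifs <;> omega

theorem sum_root {n : ℕ} (i : Fin (n - 1)) : ∑ l, glRoot i l = 0 := by
  have hi := i.isLt
  have h1 : i.val < n := by omega
  have h2 : i.val + 1 < n := by omega
  have : ∀ l : Fin n, glRoot i l = (if l = ⟨i.val, h1⟩ then 1 else 0) -
      (if l = ⟨i.val + 1, h2⟩ then 1 else 0) := by
    intro l; simp only [glRoot, Fin.ext_iff]; split_ifs <;> omega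
  simp [this]

theorem wt_compat (n d : ℕ) (w : SSeq n) :
    glBar ((presS n d).wt w) = (presSL n).wt w ∧ ∑ l, (presS n d).wt w l = 0 := by
  induction w with
  | nil => 
    have h0 : glBar (0 : Fin n → ℤ) = 0 := by funext i; simp [glBar, en]
    exact ⟨h0, Finset.sum_const_zero⟩
  | cons a w ih =>
    obtain ⟨b, i⟩ := a
    have hneg : ∀ lam : Fin n → ℤ, glBar (-lam) = - glBar lam := by
      intro lam; have := glBar_add lam (-lam)
      rw [add_neg_cancel] at this
      have h0 : glBar (0 : Fin n → ℤ) = 0 := by funext i; simp [glBar, en]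
      rw [h0] at this; exact eq_neg_of_add_eq_zero_right this.symm
    constructor
    · cases b <;> simp [Pres.wt, glBar_add, ih.1, hneg, glBar_root]
    · cases b <;> simp [Pres.wt, Finset.sum_add_distrib, ih.2, sum_root]

theorem psiObj_wt (n d : ℕ) (mu : Fin (n - 1) → ℤ) (w : SSeq n) :
    psiObj n d (mu + (presSL n).wt w) = psiObj n d mu + (presS n d).wt w := by
  rw [← (wt_compat n d w).1]; exact psiObj_add n d mu _ (wt_compat n d w).2

/-- The 2-functor `Ψ` on objects and 1-morphisms. -/
def psi (n d : ℕ) : Prefunctor (AddEnv (Obj (presSL n))) (AddEnv (Obj (presS n d))) where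
  obj a := ⟨⟨psiObj n d a.obj.wt⟩⟩
  map {a b} F :=
    { ι := F.ι
      X := fun i => ⟨(F.X i).word, (F.X i).shift, by rw [← (F.X i).eq, psiObj_wt]⟩ }

end Rings

end

end Schur

namespace Schur

open CategoryTheory MvPolynomial

noncomputable section

/-! ### The values on 2-morphisms -/

section Values

variable {n d : ℕ}

/-- The element `b ⊗ m` of the bimodule of the word `a :: w`, for a bimodule element `b`. -/
def cnsB {L nu : Fin n → ℤ} (a : Letter n) (w : SSeq n) (b : bimB d (L + (presS n d).wt w) nu)
    (m : bimW d L (L + (presS n d).wt w) w) : bimW d L nu (a :: w) :=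
  tp (f := bimW d L (L + (presS n d).wt w) w)
    (g := (bimB d (L + (presS n d).wt w) nu).sh (letterShift (L + (presS n d).wt w) a)) b m

/-- The element `p ⊗ m` of the bimodule of the word `a :: w`, for a polynomial `p`. -/
def cns {L nu : Fin n → ℤ} (a : Letter n) (w : SSeq n) (p : Poly d)
    (m : bimW d L (L + (presS n d).wt w) w) : bimW d L nu (a :: w) := cnsB a w (ofB p) m

/-- The variable `z_{j+1}` (`0` if `j` is out of range). -/
def zv (j : ℤ) : Poly d := ∑ t : Fin d, if (t.val : ℤ) = j then X t else 0

/-- The variable of the thin edge in the MOY diagram of `𝓔_a 1_ν`. -/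
def lv (nu : Fin n → ℤ) : Letter n → Poly d
  | (true, i) => zv (kk nu (i.val + 1))
  | (false, i) => zv (kk nu (i.val + 1) - 1)

/-- The index set of the variables `z_{k_i + 1}, …, z_{k_{i+1}}`. -/
abbrev Blk (d : ℕ) (lam : Fin n → ℤ) (i : ℕ) : Type :=
  {t : Fin d // kk lam i ≤ (t.val : ℤ) ∧ (t.val : ℤ) < kk lam (i + 1)}

/-- The elementary symmetric polynomial in `z_{k_i + 1}, …, z_{k_{i+1}}`. -/
def eB (lam : Fin n → ℤ) (i k : ℕ) : Poly d := rename Subtype.val (esymm (Blk d lam i) ℚ k)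

/-- The complete symmetric polynomial in `z_{k_i + 1}, …, z_{k_{i+1}}`. -/
def hB (lam : Fin n → ℤ) (i k : ℕ) : Poly d := rename Subtype.val (hsymm (Blk d lam i) ℚ k)

open scoped Classical in
/-- The divided difference `∂_{xy}(p) = (p - p(x ↔ y)) / (x - y)`, for two different variables. -/
def dd {σ : Type} [DecidableEq σ] (x y : σ) (p : MvPolynomial σ ℚ) : MvPolynomial σ ℚ :=
  if h : ∃ q, q * (X x - X y) = p - rename (Equiv.swap x y) p then h.choose else 0

/-- `∂_{u₁ x} ⋯ ∂_{u_m x}(p)` where `x` is the first of the variables `z_{k_{i+1} + 1}, …` of the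
`(i+1)`-st block of `mu` (numbered from `0`) and the `u_j` are the other ones. -/
def capL (mu : Fin n → ℤ) (i : ℕ) (p : Poly d) : Poly d :=
  ∑ x : Fin d, if (x.val : ℤ) = kk mu (i + 1) then
    ((List.finRange d).filter fun u => kk mu (i + 1) < (u.val : ℤ) ∧ (u.val : ℤ) < kk mu (i + 2)).foldr
      (fun u q => dd u x q) p else 0

/-- `∂_{x u₁} ⋯ ∂_{x u_m}(p)` where `x` is the last of the variables of the `i`-th block of `mu`
(numbered from `0`) and the `u_j` are the other ones. -/
def capR (mu : Fin n → ℤ) (i : ℕ) (p : Poly d) : Poly d :=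
  ∑ x : Fin d, if (x.val : ℤ) = kk mu (i + 1) - 1 then
    ((List.finRange d).filter fun u => kk mu i ≤ (u.val : ℤ) ∧ (u.val : ℤ) < kk mu (i + 1) - 1).foldr
      (fun u q => dd x u q) p else 0

/-- The element `Q ⊗ m` of the bimodule of the word `a :: b :: v`, for a polynomial `Q` in the
variables `X 0`, `X 1` of the thin edges of `a` and `b`. -/
def cns2 {L : Fin n → ℤ} (a b : Letter n) (v : SSeq n) {nu : Fin n → ℤ}
    (Q : MvPolynomial (Fin 2) ℚ) (m : bimW d L (L + (presS n d).wt v) v) :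
    bimW d L nu (a :: b :: v) :=
  ∑ s ∈ Q.support, Q.coeff s • cns (d := d) (L := L) (nu := nu) a (b :: v)
    (lv (L + (presS n d).wt (b :: v)) a ^ s 0) (cns b v (lv (L + (presS n d).wt v) b ^ s 1) m)

/-- Exchange of the two variables. -/
def swp (Q : MvPolynomial (Fin 2) ℚ) : MvPolynomial (Fin 2) ℚ := rename (Equiv.swap 0 1) Q

/-- The polynomial which describes the action of the crossing `.cross b i j`. -/
def crossPoly (b : Bool) (i j : Fin (n - 1)) (Q : MvPolynomial (Fin 2) ℚ) :
    MvPolynomial (Fin 2) ℚ :=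
  if i = j then (if b then dd 0 1 Q else dd 1 0 Q)
  else if b = true ∧ i.val = j.val + 1 then swp Q * (X 1 - X 0)
  else if b = false ∧ j.val = i.val + 1 then swp Q * (X 0 - X 1)
  else swp Q

/-- Linear maps assigned to the generators, with arbitrary identity strands on their right; `L` is
the rightmost region and `nu` the leftmost one. -/
abbrev Act (d : ℕ) (L : Fin n → ℤ) : Type :=
  ∀ (g : Gen n) (v : SSeq n) (nu : Fin n → ℤ),
    bimW d L nu (g.src ++ v) →ₗ[ℚ] bimW d L nu (g.tgt ++ v)

/-- The values of `F_Bim` on the generators: a dot multiplies by the variable of its strand,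
crossings are given by divided differences or by exchanging the variables, and cups and caps
by the formulas below. -/
structure FGen (L : Fin n → ℤ) (act : Act d L) : Prop where
  dot : ∀ (a : Letter n) (v : SSeq n) (p : Poly d) m,
    act (.dot a) v (L + (presS n d).wt (a :: v)) (cns a v p m) =
      cns a v (lv (L + (presS n d).wt v) a * p) m
  cross : ∀ (b : Bool) (i j : Fin (n - 1)) (v : SSeq n) (Q : MvPolynomial (Fin 2) ℚ) m,
    act (.cross b i j) v (L + (presS n d).wt ((b, i) :: (b, j) :: v)) (cns2 (b, i) (b, j) v Q m) =
      cns2 (b, j) (b, i) v (crossPoly b i j Q) m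
  rcup : ∀ (i : Fin (n - 1)) (v : SSeq n) (mu : Fin n → ℤ) (m : bimW d L (L + (presS n d).wt v) v),
    mu = L + (presS n d).wt v →
    act (.rcup i) v (L + (presS n d).wt v) m =
      ∑ l ∈ Finset.range ((en mu i.val).toNat + 1), (-1 : ℚ) ^ l •
        cns (dn i) (up i :: v) (eB mu i.val l)
          (cns (up i) v (lv mu (up i) ^ ((en mu i.val).toNat - l)) m)
  lcup : ∀ (i : Fin (n - 1)) (v : SSeq n) (mu : Fin n → ℤ) (m : bimW d L (L + (presS n d).wt v) v),
    mu = L + (presS n d).wt v →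
    act (.lcup i) v (L + (presS n d).wt v) m =
      ∑ l ∈ Finset.range ((en mu (i.val + 1)).toNat + 1), (-1 : ℚ) ^ l •
        cns (up i) (dn i :: v) (lv (L + (presS n d).wt (dn i :: v)) (up i) ^ l)
          (cns (dn i) v (eB mu (i.val + 1) ((en mu (i.val + 1)).toNat - l)) m)
  lcap : ∀ (i : Fin (n - 1)) (v : SSeq n) (mu : Fin n → ℤ) b c m, mu = L + (presS n d).wt v →
    act (.lcap i) v (L + (presS n d).wt v) (cnsB (dn i) (up i :: v) b (cnsB (up i) v c m)) =
      (bimW d L (L + (presS n d).wt v) v).l (ofR (capL mu i.val (toP b * toP c))) m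
  rcap : ∀ (i : Fin (n - 1)) (v : SSeq n) (mu : Fin n → ℤ) b c m, mu = L + (presS n d).wt v →
    act (.rcap i) v (L + (presS n d).wt v) (cnsB (up i) (dn i :: v) b (cnsB (dn i) v c m)) =
      (bimW d L (L + (presS n d).wt v) v).l (ofR (capR mu i.val (toP b * toP c))) m

/-- The element `x^a ⊗ x^b ⊗ m` of the bimodule of the word `p :: q :: v`. -/
def mon {L : Fin n → ℤ} (p q : Letter n) (v : SSeq n) {nu : Fin n → ℤ} (a b : ℕ)
    (m : bimW d L (L + (presS n d).wt v) v) : bimW d L nu (p :: q :: v) :=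
  cns p (q :: v) (lv (L + (presS n d).wt (q :: v)) p ^ a)
    (cns q v (lv (L + (presS n d).wt v) q ^ b) m)

/-- `h_k` in the `i`-th block, for an integer `k` (zero if `k` is negative). -/
def hZ (lam : Fin n → ℤ) (i : ℕ) (k : ℤ) : Poly d := if 0 ≤ k then hB lam i k.toNat else 0

/-- Khovanov and Lauda's bimodule map of a crossing, on `x^a ⊗ x^b ⊗ m`. -/
def klCross {L : Fin n → ℤ} (s : Bool) (i j : Fin (n - 1)) (v : SSeq n) {nu : Fin n → ℤ} (a b : ℕ)
    (m : bimW d L (L + (presS n d).wt v) v) : bimW d L nu ((s, j) :: (s, i) :: v) :=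
  if i = j then (if s then (1 : ℚ) else -1) •
    (∑ f ∈ Finset.range a, mon (s, j) (s, i) v (a + b - 1 - f) f m -
      ∑ g ∈ Finset.range b, mon (s, j) (s, i) v (a + b - 1 - g) g m)
  else if s = true ∧ i.val = j.val + 1 then
    mon (s, j) (s, i) v b (a + 1) m - mon (s, j) (s, i) v (b + 1) a m
  else if s = false ∧ j.val = i.val + 1 then
    mon (s, j) (s, i) v (b + 1) a m - mon (s, j) (s, i) v b (a + 1) m
  else mon (s, j) (s, i) v b a m

/-- The values of Khovanov and Lauda's 2-functor on the generators. -/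
structure KLGen (L : Fin n → ℤ) (act : Act d L) : Prop where
  dot : ∀ (a : Letter n) (v : SSeq n) (k : ℕ) m,
    act (.dot a) v (L + (presS n d).wt (a :: v)) (cns a v (lv (L + (presS n d).wt v) a ^ k) m) =
      cns a v (lv (L + (presS n d).wt v) a ^ (k + 1)) m
  cross : ∀ (s : Bool) (i j : Fin (n - 1)) (v : SSeq n) (a b : ℕ) m,
    act (.cross s i j) v (L + (presS n d).wt ((s, i) :: (s, j) :: v))
      (mon (s, i) (s, j) v a b m) = klCross s i j v a b m
  rcup : ∀ (i : Fin (n - 1)) (v : SSeq n) (mu : Fin n → ℤ) (m : bimW d L (L + (presS n d).wt v) v),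
    mu = L + (presS n d).wt v →
    act (.rcup i) v (L + (presS n d).wt v) m =
      ∑ l ∈ Finset.range ((en mu i.val).toNat + 1), (-1 : ℚ) ^ ((en mu i.val).toNat - l) •
        cns (dn i) (up i :: v) (eB mu i.val ((en mu i.val).toNat - l))
          (cns (up i) v (lv mu (up i) ^ l) m)
  lcup : ∀ (i : Fin (n - 1)) (v : SSeq n) (mu : Fin n → ℤ) (m : bimW d L (L + (presS n d).wt v) v),
    mu = L + (presS n d).wt v →
    act (.lcup i) v (L + (presS n d).wt v) m =
      ∑ l ∈ Finset.range ((en mu (i.val + 1)).toNat + 1),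
        (-1 : ℚ) ^ ((en mu (i.val + 1)).toNat - l) •
        cns (up i) (dn i :: v) (lv (L + (presS n d).wt (dn i :: v)) (up i) ^ l)
          (cns (dn i) v (eB mu (i.val + 1) ((en mu (i.val + 1)).toNat - l)) m)
  lcap : ∀ (i : Fin (n - 1)) (v : SSeq n) (mu : Fin n → ℤ) (a b : ℕ) m,
    mu = L + (presS n d).wt v →
    act (.lcap i) v (L + (presS n d).wt v) (mon (dn i) (up i) v a b m) =
      (bimW d L (L + (presS n d).wt v) v).l
        (ofR (hZ mu (i.val + 1) (a + b + 1 - en mu (i.val + 1)))) m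
  rcap : ∀ (i : Fin (n - 1)) (v : SSeq n) (mu : Fin n → ℤ) (a b : ℕ) m,
    mu = L + (presS n d).wt v →
    act (.rcap i) v (L + (presS n d).wt v) (mon (up i) (dn i) v a b m) =
      (bimW d L (L + (presS n d).wt v) v).l
        (ofR (hZ mu i.val (a + b + 1 - en mu i.val))) m

/-- Linear maps assigned to all 2-morphisms between signed sequences. -/
abbrev Real2 (P : Pres n) (d : ℕ) (e : P.W → Fin n → ℤ) : Type :=
  ∀ (lam : P.W) (nu nu' : Fin n → ℤ) (w w' : SSeq n),
    Hom2 P lam w w' →ₗ[ℚ] bimW d (e lam) nu w →ₗ[ℚ] bimW d (e lam) nu' w'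

/-- The maps `om` are compatible with adding an identity strand on the left, i.e.
`F(id_a x) = id ⊗ F(x)`. -/
def LeftStrand {P : Pres n} {e : P.W → Fin n → ℤ} (om : Real2 P d e) : Prop :=
  ∀ (lam : P.W) (a : Letter n) (w w' : SSeq n) (x : Hom2 P lam w w') (p : Poly d)
    (m : bimW d (e lam) (e lam + (presS n d).wt w) w),
    om lam (e lam + (presS n d).wt (a :: w)) (e lam + (presS n d).wt (a :: w)) (a :: w) (a :: w')
      (Hom2.whisk [a] [] (by simp [Pres.wt]) x (by simp) (by simp)) (cns a w p m) =
      cns a w' p (om lam (e lam + (presS n d).wt w) (e lam + (presS n d).wt w') w w' x m)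

/-- The maps assigned to the generators. -/
def genAct {P : Pres n} {e : P.W → Fin n → ℤ} (om : Real2 P d e) (lam : P.W) : Act d (e lam) :=
  fun g v nu => om lam nu nu _ _ (Hom2.cls P lam _ _ (lay [] g v))

/-- A map on 2-morphisms is given by the matrices of the maps `om`. -/
def IsMat {P : Pres n} {e : P.W → Fin n → ℤ}
    (F₂ : ∀ {a b : AddEnv (Obj P)} {f g : a ⟶ b}, (f ⟶ g) →
      ((repPre P d e).map f ⟶ (repPre P d e).map g)) (om : Real2 P d e) : Prop :=
  ∀ {a b : AddEnv (Obj P)} {f g : a ⟶ b} (M : f ⟶ g) (x : GBim.carrier ((repPre P d e).map f)) (j : g.ι),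
    (show ∀ j : g.ι, bimW d (e a.obj.wt) (e b.obj.wt) (g.X j).word from GBim.fn (F₂ M) x) j =
      ∑ i : f.ι, om a.obj.wt (e b.obj.wt) (e b.obj.wt) _ _ (M i j)
        ((show ∀ i : f.ι, bimW d (e a.obj.wt) (e b.obj.wt) (f.X i).word from x) i)

/-- The map assigned to a combination `x` of diagrams from `s` to `t`, with identity strands `v` on
its right. -/
def diaAct (om : Real2 (presS n d) d id) (L : Fin n → ℤ) (s t : SSeq n) (x : Alg n) (v : SSeq n)
    (nu : Fin n → ℤ) : bimW d L nu (s ++ v) →ₗ[ℚ] bimW d L nu (t ++ v) :=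
  om L nu nu _ _ (Hom2.cls (presS n d) L _ _ (whisk [] v x))

/-- The values of `F_Bim` on the sideways crossings. -/
structure Sideways (om : Real2 (presS n d) d id) (L : Fin n → ℤ) : Prop where
  left : ∀ (i j : Fin (n - 1)) (v : SSeq n) (a b : ℕ) m,
    (i = j → (a + b : ℤ) < en (L + (presS n d).wt v) i.val) →
    diaAct om L [up j, dn i] [dn i, up j] (crossL j i) v (L + (presS n d).wt (up j :: dn i :: v))
      (mon (up j) (dn i) v a b m) = mon (dn i) (up j) v b a m
  right : ∀ (i j : Fin (n - 1)) (v : SSeq n) (a b : ℕ) m,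
    (i = j → (a + b : ℤ) < en (L + (presS n d).wt v) (i.val + 1)) →
    diaAct om L [dn j, up i] [up i, dn j] (crossR j i) v (L + (presS n d).wt (dn j :: up i :: v))
      (mon (dn j) (up i) v a b m) = mon (up i) (dn j) v b a m

/-- `∑_{l=0}^{k} (-1)^l e_l(block i) h_{k-l}(block j)`, and `0` if `k < 0`. -/
def superH (mu : Fin n → ℤ) (i j : ℕ) (k : ℤ) : Poly d :=
  if 0 ≤ k then ∑ l ∈ Finset.range (k.toNat + 1), (-1 : ℚ) ^ l • (eB mu i l * hB mu j (k.toNat - l))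
  else 0

/-- The values of `F_Bim` on the (real and fake) dotted bubbles. -/
structure BubbleVal (om : Real2 (presS n d) d id) (L : Fin n → ℤ) : Prop where
  cw : ∀ (i : Fin (n - 1)) (r : ℤ) (v : SSeq n) (mu : Fin n → ℤ) m, mu = L + (presS n d).wt v →
    diaAct om L [] [] (cw mu i r) v (L + (presS n d).wt v) m =
      (bimW d L (L + (presS n d).wt v) v).l
        (ofR (sg (en mu (i.val + 1)) • superH mu (i.val + 1) i.val
          (en mu (i.val + 1) - en mu i.val + r + 1))) m
  cc : ∀ (i : Fin (n - 1)) (r : ℤ) (v : SSeq n) (mu : Fin n → ℤ) m, mu = L + (presS n d).wt v →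
    diaAct om L [] [] (cc mu i r) v (L + (presS n d).wt v) m =
      (bimW d L (L + (presS n d).wt v) v).l
        (ofR (sg (en mu (i.val + 1) + 1) • superH mu i.val (i.val + 1)
          (en mu i.val - en mu (i.val + 1) + r + 1))) m

/-- The part `∑ ± k_{i-1}` of the degree shift of the bimodule of a signed sequence. -/
def regr (L : Fin n → ℤ) : SSeq n → ℤ
  | [] => 0
  | (b, i) :: w => (if b then 1 else -1) * kk (L + (presS n 0).wt w) i.val + regr L w

/-- Diagrams are sent to homogeneous bimodule maps; up to the part `regr` of the shifts of the
1-morphisms, the degree is preserved. -/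
def Homog (om : Real2 (presS n d) d id) (L : Fin n → ℤ) : Prop :=
  ∀ (w w' : SSeq n) (k : ℤ) (x : Alg n), IsDiag (presS n d) L w w' k x →
    om L (L + (presS n d).wt w) (L + (presS n d).wt w) w w' (Hom2.cls (presS n d) L w w' x) ∈
      homDeg (bimW d L (L + (presS n d).wt w) w) (bimW d L (L + (presS n d).wt w) w')
        (k + regr L w' - regr L w)

/-- The values of `Ψ` on 2-morphisms: a diagram is sent to the same diagram, multiplied by the
sign of the comparison of sign conventions. -/
def IsPsi (Ps₂ : ∀ {a b : AddEnv (Obj (presSL n))} {f g : a ⟶ b}, (f ⟶ g) →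
    ((psi n d).map f ⟶ (psi n d).map g)) : Prop :=
  ∀ {a b : AddEnv (Obj (presSL n))} {f g : a ⟶ b} (M : f ⟶ g) (i : f.ι) (j : g.ι)
    (x : (presSL n).dia a.obj.wt (f.X i).word (g.X j).word),
    (M i j : Hom2 (presSL n) a.obj.wt (f.X i).word (g.X j).word) = Hom2.mk (presSL n) _ x →
    (Ps₂ M i j : Hom2 (presS n d) (psiObj n d a.obj.wt) (f.X i).word (g.X j).word) =
      Hom2.cls (presS n d) _ _ _ (twist (psiObj n d a.obj.wt) x.1)

end Values

end

end Schur

namespace Schur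

/-! ### Generating series and partial fractions -/

section Sums

open PowerSeries Finset

variable {K ι : Type*} [Field K] [DecidableEq ι]

noncomputable section

/-- `∏ (1 - z_s X)`. -/
def eSer (z : ι → K) (S : Finset ι) : K⟦X⟧ := ∏ s ∈ S, (1 - C (z s) * X)

/-- `∏ (1 - z_s X)⁻¹`. -/
def hSer (z : ι → K) (S : Finset ι) : K⟦X⟧ := ∏ s ∈ S, mk fun k => z s ^ k

theorem geom_mul (a : K) : (1 - C a * X) * (mk fun k => a ^ k : K⟦X⟧) = 1 := by
  ext m
  cases m with
  | zero => simp
  | succ m =>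
    rw [sub_mul, one_mul, map_sub, mul_assoc, coeff_C_mul, coeff_succ_X_mul]
    simp [pow_succ', coeff_one]

theorem eSer_mul_hSer (z : ι → K) (S : Finset ι) : eSer z S * hSer z S = 1 := by
  rw [eSer, hSer, ← prod_mul_distrib, prod_congr rfl fun s _ => geom_mul (z s), prod_const_one]

theorem eSer_insert (z : ι → K) {S : Finset ι} {x : ι} (hx : x ∉ S) :
    eSer z (insert x S) = (1 - C (z x) * X) * eSer z S := prod_insert hx

theorem hSer_insert (z : ι → K) {S : Finset ι} {x : ι} (hx : x ∉ S) :
    (1 - C (z x) * X) * hSer z (insert x S) = hSer z S := by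
  rw [hSer, prod_insert hx, ← mul_assoc, geom_mul, one_mul, hSer]

/-- The coefficient of `X^m`, for an integer `m`. -/
def cz (φ : K⟦X⟧) (m : ℤ) : K := if 0 ≤ m then coeff m.toNat φ else 0

@[simp] theorem cz_natCast (φ : K⟦X⟧) (m : ℕ) : cz φ m = coeff m φ := by simp [cz]

theorem cz_of_neg (φ : K⟦X⟧) {m : ℤ} (h : m < 0) : cz φ m = 0 := if_neg (by omega)

theorem cz_one_sub (a : K) (φ : K⟦X⟧) (m : ℤ) :
    cz ((1 - C a * X) * φ) m = cz φ m - a * cz φ (m - 1) := by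
  rcases lt_trichotomy m 0 with h | rfl | h
  · rw [cz_of_neg _ h, cz_of_neg _ h, cz_of_neg _ (by omega)]; simp
  · rw [cz_of_neg _ (show (0 : ℤ) - 1 < 0 by omega)]
    simp [cz, sub_mul]
  · obtain ⟨k, rfl⟩ : ∃ k : ℕ, m = (k + 1 : ℕ) := ⟨(m - 1).toNat, by omega⟩
    rw [show ((k + 1 : ℕ) : ℤ) - 1 = (k : ℕ) by push_cast; ring]
    simp only [cz_natCast]
    rw [sub_mul, one_mul, map_sub, mul_assoc, coeff_C_mul, coeff_succ_X_mul]

/-- Dividing by `1 - a X`. -/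
theorem cz_geom {a : K} {φ ψ : K⟦X⟧} (h : (1 - C a * X) * ψ = φ) (m : ℕ) :
    cz ψ m = ∑ f ∈ range (m + 1), cz φ f * a ^ (m - f) := by
  have hψ : ψ = φ * mk fun k => a ^ k := by
    rw [← h, mul_right_comm, geom_mul, one_mul]
  rw [cz_natCast, hψ, coeff_mul, Nat.sum_antidiagonal_eq_sum_range_succ
    fun i j => coeff i φ * coeff j (mk fun k => a ^ k)]
  simp

theorem sum_div_eq_cz_hSer (z : ι → K) (S : Finset ι) (hz : Set.InjOn z S) (r : ℕ) :
    ∑ y ∈ S, z y ^ r / ∏ u ∈ S.erase y, (z y - z u) = cz (hSer z S) (r + 1 - S.card) := by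
  induction S using Finset.induction_on generalizing r with
  | empty =>
    rw [sum_empty]
    have : ((r : ℤ) + 1 - (∅ : Finset ι).card) = (r + 1 : ℕ) := by simp
    rw [this, cz_natCast]; simp [hSer, coeff_one]
  | insert x S hx ih =>
    have hzS : Set.InjOn z S := hz.mono (by simp)
    have hne : ∀ y ∈ S, z y - z x ≠ 0 := fun y hy h => by
      have := hz (by simp [hy]) (by simp) (sub_eq_zero.1 h)
      exact hx (this ▸ hy)
    have hcard : (insert x S).card = S.card + 1 := card_insert_of_notMem hx
    have hstep : ∀ r : ℕ,
        (∑ y ∈ insert x S, z y ^ (r + 1) / ∏ u ∈ (insert x S).erase y, (z y - z u)) -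
          z x * (∑ y ∈ insert x S, z y ^ r / ∏ u ∈ (insert x S).erase y, (z y - z u)) =
          ∑ y ∈ S, z y ^ r / ∏ u ∈ S.erase y, (z y - z u) := by
      intro r
      rw [sum_insert hx, sum_insert hx, mul_add, mul_sum, add_sub_add_comm, ← sum_sub_distrib]
      rw [pow_succ', mul_div_assoc, sub_self, zero_add]
      refine sum_congr rfl fun y hy => ?_
      have hyx : x ≠ y := fun h => hx (h ▸ hy)
      rw [erase_insert_of_ne hyx, prod_insert (by simp [hx]),
        show z y ^ (r + 1) = z y * z y ^ r from pow_succ' _ _, mul_div_assoc, ← sub_mul,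
        mul_div_assoc', mul_div_mul_left _ _ (hne y hy)]
    have hser := fun m => cz_one_sub (z x) (hSer z (insert x S)) m
    simp only [hSer_insert z hx] at hser
    induction r with
    | zero =>
      have h1 := Lagrange.coeff_eq_sum (s := insert x S) (v := z) hz (P := (1 : Polynomial K))
        (by rw [Polynomial.degree_one, hcard]; exact_mod_cast Nat.succ_pos _)
      simp only [Polynomial.eval_one] at h1
      simp only [pow_zero]
      rw [← h1, hcard, Polynomial.coeff_one]
      by_cases hS : S.card = 0
      · simp [hS, cz, hSer]
      · rw [cz_of_neg _ (by push_cast; omega), if_neg (by omega)]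
    | succ r ihr =>
      have h1 := hstep r
      rw [ihr, ih hzS] at h1
      have h2 := hser (r + 1 - S.card)
      rw [sub_eq_iff_eq_add] at h1
      rw [h1, h2, hcard]
      push_cast
      rw [show (r : ℤ) + 1 - (S.card + 1) = r + 1 - S.card - 1 by ring,
        show (r : ℤ) + 1 + 1 - (S.card + 1) = r + 1 - S.card by ring]
      ring

/-- Partial fractions. -/
theorem sum_mul_div_eq_cz (z : ι → K) (S T : Finset ι) (hz : Set.InjOn z S) (r : ℕ) :
    ∑ y ∈ S, z y ^ r * (∏ t ∈ T, (z y - z t)) / ∏ u ∈ S.erase y, (z y - z u) =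
      cz (eSer z T * hSer z S) (T.card + r + 1 - S.card) := by
  induction T using Finset.induction_on generalizing r with
  | empty => simpa [eSer] using sum_div_eq_cz_hSer z S hz r
  | insert x T hx ih =>
    rw [eSer_insert z hx, mul_assoc, cz_one_sub, card_insert_of_notMem hx]
    have h1 := ih (r + 1)
    have h2 := ih r
    push_cast at h1 ⊢
    rw [show (T.card : ℤ) + 1 + r + 1 - S.card = T.card + (r + 1) + 1 - S.card by ring, ← h1,
      show (T.card : ℤ) + (r + 1) + 1 - S.card - 1 = T.card + r + 1 - S.card by ring, ← h2, mul_sum,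
      ← sum_sub_distrib]
    refine sum_congr rfl fun y _ => ?_
    rw [prod_insert hx]; ring

theorem coeff_eSer (z : ι → K) (S : Finset ι) (l : ℕ) :
    coeff l (eSer z S) = (-1) ^ l * ∑ t ∈ S.powersetCard l, ∏ s ∈ t, z s := by
  have h1 : eSer z S = ∑ t ∈ S.powerset, monomial t.card ((-1) ^ t.card * ∏ s ∈ t, z s) := by
    have : eSer z S = ∏ s ∈ S, (1 + (- C (z s) * X)) :=
      prod_congr rfl fun s _ => by ring
    rw [this, prod_one_add]
    refine sum_congr rfl fun t _ => ?_
    rw [prod_mul_distrib, prod_const, prod_neg, ← map_prod, monomial_eq_C_mul_X_pow, map_mul,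
      map_pow, map_neg, map_one]
  rw [h1, map_sum, mul_sum]
  simp only [coeff_monomial]
  rw [← sum_filter, powersetCard_eq_filter]
  refine sum_congr (filter_congr fun t _ => eq_comm) fun t ht => ?_
  rw [(mem_filter.1 ht).2]

theorem aeval_hsymm {σ : Type*} [Fintype σ] [DecidableEq σ] [CharZero K] (f : σ → K) (m : ℕ) :
    MvPolynomial.aeval f (MvPolynomial.hsymm σ ℚ m) = coeff m (hSer f Finset.univ) := by
  have key : ∀ m, MvPolynomial.aeval f (MvPolynomial.hsymm σ ℚ m) =
      ∑ s : Sym σ m, (s.1.map f).prod := by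
    intro m
    rw [MvPolynomial.hsymm, map_sum]
    refine Finset.sum_congr rfl fun s _ => ?_
    rw [map_multiset_prod, Multiset.map_map]; simp
  rw [key]
  have main : ∀ (σ : Type _) [Fintype σ] [DecidableEq σ] (f : σ → K) (m : ℕ),
      ∑ s : Sym σ m, (s.1.map f).prod = coeff m (hSer f Finset.univ) := by
    intro σ _
    refine Fintype.induction_empty_option
      (P := fun σ _ => ∀ [DecidableEq σ] (f : σ → K) (m : ℕ),
        ∑ s : Sym σ m, (s.1.map f).prod = coeff m (hSer f Finset.univ)) ?_ ?_ ?_ σ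
    · intro α β _ e ih _ f m
      letI := Fintype.ofEquiv β e.symm
      classical
      have h := ih (f ∘ e) m
      rw [show hSer (f ∘ e) Finset.univ = hSer f Finset.univ from
        Fintype.prod_equiv e _ _ fun _ => rfl] at h
      rw [← h]
      refine (Fintype.sum_equiv (Sym.equivCongr e) _ _ fun s => ?_).symm
      simp [Sym.equivCongr, Sym.map]
    · intro _ f m
      cases m with
      | zero => simp [hSer, Sym.eq_nil_of_card_zero]
      | succ m => simp [hSer, coeff_one]
    · intro α _ ih _ f m
      classical
      have hs : (1 - C (f none) * X) * hSer f Finset.univ = hSer (fun a => f (some a)) Finset.univ := by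
        rw [hSer, Fintype.prod_option, ← mul_assoc, geom_mul, one_mul, hSer]
      induction m with
      | zero => simp [hSer, Sym.eq_nil_of_card_zero, map_prod]
      | succ m ihm =>
        have h2 := cz_one_sub (f none) (hSer f Finset.univ) ((m + 1 : ℕ) : ℤ)
        rw [hs, cz_natCast, cz_natCast, show ((m + 1 : ℕ) : ℤ) - 1 = (m : ℕ) by push_cast; ring,
          cz_natCast, ← ihm, ← ih, eq_sub_iff_add_eq] at h2
        rw [← h2, ← (symOptionSuccEquiv (α := α) (n := m)).symm.sum_comp, Fintype.sum_sum_type,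
          add_comm, mul_sum]
        refine congrArg₂ _ (Finset.sum_congr rfl fun s _ => ?_) (Finset.sum_congr rfl fun s _ => ?_)
        · simp [symOptionSuccEquiv, SymOptionSuccEquiv.decode, Sym.map]
        · simp only [symOptionSuccEquiv, Equiv.coe_fn_symm_mk, SymOptionSuccEquiv.decode]
          change (Multiset.map f (none ::ₘ s.1)).prod = _
          rw [Multiset.map_cons, Multiset.prod_cons]
  exact main σ f m

end

end Sums

end Schur


namespace Schur

/-! ### The action of diagrams on functions on chains of colourings -/

/-- The colour of the variable that is moved by a letter, before the move. -/
def Letter.old {n : ℕ} : Letter n → ℕ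
  | (true, i) => i.val + 1
  | (false, i) => i.val

/-- The colour of the variable that is moved by a letter, after the move. -/
def Letter.new {n : ℕ} : Letter n → ℕ
  | (true, i) => i.val
  | (false, i) => i.val + 1

section Model

variable {n d : ℕ}

/-- The colouring obtained from `c` by moving the variables `xs` as prescribed by the letters. -/
def col (c : Fin d → ℕ) : SSeq n → List (Fin d) → Fin d → ℕ
  | a :: w, x :: xs => Function.update (col c w xs) x (Letter.new a)
  | _, _ => c

/-- All moves are possible. -/
def Valid (c : Fin d → ℕ) : SSeq n → List (Fin d) → Prop
  | [], [] => True
  | a :: w, x :: xs => Valid c w xs ∧ col c w xs x = Letter.old a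
  | _, _ => False

theorem Valid.length_eq {c : Fin d → ℕ} : ∀ {w : SSeq n} {xs : List (Fin d)}, Valid c w xs →
    xs.length = w.length
  | [], [], _ => rfl
  | a :: w, x :: xs, h => by simp [Valid.length_eq h.1]

@[simp] theorem valid_nil {c : Fin d → ℕ} : Valid (n := n) c [] [] := trivial

@[simp] theorem valid_nil_iff {c : Fin d → ℕ} {xs : List (Fin d)} :
    Valid (n := n) c [] xs ↔ xs = [] := by
  cases xs <;> simp [Valid]

@[simp] theorem valid_cons {c : Fin d → ℕ} {a : Letter n} {w : SSeq n} {x : Fin d}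
    {xs : List (Fin d)} : Valid c (a :: w) (x :: xs) ↔ Valid c w xs ∧ col c w xs x = Letter.old a :=
  Iff.rfl

@[simp] theorem valid_cons_nil {c : Fin d → ℕ} {a : Letter n} {w : SSeq n} :
    ¬ Valid c (a :: w) [] := id

@[simp] theorem col_nil (c : Fin d → ℕ) (xs : List (Fin d)) : col (n := n) c [] xs = c := by
  cases xs <;> rfl

@[simp] theorem col_cons (c : Fin d → ℕ) (a : Letter n) (w : SSeq n) (x : Fin d)
    (xs : List (Fin d)) : col c (a :: w) (x :: xs) = Function.update (col c w xs) x (Letter.new a) :=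
  rfl

theorem col_append (c : Fin d → ℕ) : ∀ (u v : SSeq n) (xu xv : List (Fin d)),
    xu.length = u.length → col c (u ++ v) (xu ++ xv) = col (col c v xv) u xu
  | [], v, [], xv, _ => by simp
  | a :: u, v, x :: xu, xv, h => by
    simp only [List.cons_append, col_cons, col_append c u v xu xv (by simpa using h)]

theorem valid_append (c : Fin d → ℕ) : ∀ (u v : SSeq n) (xu xv : List (Fin d)),
    xu.length = u.length →
    (Valid c (u ++ v) (xu ++ xv) ↔ Valid c v xv ∧ Valid (col c v xv) u xu)
  | [], v, [], xv, _ => by simp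
  | a :: u, v, x :: xu, xv, h => by
    have h' : xu.length = u.length := by simpa using h
    simp only [List.cons_append, valid_cons, valid_append c u v xu xv h', col_append c u v xu xv h',
      and_assoc]

/-- Splitting a valid chain. -/
theorem Valid.split {c : Fin d → ℕ} {u v : SSeq n} {xs : List (Fin d)} (h : Valid c (u ++ v) xs) :
    ∃ xu xv, xs = xu ++ xv ∧ xu.length = u.length ∧ Valid c v xv ∧ Valid (col c v xv) u xu := by
  have hl : (xs.take u.length).length = u.length := by
    have := h.length_eq; simp at this ⊢; omega
  refine ⟨xs.take u.length, xs.drop u.length, (List.take_append_drop _ _).symm, hl, ?_⟩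
  rw [← valid_append c u v _ _ hl, List.take_append_drop]; exact h

/-- The variables of a given colour. -/
def blk (c : Fin d → ℕ) (i : ℕ) : Finset (Fin d) := Finset.univ.filter fun t => c t = i

@[simp] theorem mem_blk {c : Fin d → ℕ} {i : ℕ} {t : Fin d} : t ∈ blk c i ↔ c t = i := by simp [blk]

/-- `c` is a colouring with `λ_i` variables of colour `i`. -/
def HasWt (c : Fin d → ℕ) (lam : Fin n → ℤ) : Prop :=
  (∀ t, c t < n) ∧ ∀ i : Fin n, lam i = (blk c i.val).card

theorem HasWt.en {c : Fin d → ℕ} {lam : Fin n → ℤ} (h : HasWt c lam) {i : ℕ} (hi : i < n) :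
    en lam i = (blk c i).card := by rw [Schur.en, dif_pos hi, h.2]

theorem HasWt.good {c : Fin d → ℕ} {lam : Fin n → ℤ} (h : HasWt c lam) : Good d lam := by
  refine ⟨fun i => by rw [h.2]; positivity, ?_⟩
  have : ∑ i : Fin n, ((blk c i.val).card : ℤ) = d := by
    have h1 := Finset.card_eq_sum_card_fiberwise (s := (Finset.univ : Finset (Fin d)))
      (t := (Finset.univ : Finset (Fin n))) (f := fun t => (⟨c t, h.1 t⟩ : Fin n)) (by simp)
    rw [Finset.card_univ, Fintype.card_fin] at h1
    have h2 : d = ∑ i : Fin n, (blk c i.val).card := by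
      refine h1.trans (Finset.sum_congr rfl fun i _ => congrArg _ ?_)
      ext t; simp [Fin.ext_iff]
    exact_mod_cast h2.symm
  rw [← this]; exact Finset.sum_congr rfl fun i _ => h.2 i

theorem Letter.old_lt {n : ℕ} (a : Letter n) : Letter.old a < n := by
  obtain ⟨b, i⟩ := a; have := i.isLt; cases b <;> simp [Letter.old] <;> omega

theorem Letter.new_lt {n : ℕ} (a : Letter n) : Letter.new a < n := by
  obtain ⟨b, i⟩ := a; have := i.isLt; cases b <;> simp [Letter.new] <;> omega

theorem Letter.old_ne_new {n : ℕ} (a : Letter n) : Letter.old a ≠ Letter.new a := by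
  obtain ⟨b, i⟩ := a; cases b <;> simp [Letter.old, Letter.new]

theorem blk_update_new {c : Fin d → ℕ} {x : Fin d} {j : ℕ} (h : c x ≠ j) :
    blk (Function.update c x j) j = insert x (blk c j) := by
  ext t; by_cases ht : t = x <;> simp [ht, Function.update_apply]

theorem blk_update_old {c : Fin d → ℕ} {x : Fin d} {i j : ℕ} (hx : c x = i) (h : i ≠ j) :
    blk (Function.update c x j) i = (blk c i).erase x := by
  ext t; by_cases ht : t = x <;> simp [ht, Function.update_apply, h.symm]

theorem blk_update_of_ne {c : Fin d → ℕ} {x : Fin d} {j k : ℕ} (hx : c x ≠ k) (h : k ≠ j) :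
    blk (Function.update c x j) k = blk c k := by
  ext t; by_cases ht : t = x <;> simp [ht, Function.update_apply, h.symm, hx]

theorem wt_single (D : ℕ) (a : Letter n) (l : Fin n) : (presS n D).wt [a] l =
    if l.val = Letter.new a then 1 else if l.val = Letter.old a then -1 else 0 := by
  obtain ⟨b, i⟩ := a
  cases b
  · change - glRoot i l + 0 = _
    simp only [glRoot, Letter.new, Letter.old]; split_ifs <;> omega
  · change glRoot i l + 0 = _
    simp only [glRoot, Letter.new, Letter.old]; split_ifs <;> omega

theorem HasWt.update {D : ℕ} {c : Fin d → ℕ} {lam : Fin n → ℤ} (h : HasWt c lam) (a : Letter n)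
    {x : Fin d} (hx : c x = Letter.old a) :
    HasWt (Function.update c x (Letter.new a)) (lam + (presS n D).wt [a]) := by
  refine ⟨fun t => ?_, fun i => ?_⟩
  · by_cases ht : t = x
    · subst ht; simpa using Letter.new_lt a
    · simpa [ht] using h.1 t
  · rw [Pi.add_apply, h.2, wt_single]
    have hne := Letter.old_ne_new a
    split_ifs with h1 h2
    · rw [h1, blk_update_new (by rw [hx]; exact hne), Finset.card_insert_of_notMem (by simp [hx, hne])]
      push_cast; ring
    · rw [h2, blk_update_old hx hne, Finset.card_erase_of_mem (by simp [hx])]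
      have : 0 < (blk c (Letter.old a)).card := Finset.card_pos.2 ⟨x, by simp [hx]⟩
      omega
    · rw [blk_update_of_ne (by rw [hx]; exact Ne.symm h2) h1, add_zero]

theorem HasWt.col {D : ℕ} {c : Fin d → ℕ} {lam : Fin n → ℤ} (h : HasWt c lam) :
    ∀ {w : SSeq n} {xs : List (Fin d)}, Valid c w xs → HasWt (col c w xs) (lam + (presS n D).wt w)
  | [], [], _ => by simpa [Pres.wt] using h
  | a :: w, x :: xs, hv => by
    have := (HasWt.col (D := D) h hv.1).update (D := D) a hv.2
    have e : lam + (presS n D).wt (a :: w) = lam + (presS n D).wt w + (presS n D).wt [a] := by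
      rw [← List.singleton_append, Pres.wt_append]; abel
    rw [e]; exact this

variable {K : Type} [Field K]

noncomputable section

/-- The factor in the action of a crossing of different colours. -/
def kap (b : Bool) (i j : Fin (n - 1)) (p q : K) : K :=
  if b = true ∧ i.val = j.val + 1 then q - p
  else if b = false ∧ j.val = i.val + 1 then p - q else 1

/-- The action of a generator; `c` is the colouring on its right. -/
def genop (z : Fin d → K) : Gen n → (Fin d → ℕ) → (List (Fin d) → K) → List (Fin d) → K
  | .dot _, _, G, [y] => z y * G [y]
  | .cross b i j, _, G, [x, y] =>
    if i = j then (if b then 1 else -1) * ((G [x, y] - G [y, x]) / (z x - z y))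
    else kap b i j (z x) (z y) * G [y, x]
  | .rcup i, c, G, [x, y] => if x = y then (∏ t ∈ blk c i.val, (z y - z t)) * G [] else 0
  | .lcup i, c, G, [x, y] => if x = y then (∏ t ∈ blk c (i.val + 1), (z t - z x)) * G [] else 0
  | .lcap i, c, G, [] =>
    ∑ x ∈ blk c (i.val + 1), G [x, x] / ∏ u ∈ (blk c (i.val + 1)).erase x, (z u - z x)
  | .rcap i, c, G, [] => ∑ x ∈ blk c i.val, G [x, x] / ∏ u ∈ (blk c i.val).erase x, (z x - z u)
  | _, _, _, _ => 0

variable (z : Fin d → K)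

@[simp] theorem genop_dot (a : Letter n) (c : Fin d → ℕ) (G : List (Fin d) → K) (y : Fin d) :
    genop z (.dot a) c G [y] = z y * G [y] := rfl

@[simp] theorem genop_cross (b : Bool) (i j : Fin (n - 1)) (c : Fin d → ℕ) (G : List (Fin d) → K)
    (x y : Fin d) : genop z (.cross b i j) c G [x, y] =
      if i = j then (if b then 1 else -1) * ((G [x, y] - G [y, x]) / (z x - z y))
      else kap b i j (z x) (z y) * G [y, x] := rfl

@[simp] theorem genop_rcup (i : Fin (n - 1)) (c : Fin d → ℕ) (G : List (Fin d) → K) (x y : Fin d) :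
    genop z (.rcup i) c G [x, y] =
      if x = y then (∏ t ∈ blk c i.val, (z y - z t)) * G [] else 0 := rfl

@[simp] theorem genop_lcup (i : Fin (n - 1)) (c : Fin d → ℕ) (G : List (Fin d) → K) (x y : Fin d) :
    genop z (.lcup i) c G [x, y] =
      if x = y then (∏ t ∈ blk c (i.val + 1), (z t - z x)) * G [] else 0 := rfl

theorem genop_lcap (i : Fin (n - 1)) (c : Fin d → ℕ) (G : List (Fin d) → K) :
    genop z (.lcap i) c G [] =
      ∑ x ∈ blk c (i.val + 1), G [x, x] / ∏ u ∈ (blk c (i.val + 1)).erase x, (z u - z x) := rfl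

theorem genop_rcap (i : Fin (n - 1)) (c : Fin d → ℕ) (G : List (Fin d) → K) :
    genop z (.rcap i) c G [] =
      ∑ x ∈ blk c i.val, G [x, x] / ∏ u ∈ (blk c i.val).erase x, (z x - z u) := rfl

theorem genop_linear (g : Gen n) (c : Fin d → ℕ) (G G' : List (Fin d) → K) (a a' : K)
    (ys : List (Fin d)) : genop z g c (fun l => a * G l + a' * G' l) ys =
      a * genop z g c G ys + a' * genop z g c G' ys := by
  unfold genop
  split
  · ring
  · split_ifs <;> ring
  · split_ifs <;> ring
  · split_ifs <;> ring
  · rw [Finset.mul_sum, Finset.mul_sum, ← Finset.sum_add_distrib]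
    exact Finset.sum_congr rfl fun _ _ => by ring
  · rw [Finset.mul_sum, Finset.mul_sum, ← Finset.sum_add_distrib]
    exact Finset.sum_congr rfl fun _ _ => by ring
  · simp

theorem genop_congr_length (g : Gen n) (c : Fin d → ℕ) {G G' : List (Fin d) → K}
    (h : ∀ l, l.length = g.src.length → G l = G' l) (ys : List (Fin d)) :
    genop z g c G ys = genop z g c G' ys := by
  unfold genop
  split <;> simp [Gen.src] at h <;> simp [h]

theorem update_update_self {c : Fin d → ℕ} {x : Fin d} {i j : ℕ} (h : c x = j) :
    Function.update (Function.update c x i) x j = c := by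
  rw [Function.update_idem, ← h, Function.update_eq_self]

/-- The action of a generator is local, and linear over functions of the final colouring. -/
theorem genop_congr (g : Gen n) {c : Fin d → ℕ} {G G' : List (Fin d) → K} {a : K}
    {ys : List (Fin d)} (hy : Valid c g.tgt ys)
    (h : ∀ l, Valid c g.src l → col c g.src l = col c g.tgt ys → G l = a * G' l) :
    genop z g c G ys = a * genop z g c G' ys := by
  have hl := hy.length_eq
  cases g with
  | dot b =>
    obtain ⟨y, rfl⟩ := List.length_eq_one_iff.1 hl
    rw [genop_dot, genop_dot, h [y] hy rfl]; ring
  | cross b i j =>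
    obtain ⟨x, y, rfl⟩ := List.length_eq_two.1 hl
    simp only [Gen.tgt, Gen.src, valid_cons, valid_nil, true_and, col_cons, col_nil] at hy h
    by_cases hxy : x = y
    · subst hxy
      rw [Function.update_self] at hy
      rw [genop_cross, genop_cross]
      have : i ≠ j ∧ kap b i j (z x) (z x) = 0 := by
        cases b <;> simp [Letter.old, Letter.new, kap] at hy ⊢ <;>
          refine ⟨fun hij => ?_, by omega⟩ <;> subst hij <;> omega
      rw [if_neg this.1, if_neg this.1, this.2]; ring
    · have hcomm : Function.update (Function.update c y (Letter.new (b, i))) x (Letter.new (b, j)) =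
          Function.update (Function.update c x (Letter.new (b, j))) y (Letter.new (b, i)) :=
        Function.update_comm (Ne.symm hxy) _ _ _
      rw [Function.update_of_ne hxy] at hy
      have h2 := h [y, x] (by simpa [Function.update_of_ne (Ne.symm hxy)] using ⟨hy.2, hy.1⟩)
        (by simpa using hcomm.symm)
      rw [genop_cross, genop_cross]
      split_ifs with hij
      · subst hij
        rw [h2, h [x, y] (by simpa [Function.update_of_ne hxy] using hy) (by simp)]; ring
      · subst hij
        rw [h2, h [x, y] (by simpa [Function.update_of_ne hxy] using hy) (by simp)]; ring
      · rw [h2]; ring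
  | rcup i =>
    obtain ⟨x, y, rfl⟩ := List.length_eq_two.1 hl
    simp only [Gen.tgt, Gen.src, valid_cons, valid_nil, true_and, col_cons, col_nil] at hy h
    rw [genop_rcup, genop_rcup]
    split_ifs with hxy
    · subst hxy
      rw [h [] (by simp) (update_update_self hy.1).symm]; ring
    · simp
  | lcup i =>
    obtain ⟨x, y, rfl⟩ := List.length_eq_two.1 hl
    simp only [Gen.tgt, Gen.src, valid_cons, valid_nil, true_and, col_cons, col_nil] at hy h
    rw [genop_lcup, genop_lcup]
    split_ifs with hxy
    · subst hxy
      rw [h [] (by simp) (update_update_self hy.1).symm]; ring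
    · simp
  | lcap i =>
    obtain rfl := List.length_eq_zero_iff.1 hl
    rw [genop_lcap, genop_lcap, Finset.mul_sum]
    refine Finset.sum_congr rfl fun x hx => ?_
    rw [mem_blk] at hx
    rw [h [x, x] (by simp [Gen.src, Letter.old, Letter.new, hx])
      (update_update_self hx)]; ring
  | rcap i =>
    obtain rfl := List.length_eq_zero_iff.1 hl
    rw [genop_rcap, genop_rcap, Finset.mul_sum]
    refine Finset.sum_congr rfl fun x hx => ?_
    rw [mem_blk] at hx
    rw [h [x, x] (by simp [Gen.src, Letter.old, Letter.new, hx])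
      (update_update_self hx)]; ring

variable [CharZero K]

/-- The action of a layer. -/
def layop (c : Fin d → ℕ) (l : Layer n) : Module.End ℚ (List (Fin d) → K) where
  toFun F xs := genop z l.gen (col c l.right (xs.drop (l.left.length + l.gen.tgt.length)))
    (fun ys => F (xs.take l.left.length ++ (ys ++ xs.drop (l.left.length + l.gen.tgt.length))))
    ((xs.drop l.left.length).take l.gen.tgt.length)
  map_add' F F' := by
    funext xs
    simpa using genop_linear z l.gen _ _ _ 1 1 _
  map_smul' q F := by
    funext xs
    simpa [Algebra.smul_def] using genop_linear z l.gen _ _ (fun _ => 0) (algebraMap ℚ K q) 0 _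

/-- The action of combinations of diagrams on functions. -/
def rho (c : Fin d → ℕ) (x : Alg n) : Module.End ℚ (List (Fin d) → K) :=
  (FreeAlgebra.lift ℚ (fun l : Layer n => MulOpposite.op (layop z c l)) x).unop

variable (c : Fin d → ℕ)

@[simp] theorem rho_one : rho (n := n) z c 1 = 1 := by simp [rho]

theorem rho_mul (x y : Alg n) (F : List (Fin d) → K) : rho z c (x * y) F = rho z c y (rho z c x F) := by
  simp [rho]

theorem rho_add (x y : Alg n) : rho z c (x + y) = rho z c x + rho z c y := by simp [rho]

theorem rho_sub (x y : Alg n) : rho z c (x - y) = rho z c x - rho z c y := by simp [rho]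

theorem rho_algebraMap (q : ℚ) : rho (n := n) z c (algebraMap ℚ _ q) = q • 1 := by
  rw [rho, AlgHom.commutes]; rfl

theorem rho_smul (q : ℚ) (x : Alg n) : rho z c (q • x) = q • rho z c x := by
  refine LinearMap.ext fun F => ?_
  rw [Algebra.smul_def, rho_mul, rho_algebraMap]
  exact map_smul (rho z c x) q F

@[simp] theorem rho_zero : rho (n := n) z c 0 = 0 := by simp [rho]

theorem rho_sum {ι : Type*} (s : Finset ι) (f : ι → Alg n) :
    rho z c (∑ i ∈ s, f i) = ∑ i ∈ s, rho z c (f i) := by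
  classical
  induction s using Finset.induction_on with
  | empty => simp
  | insert a s ha ih => rw [Finset.sum_insert ha, Finset.sum_insert ha, rho_add, ih]

theorem rho_lay (u : SSeq n) (g : Gen n) (v : SSeq n) : rho z c (lay u g v) = layop z c ⟨u, g, v⟩ := by
  simp [rho, lay]

theorem rho_lay_apply {u : SSeq n} (g : Gen n) (v : SSeq n) (F : List (Fin d) → K)
    {xu ys : List (Fin d)} (xv : List (Fin d)) (hu : xu.length = u.length)
    (hy : ys.length = g.tgt.length) : rho z c (lay u g v) F (xu ++ (ys ++ xv)) =
      genop z g (col c v xv) (fun l => F (xu ++ (l ++ xv))) ys := by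
  rw [rho_lay]
  simp only [layop, LinearMap.coe_mk, AddHom.coe_mk]
  rw [← hu, ← hy, List.take_left, List.drop_left, List.take_left, ← List.drop_drop, List.drop_left,
    List.drop_left]

variable {c} {P : Pres n} {lam : P.W}

theorem length_split {α : Type*} {xs : List α} {a b e : ℕ} (h : xs.length = a + (b + e)) :
    ∃ xu ys xv, xs = xu ++ (ys ++ xv) ∧ xu.length = a ∧ ys.length = b ∧ xv.length = e := by
  refine ⟨xs.take a, (xs.drop a).take b, (xs.drop a).drop b, ?_, ?_, ?_, ?_⟩
  · rw [List.take_append_drop, List.take_append_drop]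
  all_goals simp; omega

/-- To show that a property of the action holds for all combinations of diagrams. -/
theorem dia_induction {w w' : SSeq n} {x : Alg n} (hx : x ∈ P.dia lam w w')
    (C : SSeq n → Alg n → Prop) (h1 : C w' 1)
    (hl : ∀ u g v x, (∃ k, IsDiag P lam (u ++ g.tgt ++ v) w' k x) → C (u ++ g.tgt ++ v) x →
      C (u ++ g.src ++ v) (lay u g v * x))
    (h0 : C w 0) (ha : ∀ x y, C w x → C w y → C w (x + y)) (hs : ∀ (q : ℚ) x, C w x → C w (q • x)) :
    C w x := by
  induction hx using Submodule.span_induction with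
  | mem x hx =>
    obtain ⟨k, hx⟩ := hx
    clear h0 ha hs
    induction hx with
    | id w => exact h1
    | cons u g v h ih => exact hl u g v _ ⟨_, h⟩ (ih h1 hl)
  | zero => exact h0
  | add x y _ _ h1 h2 => exact ha x y h1 h2
  | smul q x _ h => exact hs q x h

theorem rho_congr_length {w w' : SSeq n} {x : Alg n} (hx : x ∈ P.dia lam w w')
    {F F' : List (Fin d) → K} (h : ∀ l, l.length = w.length → F l = F' l) {xs : List (Fin d)}
    (hl : xs.length = w'.length) : rho z c x F xs = rho z c x F' xs := by
  revert F F'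
  refine dia_induction hx (fun w x => ∀ {F F' : List (Fin d) → K},
    (∀ l, l.length = w.length → F l = F' l) → rho z c x F xs = rho z c x F' xs) ?_ ?_ ?_ ?_ ?_
  · intro F F' h; simpa using h xs hl
  · intro u g v x _ ih F F' h
    rw [rho_mul, rho_mul]
    refine ih fun l hl => ?_
    obtain ⟨xu, ys, xv, rfl, h1, h2, h3⟩ := length_split (a := u.length) (b := g.tgt.length)
      (e := v.length) (xs := l) (by simpa [add_assoc] using hl)
    rw [rho_lay_apply z c g v F xv h1 h2, rho_lay_apply z c g v F' xv h1 h2]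
    refine genop_congr_length z g _ (fun l hl => ?_) _
    refine h _ ?_
    simp [h1, h3, hl]
  · intro F F' _; simp
  · intro x y h1 h2 F F' h
    rw [rho_add]; simp [h1 h, h2 h]
  · intro q x h1 F F' h
    rw [rho_smul]; simp [h1 h]

/-- The action of diagrams is linear over functions of the final colouring, and depends on the
values at valid chains only. -/
theorem rho_congr {w w' : SSeq n} {x : Alg n} (hx : x ∈ P.dia lam w w')
    {F F' : List (Fin d) → K} {a : K} {xs : List (Fin d)} (hv : Valid c w' xs)
    (h : ∀ l, Valid c w l → col c w l = col c w' xs → F l = a * F' l) :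
    rho z c x F xs = a * rho z c x F' xs := by
  revert F F'
  refine dia_induction hx (fun w x => ∀ {F F' : List (Fin d) → K},
    (∀ l, Valid c w l → col c w l = col c w' xs → F l = a * F' l) →
      rho z c x F xs = a * rho z c x F' xs) ?_ ?_ ?_ ?_ ?_
  · intro F F' h; simpa using h xs hv rfl
  · intro u g v x _ ih F F' h
    rw [rho_mul, rho_mul]
    refine ih fun l hl hc => ?_
    rw [List.append_assoc] at hl hc
    obtain ⟨xu, l, rfl, h1, hl, hu⟩ := hl.split
    obtain ⟨ys, xv, rfl, h2, hv, hy⟩ := hl.split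
    rw [rho_lay_apply z c g v F xv h1 h2, rho_lay_apply z c g v F' xv h1 h2]
    refine genop_congr z g hy fun l hl hcol => ?_
    have hll := hl.length_eq
    rw [col_append _ _ _ _ _ h2] at hu
    rw [col_append _ _ _ _ _ h1, col_append _ _ _ _ _ h2] at hc
    refine h _ ?_ ?_
    · rw [List.append_assoc, valid_append _ _ _ _ _ h1, valid_append _ _ _ _ _ hll,
        col_append _ _ _ _ _ hll, hcol]
      exact ⟨⟨hv, hl⟩, hu⟩
    · rw [List.append_assoc, col_append _ _ _ _ _ h1, col_append _ _ _ _ _ hll, hcol, hc]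
  · intro F F' _; simp
  · intro x y h1 h2 F F' h
    rw [rho_add]; simp [h1 h, h2 h, mul_add]
  · intro q x h1 F F' h
    rw [rho_smul]; simp [h1 h, mul_smul_comm]

theorem rho_whisk {s t : SSeq n} {x : Alg n} (hx : x ∈ P.dia lam s t) {u v : SSeq n}
    {xu ys xv : List (Fin d)} (hu : xu.length = u.length) (hy : ys.length = t.length)
    (hv : xv.length = v.length) (F : List (Fin d) → K) :
    rho z c (whisk u v x) F (xu ++ (ys ++ xv)) =
      rho z (col c v xv) x (fun l => F (xu ++ (l ++ xv))) ys := by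
  revert F
  refine dia_induction hx (fun s x => ∀ F : List (Fin d) → K,
    rho z c (whisk u v x) F (xu ++ (ys ++ xv)) =
      rho z (col c v xv) x (fun l => F (xu ++ (l ++ xv))) ys) ?_ ?_ ?_ ?_ ?_
  · intro F; simp
  · rintro a g b x ⟨k, hx⟩ ih F
    rw [map_mul, rho_mul, rho_mul, ih, whisk_lay]
    refine rho_congr_length z (Submodule.subset_span ⟨k, hx⟩ : x ∈ P.dia lam _ _)
      (fun l hl => ?_) hy
    obtain ⟨xa, l, xb, rfl, h1, h2, h3⟩ := length_split (a := a.length) (b := g.tgt.length)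
      (e := b.length) (xs := l) (by simpa [add_assoc] using hl)
    rw [rho_lay_apply z _ g b _ xb h1 h2]
    have := rho_lay_apply z c (u := u ++ a) g (b ++ v) F (xu := xu ++ xa) (xb ++ xv)
      (by simp [hu, h1]) h2
    simp only [List.append_assoc] at this ⊢
    rw [this, col_append _ _ _ _ _ h3]
  · intro F; simp
  · intro x y h1 h2 F
    simp only [map_add, rho_add, LinearMap.add_apply, Pi.add_apply, h1, h2]
  · intro q x h1 F
    simp only [map_smul, rho_smul, LinearMap.smul_apply, Pi.smul_apply, h1]

end

end Model

end Schur


namespace Schur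

section Relations

variable {n d : ℕ} {K : Type} [Field K] [CharZero K] {z : Fin d → K} {c : Fin d → ℕ}

theorem rho_lay_app (z : Fin d → K) (c : Fin d → ℕ) (u : SSeq n) (g : Gen n) (v : SSeq n)
    (F : List (Fin d) → K) (xs : List (Fin d)) : rho z c (lay u g v) F xs =
      genop z g (col c v (xs.drop (u.length + g.tgt.length)))
        (fun ys => F (xs.take u.length ++ (ys ++ xs.drop (u.length + g.tgt.length))))
        ((xs.drop u.length).take g.tgt.length) := by
  rw [rho_lay]; rfl

theorem genop_eq_sum (z : Fin d → K) (g : Gen n) (c : Fin d → ℕ) (ys : List (Fin d)) :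
    ∃ (ι : Type) (s : Finset ι) (a : ι → K) (l : ι → List (Fin d)),
      ∀ G, genop z g c G ys = ∑ k ∈ s, a k * G (l k) := by
  have h0 : ∀ g : Gen n, (∀ G, genop z g c G ys = 0) →
      ∃ (ι : Type) (s : Finset ι) (a : ι → K) (l : ι → List (Fin d)),
        ∀ G, genop z g c G ys = ∑ k ∈ s, a k * G (l k) :=
    fun g h => ⟨Unit, ∅, fun _ => 0, fun _ => [], fun G => by simp [h]⟩
  cases g with
  | dot b =>
    match ys with
    | [y] => exact ⟨Unit, Finset.univ, fun _ => z y, fun _ => [y], fun G => by simp⟩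
    | [] => exact h0 _ fun G => rfl
    | _ :: _ :: _ => exact h0 _ fun G => rfl
  | cross b i j =>
    match ys with
    | [x, y] =>
      refine ⟨Bool, Finset.univ, fun k => if i = j then (if k then 1 else -1) *
        ((if b then 1 else -1) / (z x - z y)) else (if k then 0 else kap b i j (z x) (z y)),
        fun k => if k then [x, y] else [y, x], fun G => ?_⟩
      simp only [genop_cross, Fintype.sum_bool, if_true, Bool.false_eq_true, if_false]
      by_cases h : i = j
      · simp only [h, if_true]; ring
      · simp only [h, if_false]; ring
    | [] => exact h0 _ fun G => rfl
    | [_] => exact h0 _ fun G => rfl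
    | _ :: _ :: _ :: _ => exact h0 _ fun G => rfl
  | rcup i =>
    match ys with
    | [x, y] =>
      exact ⟨Unit, Finset.univ, fun _ => if x = y then ∏ t ∈ blk c i.val, (z y - z t) else 0,
        fun _ => [], fun G => by simp⟩
    | [] => exact h0 _ fun G => rfl
    | [_] => exact h0 _ fun G => rfl
    | _ :: _ :: _ :: _ => exact h0 _ fun G => rfl
  | lcup i =>
    match ys with
    | [x, y] =>
      exact ⟨Unit, Finset.univ, fun _ => if x = y then ∏ t ∈ blk c (i.val + 1), (z t - z x) else 0,
        fun _ => [], fun G => by simp⟩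
    | [] => exact h0 _ fun G => rfl
    | [_] => exact h0 _ fun G => rfl
    | _ :: _ :: _ :: _ => exact h0 _ fun G => rfl
  | lcap i =>
    match ys with
    | [] => exact ⟨Fin d, _, fun x => (∏ u ∈ (blk c _).erase x, (z u - z x))⁻¹, fun x => [x, x],
        fun G => Finset.sum_congr rfl fun x _ => by rw [div_eq_inv_mul]⟩
    | _ :: _ => exact h0 _ fun G => rfl
  | rcap i =>
    match ys with
    | [] => exact ⟨Fin d, _, fun x => (∏ u ∈ (blk c _).erase x, (z x - z u))⁻¹, fun x => [x, x],
        fun G => Finset.sum_congr rfl fun x _ => by rw [div_eq_inv_mul]⟩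
    | _ :: _ => exact h0 _ fun G => rfl

theorem genop_comm (z : Fin d → K) (g g' : Gen n) (c c' : Fin d → ℕ) (ys ys' : List (Fin d))
    (F : List (Fin d) → List (Fin d) → K) :
    genop z g c (fun m => genop z g' c' (fun l => F m l) ys') ys =
      genop z g' c' (fun l => genop z g c (fun m => F m l) ys) ys' := by
  obtain ⟨ι, s, a, l, h⟩ := genop_eq_sum z g c ys
  obtain ⟨ι', s', a', l', h'⟩ := genop_eq_sum z g' c' ys'
  simp only [h, h', Finset.mul_sum]
  rw [Finset.sum_comm]
  exact Finset.sum_congr rfl fun _ _ => Finset.sum_congr rfl fun _ _ => by ring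

theorem rho_exchange (g : Gen n) (v : SSeq n) (g' : Gen n) (F : List (Fin d) → K)
    {xs : List (Fin d)} (h : Valid c (g.tgt ++ v ++ g'.tgt) xs) :
    rho z c (lay [] g (v ++ g'.src) * lay (g.tgt ++ v) g' [] -
      lay (g.src ++ v) g' [] * lay [] g (v ++ g'.tgt)) F xs = 0 := by
  obtain ⟨l, ys', rfl, hl, hy', hx⟩ := h.split
  obtain ⟨ys, xv, rfl, hy, hv, hg⟩ := hx.split
  have hlv := hv.length_eq
  have e1 : rho z c (lay [] g (v ++ g'.src) * lay (g.tgt ++ v) g' []) F (ys ++ xv ++ ys') =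
      genop z g' c (fun l => genop z g (col c (v ++ g'.src) (xv ++ l))
        (fun m => F (m ++ (xv ++ l))) ys) ys' := by
    have := rho_lay_apply z c (u := g.tgt ++ v) g' [] (rho z c (lay [] g (v ++ g'.src)) F)
      (xu := ys ++ xv) (ys := ys') [] (by simp [hy, hlv]) hy'.length_eq
    rw [rho_mul, ← List.append_nil ys', this, col_nil, List.append_nil]
    congr 1; funext l
    have := rho_lay_apply z c (u := []) g (v ++ g'.src) F (xu := []) (ys := ys) (xv ++ l) rfl hy
    simpa using this
  have e2 : rho z c (lay (g.src ++ v) g' [] * lay [] g (v ++ g'.tgt)) F (ys ++ xv ++ ys') =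
      genop z g (col c (v ++ g'.tgt) (xv ++ ys'))
        (fun m => genop z g' c (fun l => F (m ++ (xv ++ l))) ys') ys := by
    have := rho_lay_apply z c (u := []) g (v ++ g'.tgt) (rho z c (lay (g.src ++ v) g' []) F)
      (xu := []) (ys := ys) (xv ++ ys') rfl hy
    simp only [List.nil_append] at this
    rw [rho_mul, List.append_assoc, this]
    refine genop_congr_length z g _ (fun m hm => ?_) _
    have := rho_lay_apply z c (u := g.src ++ v) g' [] F (xu := m ++ xv) (ys := ys') []
      (by simp [hm, hlv]) hy'.length_eq
    simpa using this
  rw [rho_sub, LinearMap.sub_apply, Pi.sub_apply, e1, e2, genop_comm, sub_eq_zero]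
  have := genop_congr z g' (a := 1) (G' := fun l => genop z g (col c (v ++ g'.tgt) (xv ++ ys'))
    (fun m => F (m ++ (xv ++ l))) ys) (G := fun l => genop z g (col c (v ++ g'.src) (xv ++ l))
    (fun m => F (m ++ (xv ++ l))) ys) hy' (fun l hl hcol => by
      simp only [one_mul]
      rw [col_append _ _ _ _ _ hlv, hcol, col_append _ _ _ _ _ hlv])
  rw [this, one_mul]

theorem sub_ne_zero_of_ne' (hz : Function.Injective z) {x y : Fin d} (h : x ≠ y) : z x - z y ≠ 0 :=
  sub_ne_zero.2 (hz.ne h)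

theorem cartan_neg_one {i j : Fin (n - 1)} :
    cartan i j = -1 ↔ i.val + 1 = j.val ∨ j.val + 1 = i.val := by
  unfold cartan
  split_ifs with h1 h2
  · subst h1; simp
  · simp [h2]
  · simp [h2]

theorem cartan_zero {i j : Fin (n - 1)} :
    cartan i j = 0 ↔ i ≠ j ∧ i.val + 1 ≠ j.val ∧ j.val + 1 ≠ i.val := by
  unfold cartan
  split_ifs with h1 h2
  · simp [h1]
  · constructor
    · intro h; exact absurd h (by norm_num)
    · rintro ⟨_, h3, h4⟩; exact absurd h2 (by tauto)
  · simp only [ne_eq, h1, not_false_eq_true, true_and, true_iff]; omega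

theorem kap_true (i j : Fin (n - 1)) (p q : K) :
    kap true i j p q = if i.val = j.val + 1 then q - p else 1 := by simp [kap]

theorem kap_false (i j : Fin (n - 1)) (p q : K) :
    kap false i j p q = if j.val = i.val + 1 then p - q else 1 := by simp [kap]

/-- `∏ (z_u - z_y)` over the variables `u ≠ y` of colour `k`. -/
noncomputable def wtA (z : Fin d → K) (c : Fin d → ℕ) (k : ℕ) (y : Fin d) : K :=
  ∏ u ∈ (blk c k).erase y, (z u - z y)

/-- `∏ (z_y - z_u)` over the variables `u ≠ y` of colour `k`. -/
noncomputable def wtB (z : Fin d → K) (c : Fin d → ℕ) (k : ℕ) (y : Fin d) : K :=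
  ∏ u ∈ (blk c k).erase y, (z y - z u)

theorem wtA_eq (z : Fin d → K) (c : Fin d → ℕ) (k : ℕ) (y : Fin d) :
    wtA z c k y = ∏ u ∈ Finset.univ.erase y, if c u = k then z u - z y else 1 := by
  rw [wtA, ← Finset.prod_filter]
  refine Finset.prod_congr ?_ fun _ _ => rfl
  ext u; simp

theorem wtA_ne_zero (hz : Function.Injective z) (c : Fin d → ℕ) (k : ℕ) (y : Fin d) :
    wtA z c k y ≠ 0 :=
  Finset.prod_ne_zero_iff.2 fun u hu => sub_ne_zero_of_ne' hz (Finset.ne_of_mem_erase hu)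

theorem wtB_eq_neg (z : Fin d → K) (c : Fin d → ℕ) (k : ℕ) (y : Fin d) :
    wtB z c k y = wtA (-z) c k y := by
  rw [wtA, wtB]
  exact Finset.prod_congr rfl fun u _ => by simp; ring

theorem wtB_ne_zero (hz : Function.Injective z) (c : Fin d → ℕ) (k : ℕ) (y : Fin d) :
    wtB z c k y ≠ 0 :=
  Finset.prod_ne_zero_iff.2 fun u hu => sub_ne_zero_of_ne' hz (Finset.ne_of_mem_erase hu).symm

theorem wtA_update_self (z : Fin d → K) (c : Fin d → ℕ) (k l : ℕ) (y : Fin d) :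
    wtA z (Function.update c y l) k y = wtA z c k y := by
  rw [wtA_eq, wtA_eq]
  exact Finset.prod_congr rfl fun u hu => by rw [Function.update_of_ne (Finset.ne_of_mem_erase hu)]

theorem wtB_update_self (z : Fin d → K) (c : Fin d → ℕ) (k l : ℕ) (y : Fin d) :
    wtB z (Function.update c y l) k y = wtB z c k y := by
  rw [wtB_eq_neg, wtB_eq_neg, wtA_update_self]

theorem wtA_update (hz : Function.Injective z) (c : Fin d → ℕ) (k l : ℕ) {x y : Fin d} (h : x ≠ y) :
    wtA z (Function.update c x l) k y = wtA z c k y * (if l = k then z x - z y else 1) /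
      (if c x = k then z x - z y else 1) := by
  have hne := sub_ne_zero_of_ne' hz h
  have hx : x ∈ Finset.univ.erase y := by simp [h]
  rw [wtA_eq, wtA_eq, ← Finset.mul_prod_erase _ _ hx, ← Finset.mul_prod_erase _ _ hx,
    Function.update_self, eq_div_iff (by split_ifs <;> simp [hne])]
  have : ∏ u ∈ (Finset.univ.erase y).erase x, (if Function.update c x l u = k then z u - z y else 1) =
      ∏ u ∈ (Finset.univ.erase y).erase x, (if c u = k then z u - z y else 1) :=
    Finset.prod_congr rfl fun u hu => by rw [Function.update_of_ne (Finset.ne_of_mem_erase hu)]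
  rw [this]; ring

theorem wtB_update (hz : Function.Injective z) (c : Fin d → ℕ) (k l : ℕ) {x y : Fin d} (h : x ≠ y) :
    wtB z (Function.update c x l) k y = wtB z c k y * (if l = k then z y - z x else 1) /
      (if c x = k then z y - z x else 1) := by
  rw [wtB_eq_neg, wtB_eq_neg, wtA_update (z := -z) (fun a b h => hz (neg_injective h)) c k l h]
  simp [add_comm, sub_eq_add_neg]

theorem prod_blk_A (z : Fin d → K) {c : Fin d → ℕ} {k : ℕ} {y : Fin d} (h : c y ≠ k) :
    ∏ t ∈ blk c k, (z t - z y) = wtA z c k y := by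
  rw [wtA, Finset.erase_eq_of_notMem (by simpa using h)]

theorem prod_blk_B (z : Fin d → K) {c : Fin d → ℕ} {k : ℕ} {y : Fin d} (h : c y ≠ k) :
    ∏ t ∈ blk c k, (z y - z t) = wtB z c k y := by
  rw [wtB, Finset.erase_eq_of_notMem (by simpa using h)]

theorem genop_lcapA (z : Fin d → K) (i : Fin (n - 1)) (c : Fin d → ℕ) (G : List (Fin d) → K) :
    genop z (.lcap i) c G [] = ∑ x ∈ blk c (i.val + 1), G [x, x] / wtA z c (i.val + 1) x := rfl

theorem genop_rcapB (z : Fin d → K) (i : Fin (n - 1)) (c : Fin d → ℕ) (G : List (Fin d) → K) :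
    genop z (.rcap i) c G [] = ∑ x ∈ blk c i.val, G [x, x] / wtB z c i.val x := rfl

theorem sum_blk_single {c : Fin d → ℕ} {k : ℕ} {y : Fin d} {f : Fin d → K} (hy : c y = k)
    (h : ∀ p, c p = k → p ≠ y → f p = 0) : ∑ p ∈ blk c k, f p = f y :=
  Finset.sum_eq_single y (fun p hp hne => h p (mem_blk.1 hp) hne) fun hn => (hn (mem_blk.2 hy)).elim

theorem sum_blk_eq_zero {c : Fin d → ℕ} {k : ℕ} {f : Fin d → K}
    (h : ∀ p, c p = k → f p = 0) : ∑ p ∈ blk c k, f p = 0 :=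
  Finset.sum_eq_zero fun p hp => h p (mem_blk.1 hp)

attribute [local simp] rho_lay_app rho_mul rho_sub rho_add rho_smul Gen.tgt genop_lcapA genop_rcapB
  Letter.old Letter.new

theorem rho_biadj1 (hz : Function.Injective z) (i : Fin (n - 1)) {x : Fin d} (hx : c x = i.val + 1)
    (F : List (Fin d) → K) :
    rho z c (lay [up i] (.rcup i) [] * lay [] (.rcap i) [up i]) F [x] = F [x] := by
  simp
  rw [sum_blk_single (y := x) (by simp) fun p _ hp => by simp [hp], if_pos rfl,
    prod_blk_B z (by omega), wtB_update_self, mul_div_cancel_left₀ _ (wtB_ne_zero hz _ _ _)]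

theorem rho_biadj2 (hz : Function.Injective z) (i : Fin (n - 1)) {x : Fin d} (hx : c x = i.val)
    (F : List (Fin d) → K) :
    rho z c (lay [dn i] (.lcup i) [] * lay [] (.lcap i) [dn i]) F [x] = F [x] := by
  simp
  rw [sum_blk_single (y := x) (by simp) fun p _ hp => by simp [hp], if_pos rfl,
    prod_blk_A z (by omega), wtA_update_self, mul_div_cancel_left₀ _ (wtA_ne_zero hz _ _ _)]

theorem rho_biadj3 (hz : Function.Injective z) (i : Fin (n - 1)) {x : Fin d} (hx : c x = i.val + 1)
    (F : List (Fin d) → K) :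
    rho z c (lay [] (.lcup i) [up i] * lay [up i] (.lcap i) []) F [x] = F [x] := by
  simp
  rw [sum_blk_single (y := x) hx fun p _ hp => by simp [hp.symm], if_pos rfl,
    prod_blk_A z (by simp), wtA_update_self, mul_div_cancel_left₀ _ (wtA_ne_zero hz _ _ _)]

theorem rho_biadj4 (hz : Function.Injective z) (i : Fin (n - 1)) {x : Fin d} (hx : c x = i.val)
    (F : List (Fin d) → K) :
    rho z c (lay [] (.rcup i) [dn i] * lay [dn i] (.rcap i) []) F [x] = F [x] := by
  simp
  rw [sum_blk_single (y := x) hx fun p _ hp => by simp [hp.symm], if_pos rfl,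
    prod_blk_B z (by simp), wtB_update_self, mul_div_cancel_left₀ _ (wtB_ne_zero hz _ _ _)]

theorem rho_cycDot1 (hz : Function.Injective z) (i : Fin (n - 1)) {x : Fin d} (hx : c x = i.val)
    (F : List (Fin d) → K) :
    rho z c (lay [dn i] (.lcup i) [] * lay [dn i] (.dot (up i)) [dn i] * lay [] (.lcap i) [dn i] -
      lay [] (.dot (dn i)) []) F [x] = 0 := by
  simp
  rw [sum_blk_single (y := x) (by simp) fun p _ hp => by simp [hp], if_pos rfl,
    prod_blk_A z (by omega), wtA_update_self, mul_left_comm,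
    mul_div_cancel_left₀ _ (wtA_ne_zero hz _ _ _), sub_self]

theorem rho_cycDot2 (hz : Function.Injective z) (i : Fin (n - 1)) {x : Fin d} (hx : c x = i.val)
    (F : List (Fin d) → K) :
    rho z c (lay [] (.rcup i) [dn i] * lay [dn i] (.dot (up i)) [dn i] * lay [dn i] (.rcap i) [] -
      lay [] (.dot (dn i)) []) F [x] = 0 := by
  simp
  rw [sum_blk_single (y := x) hx fun p _ hp => by simp [hp.symm], if_pos rfl,
    prod_blk_B z (by simp), wtB_update_self, mul_left_comm,
    mul_div_cancel_left₀ _ (wtB_ne_zero hz _ _ _), sub_self]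

theorem rho_nil (i : Fin (n - 1)) {x y : Fin d} (F : List (Fin d) → K) :
    rho z c (lay [] (crU i i) [] * lay [] (crU i i) []) F [x, y] = 0 := by
  simp
  left
  rw [← neg_sub (z x) (z y), div_neg, ← neg_sub (F [x, y]), neg_div, neg_neg, sub_self]

theorem rho_nilDot1 (hz : Function.Injective z) (i : Fin (n - 1)) {x y : Fin d} (h : x ≠ y)
    (F : List (Fin d) → K) :
    rho z c (1 - lay [] (.dot (up i)) [up i] * lay [] (crU i i) [] +
      lay [] (crU i i) [] * lay [up i] (.dot (up i)) []) F [x, y] = 0 := by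
  have := sub_ne_zero_of_ne' hz h
  simp
  field_simp; ring

theorem rho_nilDot2 (hz : Function.Injective z) (i : Fin (n - 1)) {x y : Fin d} (h : x ≠ y)
    (F : List (Fin d) → K) :
    rho z c (1 - lay [] (crU i i) [] * lay [] (.dot (up i)) [up i] +
      lay [up i] (.dot (up i)) [] * lay [] (crU i i) []) F [x, y] = 0 := by
  have := sub_ne_zero_of_ne' hz h
  simp
  field_simp; ring

theorem rho_far (i j : Fin (n - 1)) (h : cartan i j = 0) {x y : Fin d} (F : List (Fin d) → K) :
    rho z c (lay [] (crU i j) [] * lay [] (crU j i) [] - 1) F [x, y] = 0 := by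
  rw [cartan_zero] at h
  simp [kap_true, h.1, h.1.symm, h.2.1.symm, h.2.2.symm]

theorem rho_near (i j : Fin (n - 1)) (h : cartan i j = -1) {x y : Fin d} (F : List (Fin d) → K) :
    rho z c (lay [] (crU i j) [] * lay [] (crU j i) [] -
      ((i.val : ℚ) - j.val) • (lay [] (.dot (up i)) [up j] - lay [up i] (.dot (up j)) [])) F [x, y] =
      0 := by
  rw [cartan_neg_one] at h
  have hij : i ≠ j := by rintro rfl; omega
  rcases h with h | h
  · have h2 : i.val ≠ j.val + 1 := by omega
    have h3 : j.val = i.val + 1 := h.symm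
    have h4 : i.val ≠ i.val + 1 + 1 := by omega
    simp [kap_true, hij, hij.symm, h3, h4, Rat.smul_def]; ring
  · have h2 : j.val ≠ i.val + 1 := by omega
    have h3 : i.val = j.val + 1 := h.symm
    have h4 : j.val ≠ j.val + 1 + 1 := by omega
    simp [kap_true, hij, hij.symm, h3, h4, Rat.smul_def]; ring

theorem rho_slide1 (i j : Fin (n - 1)) (h : i ≠ j) {x y : Fin d} (F : List (Fin d) → K) :
    rho z c (lay [] (crU i j) [] * lay [up j] (.dot (up i)) [] -
      lay [] (.dot (up i)) [up j] * lay [] (crU i j) []) F [x, y] = 0 := by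
  simp [h]; ring

theorem rho_slide2 (i j : Fin (n - 1)) (h : i ≠ j) {x y : Fin d} (F : List (Fin d) → K) :
    rho z c (lay [] (crU i j) [] * lay [] (.dot (up j)) [up i] -
      lay [up i] (.dot (up j)) [] * lay [] (crU i j) []) F [x, y] = 0 := by
  simp [h]; ring

/-- Variables that are moved upwards by the same letter are different. -/
theorem valid_up_ne {i j k : Fin (n - 1)} {x y t : Fin d}
    (hv : Valid c [up k, up j, up i] [x, y, t]) :
    (i = j → y ≠ t) ∧ (j = k → x ≠ y) ∧ (i = k → x ≠ t) := by
  simp [Function.update_apply] at hv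
  refine ⟨?_, ?_, ?_⟩ <;> rintro rfl rfl <;> simp at hv <;> (try omega)
  split_ifs at hv <;> omega

theorem rho_triple (hz : Function.Injective z) (i j k : Fin (n - 1))
    (h : ¬ (i = k ∧ cartan i j = -1)) {x y t : Fin d}
    (hv : Valid c [up k, up j, up i] [x, y, t]) (F : List (Fin d) → K) :
    rho z c (lay [] (crU i j) [up k] * lay [up j] (crU i k) [] * lay [] (crU j k) [up i] -
      lay [up i] (crU j k) [] * lay [] (crU i k) [up j] * lay [up k] (crU i j) []) F [x, y, t] =
      0 := by
  obtain ⟨h1, h2, h3⟩ := valid_up_ne hv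
  by_cases hij : i = j
  · have e1 := sub_ne_zero_of_ne' hz (h1 hij)
    have e1' := sub_ne_zero_of_ne' hz (h1 hij).symm
    subst hij
    by_cases hik : i = k
    · have e2 := sub_ne_zero_of_ne' hz (h2 hik)
      have e3 := sub_ne_zero_of_ne' hz (h3 hik)
      have e2' := sub_ne_zero_of_ne' hz (h2 hik).symm
      subst hik
      simp
      rw [show z y - z x = -(z x - z y) by ring, show z t - z y = -(z y - z t) by ring]
      field_simp; ring
    · simp [hik, kap_true]
      split_ifs <;> field_simp <;> ring
  · by_cases hjk : j = k
    · have e2 := sub_ne_zero_of_ne' hz (h2 hjk)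
      subst hjk
      simp [hij, kap_true]
      split_ifs <;> field_simp <;> ring
    · by_cases hik : i = k
      · have e3 := sub_ne_zero_of_ne' hz (h3 hik)
        subst hik
        have h' := not_and.1 h rfl
        rw [cartan_neg_one] at h'
        have h4 : i.val ≠ j.val + 1 := by omega
        have h5 : j.val ≠ i.val + 1 := by omega
        simp [hij, Ne.symm hij, kap_true, h4, h5]
      · simp [hij, hjk, hik]; ring

theorem rho_tripleIJI (hz : Function.Injective z) (i j : Fin (n - 1)) (h : cartan i j = -1)
    {x y t : Fin d} (hv : Valid c [up i, up j, up i] [x, y, t]) (F : List (Fin d) → K) :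
    rho z c (lay [] (crU i j) [up i] * lay [up j] (crU i i) [] * lay [] (crU j i) [up i] -
        lay [up i] (crU j i) [] * lay [] (crU i i) [up j] * lay [up i] (crU i j) [] -
        algebraMap ℚ _ ((i.val : ℚ) - j.val)) F [x, y, t] = 0 := by
  have e := sub_ne_zero_of_ne' hz ((valid_up_ne hv).2.2 rfl)
  rw [cartan_neg_one] at h
  have hij : i ≠ j := by rintro rfl; omega
  rcases h with h | h
  · have h2 : i.val ≠ j.val + 1 := by omega
    have h3 : j.val = i.val + 1 := h.symm
    have h4 : i.val ≠ i.val + 1 + 1 := by omega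
    simp [kap_true, hij, hij.symm, h3, h4, rho_algebraMap, Rat.smul_def]; field_simp; ring
  · have h2 : j.val ≠ i.val + 1 := by omega
    have h3 : i.val = j.val + 1 := h.symm
    have h4 : j.val ≠ j.val + 1 + 1 := by omega
    simp [kap_true, hij, hij.symm, h3, h4, rho_algebraMap, Rat.smul_def]; field_simp; ring

end Relations
end Schur

namespace Schur
section Relations
variable {n d : ℕ} {K : Type} [Field K] [CharZero K] {z : Fin d → K} {c : Fin d → ℕ}
attribute [local simp] rho_lay_app rho_mul rho_sub rho_add rho_smul Gen.tgt genop_lcapA genop_rcapB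
  Letter.old Letter.new
theorem rho_cycCross2 (hz : Function.Injective z) (i j : Fin (n - 1)) {x y : Fin d}
    (hv : Valid c [dn i, dn j] [x, y]) (F : List (Fin d) → K) :
    rho z c (lay [] (.cross false j i) [] -
      lay [] (.rcup i) [dn j, dn i] * lay [dn i] (.rcup j) [up i, dn j, dn i] *
        lay [dn i, dn j] (crU j i) [dn j, dn i] * lay [dn i, dn j, up i] (.rcap j) [dn i] *
        lay [dn i, dn j] (.rcap i) []) F [x, y] = 0 := by
  simp at hv
  obtain ⟨hy, hx⟩ := hv
  by_cases hij : j = i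
  · subst hij
    have hxy : x ≠ y := by rintro rfl; simp at hx
    rw [Function.update_of_ne hxy] at hx
    have e1 := sub_ne_zero_of_ne' hz hxy
    have e2 := sub_ne_zero_of_ne' hz hxy.symm
    have w1 := wtB_ne_zero hz c j.val x
    have w2 := wtB_ne_zero hz c j.val y
    simp [ite_div, sub_div, Finset.sum_sub_distrib]
    rw [sum_blk_single (y := x) hx fun p _ hp => by simp [hp.symm], if_pos hy,
      if_pos (by simp [hxy, hx]), if_pos (by simp [hxy.symm, hy]), if_pos rfl]
    rw [prod_blk_B z (by simp [hxy.symm]), prod_blk_B z (by simp), prod_blk_B z (by simp [hxy.symm]),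
      prod_blk_B z (by simp [hxy])]
    simp only [wtB_update_self, wtB_update hz _ _ _ hxy, wtB_update hz _ _ _ hxy.symm,
      Function.update_self, Function.update_of_ne hxy, Function.update_of_ne hxy.symm, hx, hy, if_true,
      Nat.succ_ne_self, if_false, mul_one, div_one]
    field_simp
    ring
  · by_cases hxy : x = y
    · subst hxy
      rw [Function.update_self] at hx
      simp [hij, kap_false, hx.symm]
      exact sum_blk_eq_zero fun p hp => by
        rw [sum_blk_eq_zero fun q hq => ?_, zero_div]
        split_ifs with h1 h2
        · subst h1 h2; omega
        all_goals simp
    · rw [Function.update_of_ne hxy] at hx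
      have hyx := Ne.symm hxy
      have e1 := sub_ne_zero_of_ne' hz hxy
      have e2 := sub_ne_zero_of_ne' hz hyx
      have w1 := wtB_ne_zero hz c i.val x
      have w2 := wtB_ne_zero hz c j.val y
      have hij' : i.val ≠ j.val := fun h => hij (Fin.ext h.symm)
      simp [hij]
      rw [sum_blk_single (y := x) hx fun p _ hp => by
        rw [sum_blk_eq_zero fun q hq => by simp [hp.symm], zero_div],
        sum_blk_single (y := y) (by simp [hyx, hy]) fun p _ hp => by simp [hp.symm]]
      simp only [if_true]
      rw [prod_blk_B z (by simp [hyx]), prod_blk_B z (by simp [hxy])]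
      simp only [wtB_update_self, wtB_update hz _ _ _ hxy, wtB_update hz _ _ _ hyx,
        Function.update_self, Function.update_of_ne hxy, Function.update_of_ne hyx, hx, hy,
        kap_true, kap_false, hij', hij'.symm, if_false, mul_one, div_one]
      split_ifs <;> first | omega | (field_simp; ring)

set_option maxHeartbeats 400000 in
theorem rho_cycCross1 (hz : Function.Injective z) (i j : Fin (n - 1)) {x y : Fin d}
    (hv : Valid c [dn i, dn j] [x, y]) (F : List (Fin d) → K) :
    rho z c (lay [] (.cross false j i) [] -
      lay [dn j, dn i] (.lcup j) [] * lay [dn j, dn i, up j] (.lcup i) [dn j] *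
        lay [dn j, dn i] (crU j i) [dn i, dn j] * lay [dn j] (.lcap i) [up j, dn i, dn j] *
        lay [] (.lcap j) [dn i, dn j]) F [x, y] = 0 := by
  simp only [valid_cons, valid_nil, col_cons, col_nil, Letter.old, Letter.new, true_and] at hv
  obtain ⟨hy, hx⟩ := hv
  by_cases hij : j = i
  · subst hij
    have hxy : x ≠ y := by rintro rfl; simp at hx
    rw [Function.update_of_ne hxy] at hx
    have e1 := sub_ne_zero_of_ne' hz hxy
    have e2 := sub_ne_zero_of_ne' hz hxy.symm
    have w1 := wtA_ne_zero hz c (j.val + 1) x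
    have w2 := wtA_ne_zero hz c (j.val + 1) y
    simp only [rho_sub, rho_mul, rho_lay_app, LinearMap.sub_apply, Pi.sub_apply, Gen.tgt, List.length_cons, List.length_nil, Nat.zero_add, Nat.add_zero, Nat.reduceAdd, List.take_succ_cons, List.drop_succ_cons, List.take_zero, List.drop_zero, List.take_nil, List.drop_nil, List.cons_append, List.nil_append, genop_lcapA, genop_lcup, genop_cross, col_cons, col_nil, Letter.new, if_true]
    simp [ite_div, sub_div, Finset.sum_sub_distrib]
    rw [sum_blk_single (y := y) (by simp [hxy.symm]) fun p _ hp => by simp [hp],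
      if_pos (by simp [hxy.symm]), if_pos (by simp [hxy]), if_pos rfl]
    rw [prod_blk_A z (by simp [hxy, hx]), prod_blk_A z (by simp [hy])]
    simp only [wtA_update_self, wtA_update hz _ _ _ hxy, wtA_update hz _ _ _ hxy.symm,
      Function.update_self, Function.update_of_ne hxy, Function.update_of_ne hxy.symm, hx, hy, if_true,
      (Nat.succ_ne_self _).symm, if_false, mul_one, div_one]
    field_simp
    ring
  · by_cases hxy : x = y
    · subst hxy
      rw [Function.update_self] at hx
      simp only [rho_sub, rho_mul, rho_lay_app, LinearMap.sub_apply, Pi.sub_apply, Gen.tgt, List.length_cons, List.length_nil, Nat.zero_add, Nat.add_zero, Nat.reduceAdd, List.take_succ_cons, List.drop_succ_cons, List.take_zero, List.drop_zero, List.take_nil, List.drop_nil, List.cons_append, List.nil_append, genop_lcapA, genop_lcup, genop_cross, col_cons, col_nil, Letter.new, hij, if_false, Function.update_idem]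
      simp [kap_false, hx.symm, -Finset.sum_ite_eq, -Finset.sum_ite_eq']
      exact sum_blk_eq_zero fun p hp => by
        rw [sum_blk_eq_zero fun q hq => ?_, zero_div]
        split_ifs with h1 h2
        · subst h1 h2; simp at hp
        all_goals simp
    · rw [Function.update_of_ne hxy] at hx
      have hyx := Ne.symm hxy
      have e1 := sub_ne_zero_of_ne' hz hxy
      have e2 := sub_ne_zero_of_ne' hz hyx
      have w1 := wtA_ne_zero hz c (i.val + 1) x
      have w2 := wtA_ne_zero hz c (j.val + 1) y
      have hij' : i.val ≠ j.val := fun h => hij (Fin.ext h.symm)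
      simp only [rho_sub, rho_mul, rho_lay_app, LinearMap.sub_apply, Pi.sub_apply, Gen.tgt, List.length_cons, List.length_nil, Nat.zero_add, Nat.add_zero, Nat.reduceAdd, List.take_succ_cons, List.drop_succ_cons, List.take_zero, List.drop_zero, List.take_nil, List.drop_nil, List.cons_append, List.nil_append, genop_lcapA, genop_lcup, genop_cross, col_cons, col_nil, Letter.new, hij, if_false]
      rw [sum_blk_single (y := y) (by simp [hyx]) fun p _ hp => by
        rw [sum_blk_eq_zero fun q hq => by simp [hp], zero_div],
        sum_blk_single (y := x) (by simp [hxy]) fun p _ hp => by simp [hp]]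
      simp only [if_true]
      rw [prod_blk_A z (by simp [hxy, hx]), prod_blk_A z (by simp [hy])]
      simp only [wtA_update_self, wtA_update hz _ _ _ hxy, wtA_update hz _ _ _ hyx,
        Function.update_self, Function.update_of_ne hxy, Function.update_of_ne hyx, hx, hy,
        kap_true, kap_false, hij', hij'.symm, if_false, mul_one, div_one, add_left_inj]
      split_ifs <;> first | omega | (field_simp; ring)

end Relations

section BubbleAction

open PowerSeries

variable {n d : ℕ} {K : Type} [Field K] [CharZero K] {z : Fin d → K} {c : Fin d → ℕ}
attribute [local simp] rho_lay_app rho_mul rho_sub rho_add rho_smul Gen.tgt genop_lcapA genop_rcapB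
  Letter.old Letter.new
theorem dots_mem_dia {P : Pres n} (lam : P.W) (u : SSeq n) (a : Letter n) (v : SSeq n) (k : ℕ) :
    dots u a v k ∈ P.dia lam (u ++ [a] ++ v) (u ++ [a] ++ v) := by
  induction k with
  | zero => exact one_mem_dia lam rfl
  | succ k ih => rw [dots, pow_succ]; exact mul_mem_dia ih (layer_mem_dia lam u (.dot a) v)

theorem cwReal_mem_dia {P : Pres n} (lam : P.W) (i : Fin (n - 1)) (r : ℕ) :
    cwReal i r ∈ P.dia lam [] [] :=
  mul_mem_dia (mul_mem_dia (layer_mem_dia lam [] (.lcup i) []) (dots_mem_dia lam [] (up i) [dn i] r))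
    (layer_mem_dia lam [] (.rcap i) [])

theorem ccReal_mem_dia {P : Pres n} (lam : P.W) (i : Fin (n - 1)) (r : ℕ) :
    ccReal i r ∈ P.dia lam [] [] :=
  mul_mem_dia (mul_mem_dia (layer_mem_dia lam [] (.rcup i) []) (dots_mem_dia lam [dn i] (up i) [] r))
    (layer_mem_dia lam [] (.lcap i) [])

theorem algebraMap_mem_dia {P : Pres n} (lam : P.W) (w : SSeq n) (q : ℚ) :
    algebraMap ℚ (Alg n) q ∈ P.dia lam w w := by
  rw [Algebra.algebraMap_eq_smul_one]; exact Submodule.smul_mem _ _ (one_mem_dia lam rfl)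

theorem cwBub_mem_dia {P : Pres n} (mu : P.W) (lam : Fin n → ℤ) (i : Fin (n - 1)) (m : ℕ) :
    cwBub lam i m ∈ P.dia mu [] [] := by
  induction m using Nat.strong_induction_on with
  | _ m ih =>
    rw [cwBub]
    split_ifs
    · exact cwReal_mem_dia _ _ _
    · exact algebraMap_mem_dia _ _ _
    · exact Submodule.smul_mem _ _ (sum_mem fun j _ =>
        mul_mem_dia (ih _ j.isLt) (ccReal_mem_dia _ _ _))

theorem ccBub_mem_dia {P : Pres n} (mu : P.W) (lam : Fin n → ℤ) (i : Fin (n - 1)) (m : ℕ) :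
    ccBub lam i m ∈ P.dia mu [] [] := by
  induction m using Nat.strong_induction_on with
  | _ m ih =>
    rw [ccBub]
    split_ifs
    · exact ccReal_mem_dia _ _ _
    · exact algebraMap_mem_dia _ _ _
    · exact Submodule.smul_mem _ _ (sum_mem fun j _ =>
        mul_mem_dia (ih _ j.isLt) (cwReal_mem_dia _ _ _))

theorem cw_mem_dia {P : Pres n} (mu : P.W) (lam : Fin n → ℤ) (i : Fin (n - 1)) (r : ℤ) :
    cw lam i r ∈ P.dia mu [] [] := by
  rw [cw]
  split_ifs
  exacts [cwReal_mem_dia _ _ _, cwBub_mem_dia _ _ _ _, zero_mem _]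

theorem cc_mem_dia {P : Pres n} (mu : P.W) (lam : Fin n → ℤ) (i : Fin (n - 1)) (r : ℤ) :
    cc lam i r ∈ P.dia mu [] [] := by
  rw [cc]
  split_ifs
  exacts [ccReal_mem_dia _ _ _, ccBub_mem_dia _ _ _ _, zero_mem _]

theorem rho_dots (z : Fin d → K) (c : Fin d → ℕ) (u : SSeq n) (a : Letter n) (v : SSeq n) (k : ℕ)
    (F : List (Fin d) → K) {xu : List (Fin d)} (hu : xu.length = u.length) (y : Fin d)
    (xv : List (Fin d)) :
    rho z c (dots u a v k) F (xu ++ y :: xv) = z y ^ k * F (xu ++ y :: xv) := by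
  induction k with
  | zero => simp [dots]
  | succ k ih =>
    rw [dots, pow_succ, rho_mul]
    have := rho_lay_apply z c (.dot a) v (rho z c (lay u (.dot a) v ^ k) F) (ys := [y]) xv hu rfl
    rw [List.singleton_append] at this
    rw [this, genop_dot, List.singleton_append, ← dots, ih, pow_succ]; ring

/-- The series of clockwise bubbles. -/
noncomputable def cwS (z : Fin d → K) (c : Fin d → ℕ) (i : ℕ) : K⟦X⟧ :=
  C ((-1) ^ (blk c (i + 1)).card) * (eSer z (blk c (i + 1)) * hSer z (blk c i))

/-- The series of counterclockwise bubbles. -/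
noncomputable def ccS (z : Fin d → K) (c : Fin d → ℕ) (i : ℕ) : K⟦X⟧ :=
  C (-(-1) ^ (blk c (i + 1)).card) * (eSer z (blk c i) * hSer z (blk c (i + 1)))

theorem ccS_mul_cwS (z : Fin d → K) (c : Fin d → ℕ) (i : ℕ) : ccS z c i * cwS z c i = -1 := by
  have h : ∀ a b e f s : K⟦X⟧, a * b = 1 → e * f = 1 → s * s = 1 →
      (-s * (a * f)) * (s * (e * b)) = -1 := by
    intro a b e f s h1 h2 h3
    linear_combination -(h3 * a * f * e * b) - h1 * (f * e) - h2
  have hs : (C ((-1) ^ (blk c (i + 1)).card) : K⟦X⟧) * C ((-1) ^ (blk c (i + 1)).card) = 1 := by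
    rw [← map_mul, ← mul_pow]; simp
  rw [ccS, cwS, map_neg]
  exact h _ _ _ _ _ (eSer_mul_hSer z _) (eSer_mul_hSer z _) hs

theorem cz_C_mul (a : K) (φ : K⟦X⟧) (m : ℤ) : cz (C a * φ) m = a * cz φ m := by
  unfold cz; split_ifs <;> simp

theorem coeff_zero_eSer_mul_hSer (z : Fin d → K) (S T : Finset (Fin d)) :
    coeff 0 (eSer z S * hSer z T) = 1 := by
  simp [eSer, hSer, map_prod]

theorem rho_cwReal (hz : Function.Injective z) (i : Fin (n - 1)) (r : ℕ) (F : List (Fin d) → K) :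
    rho z c (cwReal i r) F [] =
      cz (cwS z c i.val) ((blk c (i.val + 1)).card - (blk c i.val).card + r + 1) * F [] := by
  have h : ∀ x, rho z c (lay [] (.lcup i) [] * dots [] (up i) [dn i] r) F [x, x] =
      z x ^ r * ((∏ t ∈ blk c (i.val + 1), (z t - z x)) * F []) := by
    intro x
    rw [rho_mul]
    have := rho_dots z c [] (up i) [dn i] r (rho z c (lay [] (.lcup i) []) F) (xu := []) rfl x [x]
    rw [List.nil_append] at this
    rw [this]; simp
  rw [cwReal, rho_mul]
  simp only [rho_lay_app, Gen.tgt, List.length_nil, List.take_nil, List.drop_nil, col_nil,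
    genop_rcapB, List.nil_append, List.append_nil, h]
  have := sum_mul_div_eq_cz z (blk c i.val) (blk c (i.val + 1)) hz.injOn r
  rw [cwS, cz_C_mul, show ((blk c (i.val + 1)).card - (blk c i.val).card + r + 1 : ℤ) =
    (blk c (i.val + 1)).card + r + 1 - (blk c i.val).card by ring, ← this, Finset.mul_sum,
    Finset.sum_mul]
  refine Finset.sum_congr rfl fun x _ => ?_
  have : ∏ t ∈ blk c (i.val + 1), (z t - z x) =
      (-1) ^ (blk c (i.val + 1)).card * ∏ t ∈ blk c (i.val + 1), (z x - z t) := by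
    rw [← Finset.prod_const, ← Finset.prod_mul_distrib]
    exact Finset.prod_congr rfl fun t _ => by ring
  rw [this, wtB]; ring

theorem rho_ccReal (hz : Function.Injective z) (i : Fin (n - 1)) (r : ℕ) (F : List (Fin d) → K) :
    rho z c (ccReal i r) F [] =
      cz (ccS z c i.val) ((blk c i.val).card - (blk c (i.val + 1)).card + r + 1) * F [] := by
  have h : ∀ x, rho z c (lay [] (.rcup i) [] * dots [dn i] (up i) [] r) F [x, x] =
      z x ^ r * ((∏ t ∈ blk c i.val, (z x - z t)) * F []) := by
    intro x
    rw [rho_mul]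
    have := rho_dots z c [dn i] (up i) [] r (rho z c (lay [] (.rcup i) []) F) (xu := [x]) rfl x []
    rw [List.singleton_append] at this
    rw [this]; simp
  rw [ccReal, rho_mul]
  simp only [rho_lay_app, Gen.tgt, List.length_nil, List.take_nil, List.drop_nil, col_nil,
    genop_lcapA, List.nil_append, List.append_nil, h]
  have := sum_mul_div_eq_cz z (blk c (i.val + 1)) (blk c i.val) hz.injOn r
  rw [ccS, cz_C_mul, show ((blk c i.val).card - (blk c (i.val + 1)).card + r + 1 : ℤ) =
    (blk c i.val).card + r + 1 - (blk c (i.val + 1)).card by ring, ← this, Finset.mul_sum,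
    Finset.sum_mul]
  refine Finset.sum_congr rfl fun x hx => ?_
  have h2 : wtA z c (i.val + 1) x =
      -(-1) ^ (blk c (i.val + 1)).card * ∏ t ∈ (blk c (i.val + 1)).erase x, (z x - z t) := by
    rw [← Finset.card_erase_add_one hx, pow_succ, mul_neg_one, neg_neg, ← Finset.prod_const,
      ← Finset.prod_mul_distrib]
    exact Finset.prod_congr rfl fun t _ => by ring
  have h3 : (-(-1) ^ (blk c (i.val + 1)).card : K)⁻¹ = -(-1) ^ (blk c (i.val + 1)).card := by
    rw [inv_neg, ← inv_pow]; norm_num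
  rw [h2, div_eq_mul_inv, mul_inv, h3, div_eq_mul_inv]; ring

theorem sg_eq (k : ℕ) : sg (k : ℤ) = (-1) ^ k := by
  unfold sg
  rcases Nat.even_or_odd k with h | h
  · rw [if_pos (by exact_mod_cast h), h.neg_one_pow]
  · rw [if_neg (by rw [Int.not_even_iff_odd]; exact_mod_cast h), h.neg_one_pow]

theorem HasWt.bar {lam : Fin n → ℤ} (h : HasWt c lam) (i : Fin (n - 1)) :
    Schur.en lam i.val = (blk c i.val).card ∧ Schur.en lam (i.val + 1) = (blk c (i.val + 1)).card ∧
      glBar lam i = (blk c i.val).card - (blk c (i.val + 1)).card := by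
  have hi := i.isLt
  rw [glBar, h.en (i := i.val) (by omega), h.en (i := i.val + 1) (by omega)]
  simp

theorem rho_scalar_mul {x y : Alg n} {a b : K} (hx : ∀ F, rho z c x F [] = a * F [])
    (hy : ∀ F, rho z c y F [] = b * F []) (F : List (Fin d) → K) :
    rho z c (x * y) F [] = (a * b) * F [] := by
  rw [rho_mul, hy, hx]; ring

theorem rho_cwBub (hz : Function.Injective z) {lam : Fin n → ℤ} (hc : HasWt c lam) (i : Fin (n - 1))
    (m : ℕ) (F : List (Fin d) → K) : rho z c (cwBub lam i m) F [] = coeff m (cwS z c i.val) * F [] := by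
  obtain ⟨ha, hb, hbar⟩ := hc.bar i
  revert F
  induction m using Nat.strong_induction_on with
  | _ m ih =>
    intro F
    rw [cwBub]
    split_ifs with h1 h2
    · rw [rho_cwReal hz, Int.toNat_of_nonneg h1, hbar, ← cz_natCast]
      congr 2; ring
    · subst h2
      rw [rho_algebraMap, hb, sg_eq, cwS, PowerSeries.coeff_C_mul, coeff_zero_eSer_mul_hSer]
      simp [Rat.smul_def]
    · have hm := congrArg (coeff m) (ccS_mul_cwS z c i.val)
      rw [mul_comm, coeff_mul, Finset.Nat.sum_antidiagonal_eq_sum_range_succ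
        (fun k l => coeff k (cwS z c i.val) * coeff l (ccS z c i.val)), Finset.sum_range_succ] at hm
      simp only [map_neg, coeff_one, if_neg h2, neg_zero, Nat.sub_self] at hm
      have h0 : coeff 0 (ccS z c i.val) = -(-1) ^ (blk c (i.val + 1)).card := by
        rw [ccS, PowerSeries.coeff_C_mul, coeff_zero_eSer_mul_hSer, mul_one]
      have hsq : ((-1 : K) ^ (blk c (i.val + 1)).card) * (-1) ^ (blk c (i.val + 1)).card = 1 := by
        rw [← mul_pow]; simp
      have hs : ∀ j : Fin m, rho z c (cwBub lam i j.val *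
          ccReal i (- glBar lam i - 1 + m - j.val).toNat) F [] =
          coeff j.val (cwS z c i.val) * coeff (m - j.val) (ccS z c i.val) * F [] := by
        intro j
        have hj := j.isLt
        refine rho_scalar_mul (ih _ hj) (fun F => ?_) F
        rw [rho_ccReal hz, Int.toNat_of_nonneg (by omega), hbar, ← cz_natCast]
        congr 2; push_cast [hj.le]; ring
      rw [rho_smul, rho_sum, LinearMap.smul_apply, Pi.smul_apply, LinearMap.sum_apply,
        Finset.sum_apply, Finset.sum_congr rfl fun j _ => hs j, hb, sg_eq,
        Fin.sum_univ_eq_sum_range (fun j => coeff j (cwS z c i.val) * coeff (m - j) (ccS z c i.val) *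
          F []) m, ← Finset.sum_mul, Rat.smul_def]
      rw [h0] at hm
      push_cast
      linear_combination (-1) ^ (blk c (i.val + 1)).card * F [] * hm +
        coeff m (cwS z c i.val) * F [] * hsq

theorem rho_ccBub (hz : Function.Injective z) {lam : Fin n → ℤ} (hc : HasWt c lam) (i : Fin (n - 1))
    (m : ℕ) (F : List (Fin d) → K) : rho z c (ccBub lam i m) F [] = coeff m (ccS z c i.val) * F [] := by
  obtain ⟨ha, hb, hbar⟩ := hc.bar i
  revert F
  induction m using Nat.strong_induction_on with
  | _ m ih =>
    intro F
    rw [ccBub]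
    split_ifs with h1 h2
    · rw [rho_ccReal hz, Int.toNat_of_nonneg h1, hbar, ← cz_natCast]
      congr 2; ring
    · subst h2
      rw [rho_algebraMap, hb, sg_eq, ccS, PowerSeries.coeff_C_mul, coeff_zero_eSer_mul_hSer]
      simp [Rat.smul_def]
    · have hm := congrArg (coeff m) (ccS_mul_cwS z c i.val)
      rw [coeff_mul, Finset.Nat.sum_antidiagonal_eq_sum_range_succ
        (fun k l => coeff k (ccS z c i.val) * coeff l (cwS z c i.val)), Finset.sum_range_succ] at hm
      simp only [map_neg, coeff_one, if_neg h2, neg_zero, Nat.sub_self] at hm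
      have h0 : coeff 0 (cwS z c i.val) = (-1) ^ (blk c (i.val + 1)).card := by
        rw [cwS, PowerSeries.coeff_C_mul, coeff_zero_eSer_mul_hSer, mul_one]
      have hsq : ((-1 : K) ^ (blk c (i.val + 1)).card) * (-1) ^ (blk c (i.val + 1)).card = 1 := by
        rw [← mul_pow]; simp
      have hs : ∀ j : Fin m, rho z c (ccBub lam i j.val *
          cwReal i (glBar lam i - 1 + m - j.val).toNat) F [] =
          coeff j.val (ccS z c i.val) * coeff (m - j.val) (cwS z c i.val) * F [] := by
        intro j
        have hj := j.isLt
        refine rho_scalar_mul (ih _ hj) (fun F => ?_) F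
        rw [rho_cwReal hz, Int.toNat_of_nonneg (by omega), hbar, ← cz_natCast]
        congr 2; push_cast [hj.le]; ring
      rw [rho_smul, rho_sum, LinearMap.smul_apply, Pi.smul_apply, LinearMap.sum_apply,
        Finset.sum_apply, Finset.sum_congr rfl fun j _ => hs j, hb, sg_eq,
        Fin.sum_univ_eq_sum_range (fun j => coeff j (ccS z c i.val) * coeff (m - j) (cwS z c i.val) *
          F []) m, ← Finset.sum_mul, Rat.smul_def]
      rw [h0] at hm
      push_cast
      linear_combination -(-1) ^ (blk c (i.val + 1)).card * F [] * hm +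
        coeff m (ccS z c i.val) * F [] * hsq

theorem rho_cw (hz : Function.Injective z) {lam : Fin n → ℤ} (hc : HasWt c lam) (i : Fin (n - 1))
    (r : ℤ) (F : List (Fin d) → K) : rho z c (cw lam i r) F [] =
      cz (cwS z c i.val) (r - glBar lam i + 1) * F [] := by
  obtain ⟨ha, hb, hbar⟩ := hc.bar i
  rw [cw]
  split_ifs with h1 h2
  · rw [rho_cwReal hz, Int.toNat_of_nonneg h1, hbar]; congr 2; ring
  · rw [rho_cwBub hz hc, ← cz_natCast, Int.toNat_of_nonneg h2]
  · rw [cz_of_neg _ (by omega)]; simp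

theorem rho_cc (hz : Function.Injective z) {lam : Fin n → ℤ} (hc : HasWt c lam) (i : Fin (n - 1))
    (r : ℤ) (F : List (Fin d) → K) : rho z c (cc lam i r) F [] =
      cz (ccS z c i.val) (r + glBar lam i + 1) * F [] := by
  obtain ⟨ha, hb, hbar⟩ := hc.bar i
  rw [cc]
  split_ifs with h1 h2
  · rw [rho_ccReal hz, Int.toNat_of_nonneg h1, hbar]; congr 2; ring
  · rw [rho_ccBub hz hc, ← cz_natCast, Int.toNat_of_nonneg h2]
  · rw [cz_of_neg _ (by omega)]; simp

theorem rho_grass (hz : Function.Injective z) {lam : Fin n → ℤ} (hc : HasWt c lam) (i : Fin (n - 1))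
    (m : ℕ) (F : List (Fin d) → K) :
    rho z c (∑ j ∈ Finset.range (m + 1), ccBub lam i j * cwBub lam i (m - j) +
      if m = 0 then 1 else 0) F [] = 0 := by
  have hm := congrArg (coeff m) (ccS_mul_cwS z c i.val)
  rw [coeff_mul, Finset.Nat.sum_antidiagonal_eq_sum_range_succ
    (fun k l => coeff k (ccS z c i.val) * coeff l (cwS z c i.val))] at hm
  rw [rho_add, rho_sum, LinearMap.add_apply, Pi.add_apply, LinearMap.sum_apply, Finset.sum_apply,
    Finset.sum_congr rfl fun j _ => rho_scalar_mul (rho_ccBub hz hc i j) (rho_cwBub hz hc i (m - j)) F,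
    ← Finset.sum_mul, hm]
  split_ifs with h
  · subst h; simp
  · simp [coeff_one, h]

end BubbleAction
end Schur


namespace Schur

section PartialFractions

open PowerSeries Finset

variable {K ι : Type*} [Field K] [DecidableEq ι] {z : ι → K}

/-- The geometric series. -/
noncomputable def geom (a : K) : K⟦X⟧ := mk fun k => a ^ k

theorem hSer_insert' {S : Finset ι} {x : ι} (hx : x ∉ S) :
    hSer z (insert x S) = hSer z S * geom (z x) := by
  rw [hSer, prod_insert hx, mul_comm]; rfl

theorem cz_mul_geom (φ : K⟦X⟧) (a : K) (m : ℤ) :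
    cz (φ * geom a) m = ∑ f ∈ range (m + 1).toNat, cz φ f * a ^ (m - f).toNat := by
  rcases lt_or_ge m 0 with h | h
  · rw [cz_of_neg _ h, Int.toNat_of_nonpos (by omega)]; simp
  · obtain ⟨k, rfl⟩ := Int.eq_ofNat_of_zero_le h
    rw [cz_geom (φ := φ) (a := a) (by rw [mul_comm φ, ← mul_assoc, geom, geom_mul, one_mul])]
    refine sum_congr (by congr 1) fun f _ => ?_
    congr 2; omega

theorem sum_curl (hz : Function.Injective z) {S T : Finset ι} {x : ι} (hS : x ∉ S) (hT : x ∈ T) :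
    ∑ y ∈ S, (∏ t ∈ T, (z y - z t)) / ((z y - z x) * ∏ u ∈ S.erase y, (z y - z u)) =
      cz (eSer z T * hSer z S * geom (z x)) (T.card - S.card) := by
  have := sum_mul_div_eq_cz z (insert x S) T hz.injOn 0
  rw [sum_insert hS, prod_eq_zero hT (sub_self (z x)), mul_zero, zero_div, zero_add,
    card_insert_of_notMem hS, hSer_insert' hS, ← mul_assoc] at this
  rw [show ((T.card : ℤ) - S.card) = T.card + (0 : ℕ) + 1 - (S.card + 1 : ℕ) by push_cast; ring, ← this]
  refine sum_congr rfl fun y hy => ?_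
  have hyx : x ≠ y := fun h => hS (h ▸ hy)
  rw [erase_insert_of_ne hyx, prod_insert (by simp [hS]), pow_zero, one_mul]

theorem sum_double (hz : Function.Injective z) {S T : Finset ι} {x y : ι} (hx : x ∉ S) (hy : y ∉ S)
    (hxT : x ∈ T) (hyT : y ∈ T) :
    ∑ p ∈ S, (∏ t ∈ T, (z p - z t)) / ((z p - z x) * (z p - z y) * ∏ u ∈ S.erase p, (z p - z u)) =
      cz (eSer z T * hSer z S * geom (z y) * geom (z x)) (T.card - S.card - 1) -
        if y = x then (∏ t ∈ T.erase x, (z x - z t)) / ∏ u ∈ S, (z x - z u) else 0 := by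
  by_cases hxy : y = x
  · subst hxy
    have := sum_mul_div_eq_cz z (insert y S) (T.erase y) hz.injOn 0
    have hc := card_erase_add_one hyT
    have he : eSer z T * hSer z S * geom (z y) * geom (z y) =
        eSer z (T.erase y) * hSer z (insert y S) := by
      rw [← insert_erase hyT, eSer_insert z (by simp), hSer_insert' hy, erase_insert (by simp)]
      calc _ = ((1 - C (z y) * X) * geom (z y)) * (eSer z (T.erase y) * (hSer z S * geom (z y))) := by
            ring
        _ = _ := by rw [geom, geom_mul, one_mul]
    rw [sum_insert hy, card_insert_of_notMem hy, erase_insert hy, pow_zero, one_mul] at this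
    rw [he, if_pos rfl, show ((T.card : ℤ) - S.card - 1) =
      (T.erase y).card + (0 : ℕ) + 1 - (S.card + 1 : ℕ) by push_cast [← hc]; ring, ← this,
      add_sub_cancel_left]
    refine sum_congr rfl fun p hp => ?_
    have hyp : y ≠ p := fun h => hy (h ▸ hp)
    have hne : z p - z y ≠ 0 := sub_ne_zero.2 (hz.ne hyp.symm)
    rw [erase_insert_of_ne hyp, prod_insert (by simp [hy]), pow_zero, one_mul,
      ← mul_prod_erase T _ hyT, mul_assoc, mul_div_mul_left _ _ hne]
  · have hyS : y ∉ insert x S := by simp [hxy, hy]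
    have := sum_mul_div_eq_cz z (insert y (insert x S)) T hz.injOn 0
    rw [sum_insert hyS, prod_eq_zero hyT (sub_self (z y)), sum_insert hx,
      prod_eq_zero hxT (sub_self (z x)), mul_zero, zero_div, zero_add, mul_zero, zero_div, zero_add,
      card_insert_of_notMem hyS, card_insert_of_notMem hx, hSer_insert' hyS, hSer_insert' hx] at this
    rw [if_neg hxy, sub_zero, show eSer z T * hSer z S * geom (z y) * geom (z x) =
      eSer z T * (hSer z S * geom (z x) * geom (z y)) by ring, show ((T.card : ℤ) - S.card - 1) =
      T.card + (0 : ℕ) + 1 - (S.card + 1 + 1 : ℕ) by push_cast; ring, ← this]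
    refine sum_congr rfl fun p hp => ?_
    have hyp : y ≠ p := fun h => hy (h ▸ hp)
    have hxp : x ≠ p := fun h => hx (h ▸ hp)
    rw [erase_insert_of_ne hyp, prod_insert (by simp [hy, hxy]), erase_insert_of_ne hxp,
      prod_insert (by simp [hx]), pow_zero, one_mul, ← mul_assoc, mul_comm (z p - z y)]

end PartialFractions

section Sideways

open PowerSeries

variable {n d : ℕ} {K : Type} [Field K] [CharZero K] {z : Fin d → K} {c : Fin d → ℕ}
attribute [local simp] rho_lay_app rho_mul rho_sub rho_add rho_smul Gen.tgt genop_lcapA genop_rcapB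
  Letter.old Letter.new
theorem rho_crossL_ne (hz : Function.Injective z) (j i : Fin (n - 1)) {x y : Fin d} (hxy : x ≠ y)
    (hv : Valid c [dn i, up j] [x, y]) (F : List (Fin d) → K) :
    rho z c (crossL j i) F [x, y] = F [y, x] := by
  simp at hv
  obtain ⟨hy, hx⟩ := hv
  rw [Function.update_of_ne hxy] at hx
  have hyx := hxy.symm
  have e1 := sub_ne_zero_of_ne' hz hxy
  have e2 := sub_ne_zero_of_ne' hz hyx
  have w1 := wtB_ne_zero hz c i.val x
  by_cases hij : i = j
  · subst hij
    simp [crossL, -Finset.sum_ite_eq, -Finset.sum_ite_eq', hxy]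
    rw [sum_blk_single (y := x) hx fun p _ hp => by simp [hp.symm], if_pos rfl,
      prod_blk_B z (by simp [hxy])]
    simp only [wtB_update_self, wtB_update hz _ _ _ hyx, Function.update_of_ne hyx, hy, if_true,
      Nat.succ_ne_self, if_false, div_one]
    rw [div_div, neg_div, neg_eq_iff_eq_neg, div_eq_iff (mul_ne_zero e2 w1)]
    ring
  · have hij' : i.val ≠ j.val := fun h => hij (Fin.ext h)
    simp [crossL, -Finset.sum_ite_eq, -Finset.sum_ite_eq', hij]
    rw [sum_blk_single (y := x) hx fun p _ hp => by simp [hp.symm], if_pos rfl,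
      prod_blk_B z (by simp [hxy])]
    simp only [wtB_update_self, wtB_update hz _ _ _ hyx, Function.update_of_ne hyx, hy, kap_true,
      hij'.symm, if_false, mul_one]
    split_ifs <;> first | omega | field_simp

theorem rho_crossL_self (hz : Function.Injective z) (i : Fin (n - 1)) {x : Fin d}
    (hx : c x = i.val + 1) (F : List (Fin d) → K) : rho z c (crossL i i) F [x, x] =
      wtB z c i.val x * ∑ y ∈ blk c i.val, F [y, y] / ((z x - z y) * wtB z c i.val y) := by
  simp [crossL, -Finset.sum_ite_eq, -Finset.sum_ite_eq', Finset.mul_sum]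
  refine Finset.sum_congr rfl fun y hy => ?_
  rw [mem_blk] at hy
  have hxy : x ≠ y := by rintro rfl; omega
  rw [if_neg hxy, sub_zero, show Function.update c y i.val = c by rw [← hy, Function.update_eq_self],
    prod_blk_B z (by omega), div_div]
  ring

theorem rho_crossR_ne (hz : Function.Injective z) (j i : Fin (n - 1)) {x y : Fin d} (hxy : x ≠ y)
    (hv : Valid c [up i, dn j] [x, y]) (F : List (Fin d) → K) :
    rho z c (crossR j i) F [x, y] = F [y, x] := by
  simp at hv
  obtain ⟨hy, hx⟩ := hv
  rw [Function.update_of_ne hxy] at hx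
  have hyx := hxy.symm
  have e1 := sub_ne_zero_of_ne' hz hxy
  have e2 := sub_ne_zero_of_ne' hz hyx
  have w1 := wtA_ne_zero hz c (j.val + 1) y
  by_cases hij : i = j
  · subst hij
    simp [crossR, -Finset.sum_ite_eq, -Finset.sum_ite_eq', hxy]
    rw [sum_blk_single (y := y) (by simp [hyx]) fun p _ hp => by simp [hp], if_pos rfl,
      prod_blk_A z (by omega)]
    simp only [wtA_update_self, wtA_update hz _ _ _ hxy, Function.update_of_ne hxy, hx, if_true,
      (Nat.succ_ne_self _).symm, if_false, mul_one]
    rw [div_div, neg_div, neg_eq_iff_eq_neg, div_eq_iff (mul_ne_zero e2 (div_ne_zero w1 e1))]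
    field_simp; ring
  · have hij' : i.val ≠ j.val := fun h => hij (Fin.ext h)
    simp [crossR, -Finset.sum_ite_eq, -Finset.sum_ite_eq', hij]
    rw [sum_blk_single (y := y) (by simp [hyx]) fun p _ hp => by simp [hp], if_pos rfl,
      prod_blk_A z (by omega)]
    simp only [wtA_update_self, wtA_update hz _ _ _ hxy, Function.update_of_ne hxy, hx, kap_true,
      add_left_inj, hij', if_false, div_one]
    split_ifs <;> first | omega | field_simp

theorem rho_crossR_self (hz : Function.Injective z) (i : Fin (n - 1)) {x : Fin d}
    (hx : c x = i.val) (F : List (Fin d) → K) : rho z c (crossR i i) F [x, x] =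
      wtA z c (i.val + 1) x *
        ∑ p ∈ blk c (i.val + 1), F [p, p] / ((z p - z x) * wtA z c (i.val + 1) p) := by
  simp [crossR, -Finset.sum_ite_eq, -Finset.sum_ite_eq', Finset.mul_sum]
  rw [← hx, Function.update_eq_self, hx]
  refine Finset.sum_congr rfl fun p hp => ?_
  rw [mem_blk] at hp
  have hxp : p ≠ x := by rintro rfl; omega
  rw [if_neg hxp, sub_zero, prod_blk_A z (by omega), div_div]
  ring

theorem rho_sideLR (hz : Function.Injective z) (i j : Fin (n - 1)) (h : i ≠ j) {x y : Fin d}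
    (hv : Valid c [up i, dn j] [x, y]) (F : List (Fin d) → K) :
    rho z c (crossL i j * crossR j i - 1) F [x, y] = 0 := by
  have hv' := hv
  simp at hv
  have hxy : x ≠ y := by
    rintro rfl
    rw [Function.update_self] at hv
    exact h (Fin.ext (by omega))
  rw [Function.update_of_ne hxy] at hv
  rw [rho_sub, LinearMap.sub_apply, Pi.sub_apply, rho_mul, rho_crossR_ne hz j i hxy hv',
    rho_crossL_ne hz i j hxy.symm (by simp [hv, hxy.symm])]
  simp

theorem rho_sideRL (hz : Function.Injective z) (i j : Fin (n - 1)) (h : i ≠ j) {x y : Fin d}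
    (hv : Valid c [dn i, up j] [x, y]) (F : List (Fin d) → K) :
    rho z c (crossR i j * crossL j i - 1) F [x, y] = 0 := by
  have hv' := hv
  simp at hv
  have hxy : x ≠ y := by
    rintro rfl
    rw [Function.update_self] at hv
    exact h (Fin.ext (by omega))
  rw [Function.update_of_ne hxy] at hv
  rw [rho_sub, LinearMap.sub_apply, Pi.sub_apply, rho_mul, rho_crossL_ne hz j i hxy hv',
    rho_crossR_ne hz i j hxy.symm (by simp [hv, hxy.symm])]
  simp

theorem prod_sub_comm (z : Fin d → K) (S : Finset (Fin d)) (x : Fin d) :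
    ∏ t ∈ S, (z t - z x) = (-1) ^ S.card * ∏ t ∈ S, (z x - z t) := by
  rw [← Finset.prod_const, ← Finset.prod_mul_distrib]
  exact Finset.prod_congr rfl fun t _ => by ring

theorem neg_one_pow_inv (k : ℕ) : ((-1 : K) ^ k)⁻¹ = (-1) ^ k := by
  rw [← inv_pow]; norm_num

theorem wtA_eq_of_mem (z : Fin d → K) {c : Fin d → ℕ} {k : ℕ} {x : Fin d} (hx : c x = k) :
    wtA z c k x = -(-1) ^ (blk c k).card * ∏ t ∈ (blk c k).erase x, (z x - z t) := by
  rw [wtA, prod_sub_comm, ← Finset.card_erase_add_one (s := blk c k) (a := x) (by simpa using hx),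
    pow_succ]; ring

theorem rho_curlR (hz : Function.Injective z) {lam : Fin n → ℤ} (hc : HasWt c lam) (i : Fin (n - 1))
    {x : Fin d} (hx : c x = i.val + 1) (F : List (Fin d) → K) :
    rho z c (lay [up i] (.lcup i) [] * lay [] (crU i i) [dn i] * lay [up i] (.rcap i) [] +
      ∑ f ∈ Finset.range (1 - glBar lam i).toNat, whisk [up i] [] (cw lam i (glBar lam i - 1 + f)) *
        dots [] (up i) [] (- glBar lam i - f).toNat) F [x] = 0 := by
  obtain ⟨ha, hb, hbar⟩ := hc.bar i
  have h1 : rho z c (lay [up i] (.lcup i) [] * lay [] (crU i i) [dn i] *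
      lay [up i] (.rcap i) []) F [x] = - cz (cwS z c i.val * geom (z x)) (- glBar lam i) * F [x] := by
    simp [-Finset.sum_ite_eq, -Finset.sum_ite_eq']
    rw [cwS, mul_assoc (C _), cz_C_mul, hbar, neg_sub, ← sum_curl hz (x := x) (by simp [hx])
      (by simp [hx]), Finset.mul_sum, Finset.sum_mul, ← Finset.sum_neg_distrib]
    refine Finset.sum_congr rfl fun y hy => ?_
    rw [mem_blk] at hy
    have hxy : x ≠ y := by rintro rfl; omega
    rw [if_neg hxy, sub_zero, prod_sub_comm, div_div, wtB, ← neg_sub (z y) (z x), neg_mul, div_neg]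
    ring
  have h2 : ∀ f : ℕ, rho z c (whisk [up i] [] (cw lam i (glBar lam i - 1 + f)) *
        dots [] (up i) [] (- glBar lam i - f).toNat) F [x] =
      cz (cwS z c i.val) f * z x ^ (- glBar lam i - f).toNat * F [x] := by
    intro f
    have e1 := rho_dots z c [] (up i) [] (- glBar lam i - f).toNat
      (rho z c (whisk [up i] [] (cw lam i (glBar lam i - 1 + f))) F) (xu := []) rfl x []
    have e2 := rho_whisk z (c := c) (cw_mem_dia (P := presS n d) lam lam i (glBar lam i - 1 + f))
      (u := [up i]) (v := []) (xu := [x]) (ys := []) (xv := []) rfl rfl rfl F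
    rw [col_nil, rho_cw hz hc] at e2
    rw [rho_mul]
    refine e1.trans ?_
    have e3 : rho z c (whisk [up i] [] (cw lam i (glBar lam i - 1 + f))) F [x] = _ := e2
    rw [List.nil_append, e3, show glBar lam i - 1 + f - glBar lam i + 1 = (f : ℤ) by ring]
    simp only [List.append_nil]; ring
  rw [rho_add, LinearMap.add_apply, Pi.add_apply, h1, rho_sum, LinearMap.sum_apply,
    Finset.sum_apply, Finset.sum_congr rfl fun f _ => h2 f, cz_mul_geom, ← Finset.sum_mul,
    show (- glBar lam i + 1).toNat = (1 - glBar lam i).toNat by congr 1; ring]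
  ring

theorem rho_curlL (hz : Function.Injective z) {lam mu : Fin n → ℤ} (hc : HasWt c lam)
    (i : Fin (n - 1)) (hmu : mu = lam + glRoot i) {x : Fin d} (hx : c x = i.val + 1)
    (F : List (Fin d) → K) :
    rho z c (lay [] (.rcup i) [up i] * lay [dn i] (crU i i) [] * lay [] (.lcap i) [up i] -
      ∑ g ∈ Finset.range (glBar mu i + 1).toNat, whisk [] [up i] (cc mu i (- glBar mu i - 1 + g)) *
        dots [] (up i) [] (glBar mu i - g).toNat) F [x] = 0 := by
  set c' := Function.update c x i.val with hc'
  have hw : HasWt c' mu := by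
    have := hc.update (D := d) (up i) (x := x) hx
    rw [hmu]; simpa [Pres.wt] using this
  obtain ⟨ha, hb, hbar⟩ := hw.bar i
  have hx' : c' x = i.val := by simp [hc']
  have h1 : rho z c (lay [] (.rcup i) [up i] * lay [dn i] (crU i i) [] *
      lay [] (.lcap i) [up i]) F [x] = cz (ccS z c' i.val * geom (z x)) (glBar mu i) * F [x] := by
    simp [-Finset.sum_ite_eq, -Finset.sum_ite_eq']
    rw [← hc', ccS, mul_assoc (C _), cz_C_mul, hbar, ← sum_curl hz (x := x) (by simp [hx'])
      (by simp [hx']), Finset.mul_sum, Finset.sum_mul]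
    refine Finset.sum_congr rfl fun y hy => ?_
    rw [mem_blk] at hy
    have hxy : y ≠ x := by rintro rfl; omega
    rw [if_neg hxy, sub_zero, div_div, wtA_eq_of_mem z hy, div_eq_mul_inv, mul_inv, mul_inv, inv_neg,
      neg_one_pow_inv, div_eq_mul_inv, mul_inv]
    ring
  have h2 : ∀ f : ℕ, rho z c (whisk [] [up i] (cc mu i (- glBar mu i - 1 + f)) *
        dots [] (up i) [] (glBar mu i - f).toNat) F [x] =
      cz (ccS z c' i.val) f * z x ^ (glBar mu i - f).toNat * F [x] := by
    intro f
    have e1 := rho_dots z c [] (up i) [] (glBar mu i - f).toNat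
      (rho z c (whisk [] [up i] (cc mu i (- glBar mu i - 1 + f))) F) (xu := []) rfl x []
    have e2 := rho_whisk z (c := c) (cc_mem_dia (P := presS n d) mu mu i (- glBar mu i - 1 + f))
      (u := []) (v := [up i]) (xu := []) (ys := []) (xv := [x]) rfl rfl rfl F
    rw [col_cons, col_nil] at e2
    change _ = rho z c' _ _ _ at e2
    rw [rho_cc hz hw] at e2
    rw [rho_mul]
    refine e1.trans ?_
    have e3 : rho z c (whisk [] [up i] (cc mu i (- glBar mu i - 1 + f))) F [x] = _ := e2
    rw [List.nil_append, e3, show - glBar mu i - 1 + f + glBar mu i + 1 = (f : ℤ) by ring]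
    simp only [List.nil_append]; ring
  rw [rho_sub, LinearMap.sub_apply, Pi.sub_apply, h1, rho_sum, LinearMap.sum_apply,
    Finset.sum_apply, Finset.sum_congr rfl fun f _ => h2 f, cz_mul_geom, ← Finset.sum_mul]
  ring

theorem cz_mul_geom_geom (φ : K⟦X⟧) (a b : K) (m : ℤ) :
    cz (φ * geom b * geom a) (m - 1) = ∑ f ∈ Finset.range m.toNat, ∑ g ∈ Finset.range (f + 1),
      b ^ (f - g) * cz φ g * a ^ (m - 1 - f).toNat := by
  rw [cz_mul_geom, sub_add_cancel]
  refine Finset.sum_congr rfl fun f _ => ?_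
  rw [cz_mul_geom, Finset.sum_mul]
  refine Finset.sum_congr rfl fun g _ => ?_
  rw [show ((f : ℤ) - g).toNat = f - g by omega]; ring

theorem sum_cz_geom_geom {ι : Type*} (S : Finset ι) (φ : K⟦X⟧) (a : K) (b h : ι → K) (m : ℤ) :
    ∑ f ∈ Finset.range m.toNat, ∑ g ∈ Finset.range (f + 1), ∑ p ∈ S,
      b p ^ (f - g) * cz φ g * a ^ (m - 1 - f).toNat * h p =
      ∑ p ∈ S, cz (φ * geom (b p) * geom a) (m - 1) * h p := by
  simp only [cz_mul_geom_geom, Finset.sum_mul]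
  rw [Finset.sum_comm (s := S)]
  exact Finset.sum_congr rfl fun f _ => Finset.sum_comm

theorem rho_decEF (hz : Function.Injective z) {lam : Fin n → ℤ} (hc : HasWt c lam) (i : Fin (n - 1))
    {x y : Fin d} (hv : Valid c [up i, dn i] [x, y]) (F : List (Fin d) → K) :
    rho z c (1 - crossL i i * crossR i i +
      ∑ f ∈ Finset.range (glBar lam i).toNat, ∑ g ∈ Finset.range (f + 1),
        dots [] (up i) [dn i] (f - g) * lay [] (.rcap i) [] * cc lam i (- glBar lam i - 1 + g) *
        lay [] (.lcup i) [] * dots [] (up i) [dn i] (glBar lam i - 1 - f).toNat) F [x, y] = 0 := by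
  obtain ⟨ha, hb, hbar⟩ := hc.bar i
  have hterm : ∀ f g : ℕ, rho z c (dots [] (up i) [dn i] (f - g) * lay [] (.rcap i) [] *
      cc lam i (- glBar lam i - 1 + g) * lay [] (.lcup i) [] *
      dots [] (up i) [dn i] (glBar lam i - 1 - f).toNat) F [x, y] =
      if x = y then ∑ p ∈ blk c i.val, z p ^ (f - g) * cz (ccS z c i.val) g *
        z x ^ (glBar lam i - 1 - f).toNat * ((∏ t ∈ blk c (i.val + 1), (z t - z x)) * F [p, p] /
          wtB z c i.val p) else 0 := by
    intro f g
    have e1 := rho_dots z c [] (up i) [dn i] (glBar lam i - 1 - f).toNat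
      (rho z c (dots [] (up i) [dn i] (f - g) * lay [] (.rcap i) [] *
      cc lam i (- glBar lam i - 1 + g) * lay [] (.lcup i) []) F) (xu := []) rfl x [y]
    rw [List.nil_append] at e1
    rw [rho_mul, e1, rho_mul]
    simp only [rho_lay_app (g := Gen.lcup i), Gen.tgt, List.length_nil, List.length_cons,
      List.take_succ_cons, List.take_zero, List.drop_succ_cons, List.drop_zero, genop_lcup, col_nil,
      Nat.zero_add, Nat.reduceAdd, List.nil_append]
    split_ifs with hxy
    · subst hxy
      rw [rho_mul, rho_cc hz hc, rho_mul,
        show - glBar lam i - 1 + g + glBar lam i + 1 = (g : ℤ) by ring]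
      simp only [rho_lay_app (g := Gen.rcap i), Gen.tgt, List.length_nil, List.take_nil,
        List.drop_nil, genop_rcapB, col_nil, List.nil_append, List.append_nil]
      have e2 : ∀ p, rho z c (dots [] (up i) [dn i] (f - g)) F [p, p] = z p ^ (f - g) * F [p, p] :=
        fun p => rho_dots z c [] (up i) [dn i] (f - g) F (xu := []) rfl p [p]
      simp only [e2, Finset.mul_sum]
      exact Finset.sum_congr rfl fun p _ => by ring
    · simp
  rw [rho_add, LinearMap.add_apply, Pi.add_apply, rho_sub, LinearMap.sub_apply, Pi.sub_apply,
    rho_one, rho_mul, rho_sum]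
  simp only [rho_sum, LinearMap.sum_apply, Finset.sum_apply, hterm, Module.End.one_apply]
  have hv' := hv
  simp at hv
  obtain ⟨hy, hx⟩ := hv
  by_cases hxy : x = y
  · subst hxy
    simp only [if_true]
    have hR : rho z c (crossR i i) (rho z c (crossL i i) F) [x, x] =
        ∑ p ∈ blk c i.val, (wtA z c (i.val + 1) x * F [p, p] / wtB z c i.val p) *
          ∑ q ∈ blk c (i.val + 1), (-(-1) ^ (blk c (i.val + 1)).card) *
            ((∏ t ∈ blk c i.val, (z q - z t)) /
              ((z q - z x) * (z q - z p) * ∏ u ∈ (blk c (i.val + 1)).erase q, (z q - z u))) := by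
      rw [rho_crossR_self hz i hy]
      simp only [Finset.mul_sum]
      rw [Finset.sum_comm]
      refine Finset.sum_congr rfl fun q hq => ?_
      rw [mem_blk] at hq
      rw [rho_crossL_self hz i hq, Finset.mul_sum, Finset.sum_div, Finset.mul_sum]
      refine Finset.sum_congr rfl fun p hp => ?_
      rw [wtA_eq_of_mem z hq, prod_blk_B z (by omega)]
      simp only [div_eq_mul_inv, mul_inv, inv_neg, neg_one_pow_inv]
      ring
    have hcc : ∀ p, cz (ccS z c i.val * geom (z p) * geom (z x)) (glBar lam i - 1) =
        -(-1) ^ (blk c (i.val + 1)).card *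
          cz (eSer z (blk c i.val) * hSer z (blk c (i.val + 1)) * geom (z p) * geom (z x))
            ((blk c i.val).card - (blk c (i.val + 1)).card - 1) := by
      intro p; rw [← cz_C_mul, hbar, ccS]; congr 1; ring
    have hS : ∀ p ∈ blk c i.val, (wtA z c (i.val + 1) x * F [p, p] / wtB z c i.val p) *
          ∑ q ∈ blk c (i.val + 1), (-(-1) ^ (blk c (i.val + 1)).card) *
            ((∏ t ∈ blk c i.val, (z q - z t)) /
              ((z q - z x) * (z q - z p) * ∏ u ∈ (blk c (i.val + 1)).erase q, (z q - z u))) =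
        cz (ccS z c i.val * geom (z p) * geom (z x)) (glBar lam i - 1) *
          ((∏ t ∈ blk c (i.val + 1), (z t - z x)) * F [p, p] / wtB z c i.val p) +
          if p = x then F [x, x] else 0 := by
      intro p hp
      rw [mem_blk] at hp
      rw [← Finset.mul_sum, sum_double hz (by simp [hy]) (by simp [hp]) (by simp [hy])
        (by simp [hp]), hcc, prod_blk_A z (by omega)]
      split_ifs with hpx
      · subst hpx
        have h1 := wtB_ne_zero hz c i.val p
        have h2 := wtA_ne_zero hz c (i.val + 1) p
        have h3 : wtA z c (i.val + 1) p = (-1) ^ (blk c (i.val + 1)).card *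
            ∏ u ∈ blk c (i.val + 1), (z p - z u) := by
          rw [← prod_blk_A z (by omega), prod_sub_comm]
        rw [← wtB]
        rw [h3] at h2 ⊢
        have h4 := right_ne_zero_of_mul h2
        have h5 : ((-1 : K) ^ (blk c (i.val + 1)).card) ^ 2 = 1 := by rw [← pow_mul, mul_comm]; simp
        field_simp
        linear_combination F [p, p] * wtB z c i.val p * h5
      · ring
    rw [hR, Finset.sum_congr rfl hS, sum_cz_geom_geom, Finset.sum_add_distrib,
      Finset.sum_ite_eq' _ x, if_pos (by simp [hy])]
    ring
  · rw [rho_crossR_ne hz i i hxy hv']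
    rw [Function.update_of_ne hxy] at hx
    rw [rho_crossL_ne hz i i (Ne.symm hxy) (by simp [hx, hy, Ne.symm hxy])]
    simp [hxy]

theorem rho_decFE (hz : Function.Injective z) {lam : Fin n → ℤ} (hc : HasWt c lam) (i : Fin (n - 1))
    {x y : Fin d} (hv : Valid c [dn i, up i] [x, y]) (F : List (Fin d) → K) :
    rho z c (1 - crossR i i * crossL i i +
      ∑ f ∈ Finset.range (- glBar lam i).toNat, ∑ g ∈ Finset.range (f + 1),
        dots [dn i] (up i) [] (f - g) * lay [] (.lcap i) [] * cw lam i (glBar lam i - 1 + g) *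
        lay [] (.rcup i) [] * dots [dn i] (up i) [] (- glBar lam i - 1 - f).toNat) F [x, y] = 0 := by
  obtain ⟨ha, hb, hbar⟩ := hc.bar i
  have hterm : ∀ f g : ℕ, rho z c (dots [dn i] (up i) [] (f - g) * lay [] (.lcap i) [] *
      cw lam i (glBar lam i - 1 + g) * lay [] (.rcup i) [] *
      dots [dn i] (up i) [] (- glBar lam i - 1 - f).toNat) F [x, y] =
      if x = y then ∑ p ∈ blk c (i.val + 1), z p ^ (f - g) * cz (cwS z c i.val) g *
        z x ^ (- glBar lam i - 1 - f).toNat * ((∏ t ∈ blk c i.val, (z x - z t)) * F [p, p] /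
          wtA z c (i.val + 1) p) else 0 := by
    intro f g
    have e1 := rho_dots z c [dn i] (up i) [] (- glBar lam i - 1 - f).toNat
      (rho z c (dots [dn i] (up i) [] (f - g) * lay [] (.lcap i) [] *
      cw lam i (glBar lam i - 1 + g) * lay [] (.rcup i) []) F) (xu := [x]) rfl y []
    rw [List.singleton_append] at e1
    rw [rho_mul, e1, rho_mul]
    simp only [rho_lay_app (g := Gen.rcup i), Gen.tgt, List.length_nil, List.length_cons,
      List.take_succ_cons, List.take_zero, List.drop_succ_cons, List.drop_zero, genop_rcup, col_nil,
      Nat.zero_add, Nat.reduceAdd, List.nil_append]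
    split_ifs with hxy
    · subst hxy
      rw [rho_mul, rho_cw hz hc, rho_mul,
        show glBar lam i - 1 + g - glBar lam i + 1 = (g : ℤ) by ring]
      simp only [rho_lay_app (g := Gen.lcap i), Gen.tgt, List.length_nil, List.take_nil,
        List.drop_nil, genop_lcapA, col_nil, List.nil_append, List.append_nil]
      have e2 : ∀ p, rho z c (dots [dn i] (up i) [] (f - g)) F [p, p] = z p ^ (f - g) * F [p, p] :=
        fun p => rho_dots z c [dn i] (up i) [] (f - g) F (xu := [p]) rfl p []
      simp only [e2, Finset.mul_sum]
      exact Finset.sum_congr rfl fun p _ => by ring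
    · simp
  rw [rho_add, LinearMap.add_apply, Pi.add_apply, rho_sub, LinearMap.sub_apply, Pi.sub_apply,
    rho_one, rho_mul, rho_sum]
  simp only [rho_sum, LinearMap.sum_apply, Finset.sum_apply, hterm, Module.End.one_apply]
  have hv' := hv
  simp at hv
  obtain ⟨hy, hx⟩ := hv
  by_cases hxy : x = y
  · subst hxy
    simp only [if_true]
    have hR : rho z c (crossL i i) (rho z c (crossR i i) F) [x, x] =
        ∑ p ∈ blk c (i.val + 1), (wtB z c i.val x * F [p, p] / wtA z c (i.val + 1) p) *
          ∑ q ∈ blk c i.val, (-1) ^ (blk c (i.val + 1)).card *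
            ((∏ t ∈ blk c (i.val + 1), (z q - z t)) /
              ((z q - z x) * (z q - z p) * ∏ u ∈ (blk c i.val).erase q, (z q - z u))) := by
      rw [rho_crossL_self hz i hy]
      simp only [Finset.mul_sum]
      rw [Finset.sum_comm]
      refine Finset.sum_congr rfl fun q hq => ?_
      rw [mem_blk] at hq
      rw [rho_crossR_self hz i hq, Finset.mul_sum, Finset.sum_div, Finset.mul_sum]
      refine Finset.sum_congr rfl fun p hp => ?_
      rw [← prod_blk_A z (show c q ≠ i.val + 1 by omega), prod_sub_comm, ← neg_sub (z q) (z x),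
        ← neg_sub (z q) (z p), wtB, wtB]
      simp only [div_eq_mul_inv, mul_inv, inv_neg]
      ring
    have hcc : ∀ p, cz (cwS z c i.val * geom (z p) * geom (z x)) (- glBar lam i - 1) =
        (-1) ^ (blk c (i.val + 1)).card *
          cz (eSer z (blk c (i.val + 1)) * hSer z (blk c i.val) * geom (z p) * geom (z x))
            ((blk c (i.val + 1)).card - (blk c i.val).card - 1) := by
      intro p; rw [← cz_C_mul, hbar, cwS, neg_sub]; congr 1; ring
    have hS : ∀ p ∈ blk c (i.val + 1), (wtB z c i.val x * F [p, p] / wtA z c (i.val + 1) p) *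
          ∑ q ∈ blk c i.val, (-1) ^ (blk c (i.val + 1)).card *
            ((∏ t ∈ blk c (i.val + 1), (z q - z t)) /
              ((z q - z x) * (z q - z p) * ∏ u ∈ (blk c i.val).erase q, (z q - z u))) =
        cz (cwS z c i.val * geom (z p) * geom (z x)) (- glBar lam i - 1) *
          ((∏ t ∈ blk c i.val, (z x - z t)) * F [p, p] / wtA z c (i.val + 1) p) +
          if p = x then F [x, x] else 0 := by
      intro p hp
      rw [mem_blk] at hp
      rw [← Finset.mul_sum, sum_double hz (by simp [hy]) (by simp [hp]) (by simp [hy])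
        (by simp [hp]), hcc, prod_blk_B z (by omega)]
      split_ifs with hpx
      · subst hpx
        have h1 := wtB_ne_zero hz c i.val p
        have h2 := wtA_ne_zero hz c (i.val + 1) p
        rw [prod_blk_B z (by omega), wtA_eq_of_mem z hp] at *
        have h4 := right_ne_zero_of_mul h2
        have h5 : ((-1 : K) ^ (blk c (i.val + 1)).card) ^ 2 = 1 := by rw [← pow_mul, mul_comm]; simp
        field_simp
        ring
      · ring
    rw [hR, Finset.sum_congr rfl hS, sum_cz_geom_geom, Finset.sum_add_distrib,
      Finset.sum_ite_eq' _ x, if_pos (by simp [hy])]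
    ring
  · rw [rho_crossL_ne hz i i hxy hv']
    rw [Function.update_of_ne hxy] at hx
    rw [rho_crossR_ne hz i i (Ne.symm hxy) (by simp [hx, hy, Ne.symm hxy])]
    simp [hxy]

end Sideways

section Ideal

variable {n d : ℕ} {K : Type} [Field K] [CharZero K] {z : Fin d → K} {c : Fin d → ℕ}

theorem Valid.one {a : Letter n} {ys : List (Fin d)} (h : Valid c [a] ys) :
    ∃ x, ys = [x] ∧ c x = Letter.old a := by
  obtain ⟨x, rfl⟩ := List.length_eq_one_iff.1 h.length_eq
  exact ⟨x, rfl, by simpa using h⟩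

theorem Valid.two {a b : Letter n} {ys : List (Fin d)} (h : Valid c [a, b] ys) :
    ∃ x y, ys = [x, y] := List.length_eq_two.1 h.length_eq

theorem Valid.up_up {i : Fin (n - 1)} {x y : Fin d} (h : Valid c [up i, up i] [x, y]) : x ≠ y := by
  rintro rfl
  simp [Letter.old, Letter.new] at h

theorem rho_rel (hz : Function.Injective z) {lam : Fin n → ℤ} {s t : SSeq n} {x : Alg n}
    (h : RelGL lam s t x) (hc : HasWt c lam) {ys : List (Fin d)} (hv : Valid c t ys)
    (F : List (Fin d) → K) : rho z c x F ys = 0 := by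
  have sub1 : ∀ {a : Alg n} {ys : List (Fin d)}, rho z c a F ys = F ys → rho z c (a - 1) F ys = 0 := by
    intro a ys h; rw [rho_sub, LinearMap.sub_apply, Pi.sub_apply, h, rho_one]; simp
  have subq : ∀ {a : Alg n} {q : ℚ}, rho z c a F [] = q • F [] →
      rho z c (a - algebraMap ℚ _ q) F [] = 0 := by
    intro a q h
    rw [rho_sub, LinearMap.sub_apply, Pi.sub_apply, h, rho_algebraMap]; simp
  cases h with
  | biadj1 i => obtain ⟨x, rfl, hx⟩ := hv.one; exact sub1 (rho_biadj1 hz i hx F)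
  | biadj2 i => obtain ⟨x, rfl, hx⟩ := hv.one; exact sub1 (rho_biadj2 hz i hx F)
  | biadj3 i => obtain ⟨x, rfl, hx⟩ := hv.one; exact sub1 (rho_biadj3 hz i hx F)
  | biadj4 i => obtain ⟨x, rfl, hx⟩ := hv.one; exact sub1 (rho_biadj4 hz i hx F)
  | cycDot1 i => obtain ⟨x, rfl, hx⟩ := hv.one; exact rho_cycDot1 hz i hx F
  | cycDot2 i => obtain ⟨x, rfl, hx⟩ := hv.one; exact rho_cycDot2 hz i hx F
  | cycCross1 i j => obtain ⟨x, y, rfl⟩ := hv.two; exact rho_cycCross1 hz i j hv F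
  | cycCross2 i j => obtain ⟨x, y, rfl⟩ := hv.two; exact rho_cycCross2 hz i j hv F
  | posCw i r h =>
    obtain rfl := valid_nil_iff.1 hv
    obtain ⟨_, _, hbar⟩ := hc.bar i
    rw [rho_cwReal hz, cz_of_neg _ (by omega), zero_mul]
  | posCc i r h =>
    obtain rfl := valid_nil_iff.1 hv
    obtain ⟨_, _, hbar⟩ := hc.bar i
    rw [rho_ccReal hz, cz_of_neg _ (by omega), zero_mul]
  | zeroCw i h =>
    obtain rfl := valid_nil_iff.1 hv
    obtain ⟨_, hb, hbar⟩ := hc.bar i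
    refine subq ?_
    rw [rho_cwReal hz, Int.toNat_of_nonneg (by omega), hbar, show ((blk c (i.val + 1)).card -
      (blk c i.val).card + ((blk c i.val).card - (blk c (i.val + 1)).card - 1) + 1 : ℤ) = (0 : ℕ) by
      push_cast; ring, cz_natCast, cwS, PowerSeries.coeff_C_mul, coeff_zero_eSer_mul_hSer, hb, sg_eq,
      Rat.smul_def]
    simp
  | zeroCc i h =>
    obtain rfl := valid_nil_iff.1 hv
    obtain ⟨_, hb, hbar⟩ := hc.bar i
    have hs : sg (en lam (i.val + 1) - 1) = -(-1) ^ (blk c (i.val + 1)).card := by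
      have hp : 0 < (blk c (i.val + 1)).card := by omega
      rw [hb, show ((blk c (i.val + 1)).card - 1 : ℤ) = ((blk c (i.val + 1)).card - 1 : ℕ) by omega,
        sg_eq]
      obtain ⟨k, hk⟩ := Nat.exists_eq_succ_of_ne_zero hp.ne'
      rw [hk]; simp [pow_succ]
    refine subq ?_
    rw [rho_ccReal hz, Int.toNat_of_nonneg (by omega), hbar, show ((blk c i.val).card -
      (blk c (i.val + 1)).card + (-((blk c i.val).card - (blk c (i.val + 1)).card) - 1) + 1 : ℤ) =
      (0 : ℕ) by push_cast; ring, cz_natCast, ccS, PowerSeries.coeff_C_mul, coeff_zero_eSer_mul_hSer,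
      hs, Rat.smul_def]
    simp
  | grass i m => obtain rfl := valid_nil_iff.1 hv; exact rho_grass hz hc i m F
  | curlR i => obtain ⟨x, rfl, hx⟩ := hv.one; exact rho_curlR hz hc i hx F
  | curlL i mu hmu => obtain ⟨x, rfl, hx⟩ := hv.one; exact rho_curlL hz hc i hmu hx F
  | decEF i => obtain ⟨x, y, rfl⟩ := hv.two; exact rho_decEF hz hc i hv F
  | decFE i => obtain ⟨x, y, rfl⟩ := hv.two; exact rho_decFE hz hc i hv F
  | nil i => obtain ⟨x, y, rfl⟩ := hv.two; exact rho_nil i F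
  | nilDot1 i => obtain ⟨x, y, rfl⟩ := hv.two; exact rho_nilDot1 hz i hv.up_up F
  | nilDot2 i => obtain ⟨x, y, rfl⟩ := hv.two; exact rho_nilDot2 hz i hv.up_up F
  | sideLR i j h => obtain ⟨x, y, rfl⟩ := hv.two; exact rho_sideLR hz i j h hv F
  | sideRL i j h => obtain ⟨x, y, rfl⟩ := hv.two; exact rho_sideRL hz i j h hv F
  | far i j h => obtain ⟨x, y, rfl⟩ := hv.two; exact rho_far i j h F
  | near i j h => obtain ⟨x, y, rfl⟩ := hv.two; exact rho_near i j h F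
  | slide1 i j h => obtain ⟨x, y, rfl⟩ := hv.two; exact rho_slide1 i j h F
  | slide2 i j h => obtain ⟨x, y, rfl⟩ := hv.two; exact rho_slide2 i j h F
  | triple i j k h =>
    obtain ⟨x, y, t, rfl⟩ := List.length_eq_three.1 hv.length_eq
    exact rho_triple hz i j k h hv F
  | tripleIJI i j h =>
    obtain ⟨x, y, t, rfl⟩ := List.length_eq_three.1 hv.length_eq
    exact rho_tripleIJI hz i j h hv F

theorem exchange_mem_dia {P : Pres n} (lam : P.W) (g : Gen n) (v : SSeq n) (g' : Gen n) :
    lay [] g (v ++ g'.src) * lay (g.tgt ++ v) g' [] -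
      lay (g.src ++ v) g' [] * lay [] g (v ++ g'.tgt) ∈
      P.dia lam (g.src ++ v ++ g'.src) (g.tgt ++ v ++ g'.tgt) := by
  have h1 := layer_mem_dia lam [] g (v ++ g'.src)
  have h2 := layer_mem_dia lam (g.tgt ++ v) g' []
  have h3 := layer_mem_dia lam (g.src ++ v) g' []
  have h4 := layer_mem_dia lam [] g (v ++ g'.tgt)
  simp only [List.nil_append, List.append_nil, ← List.append_assoc] at h1 h2 h3 h4
  exact sub_mem (mul_mem_dia h1 h2) (mul_mem_dia h3 h4)

theorem LocalRel.mem_dia {P : Pres n} {lam : P.W} {s t : SSeq n} {r : Alg n}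
    (h : LocalRel P lam s t r) : r ∈ P.dia lam s t := by
  cases h with
  | rel h hd => exact hd
  | exchange g v g' => exact exchange_mem_dia lam g v g'

theorem rho_ker (hz : Function.Injective z) {lam : Fin n → ℤ} {w w' : SSeq n} {x : Alg n}
    (hx : x ∈ (presS n d).ker lam w w') (hc : HasWt c lam) {ys : List (Fin d)} (hv : Valid c w' ys)
    (F : List (Fin d) → K) : rho z c x F ys = 0 := by
  induction hx using Submodule.span_induction with
  | mem x hx =>
    rcases hx with ⟨u, s, t, v, a, r, b, ha, hr, hb, rfl⟩ | ⟨y, a, b, ⟨u, v, rfl, hy⟩, ha, hb, rfl⟩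
    · rw [rho_mul, rho_mul]
      refine (rho_congr z (a := 0) (F' := fun _ => 0) hb hv fun l hl _ => ?_).trans (zero_mul _)
      rw [List.append_assoc] at hl
      obtain ⟨xu, l, rfl, hxu, hl, hu⟩ := hl.split
      obtain ⟨ys, xv, rfl, hys, hv, hy⟩ := hl.split
      rw [rho_whisk z hr.mem_dia hxu hys hv.length_eq, zero_mul]
      have hw := hc.col (D := d) hv
      cases hr with
      | rel h hd => exact rho_rel hz h hw hy _
      | exchange g v g' => exact rho_exchange g v g' _ hy
    · rw [rho_mul]
      refine (rho_congr z (a := 0) (F' := fun _ => 0) hb hv fun l hl _ => ?_).trans (zero_mul _)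
      obtain ⟨xu, l, rfl, hxu, hl, hu⟩ := hl.split
      exact (hy (hc.col (D := d) hl).good).elim
  | zero => simp
  | add x y _ _ h1 h2 => rw [rho_add, LinearMap.add_apply, Pi.add_apply, h1, h2, add_zero]
  | smul q x _ h => rw [rho_smul, LinearMap.smul_apply, Pi.smul_apply, h, smul_zero]

end Ideal
end Schur


namespace Schur

open CategoryTheory MvPolynomial

section Standard

variable {n d : ℕ}

/-! ### Standard colourings -/

theorem kk_zero (lam : Fin n → ℤ) : kk lam 0 = 0 := by simp [kk]

theorem kk_succ (lam : Fin n → ℤ) (i : ℕ) : kk lam (i + 1) = kk lam i + en lam i := by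
  have h : en lam i = ∑ l : Fin n, if l.val = i then lam l else 0 := by
    unfold en
    split_ifs with hi
    · rw [Finset.sum_eq_single ⟨i, hi⟩]
      · simp
      · intro l _ hl; rw [if_neg]; intro e; exact hl (Fin.ext e)
      · simp
    · rw [Finset.sum_eq_zero]; intro l _; rw [if_neg]; intro e; exact hi (e ▸ l.isLt)
  rw [h, kk, kk, ← Finset.sum_add_distrib]
  exact Finset.sum_congr rfl fun l _ => by split_ifs <;> first | omega | simp

theorem kk_add (lam mu : Fin n → ℤ) (i : ℕ) : kk (lam + mu) i = kk lam i + kk mu i := by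
  rw [kk, kk, kk, ← Finset.sum_add_distrib]
  exact Finset.sum_congr rfl fun l _ => by split_ifs <;> simp

theorem en_nonneg {lam : Fin n → ℤ} (h : Good d lam) (i : ℕ) : 0 ≤ en lam i := by
  unfold en; split_ifs
  · exact h.1 _
  · exact le_rfl

theorem kk_mono {lam : Fin n → ℤ} (h : Good d lam) {i j : ℕ} (hij : i ≤ j) : kk lam i ≤ kk lam j := by
  induction j, hij using Nat.le_induction with
  | base => exact le_rfl
  | succ j _ ih => rw [kk_succ]; have := en_nonneg h j; omega

theorem kk_of_le {lam : Fin n → ℤ} (h : Good d lam) {i : ℕ} (hi : n ≤ i) : kk lam i = d := by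
  rw [← h.2, kk]
  exact Finset.sum_congr rfl fun l _ => if_pos (l.isLt.trans_le hi)

theorem kk_le {lam : Fin n → ℤ} (h : Good d lam) (i : ℕ) : kk lam i ≤ d := by
  rcases le_total i n with hi | hi
  · rw [← kk_of_le h le_rfl]; exact kk_mono h hi
  · rw [kk_of_le h hi]

theorem kk_nonneg {lam : Fin n → ℤ} (h : Good d lam) (i : ℕ) : 0 ≤ kk lam i := by
  rw [← kk_zero lam]; exact kk_mono h (Nat.zero_le i)

/-- The colouring by blocks. -/
noncomputable def std (lam : Fin n → ℤ) (j : Fin d) : ℕ := sInf {i | (j.val : ℤ) < kk lam (i + 1)}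

theorem std_lt {lam : Fin n → ℤ} (h : Good d lam) (j : Fin d) (i : ℕ) :
    std lam j < i ↔ (j.val : ℤ) < kk lam i := by
  constructor
  · intro hi
    have hne : {i | (j.val : ℤ) < kk lam (i + 1)}.Nonempty :=
      ⟨n, by rw [Set.mem_setOf_eq, kk_of_le h (by omega)]; exact_mod_cast j.isLt⟩
    exact lt_of_lt_of_le (Nat.sInf_mem hne) (kk_mono h hi)
  · intro hi
    cases i with
    | zero => rw [kk_zero] at hi; omega
    | succ i => exact Nat.lt_succ_of_le (Nat.sInf_le hi)

theorem std_eq {lam : Fin n → ℤ} (h : Good d lam) (j : Fin d) (i : ℕ) :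
    std lam j = i ↔ kk lam i ≤ j.val ∧ (j.val : ℤ) < kk lam (i + 1) := by
  have h1 := std_lt h j i
  have h2 := std_lt h j (i + 1)
  omega

theorem young_iff {lam : Fin n → ℤ} (h : Good d lam) (σ : Equiv.Perm (Fin d)) :
    Young d lam σ ↔ std lam ∘ σ = std lam := by
  constructor
  · intro hs
    funext j
    have : ∀ i, std lam (σ j) < i ↔ std lam j < i := fun i => by rw [std_lt h, std_lt h, hs i j]
    have h1 := this (std lam j)
    have h2 := this (std lam (σ j))
    simp only [Function.comp_apply]; omega
  · intro hs i j
    rw [← std_lt h, ← std_lt h, show std lam (σ j) = std lam j from congrFun hs j]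

theorem card_Ico_fin {a b : ℤ} (ha : 0 ≤ a) (hab : a ≤ b) (hb : b ≤ d) :
    ((Finset.univ.filter fun j : Fin d => a ≤ (j.val : ℤ) ∧ (j.val : ℤ) < b).card : ℤ) = b - a := by
  have : (Finset.univ.filter fun j : Fin d => a ≤ (j.val : ℤ) ∧ (j.val : ℤ) < b).card =
      (Finset.Ico a.toNat b.toNat).card := by
    refine Finset.card_bij (fun j _ => j.val) ?_ ?_ ?_
    · intro j hj; simp at hj ⊢; omega
    · intro j _ j' _ h; exact Fin.ext h
    · intro k hk
      simp at hk
      exact ⟨⟨k, by omega⟩, by simp; omega, rfl⟩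
  rw [this, Nat.card_Ico]; omega

theorem std_hasWt {lam : Fin n → ℤ} (h : Good d lam) : HasWt (std (d := d) lam) lam := by
  refine ⟨fun j => ?_, fun i => ?_⟩
  · rw [std_lt h, kk_of_le h le_rfl]; exact_mod_cast j.isLt
  · have : blk (std (d := d) lam) i.val =
        Finset.univ.filter fun j : Fin d => kk lam i.val ≤ (j.val : ℤ) ∧ (j.val : ℤ) < kk lam (i.val + 1) := by
      ext j; rw [mem_blk, std_eq h]; simp
    rw [this, card_Ico_fin (kk_nonneg h _) (kk_mono h (by omega)) (kk_le h _), kk_succ, en,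
      dif_pos i.isLt]
    ring

theorem exists_perm_comp {c c' : Fin d → ℕ} (h : ∀ i, (blk c i).card = (blk c' i).card) :
    ∃ σ : Equiv.Perm (Fin d), c ∘ σ = c' := by
  have e : ∀ i, Nonempty ({t // c' t = i} ≃ {t // c t = i}) := by
    intro i
    refine ⟨Fintype.equivOfCardEq ?_⟩
    rw [Fintype.card_subtype, Fintype.card_subtype]; exact (h i).symm
  replace e := fun i => Classical.choice (e i)
  refine ⟨(Equiv.sigmaFiberEquiv c').symm.trans ((Equiv.sigmaCongrRight e).trans
    (Equiv.sigmaFiberEquiv c)), ?_⟩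
  funext j
  exact (e (c' j) ⟨j, rfl⟩).2

theorem HasWt.exists_perm {c : Fin d → ℕ} {lam : Fin n → ℤ} (hc : HasWt c lam) :
    ∃ σ : Equiv.Perm (Fin d), c ∘ σ = std lam := by
  have h := std_hasWt hc.good
  refine exists_perm_comp fun i => ?_
  by_cases hi : i < n
  · have := (hc.2 ⟨i, hi⟩).symm.trans (h.2 ⟨i, hi⟩); exact_mod_cast this
  · have e : ∀ c : Fin d → ℕ, (∀ t, c t < n) → blk c i = ∅ := by
      intro c hc; ext t; simp; have := hc t; omega
    rw [e c hc.1, e _ h.1]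

/-- The position of the thin edge of a letter. -/
def thin (lam : Fin n → ℤ) : Letter n → ℤ
  | (true, i) => kk lam (i.val + 1)
  | (false, i) => kk lam (i.val + 1) - 1

theorem lv_eq (lam : Fin n → ℤ) (a : Letter n) : lv (d := d) lam a = zv (thin lam a) := by
  obtain ⟨b, i⟩ := a; cases b <;> rfl

theorem zv_eq (τ : Fin d) : zv (d := d) τ.val = X τ := by
  rw [zv, Finset.sum_eq_single τ]
  · simp
  · intro t _ ht; rw [if_neg]; intro h; exact ht (Fin.ext (by exact_mod_cast h))
  · simp

theorem kk_root (i : Fin (n - 1)) (m : ℕ) : kk (glRoot i) m = if m = i.val + 1 then 1 else 0 := by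
  have hi := i.isLt
  have e : ∀ m, en (glRoot i) m = if m = i.val then 1 else if m = i.val + 1 then -1 else 0 := by
    intro m; unfold en glRoot
    split_ifs <;> first | rfl | omega
  induction m with
  | zero => rw [kk_zero, if_neg (by omega)]
  | succ m ih => rw [kk_succ, ih, e]; split_ifs <;> omega

theorem wt_letter (D : ℕ) (b : Bool) (i : Fin (n - 1)) :
    (presS n D).wt [(b, i)] = if b then glRoot i else - glRoot i := by
  change (if b then glRoot i else - glRoot i) + 0 = _
  rw [add_zero]

theorem kk_neg (lam : Fin n → ℤ) (m : ℕ) : kk (-lam) m = - kk lam m := by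
  have := kk_add lam (-lam) m
  rw [add_neg_cancel] at this
  have h0 : kk (0 : Fin n → ℤ) m = 0 := by simp [kk]
  omega

theorem kk_letter (D : ℕ) (lam : Fin n → ℤ) (b : Bool) (i : Fin (n - 1)) (m : ℕ) :
    kk (lam + (presS n D).wt [(b, i)]) m =
      kk lam m + if m = i.val + 1 then (if b then 1 else -1) else 0 := by
  rw [kk_add, wt_letter]
  cases b
  · simp only [Bool.false_eq_true, if_false, kk_neg, kk_root]; split_ifs <;> simp
  · simp only [if_true, kk_root]

theorem eq_of_lt_iff {a b : ℕ} (h : ∀ m, a < m ↔ b < m) : a = b := by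
  have h1 := h a; have h2 := h b; omega

/-- The index of the thin edge, and the standard colouring on its other side. -/
theorem exists_thin (D : ℕ) {lam : Fin n → ℤ} (a : Letter n) (h : Good d lam)
    (h' : Good d (lam + (presS n D).wt [a])) :
    ∃ τ : Fin d, (τ.val : ℤ) = thin lam a ∧ std lam τ = Letter.old a ∧
      std (lam + (presS n D).wt [a]) = Function.update (std lam) τ (Letter.new a) := by
  obtain ⟨b, i⟩ := a
  have hi := i.isLt
  have hk := kk_letter D lam b i
  have s1 := kk_succ lam i.val
  have s2 := kk_succ lam (i.val + 1)
  cases b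
  · simp only [Bool.false_eq_true, if_false] at hk
    have p1 : kk lam i.val ≤ kk lam (i.val + 1) - 1 := by
      have := kk_mono h' (show i.val ≤ i.val + 1 by omega)
      rw [hk, hk] at this; simp at this; omega
    have p2 := kk_nonneg h i.val
    have p3 := kk_le h (i.val + 1)
    have hτ : (kk lam (i.val + 1) - 1).toNat < d := by omega
    refine ⟨⟨_, hτ⟩, ?_, ?_, ?_⟩
    · simp [thin]; omega
    · rw [std_eq h]; simp [Letter.old]; omega
    · funext j
      refine eq_of_lt_iff fun m => ?_
      rw [std_lt h', hk]
      by_cases hj : j = ⟨_, hτ⟩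
      · subst hj
        rw [Function.update_self]
        simp only [Letter.new]
        rw [Int.toNat_of_nonneg (by omega)]
        rcases lt_trichotomy m (i.val + 1) with hm | hm | hm
        · have := kk_mono h (show m ≤ i.val by omega)
          rw [if_neg (by omega)]; omega
        · subst hm; simp
        · have := kk_mono h (show i.val + 1 ≤ m by omega)
          rw [if_neg (by omega)]; omega
      · have hj' : (j.val : ℤ) ≠ kk lam (i.val + 1) - 1 := by
          intro e; apply hj; apply Fin.ext; simp; omega
        rw [Function.update_of_ne hj, std_lt h]
        split_ifs with hm
        · subst hm; omega
        · simp
  · simp only [if_true] at hk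
    have p1 : kk lam (i.val + 1) + 1 ≤ kk lam (i.val + 1 + 1) := by
      have := kk_mono h' (show i.val + 1 ≤ i.val + 1 + 1 by omega)
      rw [hk, hk] at this; simp at this; omega
    have p2 := kk_nonneg h (i.val + 1)
    have p3 := kk_le h (i.val + 1 + 1)
    have hτ : (kk lam (i.val + 1)).toNat < d := by omega
    refine ⟨⟨_, hτ⟩, ?_, ?_, ?_⟩
    · simp [thin]; omega
    · rw [std_eq h]; simp [Letter.old]; omega
    · funext j
      refine eq_of_lt_iff fun m => ?_
      rw [std_lt h', hk]
      by_cases hj : j = ⟨_, hτ⟩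
      · subst hj
        rw [Function.update_self]
        simp only [Letter.new]
        rw [Int.toNat_of_nonneg (by omega)]
        rcases lt_trichotomy m (i.val + 1) with hm | hm | hm
        · have := kk_mono h (show m ≤ i.val + 1 by omega)
          rw [if_neg (by omega)]; omega
        · subst hm; simp
        · have := kk_mono h (show i.val + 1 + 1 ≤ m by omega)
          rw [if_neg (by omega)]; omega
      · have hj' : (j.val : ℤ) ≠ kk lam (i.val + 1) := by
          intro e; apply hj; apply Fin.ext; simp; omega
        rw [Function.update_of_ne hj, std_lt h]
        split_ifs with hm
        · subst hm; omega
        · simp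

end Standard
end Schur


namespace Schur

open CategoryTheory MvPolynomial

/-! ### Values of partially symmetric polynomials at colourings -/

section Value

variable {n d : ℕ} {K : Type} [Field K] [CharZero K]

noncomputable section

open scoped Classical in
/-- The value of a polynomial at a permutation of the variables with property `S`. -/
def pv (z : Fin d → K) (S : Equiv.Perm (Fin d) → Prop) : Poly d →ₗ[ℚ] K :=
  if h : ∃ σ, S σ then (aeval (z ∘ h.choose) : Poly d →ₐ[ℚ] K).toLinearMap else 0

theorem aeval_comp_mul (z : Fin d → K) (σ ρ : Equiv.Perm (Fin d)) (p : Poly d) :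
    aeval (z ∘ ⇑(σ * ρ)) p = aeval (z ∘ σ) (rename ρ p) := by
  rw [aeval_rename]; rfl

theorem pv_eq {z : Fin d → K} {S : Equiv.Perm (Fin d) → Prop} {p : Poly d} {σ : Equiv.Perm (Fin d)}
    (hσ : S σ) (h : ∀ σ', S σ' → rename ⇑(σ⁻¹ * σ') p = p) : pv z S p = aeval (z ∘ σ) p := by
  have hS : ∃ σ, S σ := ⟨σ, hσ⟩
  rw [pv, dif_pos hS]
  have := aeval_comp_mul z σ (σ⁻¹ * hS.choose) p
  rw [mul_inv_cancel_left, h _ hS.choose_spec] at this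
  exact this

open scoped Classical in
/-- The polynomial underlying an invariant. -/
def pol {P : Prop} {G : Equiv.Perm (Fin d) → Prop} : InvSub d P G →ₗ[ℚ] Poly d :=
  if h : P then LinearMap.proj ⟨h⟩ ∘ₗ (InvSub d P G).val.toLinearMap else 0

theorem pol_of {P : Prop} {G : Equiv.Perm (Fin d) → Prop} (f : InvSub d P G) (h : P) :
    pol f = f.1 ⟨h⟩ := by rw [pol, dif_pos h]; rfl

theorem pol_not {P : Prop} {G : Equiv.Perm (Fin d) → Prop} (f : InvSub d P G) (h : ¬ P) :
    pol f = 0 := by rw [pol, dif_neg h]; rfl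

theorem pol_mul {P : Prop} {G : Equiv.Perm (Fin d) → Prop} (f g : InvSub d P G) :
    pol (f * g) = pol f * pol g := by
  by_cases h : P
  · rw [pol_of _ h, pol_of _ h, pol_of _ h]; rfl
  · rw [pol_not _ h, pol_not _ h, zero_mul]

theorem pol_inv {P : Prop} {G : Equiv.Perm (Fin d) → Prop} (f : InvSub d P G)
    {σ : Equiv.Perm (Fin d)} (h : P → G σ) : rename σ (pol f) = pol f := by
  by_cases hP : P
  · rw [pol_of _ hP]; exact f.2 _ σ (h hP)
  · rw [pol_not _ hP, map_zero]

theorem pol_ext {P : Prop} {G : Equiv.Perm (Fin d) → Prop} {f g : InvSub d P G}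
    (h : P → pol f = pol g) : f = g := by
  refine Subtype.ext (funext fun hP => ?_)
  have := h hP.down
  rwa [pol_of _ hP.down, pol_of _ hP.down] at this

theorem toP_eq {lam mu : Fin n → ℤ} (b : bimB d lam mu) :
    toP b = pol (show InvSub d (Good d lam ∧ Good d mu) (fun σ => Young d lam σ ∧ Young d mu σ) from b) := by
  unfold toP
  split_ifs with h
  · rw [pol_of _ h]
  · rw [pol_not _ h]

/-- The linear map `toP`. -/
def toPL (lam mu : Fin n → ℤ) : bimB d lam mu →ₗ[ℚ] Poly d :=
  (pol : InvSub d (Good d lam ∧ Good d mu) (fun σ => Young d lam σ ∧ Young d mu σ) →ₗ[ℚ] Poly d)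

theorem toPL_eq {lam mu : Fin n → ℤ} (b : bimB d lam mu) : toPL lam mu b = toP b := (toP_eq b).symm

/-- The polynomial underlying an element of the ring of an object. -/
def polR (lam : Fin n → ℤ) : ringR d lam →ₗ[ℚ] Poly d :=
  (pol : InvSub d (Good d lam) (Young d lam) →ₗ[ℚ] Poly d)

/-- The value of an element of the ring of an object at a colouring. -/
def rv (z : Fin d → K) (c : Fin d → ℕ) (lam : Fin n → ℤ) : ringR d lam →ₗ[ℚ] K :=
  pv z (fun σ => c ∘ σ = std lam) ∘ₗ polR lam

/-- The value of an element of a bimodule at a pair of colourings. -/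
def bv (z : Fin d → K) (c c' : Fin d → ℕ) (lam mu : Fin n → ℤ) : bimB d lam mu →ₗ[ℚ] K :=
  pv z (fun σ => c ∘ σ = std lam ∧ c' ∘ σ = std mu) ∘ₗ toPL lam mu

theorem std_comp_inv_mul {lam : Fin n → ℤ} {c : Fin d → ℕ} {σ σ' : Equiv.Perm (Fin d)}
    (h : c ∘ σ = std lam) (h' : c ∘ σ' = std lam) : std lam ∘ ⇑(σ⁻¹ * σ') = std lam := by
  conv_lhs => rw [← h]
  rw [← h']
  funext j; simp

variable {z : Fin d → K} {c c' : Fin d → ℕ} {lam mu : Fin n → ℤ} {σ : Equiv.Perm (Fin d)}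

theorem rv_eq (h : c ∘ σ = std lam) (r : ringR d lam) : rv z c lam r = aeval (z ∘ σ) (polR lam r) :=
  pv_eq h fun _ h' => pol_inv _ fun hl => (young_iff hl _).2 (std_comp_inv_mul h h')

theorem bv_eq (h : c ∘ σ = std lam) (h' : c' ∘ σ = std mu) (b : bimB d lam mu) :
    bv z c c' lam mu b = aeval (z ∘ σ) (toP b) := by
  rw [← toPL_eq]
  exact pv_eq (S := fun σ => c ∘ σ = std lam ∧ c' ∘ σ = std mu) ⟨h, h'⟩ fun _ hs => pol_inv _ fun hl =>
    ⟨(young_iff hl.1 _).2 (std_comp_inv_mul h hs.1), (young_iff hl.2 _).2 (std_comp_inv_mul h' hs.2)⟩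

theorem bv_none (h : ¬ ∃ σ : Equiv.Perm (Fin d), c ∘ σ = std lam ∧ c' ∘ σ = std mu)
    (b : bimB d lam mu) : bv z c c' lam mu b = 0 := by
  rw [bv, pv, dif_neg h]; rfl

theorem toP_l (r : ringR d mu) (b : bimB d lam mu) :
    toP ((bimB d lam mu).l r b) = polR mu r * toP b := by
  rw [toP_eq, toP_eq]
  refine (pol_mul _ _).trans ?_
  by_cases h : Good d lam ∧ Good d mu
  · congr 1
    exact (pol_of _ h).trans (pol_of (P := Good d mu) _ h.2).symm
  · rw [pol_not b h, mul_zero, mul_zero]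

theorem toP_r (r : ringR d lam) (b : bimB d lam mu) :
    toP ((bimB d lam mu).r r b) = polR lam r * toP b := by
  rw [toP_eq, toP_eq]
  refine (pol_mul _ _).trans ?_
  by_cases h : Good d lam ∧ Good d mu
  · congr 1
    exact (pol_of _ h).trans (pol_of (P := Good d lam) _ h.1).symm
  · rw [pol_not b h, mul_zero, mul_zero]

theorem bv_l (r : ringR d mu) (b : bimB d lam mu) :
    bv z c c' lam mu ((bimB d lam mu).l r b) = rv z c' mu r * bv z c c' lam mu b := by
  by_cases h : ∃ σ : Equiv.Perm (Fin d), c ∘ σ = std lam ∧ c' ∘ σ = std mu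
  · obtain ⟨σ, h1, h2⟩ := h
    rw [bv_eq h1 h2, bv_eq h1 h2, rv_eq h2, toP_l, map_mul]
  · rw [bv_none h, bv_none h, mul_zero]

theorem bv_r (r : ringR d lam) (b : bimB d lam mu) :
    bv z c c' lam mu ((bimB d lam mu).r r b) = rv z c lam r * bv z c c' lam mu b := by
  by_cases h : ∃ σ : Equiv.Perm (Fin d), c ∘ σ = std lam ∧ c' ∘ σ = std mu
  · obtain ⟨σ, h1, h2⟩ := h
    rw [bv_eq h1 h2, bv_eq h1 h2, rv_eq h1, toP_r, map_mul]
  · rw [bv_none h, bv_none h, mul_zero]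

theorem toP_ofB {p : Poly d} (h1 : Good d lam) (h2 : Good d mu)
    (hp : ∀ ρ : Equiv.Perm (Fin d), std lam ∘ ρ = std lam → std mu ∘ ρ = std mu → rename ρ p = p) :
    toP (ofB (lam := lam) (mu := mu) p) = p := by
  have h : ∀ σ, Young d lam σ ∧ Young d mu σ → rename σ p = p := fun σ hσ =>
    hp σ ((young_iff h1 σ).1 hσ.1) ((young_iff h2 σ).1 hσ.2)
  have e : ofB (lam := lam) (mu := mu) p = (⟨fun _ => p, fun _ σ hσ => h σ hσ⟩ : InvSub d _ _) :=
    dif_pos h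
  rw [toP_eq]
  exact (congrArg (toPL lam mu) e).trans (pol_of _ ⟨h1, h2⟩)

theorem polR_ofR {p : Poly d} (h1 : Good d lam)
    (hp : ∀ ρ : Equiv.Perm (Fin d), std lam ∘ ρ = std lam → rename ρ p = p) :
    polR lam (ofR p) = p := by
  have h : ∀ σ, Young d lam σ → rename σ p = p := fun σ hσ => hp σ ((young_iff h1 σ).1 hσ)
  have e : ofR (lam := lam) p = (⟨fun _ => p, fun _ σ hσ => h σ hσ⟩ : InvSub d _ _) := dif_pos h
  exact (congrArg (polR lam) e).trans (pol_of _ h1)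

theorem toP_ext {b b' : bimB d lam mu} (h : toP b = toP b') : b = b' := by
  rw [toP_eq, toP_eq] at h
  exact pol_ext fun _ => h

theorem toP_inv {ρ : Equiv.Perm (Fin d)} (b : bimB d lam mu) (h1 : std lam ∘ ρ = std lam)
    (h2 : std mu ∘ ρ = std mu) : rename ρ (toP b) = toP b := by
  rw [toP_eq]
  exact pol_inv _ fun h => ⟨(young_iff h.1 ρ).2 h1, (young_iff h.2 ρ).2 h2⟩

theorem toP_not (h : ¬ (Good d lam ∧ Good d mu)) (b : bimB d lam mu) : b = 0 :=
  pol_ext (P := Good d lam ∧ Good d mu) fun h' => (h h').elim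

end

end Value

/-! ### Divided differences -/

section Divided

theorem dvd_sub_rename_swap {σ : Type} [DecidableEq σ] (x y : σ) (p : MvPolynomial σ ℚ) :
    (X x - X y) ∣ p - rename (Equiv.swap x y) p := by
  induction p using MvPolynomial.induction_on with
  | C a => simp
  | add p q hp hq =>
    rw [map_add, show p + q - (rename (Equiv.swap x y) p + rename (Equiv.swap x y) q) =
      (p - rename (Equiv.swap x y) p) + (q - rename (Equiv.swap x y) q) by ring]
    exact dvd_add hp hq
  | mul_X p j hp =>
    rw [map_mul, rename_X, show p * X j - rename (Equiv.swap x y) p * X (Equiv.swap x y j) =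
      (p - rename (Equiv.swap x y) p) * X j +
        rename (Equiv.swap x y) p * (X j - X (Equiv.swap x y j)) by ring]
    refine dvd_add (hp.mul_right _) (Dvd.dvd.mul_left ?_ _)
    rcases eq_or_ne j x with rfl | hx
    · simp
    rcases eq_or_ne j y with rfl | hy
    · simp only [Equiv.swap_apply_right]; exact ⟨-1, by ring⟩
    · simp [Equiv.swap_apply_of_ne_of_ne hx hy]

theorem dd_mul {σ : Type} [DecidableEq σ] (x y : σ) (p : MvPolynomial σ ℚ) :
    dd x y p * (X x - X y) = p - rename (Equiv.swap x y) p := by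
  have h : ∃ q, q * (X x - X y) = p - rename (Equiv.swap x y) p := by
    obtain ⟨q, hq⟩ := dvd_sub_rename_swap x y p
    exact ⟨q, by rw [hq, mul_comm]⟩
  rw [dd, dif_pos h]; exact h.choose_spec

variable {n d : ℕ} {K : Type} [Field K] [CharZero K]

theorem aeval_dd {σ : Type} [DecidableEq σ] (z : σ → K) {x y : σ} (h : z x ≠ z y)
    (p : MvPolynomial σ ℚ) :
    aeval z (dd x y p) = (aeval z p - aeval (z ∘ Equiv.swap x y) p) / (z x - z y) := by
  rw [eq_div_iff (sub_ne_zero.2 h)]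
  have := congrArg (aeval z) (dd_mul x y p)
  simpa [aeval_rename] using this

/-- The values of an iterated divided difference. -/
theorem aeval_foldr_dd (e : K) (he : e = 1 ∨ e = -1) (D : Fin d → Poly d → Poly d) (x : Fin d)
    (hD : ∀ (z : Fin d → K) u q, Function.Injective z → x ≠ u →
      aeval z (D u q) = (aeval z q - aeval (z ∘ Equiv.swap x u) q) / (e * (z x - z u)))
    (p : Poly d) : ∀ us : List (Fin d), us.Nodup → x ∉ us →
    (∀ u ∈ us, ∀ u' ∈ us, rename (Equiv.swap u u') p = p) →
    ∀ z : Fin d → K, Function.Injective z → aeval z (us.foldr D p) =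
      ∑ y ∈ insert x us.toFinset, aeval (z ∘ Equiv.swap x y) p /
        ∏ u ∈ (insert x us.toFinset).erase y, (e * (z y - z u)) := by
  have he0 : e ≠ 0 := by rcases he with rfl | rfl <;> simp
  intro us
  induction us with
  | nil => intro _ _ _ z hz; simp
  | cons u us ih =>
    intro hn hx hp z hz
    rw [List.nodup_cons] at hn
    rw [List.mem_cons, not_or] at hx
    have ih' := ih hn.2 hx.2 fun a ha b hb => hp a (by simp [ha]) b (by simp [hb])
    set S := us.toFinset with hS
    have hxS : x ∉ S := by simpa [hS] using hx.2
    have huS : u ∉ S := by simpa [hS] using hn.1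
    have hxu : z x - z u ≠ 0 := sub_ne_zero.2 (hz.ne hx.1)
    rw [List.foldr_cons, hD z u _ hz hx.1, ih' z hz,
      ih' (z ∘ Equiv.swap x u) (hz.comp (Equiv.injective _)), List.toFinset_cons, ← hS,
      Finset.sum_insert hxS, Finset.sum_insert hxS, Finset.insert_comm,
      Finset.sum_insert (by simp [huS, Ne.symm hx.1]), Finset.sum_insert hxS]
    have e1 : (insert x S).erase x = S := Finset.erase_insert hxS
    have e2 : (insert u (insert x S)).erase u = insert x S :=
      Finset.erase_insert (by simp [huS, Ne.symm hx.1])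
    have e3 : (insert u (insert x S)).erase x = insert u S := by
      rw [Finset.insert_comm]; exact Finset.erase_insert (by simp [hxS, hx.1])
    have e4 : ∀ y ∈ S, y ≠ x ∧ y ≠ u := fun y hy =>
      ⟨fun h => hxS (h ▸ hy), fun h => huS (h ▸ hy)⟩
    have e5 : ∀ y ∈ S, (insert x S).erase y = insert x (S.erase y) := fun y hy =>
      Finset.erase_insert_of_ne (e4 y hy).1.symm
    have e6 : ∀ y ∈ S, (insert u (insert x S)).erase y = insert u (insert x (S.erase y)) :=
      fun y hy => by
        rw [Finset.erase_insert_of_ne (e4 y hy).2.symm, e5 y hy]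
    have p1 : ∏ v ∈ S, (e * ((z ∘ Equiv.swap x u) x - (z ∘ Equiv.swap x u) v)) =
        ∏ v ∈ S, (e * (z u - z v)) := Finset.prod_congr rfl fun v hv => by
      simp [Equiv.swap_apply_of_ne_of_ne (e4 v hv).1 (e4 v hv).2]
    rw [e1, e2, e3, p1, Finset.prod_insert huS, Finset.prod_insert hxS, Equiv.swap_self]
    have hs : ∀ y ∈ S, aeval ((z ∘ Equiv.swap x u) ∘ Equiv.swap x y) p /
          ∏ v ∈ (insert x S).erase y, (e * ((z ∘ Equiv.swap x u) y - (z ∘ Equiv.swap x u) v)) =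
        aeval (z ∘ Equiv.swap x y) p / ((e * (z y - z u)) * ∏ v ∈ S.erase y, (e * (z y - z v))) := by
      intro y hy
      obtain ⟨h1, h2⟩ := e4 y hy
      have hy' : y ∈ us := by simpa [hS] using hy
      congr 1
      · have h3 : (z ∘ Equiv.swap x u) ∘ Equiv.swap x y = z ∘ ⇑(Equiv.swap x y * Equiv.swap y u) := by
          funext t
          simp only [Function.comp_apply, Equiv.Perm.mul_apply]
          congr 1
          have := hx.1
          simp only [Equiv.swap_apply_def]
          split_ifs <;> simp_all
        rw [h3, aeval_comp_mul, hp y (by simp [hy']) u (by simp)]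
      · rw [e5 y hy, Finset.prod_insert (by simp [hxS])]
        congr 1
        · simp [Equiv.swap_apply_of_ne_of_ne h1 h2]
        · refine Finset.prod_congr rfl fun v hv => ?_
          have hv' := e4 v (Finset.mem_of_mem_erase hv)
          simp [Equiv.swap_apply_of_ne_of_ne h1 h2, Equiv.swap_apply_of_ne_of_ne hv'.1 hv'.2]
    rw [Finset.sum_congr rfl hs]
    have hs2 : ∀ y ∈ S, aeval (z ∘ Equiv.swap x y) p /
          ∏ v ∈ (insert u (insert x S)).erase y, (e * (z y - z v)) =
        (aeval (z ∘ Equiv.swap x y) p / ∏ v ∈ (insert x S).erase y, (e * (z y - z v)) -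
          aeval (z ∘ Equiv.swap x y) p / ((e * (z y - z u)) * ∏ v ∈ S.erase y, (e * (z y - z v)))) /
            (e * (z x - z u)) := by
      intro y hy
      obtain ⟨h1, h2⟩ := e4 y hy
      have g1 : z y - z x ≠ 0 := sub_ne_zero.2 (hz.ne h1)
      have g2 : z y - z u ≠ 0 := sub_ne_zero.2 (hz.ne h2)
      have g3 : ∏ v ∈ S.erase y, (e * (z y - z v)) ≠ 0 := by
        refine Finset.prod_ne_zero_iff.2 fun v hv => mul_ne_zero he0 (sub_ne_zero.2 (hz.ne ?_))
        exact (Finset.ne_of_mem_erase hv).symm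
      rw [e6 y hy, e5 y hy, Finset.prod_insert (by simp [huS, Ne.symm hx.1]),
        Finset.prod_insert (by simp [hxS])]
      field_simp
      ring
    rw [Finset.sum_congr rfl hs2, ← Finset.sum_div, Finset.sum_sub_distrib]
    have g4 : ∏ v ∈ S, (e * (z u - z v)) ≠ 0 :=
      Finset.prod_ne_zero_iff.2 fun v hv => mul_ne_zero he0 (sub_ne_zero.2 (hz.ne (e4 v hv).2.symm))
    have g5 : ∏ v ∈ S, (e * (z x - z v)) ≠ 0 :=
      Finset.prod_ne_zero_iff.2 fun v hv => mul_ne_zero he0 (sub_ne_zero.2 (hz.ne (e4 v hv).1.symm))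
    have g6 : z u - z x ≠ 0 := sub_ne_zero.2 (hz.ne (Ne.symm hx.1))
    have g7 : aeval (z ∘ Equiv.swap x u) p / (e * (z u - z x) * ∏ v ∈ S, (e * (z u - z v))) =
        - (aeval (z ∘ Equiv.swap x u) p / ∏ v ∈ S, (e * (z u - z v))) / (e * (z x - z u)) := by
      rw [show z x - z u = - (z u - z x) by ring]; field_simp
    have g8 : (z ∘ Equiv.swap x u) ∘ ⇑(Equiv.refl (Fin d)) = z ∘ Equiv.swap x u := rfl
    rw [g7, g8]
    generalize ∑ y ∈ S, aeval (z ∘ Equiv.swap x y) p / ∏ v ∈ (insert x S).erase y, (e * (z y - z v)) = A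
    generalize ∑ y ∈ S, aeval (z ∘ Equiv.swap x y) p /
      ((e * (z y - z u)) * ∏ v ∈ S.erase y, (e * (z y - z v))) = B
    field_simp
    ring

end Divided

end Schur


namespace Schur

open CategoryTheory MvPolynomial

/-! ### Traces and spanning sets -/

section Trace

variable {n d : ℕ} {K : Type} [Field K] [CharZero K]

/-- The values `z` are algebraically independent. -/
def Generic (z : Fin d → K) : Prop := Function.Injective (aeval z : Poly d →ₐ[ℚ] K)

theorem Generic.injective {z : Fin d → K} (h : Generic z) : Function.Injective z := by
  intro i j hij
  have : (X i : Poly d) = X j := h (by simpa using hij)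
  exact X_injective this

theorem Generic.comp {z : Fin d → K} (h : Generic z) (σ : Equiv.Perm (Fin d)) : Generic (z ∘ σ) := by
  intro p q hpq
  rw [← aeval_rename, ← aeval_rename] at hpq
  exact rename_injective _ σ.injective (h hpq)

theorem exists_generic (d : ℕ) : ∃ (K : Type) (_ : Field K) (_ : CharZero K) (z : Fin d → K),
    Generic z := by
  refine ⟨FractionRing (Poly d), inferInstance, ?_, fun i => algebraMap (Poly d) _ (X i), ?_⟩
  · exact charZero_of_injective_algebraMap (IsFractionRing.injective (Poly d) (FractionRing (Poly d)))
  · have hc : CharZero (FractionRing (Poly d)) :=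
      charZero_of_injective_algebraMap (IsFractionRing.injective (Poly d) (FractionRing (Poly d)))
    intro p q h
    have : ∀ p : Poly d, aeval (fun i => algebraMap (Poly d) (FractionRing (Poly d)) (X i)) p =
        algebraMap (Poly d) (FractionRing (Poly d)) p := by
      intro p
      induction p using MvPolynomial.induction_on with
      | C a =>
        rw [← algebraMap_eq, AlgHom.commutes]
        exact (RingHom.congr_fun (Subsingleton.elim (algebraMap ℚ (FractionRing (Poly d)))
          ((algebraMap (Poly d) (FractionRing (Poly d))).comp (algebraMap ℚ (Poly d)))) a)
      | add p q hp hq => rw [map_add, map_add, hp, hq]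
      | mul_X p i hp => rw [map_mul, map_mul, hp, aeval_X]
    rw [this, this] at h
    exact IsFractionRing.injective (Poly d) (FractionRing (Poly d)) h

noncomputable section

/-- The iterated divided difference over the block from which a letter takes its variable. -/
def tr (mu : Fin n → ℤ) : Letter n → Poly d → Poly d
  | (true, i) => capL mu i.val
  | (false, i) => capR mu i.val

/-- A sign. -/
def eps (a : Letter n) : K := if a.1 then -1 else 1

theorem eps_cases (a : Letter n) : (eps a : K) = 1 ∨ (eps a : K) = -1 := by
  unfold eps; split_ifs <;> simp

theorem eps_ne_zero (a : Letter n) : (eps a : K) ≠ 0 := by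
  rcases eps_cases (K := K) a with h | h <;> rw [h] <;> simp

theorem sum_ite_val {τ : Fin d} {k : ℤ} (hk : (τ.val : ℤ) = k) (f : Fin d → Poly d) :
    (∑ x : Fin d, if (x.val : ℤ) = k then f x else 0) = f τ := by
  subst hk
  rw [Finset.sum_eq_single τ]
  · simp
  · intro t _ ht; rw [if_neg]; intro h; exact ht (Fin.ext (by exact_mod_cast h))
  · simp

theorem aeval_tr_std {mu : Fin n → ℤ} (hmu : Good d mu) (a : Letter n) {τ : Fin d}
    (hτ : (τ.val : ℤ) = thin mu a) (hτ' : std mu τ = Letter.old a) {p : Poly d}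
    (hp : ∀ ρ : Equiv.Perm (Fin d), std mu ∘ ρ = std mu → ρ τ = τ → rename ρ p = p)
    {z : Fin d → K} (hz : Function.Injective z) : aeval z (tr mu a p) =
      ∑ y ∈ blk (std (d := d) mu) (Letter.old a), aeval (z ∘ Equiv.swap τ y) p /
        ∏ u ∈ (blk (std (d := d) mu) (Letter.old a)).erase y, (eps a * (z y - z u)) := by
  have key : ∀ us : List (Fin d), us.Nodup → (∀ u, u ∈ us ↔ u ≠ τ ∧ std mu u = Letter.old a) →
      (τ ∉ us ∧ (∀ u ∈ us, ∀ u' ∈ us, rename (Equiv.swap u u') p = p) ∧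
        insert τ us.toFinset = blk (std (d := d) mu) (Letter.old a)) := by
    intro us hn hus
    refine ⟨fun h => ((hus _).1 h).1 rfl, fun u hu u' hu' => ?_, ?_⟩
    · rw [hus] at hu hu'
      refine hp _ ?_ (Equiv.swap_apply_of_ne_of_ne hu.1.symm hu'.1.symm)
      funext j
      simp only [Function.comp_apply, Equiv.swap_apply_def]
      split_ifs with e1 e2
      · rw [e1, hu.2, hu'.2]
      · rw [e2, hu.2, hu'.2]
      · rfl
    · ext u
      rw [Finset.mem_insert, List.mem_toFinset, hus, mem_blk]
      constructor
      · rintro (rfl | h)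
        · exact hτ'
        · exact h.2
      · intro h; by_cases e : u = τ
        · exact Or.inl e
        · exact Or.inr ⟨e, h⟩
  obtain ⟨b, i⟩ := a
  have hne : ∀ u : Fin d, u ≠ τ ↔ (u.val : ℤ) ≠ τ.val := by
    intro u; rw [Ne, Ne, Fin.ext_iff]; norm_cast
  cases b
  · obtain ⟨h1, h2, h3⟩ := key ((List.finRange d).filter fun u => kk mu i.val ≤ (u.val : ℤ) ∧
        (u.val : ℤ) < kk mu (i.val + 1) - 1) ((List.nodup_finRange d).filter _) (by
        intro u; simp [hne, std_eq hmu, hτ, thin, Letter.old, add_assoc]; omega)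
    have e : tr mu (false, i) p = ((List.finRange d).filter fun u => kk mu i.val ≤ (u.val : ℤ) ∧
        (u.val : ℤ) < kk mu (i.val + 1) - 1).foldr (fun u q => dd τ u q) p := by
      exact sum_ite_val hτ _
    rw [e, aeval_foldr_dd (eps (false, i)) (eps_cases _) (fun u q => dd τ u q) τ (fun z u q hz hu => by
      rw [aeval_dd z (hz.ne hu)]; simp [eps]) p _ ((List.nodup_finRange d).filter _) h1 h2 z hz, h3]
  · obtain ⟨h1, h2, h3⟩ := key ((List.finRange d).filter fun u => kk mu (i.val + 1) < (u.val : ℤ) ∧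
        (u.val : ℤ) < kk mu (i.val + 2)) ((List.nodup_finRange d).filter _) (by
        intro u; simp [hne, std_eq hmu, hτ, thin, Letter.old, add_assoc]; omega)
    have e : tr mu (true, i) p = ((List.finRange d).filter fun u => kk mu (i.val + 1) < (u.val : ℤ) ∧
        (u.val : ℤ) < kk mu (i.val + 2)).foldr (fun u q => dd u τ q) p := by
      exact sum_ite_val hτ _
    rw [e, aeval_foldr_dd (eps (true, i)) (eps_cases _) (fun u q => dd u τ q) τ (fun z u q hz hu => by
      rw [aeval_dd z (hz.ne hu.symm), Equiv.swap_comm]; simp [eps]) p _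
      ((List.nodup_finRange d).filter _) h1 h2 z hz, h3]

/-- The values of the trace. -/
theorem aeval_tr {mu : Fin n → ℤ} (hmu : Good d mu) (a : Letter n) {τ : Fin d}
    (hτ : (τ.val : ℤ) = thin mu a) (hτ' : std mu τ = Letter.old a) {p : Poly d}
    (hp : ∀ ρ : Equiv.Perm (Fin d), std mu ∘ ρ = std mu → ρ τ = τ → rename ρ p = p)
    {z : Fin d → K} (hz : Function.Injective z) {c : Fin d → ℕ} {σ : Equiv.Perm (Fin d)}
    (hσ : c ∘ σ = std mu) (f : Fin d → K)
    (hf : ∀ y, c y = Letter.old a → ∀ σ' : Equiv.Perm (Fin d), c ∘ σ' = std mu → σ' τ = y →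
      aeval (z ∘ σ') p = f y) : aeval (z ∘ σ) (tr mu a p) =
      ∑ y ∈ blk c (Letter.old a), f y / ∏ u ∈ (blk c (Letter.old a)).erase y, (eps a * (z y - z u)) := by
  rw [aeval_tr_std hmu a hτ hτ' hp (hz.comp σ.injective)]
  have hs : ∀ y, std mu y = c (σ y) := fun y => (congrFun hσ y).symm
  refine Finset.sum_equiv σ (fun y => by simp [hs]) fun y hy => ?_
  rw [mem_blk] at hy
  congr 1
  · refine hf _ (by rw [← hs, hy]) (σ * Equiv.swap τ y) ?_ (by simp)
    funext j
    simp only [Function.comp_apply, Equiv.Perm.mul_apply, ← hs, Equiv.swap_apply_def]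
    split_ifs with e1 e2
    · rw [e1, hy, hτ']
    · rw [e2, hy, hτ']
    · rfl
  · exact Finset.prod_equiv σ (fun u => by simp [hs]) fun u _ => rfl

theorem tr_inv {mu : Fin n → ℤ} (hmu : Good d mu) (a : Letter n) {τ : Fin d}
    (hτ : (τ.val : ℤ) = thin mu a) (hτ' : std mu τ = Letter.old a) {p : Poly d}
    (hp : ∀ ρ : Equiv.Perm (Fin d), std mu ∘ ρ = std mu → ρ τ = τ → rename ρ p = p)
    {ρ : Equiv.Perm (Fin d)} (hρ : std mu ∘ ρ = std mu) : rename ρ (tr mu a p) = tr mu a p := by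
  obtain ⟨K, _, _, z, hz⟩ := exists_generic d
  apply hz
  classical
  have hf : ∀ y, std mu y = Letter.old a → ∀ σ' : Equiv.Perm (Fin d), std mu ∘ σ' = std mu →
      σ' τ = y → aeval (z ∘ σ') p = aeval (z ∘ Equiv.swap τ y) p := by
    intro y hy σ' h1 h2
    have : σ' = Equiv.swap τ y * (Equiv.swap τ y * σ') := by rw [← mul_assoc]; simp
    rw [this, aeval_comp_mul, hp]
    · funext j
      simp only [Function.comp_apply, Equiv.Perm.mul_apply, Equiv.swap_apply_def]
      have hj := congrFun h1 j
      simp only [Function.comp_apply] at hj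
      split_ifs with e1 e2
      · rw [← hj, e1, hy, hτ']
      · rw [← hj, e2, hy, hτ']
      · exact hj
    · simp [h2]
  have h1 := aeval_tr hmu a hτ hτ' hp hz.injective (c := std mu) (σ := 1) rfl _ hf
  have h2 := aeval_tr hmu a hτ hτ' hp hz.injective (c := std mu) (σ := ρ) hρ _ hf
  rw [aeval_rename]
  exact h2.trans h1.symm

theorem blk_eq_map {mu : Fin n → ℤ} (hmu : Good d mu) {c : Fin d → ℕ}
    {σ : Equiv.Perm (Fin d)} (hσ : c ∘ σ = std mu) (i : ℕ) :
    blk c i = (Finset.univ : Finset (Blk d mu i)).map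
      ((Function.Embedding.subtype _).trans σ.toEmbedding) := by
  have hs : ∀ y, std mu y = c (σ y) := fun y => (congrFun hσ y).symm
  ext y
  simp only [mem_blk, Finset.mem_map, Finset.mem_univ, true_and, Subtype.exists]
  constructor
  · intro hy
    refine ⟨σ⁻¹ y, ?_, by simp⟩
    rw [← std_eq hmu, hs]; simpa using hy
  · rintro ⟨t, ht, rfl⟩
    rw [← std_eq hmu, hs] at ht; exact ht

/-- The value of an elementary symmetric polynomial. -/
theorem aeval_eB {mu : Fin n → ℤ} (hmu : Good d mu) {z : Fin d → K} {c : Fin d → ℕ}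
    {σ : Equiv.Perm (Fin d)} (hσ : c ∘ σ = std mu) (i k : ℕ) :
    aeval (z ∘ σ) (eB mu i k) = (-1) ^ k * PowerSeries.coeff k (eSer z (blk c i)) := by
  rw [eB, aeval_rename, coeff_eSer, ← mul_assoc, ← mul_pow]
  rw [esymm, map_sum]
  simp only [neg_mul_neg, mul_one, one_pow, one_mul, map_prod, aeval_X]
  rw [blk_eq_map hmu hσ, Finset.powersetCard_map, Finset.sum_map]
  refine Finset.sum_congr rfl fun s _ => ?_
  simp only [Finset.mapEmbedding_apply, RelEmbedding.coe_toEmbedding, Finset.prod_map]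
  rfl

/-- The value of a complete symmetric polynomial. -/
theorem aeval_hB {mu : Fin n → ℤ} (hmu : Good d mu) {z : Fin d → K} {c : Fin d → ℕ}
    {σ : Equiv.Perm (Fin d)} (hσ : c ∘ σ = std mu) (i k : ℕ) :
    aeval (z ∘ σ) (hB mu i k) = PowerSeries.coeff k (hSer z (blk c i)) := by
  rw [hB, aeval_rename, aeval_hsymm, blk_eq_map hmu hσ, hSer, hSer, Finset.prod_map]
  rfl

/-- Invariance can be tested on values. -/
theorem rename_eq_of_values {mu : Fin n → ℤ} {p : Poly d}
    (h : ∀ (K : Type) [Field K] [CharZero K] (z : Fin d → K), Function.Injective z →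
      ∀ (σ σ' : Equiv.Perm (Fin d)) (c : Fin d → ℕ), c ∘ σ = std mu → c ∘ σ' = std mu →
      aeval (z ∘ σ) p = aeval (z ∘ σ') p) {ρ : Equiv.Perm (Fin d)} (hρ : std mu ∘ ρ = std mu) :
    rename ρ p = p := by
  obtain ⟨K, _, _, z, hz⟩ := exists_generic d
  apply hz
  rw [aeval_rename]
  exact h K z hz.injective ρ 1 (std mu) hρ rfl

theorem eB_inv {mu : Fin n → ℤ} (hmu : Good d mu) (i k : ℕ) {ρ : Equiv.Perm (Fin d)}
    (hρ : std mu ∘ ρ = std mu) : rename ρ (eB (d := d) mu i k) = eB mu i k :=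
  rename_eq_of_values (fun K _ _ z _ σ σ' c h h' => by rw [aeval_eB hmu h, aeval_eB hmu h']) hρ

theorem hB_inv {mu : Fin n → ℤ} (hmu : Good d mu) (i k : ℕ) {ρ : Equiv.Perm (Fin d)}
    (hρ : std mu ∘ ρ = std mu) : rename ρ (hB (d := d) mu i k) = hB mu i k :=
  rename_eq_of_values (fun K _ _ z _ σ σ' c h h' => by rw [aeval_hB hmu h, aeval_hB hmu h']) hρ

end

end Trace

/-! ### Bimodules of letters -/

section LetterBim

variable {n d : ℕ} {K : Type} [Field K] [CharZero K]

/-- The situation of a letter `a` between two weights in `Λ(n,d)`. -/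
structure IsStep (lam mu : Fin n → ℤ) (a : Letter n) (τ : Fin d) : Prop where
  good : Good d lam
  good' : Good d mu
  pos : (τ.val : ℤ) = thin lam a
  old : std lam τ = Letter.old a
  upd : std mu = Function.update (std lam) τ (Letter.new a)

theorem exists_step (D : ℕ) {lam mu : Fin n → ℤ} (a : Letter n) (hmu : mu = lam + (presS n D).wt [a])
    (h : Good d lam) (h' : Good d mu) : ∃ τ : Fin d, IsStep lam mu a τ := by
  subst hmu
  obtain ⟨τ, h1, h2, h3⟩ := exists_thin D a h h'
  exact ⟨τ, h, h', h1, h2, h3⟩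

namespace IsStep

variable {lam mu : Fin n → ℤ} {a : Letter n} {τ : Fin d}

theorem lv_eq (hs : IsStep lam mu a τ) : lv (d := d) lam a = X τ := by rw [Schur.lv_eq, ← hs.pos, zv_eq]

/-- The common stabilizer. -/
theorem stab (hs : IsStep lam mu a τ) {ρ : Equiv.Perm (Fin d)} (h : std lam ∘ ρ = std lam) :
    std mu ∘ ρ = std mu ↔ ρ τ = τ := by
  have hj := fun j => congrFun h j
  simp only [Function.comp_apply] at hj
  constructor
  · intro h'
    obtain ⟨t, ht⟩ := ρ.surjective τ
    have h2 := congrFun h' t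
    rw [hs.upd] at h2
    simp only [Function.comp_apply, ht, Function.update_self] at h2
    by_contra hne
    have : t ≠ τ := fun e => hne (by rw [e] at ht; exact ht)
    rw [Function.update_of_ne this] at h2
    have h3 := hj t
    rw [ht, hs.old, ← h2] at h3
    exact Letter.old_ne_new a h3
  · intro h'
    rw [hs.upd]
    funext j
    by_cases e : j = τ
    · subst e; simp [h']
    · have : ρ j ≠ τ := fun e' => e (ρ.injective (e'.trans h'.symm))
      simp [Function.update_of_ne e, Function.update_of_ne this, hj]

theorem toP_inv (hs : IsStep lam mu a τ) {ρ : Equiv.Perm (Fin d)} (b : bimB d lam mu) (h : std lam ∘ ρ = std lam)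
    (h' : ρ τ = τ) : rename ρ (toP b) = toP b := Schur.toP_inv b h ((hs.stab h).2 h')

theorem toP_ofB (hs : IsStep lam mu a τ) {p : Poly d}
    (hp : ∀ ρ : Equiv.Perm (Fin d), std lam ∘ ρ = std lam → ρ τ = τ → rename ρ p = p) :
    toP (ofB (lam := lam) (mu := mu) p) = p :=
  Schur.toP_ofB hs.good hs.good' fun ρ h h' => hp ρ h ((hs.stab h).1 h')

theorem toP_lv (hs : IsStep lam mu a τ) (k : ℕ) : toP (ofB (lam := lam) (mu := mu) (lv lam a ^ k)) = X τ ^ k := by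
  rw [hs.lv_eq]
  exact hs.toP_ofB fun ρ _ h => by simp [h]

theorem comp_upd (hs : IsStep lam mu a τ) {c c' : Fin d → ℕ} {y : Fin d} {σ : Equiv.Perm (Fin d)}
    (hc : c ∘ σ = std lam) (hy : σ τ = y) (hc' : c' = Function.update c y (Letter.new a)) :
    c' ∘ σ = std mu := by
  rw [hc', hs.upd, ← hc]
  funext j
  by_cases e : j = τ
  · subst e; simp [hy]
  · have : σ j ≠ y := fun e' => e (σ.injective (e'.trans hy.symm))
    simp [Function.update_of_ne e, Function.update_of_ne this]

/-- The value at a step. -/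
theorem bv (hs : IsStep lam mu a τ) {z : Fin d → K} {c c' : Fin d → ℕ} {y : Fin d} {σ : Equiv.Perm (Fin d)}
    (hc : c ∘ σ = std lam) (hy : σ τ = y) (hc' : c' = Function.update c y (Letter.new a))
    (b : bimB d lam mu) : bv z c c' lam mu b = aeval (z ∘ σ) (toP b) :=
  bv_eq hc (hs.comp_upd hc hy hc') b

theorem exists_perm (hs : IsStep lam mu a τ) {c : Fin d → ℕ} (hc : HasWt c lam) {y : Fin d} (hy : c y = Letter.old a) :
    ∃ σ : Equiv.Perm (Fin d), c ∘ σ = std lam ∧ σ τ = y := by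
  obtain ⟨σ, hσ⟩ := hc.exists_perm
  refine ⟨Equiv.swap (σ τ) y * σ, ?_, by simp⟩
  have hτ : c (σ τ) = c y := by rw [hy, ← hs.old, ← hσ]; rfl
  rw [← hσ]
  funext j
  simp only [Function.comp_apply, Equiv.Perm.mul_apply, Equiv.swap_apply_def]
  split_ifs with e1 e2
  · rw [e1, hτ]
  · rw [e2, hτ]
  · rfl

theorem bv_lv (hs : IsStep lam mu a τ) {z : Fin d → K} {c c' : Fin d → ℕ} (hc : HasWt c lam) {y : Fin d}
    (hy : c y = Letter.old a) (hc' : c' = Function.update c y (Letter.new a)) (k : ℕ) :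
    Schur.bv z c c' lam mu (ofB (lv lam a ^ k)) = z y ^ k := by
  obtain ⟨σ, h1, h2⟩ := hs.exists_perm hc hy
  rw [hs.bv h1 h2 hc', hs.toP_lv]
  simp [h2]

/-- Every element of the bimodule is a combination of powers of the variable of the thin edge. -/
theorem span (hs : IsStep lam mu a τ) (b : bimB d lam mu) : ∃ s : ℕ → ringR d lam,
    b = ∑ k ∈ Finset.range (blk (std (d := d) lam) (Letter.old a)).card,
      (bimB d lam mu).r (s k) (ofB (lv lam a ^ k)) := by
  classical
  let B := blk (std (d := d) lam) (Letter.old a)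
  let g : Polynomial (Poly d) := ∏ u ∈ B.erase τ, Polynomial.C (C (eps a)) * (Polynomial.X - Polynomial.C (X u))
  have hg : ∀ ρ : Equiv.Perm (Fin d), std lam ∘ ρ = std lam → ρ τ = τ → ∀ k,
      rename ρ (g.coeff k) = g.coeff k := by
    intro ρ h1 h2 k
    have : g.map (rename ρ : Poly d →ₐ[ℚ] Poly d).toRingHom = g := by
      simp only [g, Polynomial.map_prod]
      refine Finset.prod_equiv ρ (fun u => ?_) fun u _ => ?_
      · have : std lam (ρ u) = std lam u := congrFun h1 u
        simp only [B, Finset.mem_erase, mem_blk, this]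
        refine and_congr_left' (not_congr ⟨fun e => by rw [e, h2], fun e => ρ.injective (e.trans h2.symm)⟩)
      · simp
    conv_rhs => rw [← this]
    rw [Polynomial.coeff_map]; rfl
  have hp : ∀ k, ∀ ρ : Equiv.Perm (Fin d), std lam ∘ ρ = std lam → ρ τ = τ →
      rename ρ (toP b * g.coeff k) = toP b * g.coeff k := fun k ρ h1 h2 => by
    rw [map_mul, hg ρ h1 h2, hs.toP_inv b h1 h2]
  refine ⟨fun k => ofR (tr lam a (toP b * g.coeff k)), toP_ext ?_⟩
  have hsum : ∀ (s : Finset ℕ) (f : ℕ → bimB d lam mu), toP (∑ k ∈ s, f k) = ∑ k ∈ s, toP (f k) := by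
    intro s f
    simp only [← toPL_eq, map_sum]
  rw [hsum]
  have hk : ∀ k, polR lam (ofR (tr lam a (toP b * g.coeff k))) = tr lam a (toP b * g.coeff k) :=
    fun k => polR_ofR hs.good fun ρ hρ => tr_inv hs.good a hs.pos hs.old (hp k) hρ
  simp only [toP_r, hk, hs.toP_lv]
  obtain ⟨K, _, _, z, hz⟩ := exists_generic d
  apply hz
  rw [map_sum]
  simp only [map_mul, map_pow, aeval_X]
  have hτB : τ ∈ B := by simp [B, hs.old]
  have hv : ∀ k, aeval z (tr lam a (toP b * g.coeff k)) = ∑ y ∈ B, aeval (z ∘ Equiv.swap τ y) (toP b) *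
      aeval (z ∘ Equiv.swap τ y) (g.coeff k) / ∏ u ∈ B.erase y, (eps a * (z y - z u)) := by
    intro k
    rw [aeval_tr_std hs.good a hs.pos hs.old (hp k) hz.injective]
    simp only [map_mul, B]
  simp only [hv, Finset.sum_mul]
  rw [Finset.sum_comm]
  have hgy : ∀ y ∈ B, ∑ k ∈ Finset.range B.card, aeval (z ∘ Equiv.swap τ y) (g.coeff k) * z τ ^ k =
      ∏ u ∈ B.erase y, (eps a * (z τ - z u)) := by
    intro y hy
    let φ : Poly d →+* K := (aeval (z ∘ Equiv.swap τ y) : Poly d →ₐ[ℚ] K).toRingHom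
    have h1 : (g.map φ).natDegree < B.card := by
      refine lt_of_le_of_lt Polynomial.natDegree_map_le ?_
      refine lt_of_le_of_lt (Polynomial.natDegree_prod_le _ _) ?_
      refine lt_of_le_of_lt (Finset.sum_le_card_nsmul _ _ 1 fun u _ => ?_) ?_
      · refine (Polynomial.natDegree_C_mul_le _ _).trans (Polynomial.natDegree_X_sub_C_le _)
      · rw [smul_eq_mul, mul_one, Finset.card_erase_of_mem hτB]
        have := Finset.card_pos.2 ⟨τ, hτB⟩; omega
    have h2 := Polynomial.eval_eq_sum_range' h1 (z τ)
    have h3 : ∀ k, aeval (z ∘ Equiv.swap τ y) (g.coeff k) = (g.map φ).coeff k := fun k => by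
      rw [Polynomial.coeff_map]; rfl
    simp only [h3, ← h2]
    have h4 : φ (C (eps a)) = eps a := by
      change aeval (z ∘ Equiv.swap τ y) (C (eps a : ℚ)) = _
      rw [← algebraMap_eq, AlgHom.commutes]; unfold eps; split_ifs <;> simp
    simp only [g, Polynomial.map_prod, Polynomial.eval_prod, Polynomial.map_mul, Polynomial.map_C,
      Polynomial.map_sub, Polynomial.map_X, Polynomial.eval_mul, Polynomial.eval_C,
      Polynomial.eval_sub, Polynomial.eval_X, h4]
    refine Finset.prod_equiv (Equiv.swap τ y) (fun u => ?_) fun u _ => ?_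
    · have hy' : std lam y = Letter.old a := by simpa [B] using hy
      simp only [Finset.mem_erase, B, mem_blk, Equiv.swap_apply_def]
      have := hs.old
      split_ifs with e1 e2
      · subst e1; simp
      · subst e2; simp [hy', this, Ne.symm e1, e1]
      · tauto
    · have : φ (X u) = z (Equiv.swap τ y u) := aeval_X _ _
      rw [this]
  rw [Finset.sum_eq_single τ]
  · have h0 : ∏ u ∈ B.erase τ, (eps a * (z τ - z u)) ≠ 0 := by
      refine Finset.prod_ne_zero_iff.2 fun v hv => mul_ne_zero (eps_ne_zero a)
        (sub_ne_zero.2 (hz.injective.ne (Finset.ne_of_mem_erase hv).symm))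
    have h1 := hgy τ hτB
    have h2 : aeval (z ∘ Equiv.swap τ τ) (toP b) = aeval z (toP b) := by rw [Equiv.swap_self]; rfl
    simp only [div_mul_eq_mul_div, mul_assoc]
    rw [← Finset.sum_div, ← Finset.mul_sum, h1, mul_div_cancel_right₀ _ h0, h2]
  · intro y hy hne
    have h0 : ∏ u ∈ B.erase y, (eps a * (z τ - z u)) = 0 :=
      Finset.prod_eq_zero (i := τ) (Finset.mem_erase.2 ⟨hne.symm, hτB⟩) (by simp)
    simp only [div_mul_eq_mul_div, mul_assoc]
    rw [← Finset.sum_div, ← Finset.mul_sum, hgy y hy, h0]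
    simp
  · exact fun h => (h hτB).elim

end IsStep

end LetterBim

end Schur


namespace Schur

open CategoryTheory MvPolynomial

/-! ### Realization of the bimodules by functions on chains -/

section Eval

variable {n d : ℕ} {K : Type} [Field K] [CharZero K]

noncomputable section

open scoped Classical in
/-- The value of `b ⊗ m` at a chain, given the values of `m`. -/
def evStep (z : Fin d → K) (c : Fin d → ℕ) (L nu : Fin n → ℤ) (a : Letter n) (w : SSeq n)
    (φ : bimW d L (L + (presS n d).wt w) w →ₗ[ℚ] (List (Fin d) → K)) :
    ((bimB d (L + (presS n d).wt w) nu).sh (letterShift (L + (presS n d).wt w) a)) →ₗ[ℚ]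
      bimW d L (L + (presS n d).wt w) w →ₗ[ℚ] (List (Fin d) → K) :=
  LinearMap.mk₂ ℚ (fun b m ys => match ys with
    | [] => 0
    | y :: ys => if Valid c (a :: w) (y :: ys) then
        bv z (col c w ys) (col c (a :: w) (y :: ys)) (L + (presS n d).wt w) nu b * φ m ys else 0)
    (by
      intro b b' m; funext ys
      rcases ys with _ | ⟨y, ys⟩
      · exact (add_zero _).symm
      · have : bv z (col c w ys) (col c (a :: w) (y :: ys)) (L + (presS n d).wt w) nu (b + b') =
          bv z (col c w ys) (col c (a :: w) (y :: ys)) (L + (presS n d).wt w) nu b +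
          bv z (col c w ys) (col c (a :: w) (y :: ys)) (L + (presS n d).wt w) nu b' := map_add _ _ _
        simp only [Pi.add_apply]
        split_ifs
        · rw [this, add_mul]
        · simp)
    (by
      intro q b m; funext ys
      rcases ys with _ | ⟨y, ys⟩
      · exact (smul_zero (A := K) q).symm
      · have : bv z (col c w ys) (col c (a :: w) (y :: ys)) (L + (presS n d).wt w) nu (q • b) =
          q • bv z (col c w ys) (col c (a :: w) (y :: ys)) (L + (presS n d).wt w) nu b := map_smul _ _ _
        simp only [Pi.smul_apply]
        split_ifs
        · rw [this, smul_mul_assoc]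
        · simp)
    (by
      intro b m m'; funext ys
      rcases ys with _ | ⟨y, ys⟩
      · exact (add_zero _).symm
      · simp only [Pi.add_apply, map_add]
        split_ifs
        · rw [mul_add]
        · simp)
    (by
      intro q b m; funext ys
      rcases ys with _ | ⟨y, ys⟩
      · exact (smul_zero (A := K) q).symm
      · simp only [Pi.smul_apply, map_smul]
        split_ifs
        · rw [mul_smul_comm]
        · simp)

open scoped Classical in
theorem evStep_cons (z : Fin d → K) (c : Fin d → ℕ) (L nu : Fin n → ℤ) (a : Letter n) (w : SSeq n)
    (φ : bimW d L (L + (presS n d).wt w) w →ₗ[ℚ] (List (Fin d) → K))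
    (b : bimB d (L + (presS n d).wt w) nu) (m : bimW d L (L + (presS n d).wt w) w) (y : Fin d)
    (ys : List (Fin d)) : evStep z c L nu a w φ b m (y :: ys) = if Valid c (a :: w) (y :: ys) then
        bv z (col c w ys) (col c (a :: w) (y :: ys)) (L + (presS n d).wt w) nu b * φ m ys else 0 :=
  rfl

open scoped Classical in
/-- The realization for the empty sequence. -/
def evNil (z : Fin d → K) (c : Fin d → ℕ) (L nu : Fin n → ℤ) : bimB d L nu →ₗ[ℚ] (List (Fin d) → K) :=
  LinearMap.pi fun ys => if ys = [] then bv z c c L nu else 0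

theorem evNil_nil (z : Fin d → K) (c : Fin d → ℕ) (L nu : Fin n → ℤ) (m : bimB d L nu) :
    evNil z c L nu m [] = bv z c c L nu m := by
  rw [evNil, LinearMap.pi_apply, if_pos rfl]

theorem evNil_l (z : Fin d → K) (c : Fin d → ℕ) (L nu : Fin n → ℤ) (r : ringR d nu) (m : bimB d L nu)
    (ys : List (Fin d)) : evNil z c L nu ((bimB d L nu).l r m) ys =
      rv z (col (n := n) c [] ys) nu r * evNil z c L nu m ys := by
  rcases ys with _ | ⟨y, ys⟩
  · rw [evNil_nil, evNil_nil]; exact bv_l r m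
  · exact (mul_zero _).symm

theorem evStep_bal (z : Fin d → K) (c : Fin d → ℕ) (L nu : Fin n → ℤ) (a : Letter n) (w : SSeq n)
    (φ : bimW d L (L + (presS n d).wt w) w →ₗ[ℚ] (List (Fin d) → K))
    (hφ : ∀ r m ys, φ ((bimW d L (L + (presS n d).wt w) w).l r m) ys =
      rv z (col c w ys) (L + (presS n d).wt w) r * φ m ys) (r : ringR d (L + (presS n d).wt w))
    (b : (bimB d (L + (presS n d).wt w) nu).sh (letterShift (L + (presS n d).wt w) a))
    (m : bimW d L (L + (presS n d).wt w) w) : evStep z c L nu a w φ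
      (((bimB d (L + (presS n d).wt w) nu).sh (letterShift (L + (presS n d).wt w) a)).r r b) m =
      evStep z c L nu a w φ b ((bimW d L (L + (presS n d).wt w) w).l r m) := by
  funext ys
  rcases ys with _ | ⟨y, ys⟩
  · rfl
  · simp only [evStep, LinearMap.mk₂_apply]
    have := bv_r (z := z) (c := col c w ys) (c' := col c (a :: w) (y :: ys)) r b
    rw [hφ]
    split_ifs
    · refine (congrArg (· * _) this).trans ?_; ring
    · rfl

/-- The realization for a nonempty sequence. -/
def evCons (z : Fin d → K) (c : Fin d → ℕ) (L nu : Fin n → ℤ) (a : Letter n) (w : SSeq n)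
    (φ : bimW d L (L + (presS n d).wt w) w →ₗ[ℚ] (List (Fin d) → K))
    (hφ : ∀ r m ys, φ ((bimW d L (L + (presS n d).wt w) w).l r m) ys =
      rv z (col c w ys) (L + (presS n d).wt w) r * φ m ys) :
    bimW d L nu (a :: w) →ₗ[ℚ] (List (Fin d) → K) :=
  tlift (evStep z c L nu a w φ) (evStep_bal z c L nu a w φ hφ)

theorem evCons_cnsB (z : Fin d → K) (c : Fin d → ℕ) (L nu : Fin n → ℤ) (a : Letter n) (w : SSeq n)
    (φ : bimW d L (L + (presS n d).wt w) w →ₗ[ℚ] (List (Fin d) → K))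
    (hφ : ∀ r m ys, φ ((bimW d L (L + (presS n d).wt w) w).l r m) ys =
      rv z (col c w ys) (L + (presS n d).wt w) r * φ m ys)
    (b : bimB d (L + (presS n d).wt w) nu) (m : bimW d L (L + (presS n d).wt w) w) :
    evCons z c L nu a w φ hφ (cnsB a w b m) = evStep z c L nu a w φ b m :=
  tlift_tp _ (evStep_bal z c L nu a w φ hφ) _ _

theorem bimW_ext {L nu : Fin n → ℤ} {a : Letter n} {w : SSeq n} {V : Type*} [AddCommGroup V]
    [Module ℚ V] {φ ψ : bimW d L nu (a :: w) →ₗ[ℚ] V}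
    (h : ∀ b m, φ (cnsB a w b m) = ψ (cnsB a w b m)) : φ = ψ :=
  tp_ext h

theorem bimW_l_cnsB {L nu : Fin n → ℤ} (a : Letter n) (w : SSeq n) (s : ringR d nu)
    (b : bimB d (L + (presS n d).wt w) nu) (m : bimW d L (L + (presS n d).wt w) w) :
    (bimW d L nu (a :: w)).l s (cnsB a w b m) = cnsB a w ((bimB d (L + (presS n d).wt w) nu).l s b) m :=
  tens_l _ _ _

theorem evCons_l (z : Fin d → K) (c : Fin d → ℕ) (L nu : Fin n → ℤ) (a : Letter n) (w : SSeq n)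
    (φ : bimW d L (L + (presS n d).wt w) w →ₗ[ℚ] (List (Fin d) → K))
    (hφ : ∀ r m ys, φ ((bimW d L (L + (presS n d).wt w) w).l r m) ys =
      rv z (col c w ys) (L + (presS n d).wt w) r * φ m ys) (r : ringR d nu)
    (m : bimW d L nu (a :: w)) (ys : List (Fin d)) :
    evCons z c L nu a w φ hφ ((bimW d L nu (a :: w)).l r m) ys =
      rv z (col c (a :: w) ys) nu r * evCons z c L nu a w φ hφ m ys := by
  refine LinearMap.congr_fun (f := LinearMap.proj ys ∘ₗ evCons z c L nu a w φ hφ ∘ₗ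
    (bimW d L nu (a :: w)).l r)
    (g := rv z (col c (a :: w) ys) nu r • LinearMap.proj ys ∘ₗ evCons z c L nu a w φ hφ)
    (bimW_ext fun b m => ?_) m
  simp only [LinearMap.comp_apply, LinearMap.smul_apply, LinearMap.proj_apply, smul_eq_mul]
  rw [bimW_l_cnsB, evCons_cnsB, evCons_cnsB]
  rcases ys with _ | ⟨y, ys⟩
  · exact (mul_zero _).symm
  · rw [evStep_cons, evStep_cons, bv_l]
    split_ifs
    · ring
    · simp

/-- The realization of the bimodule of a signed sequence by functions on chains. -/
def evS (z : Fin d → K) (c : Fin d → ℕ) (L : Fin n → ℤ) : (w : SSeq n) → (nu : Fin n → ℤ) →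
    {φ : bimW d L nu w →ₗ[ℚ] (List (Fin d) → K) // ∀ r m ys,
      φ ((bimW d L nu w).l r m) ys = rv z (col c w ys) nu r * φ m ys}
  | [], nu => ⟨evNil z c L nu, evNil_l z c L nu⟩
  | a :: w, nu => ⟨evCons z c L nu a w (evS z c L w (L + (presS n d).wt w)).1
      (evS z c L w (L + (presS n d).wt w)).2, evCons_l z c L nu a w _ _⟩

/-- The realization of the bimodule of a signed sequence by functions on chains. -/
def ev (z : Fin d → K) (c : Fin d → ℕ) (L nu : Fin n → ℤ) (w : SSeq n) :
    bimW d L nu w →ₗ[ℚ] (List (Fin d) → K) := (evS z c L w nu).1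

variable {z : Fin d → K} {c : Fin d → ℕ} {L nu : Fin n → ℤ}

theorem ev_l (w : SSeq n) (r : ringR d nu) (m : bimW d L nu w) (ys : List (Fin d)) :
    ev z c L nu w ((bimW d L nu w).l r m) ys = rv z (col c w ys) nu r * ev z c L nu w m ys :=
  (evS z c L w nu).2 r m ys

theorem ev_nil (m : bimW d L nu []) : ev z c L nu [] m [] = bv z c c L nu m :=
  evNil_nil z c L nu m

open scoped Classical in
theorem ev_cnsB (a : Letter n) (w : SSeq n) (b : bimB d (L + (presS n d).wt w) nu)
    (m : bimW d L (L + (presS n d).wt w) w) (y : Fin d) (ys : List (Fin d)) :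
    ev z c L nu (a :: w) (cnsB a w b m) (y :: ys) = if Valid c (a :: w) (y :: ys) then
      bv z (col c w ys) (col c (a :: w) (y :: ys)) (L + (presS n d).wt w) nu b *
        ev z c L (L + (presS n d).wt w) w m ys else 0 :=
  congrFun (evCons_cnsB z c L nu a w _ (evS z c L w _).2 b m) (y :: ys)

theorem ev_cnsB_of {a : Letter n} {w : SSeq n} (b : bimB d (L + (presS n d).wt w) nu)
    (m : bimW d L (L + (presS n d).wt w) w) {y : Fin d} {ys : List (Fin d)}
    (h : Valid c (a :: w) (y :: ys)) : ev z c L nu (a :: w) (cnsB a w b m) (y :: ys) =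
      bv z (col c w ys) (col c (a :: w) (y :: ys)) (L + (presS n d).wt w) nu b *
        ev z c L (L + (presS n d).wt w) w m ys := by
  rw [ev_cnsB, if_pos h]

/-- `cnsB` as a bilinear map. -/
def cnsL (L nu : Fin n → ℤ) (a : Letter n) (w : SSeq n) : bimB d (L + (presS n d).wt w) nu →ₗ[ℚ]
    bimW d L (L + (presS n d).wt w) w →ₗ[ℚ] bimW d L nu (a :: w) :=
  tpL (bimW d L (L + (presS n d).wt w) w)
    ((bimB d (L + (presS n d).wt w) nu).sh (letterShift (L + (presS n d).wt w) a))

theorem cnsL_apply (a : Letter n) (w : SSeq n) (b : bimB d (L + (presS n d).wt w) nu)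
    (m : bimW d L (L + (presS n d).wt w) w) : cnsL L nu a w b m = cnsB a w b m := rfl

theorem bimW_mem {a : Letter n} {w : SSeq n} (S : Submodule ℚ (bimW d L nu (a :: w)))
    (h : ∀ b m, cnsB a w b m ∈ S) (t : bimW d L nu (a :: w)) : t ∈ S := by
  rw [← Submodule.Quotient.mk_eq_zero]
  exact LinearMap.congr_fun (f := S.mkQ) (g := 0)
    (bimW_ext fun b m => (Submodule.Quotient.mk_eq_zero S).2 (h b m)) t

theorem cnsB_r (a : Letter n) (w : SSeq n) (s : ringR d (L + (presS n d).wt w))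
    (b : bimB d (L + (presS n d).wt w) nu) (m : bimW d L (L + (presS n d).wt w) w) :
    cnsB a w ((bimB d (L + (presS n d).wt w) nu).r s b) m = cnsB a w b
      ((bimW d L (L + (presS n d).wt w) w).l s m) := tp_bal _ _ _

theorem bimW_r_cnsB (a : Letter n) (w : SSeq n) (s : ringR d L)
    (b : bimB d (L + (presS n d).wt w) nu) (m : bimW d L (L + (presS n d).wt w) w) :
    (bimW d L nu (a :: w)).r s (cnsB a w b m) =
      cnsB a w b ((bimW d L (L + (presS n d).wt w) w).r s m) :=
  tens_r _ _ _

theorem ev_r : ∀ (w : SSeq n) (nu : Fin n → ℤ) (r : ringR d L) (m : bimW d L nu w) {ys : List (Fin d)},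
    Valid c w ys → ev z c L nu w ((bimW d L nu w).r r m) ys = rv z c L r * ev z c L nu w m ys
  | [], nu, r, m, [], _ => by rw [ev_nil, ev_nil]; exact bv_r r m
  | a :: w, nu, r, m, y :: ys, h => by
    refine LinearMap.congr_fun (f := LinearMap.proj (y :: ys) ∘ₗ ev z c L nu (a :: w) ∘ₗ
      (bimW d L nu (a :: w)).r r) (g := rv z c L r • LinearMap.proj (y :: ys) ∘ₗ ev z c L nu (a :: w))
      (bimW_ext fun b m => ?_) m
    simp only [LinearMap.comp_apply, LinearMap.smul_apply, LinearMap.proj_apply, smul_eq_mul]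
    rw [bimW_r_cnsB, ev_cnsB_of _ _ h, ev_cnsB_of _ _ h, ev_r w _ r m h.1]
    ring

/-- The bimodule of a signed sequence vanishes if one of its regions is not in `Λ(n,d)`. -/
theorem bimW_eq_zero_of_right (h : ¬ Good d L) (w : SSeq n) (m : bimW d L nu w) : m = 0 := by
  have h1 : (1 : ringR d L) = 0 := pol_ext (P := Good d L) fun h' => (h h').elim
  have h2 : (bimW d L nu w).r 1 m = m := by rw [map_one]; rfl
  rw [← h2, h1, map_zero]; rfl

theorem bimW_eq_zero_of_left (h : ¬ Good d nu) (w : SSeq n) (m : bimW d L nu w) : m = 0 := by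
  have h1 : (1 : ringR d nu) = 0 := pol_ext (P := Good d nu) fun h' => (h h').elim
  have h2 : (bimW d L nu w).l 1 m = m := by rw [map_one]; rfl
  rw [← h2, h1, map_zero]; rfl

theorem wt_cons (D : ℕ) (L : Fin n → ℤ) (a : Letter n) (w : SSeq n) :
    L + (presS n D).wt (a :: w) = L + (presS n D).wt w + (presS n D).wt [a] := by
  rw [← List.singleton_append, Pres.wt_append]; abel

theorem card_blk_eq {c c' : Fin d → ℕ} {lam : Fin n → ℤ} (h : HasWt c lam) (h' : HasWt c' lam)
    {i : ℕ} (hi : i < n) : (blk c i).card = (blk c' i).card := by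
  have := (h.en hi).symm.trans (h'.en hi); exact_mod_cast this

/-- Every element of the bimodule of `a :: w` is a combination of powers of the variable of the
first thin edge. -/
theorem bimW_span {a : Letter n} {w : SSeq n} (hnu : nu = L + (presS n d).wt (a :: w))
    (h1 : Good d (L + (presS n d).wt w)) (h2 : Good d nu) (t : bimW d L nu (a :: w)) :
    ∃ m : ℕ → bimW d L (L + (presS n d).wt w) w,
      t = ∑ k ∈ Finset.range (blk (std (d := d) (L + (presS n d).wt w)) (Letter.old a)).card,
        cns a w (lv (L + (presS n d).wt w) a ^ k) (m k) := by
  rw [wt_cons] at hnu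
  obtain ⟨τ, hs⟩ := exists_step d a hnu h1 h2
  let S : Submodule ℚ (bimW d L nu (a :: w)) :=
    { carrier := {t | ∃ m : ℕ → bimW d L (L + (presS n d).wt w) w,
        t = ∑ k ∈ Finset.range (blk (std (d := d) (L + (presS n d).wt w)) (Letter.old a)).card,
          cns a w (lv (L + (presS n d).wt w) a ^ k) (m k)}
      zero_mem' := ⟨fun _ => 0, by
        refine (Finset.sum_eq_zero fun k _ => ?_).symm
        exact map_zero (cnsL L nu a w _)⟩
      add_mem' := by
        rintro _ _ ⟨m, rfl⟩ ⟨m', rfl⟩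
        refine ⟨m + m', ?_⟩
        rw [← Finset.sum_add_distrib]
        exact Finset.sum_congr rfl fun k _ => (map_add (cnsL L nu a w _) _ _).symm
      smul_mem' := by
        rintro q _ ⟨m, rfl⟩
        refine ⟨q • m, ?_⟩
        rw [Finset.smul_sum]
        exact Finset.sum_congr rfl fun k _ => (map_smul (cnsL L nu a w _) _ _).symm }
  refine bimW_mem S (fun b m => ?_) t
  obtain ⟨s, hb⟩ := hs.span b
  refine ⟨fun k => (bimW d L (L + (presS n d).wt w) w).l (s k) m, ?_⟩
  conv_lhs => rw [hb]
  rw [← cnsL_apply, map_sum, LinearMap.sum_apply]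
  refine Finset.sum_congr rfl fun k _ => ?_
  rw [cnsL_apply, cnsB_r]; rfl

theorem Valid.hasWt_cons {a : Letter n} {w : SSeq n} {y : Fin d} {ys : List (Fin d)}
    (hc : HasWt c L) (h : Valid c (a :: w) (y :: ys)) (hnu : nu = L + (presS n d).wt (a :: w)) :
    ∃ τ : Fin d, IsStep (L + (presS n d).wt w) nu a τ := by
  have h1 := (hc.col (D := d) h.1).good
  have h2 : Good d nu := by rw [hnu]; exact (hc.col (D := d) h).good
  exact exists_step d a (hnu.trans (wt_cons d L a w)) h1 h2

theorem ev_cns_lv {a : Letter n} {w : SSeq n} (hnu : nu = L + (presS n d).wt (a :: w))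
    (hc : HasWt c L) (k : ℕ) (m : bimW d L (L + (presS n d).wt w) w) {y : Fin d} {ys : List (Fin d)}
    (h : Valid c (a :: w) (y :: ys)) :
    ev z c L nu (a :: w) (cns a w (lv (L + (presS n d).wt w) a ^ k) m) (y :: ys) =
      z y ^ k * ev z c L (L + (presS n d).wt w) w m ys := by
  obtain ⟨τ, hs⟩ := h.hasWt_cons hc hnu
  rw [cns, ev_cnsB_of _ _ h, hs.bv_lv (hc.col (D := d) h.1) h.2 (col_cons c a w y ys)]

/-- The realization is faithful. -/
theorem ev_eq_zero (hz : Generic z) (hc : HasWt c L) : ∀ (w : SSeq n) (nu : Fin n → ℤ),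
    nu = L + (presS n d).wt w → ∀ t : bimW d L nu w,
    (∀ ys, Valid c w ys → ev z c L nu w t ys = 0) → t = 0
  | [], nu, hnu, t, h => by
    have h0 := h [] trivial
    rw [ev_nil] at h0
    obtain ⟨σ, hσ⟩ := hc.exists_perm
    have hL : nu = L := by rw [hnu]; simp [Pres.wt]
    subst hL
    have h1 : toP (lam := nu) (mu := nu) t = 0 :=
      hz.comp σ (((bv_eq hσ hσ _).symm.trans h0).trans (map_zero _).symm)
    have h2 : toP (0 : bimB d nu nu) = 0 := by rw [← toPL_eq, map_zero]
    exact toP_ext (h1.trans h2.symm)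
  | a :: w, nu, hnu, t, h => by
    classical
    by_cases h2 : Good d nu
    swap
    · exact bimW_eq_zero_of_left h2 _ t
    by_cases h1 : Good d (L + (presS n d).wt w)
    swap
    · refine bimW_mem ⊥ (fun b m => ?_) t
      rw [bimW_eq_zero_of_left h1 _ m]
      exact map_zero (cnsL L nu a w b)
    obtain ⟨m, rfl⟩ := bimW_span hnu h1 h2 t
    have hm : ∀ k ∈ Finset.range (blk (std (d := d) (L + (presS n d).wt w)) (Letter.old a)).card, m k = 0 := by
      intro k hk
      refine ev_eq_zero hz hc w _ rfl (m k) fun ys hys => ?_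
      set N := (blk (std (d := d) (L + (presS n d).wt w)) (Letter.old a)).card with hN
      have hw := hc.col (D := d) hys
      have hcard : (blk (col c w ys) (Letter.old a)).card = N :=
        card_blk_eq hw (std_hasWt h1) (Letter.old_lt a)
      let f : Polynomial K := ∑ k ∈ Finset.range N,
        Polynomial.C (ev z c L (L + (presS n d).wt w) w (m k) ys) * Polynomial.X ^ k
      have hf : f = 0 := by
        refine Polynomial.eq_zero_of_natDegree_lt_card_of_eval_eq_zero' f
          ((blk (col c w ys) (Letter.old a)).image z) ?_ ?_
        · intro x hx
          obtain ⟨y, hy, rfl⟩ := Finset.mem_image.1 hx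
          rw [mem_blk] at hy
          have h3 := h (y :: ys) ⟨hys, hy⟩
          rw [map_sum, Finset.sum_apply] at h3
          simp only [f, Polynomial.eval_finset_sum, Polynomial.eval_mul, Polynomial.eval_C,
            Polynomial.eval_pow, Polynomial.eval_X]
          rw [← h3]
          refine Finset.sum_congr rfl fun k _ => ?_
          rw [ev_cns_lv hnu hc k (m k) (y := y) (ys := ys) ⟨hys, hy⟩, mul_comm]
        · rw [Finset.card_image_of_injective _ hz.injective, hcard]
          have hpos : 0 < N := by have := Finset.mem_range.1 hk; omega
          refine lt_of_le_of_lt (Polynomial.natDegree_sum_le_of_forall_le (n := N - 1) _ _ fun k hk => ?_) (by omega)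
          refine (Polynomial.natDegree_C_mul_X_pow_le _ _).trans ?_
          have := Finset.mem_range.1 hk; omega
      have := congrArg (fun g => Polynomial.coeff g k) hf
      simp only [f, Polynomial.finset_sum_coeff, Polynomial.coeff_C_mul_X_pow, Polynomial.coeff_zero] at this
      rw [Finset.sum_ite_eq, if_pos hk] at this
      exact this
    refine Finset.sum_eq_zero fun k hk => ?_
    rw [hm k hk]
    exact map_zero (cnsL L nu a w _)

/-- The realizations determine the elements of the bimodules. -/
theorem ev_ext (hz : Generic z) {w : SSeq n} (hnu : nu = L + (presS n d).wt w) {t t' : bimW d L nu w}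
    (h : ∀ c ys, HasWt c L → Valid c w ys → ev z c L nu w t ys = ev z c L nu w t' ys) : t = t' := by
  by_cases hL : Good d L
  · rw [← sub_eq_zero]
    refine ev_eq_zero hz (std_hasWt hL) w nu hnu _ fun ys hys => ?_
    rw [map_sub, Pi.sub_apply, h _ ys (std_hasWt hL) hys, sub_self]
  · rw [bimW_eq_zero_of_right hL w t, bimW_eq_zero_of_right hL w t']

end

end Eval

end Schur


namespace Schur

open CategoryTheory MvPolynomial

/-! ### The bimodule maps of the generators -/

section Realize

variable {n d : ℕ} {L nu nu' : Fin n → ℤ}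

noncomputable section

/-- The diagram `x` sends `t` to `t'`. -/
def Realizes (x : Alg n) {w w' : SSeq n} (t : bimW d L nu w) (t' : bimW d L nu' w') : Prop :=
  ∀ (K : Type) [Field K] [CharZero K] (z : Fin d → K), Function.Injective z → ∀ c : Fin d → ℕ,
    HasWt c L → ∀ ys, Valid c w' ys → ev z c L nu' w' t' ys = rho z c x (ev z c L nu w t) ys

theorem Realizes.unique {x x' : Alg n} {w w' : SSeq n} {t : bimW d L nu w} {t' t'' : bimW d L nu' w'}
    (h : Realizes x t t') (h' : Realizes x' t t'') (hx : x - x' ∈ (presS n d).ker L w w')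
    (hnu : nu' = L + (presS n d).wt w') : t' = t'' := by
  obtain ⟨K, _, _, z, hz⟩ := exists_generic d
  refine ev_ext hz hnu fun c ys hc hys => ?_
  rw [h K z hz.injective c hc ys hys, h' K z hz.injective c hc ys hys, ← sub_eq_zero,
    ← rho_ker hz.injective hx hc hys (ev z c L nu w t), rho_sub]
  rfl

theorem Realizes.zero (x : Alg n) {w w' : SSeq n} :
    Realizes x (0 : bimW d L nu w) (0 : bimW d L nu' w') := by
  intro K _ _ z hz c hc ys hys
  rw [map_zero, map_zero, map_zero]

theorem Realizes.add {x : Alg n} {w w' : SSeq n} {s t : bimW d L nu w} {s' t' : bimW d L nu' w'}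
    (h : Realizes x s s') (h' : Realizes x t t') : Realizes x (s + t) (s' + t') := by
  intro K _ _ z hz c hc ys hys
  rw [map_add, map_add, map_add, Pi.add_apply, Pi.add_apply, h K z hz c hc ys hys, h' K z hz c hc ys hys]

theorem Realizes.smul {x : Alg n} {w w' : SSeq n} {t : bimW d L nu w} {t' : bimW d L nu' w'} (q : ℚ)
    (h : Realizes x t t') : Realizes x (q • t) (q • t') := by
  intro K _ _ z hz c hc ys hys
  rw [map_smul, map_smul, map_smul, Pi.smul_apply, Pi.smul_apply, h K z hz c hc ys hys]

theorem Realizes.add_diag {x y : Alg n} {w w' : SSeq n} {t : bimW d L nu w} {s' t' : bimW d L nu' w'}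
    (h : Realizes x t s') (h' : Realizes y t t') : Realizes (x + y) t (s' + t') := by
  intro K _ _ z hz c hc ys hys
  rw [map_add, Pi.add_apply, h K z hz c hc ys hys, h' K z hz c hc ys hys, rho_add]; rfl

theorem Realizes.smul_diag {x : Alg n} {w w' : SSeq n} {t : bimW d L nu w} {t' : bimW d L nu' w'}
    (q : ℚ) (h : Realizes x t t') : Realizes (q • x) t (q • t') := by
  intro K _ _ z hz c hc ys hys
  rw [map_smul, Pi.smul_apply, h K z hz c hc ys hys, rho_smul]; rfl

theorem Realizes.zero_diag {w w' : SSeq n} (t : bimW d L nu w) :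
    Realizes 0 t (0 : bimW d L nu' w') := by
  intro K _ _ z hz c hc ys hys
  rw [map_zero, rho_zero]; rfl

theorem Realizes.one {w : SSeq n} (t : bimW d L nu w) : Realizes 1 t t := by
  intro K _ _ z hz c hc ys hys
  rw [rho_one]; rfl

theorem Realizes.mul {nu'' : Fin n → ℤ} {x y : Alg n} {w w' w'' : SSeq n} {t : bimW d L nu w}
    {t' : bimW d L nu' w'} {t'' : bimW d L nu'' w''} (hy : y ∈ (presS n d).dia L w' w'')
    (h : Realizes x t t') (h' : Realizes y t' t'') : Realizes (x * y) t t'' := by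
  intro K _ _ z hz c hc ys hys
  rw [h' K z hz c hc ys hys, rho_mul]
  refine (rho_congr z hy hys (a := 1) fun l hl _ => ?_).trans (one_mul _)
  rw [h K z hz c hc l hl, one_mul]

/-- The elements `b` and `b'` of bimodules for equal weights are equal. -/
def Same {lam lam' mu mu' : Fin n → ℤ} (b : bimB d lam mu) (b' : bimB d lam' mu') : Prop :=
  ∀ (K : Type) [Field K] [CharZero K] (z : Fin d → K) (c c' : Fin d → ℕ),
    bv z c c' lam mu b = bv z c c' lam' mu' b'

theorem exists_same {lam lam' mu mu' : Fin n → ℤ} (h : lam = lam') (h' : mu = mu')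
    (b : bimB d lam mu) : ∃ b' : bimB d lam' mu', Same b b' := by
  subst h h'; exact ⟨b, fun _ _ _ _ _ _ => rfl⟩

theorem same_ofB {lam lam' mu mu' : Fin n → ℤ} (h : lam = lam') (h' : mu = mu') (p : Poly d) :
    Same (ofB p : bimB d lam mu) (ofB p : bimB d lam' mu') := by
  subst h h'; exact fun _ _ _ _ _ _ => rfl

theorem Realizes.cons {x : Alg n} {w w' : SSeq n} (hx : x ∈ (presS n d).dia L w w')
    {m : bimW d L (L + (presS n d).wt w) w} {m' : bimW d L (L + (presS n d).wt w') w'}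
    (h : Realizes x m m') (a : Letter n) {b : bimB d (L + (presS n d).wt w) nu}
    {b' : bimB d (L + (presS n d).wt w') nu'} (hb : Same b b') :
    Realizes (whisk [a] [] x) (cnsB a w b m) (cnsB a w' b' m') := by
  intro K _ _ z hz c hc ys hys
  rcases ys with _ | ⟨y, ys⟩
  · exact (valid_cons_nil hys).elim
  have e := rho_whisk z (c := c) hx (u := [a]) (v := []) (xu := [y]) (ys := ys) (xv := []) rfl
    hys.1.length_eq rfl (ev z c L nu (a :: w) (cnsB a w b m))
  simp only [List.append_nil, List.singleton_append, col_nil] at e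
  rw [e, ev_cnsB_of _ _ hys, h K z hz c hc ys hys.1, ← hb]
  symm
  refine rho_congr z hx hys.1 fun l hl hcol => ?_
  have hv : Valid c (a :: w) (y :: l) := ⟨hl, by rw [hcol]; exact hys.2⟩
  rw [ev_cnsB_of _ _ hv, col_cons, col_cons, hcol]

theorem rho_lay_cons {K : Type} [Field K] [CharZero K] (z : Fin d → K) (c : Fin d → ℕ) (g : Gen n)
    (v : SSeq n) (F : List (Fin d) → K) {ys : List (Fin d)} (hys : Valid c (g.tgt ++ v) ys) :
    ∃ l xv, ys = l ++ xv ∧ Valid c v xv ∧ Valid (col c v xv) g.tgt l ∧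
      rho z c (lay [] g v) F ys = genop z g (col c v xv) (fun l => F (l ++ xv)) l := by
  obtain ⟨l, xv, rfl, h1, h2, h3⟩ := hys.split
  exact ⟨l, xv, rfl, h2, h3, rho_lay_apply z c (u := []) g v F (xu := []) xv rfl h1⟩

/-- A dot. -/
theorem realizes_dot (a : Letter n) (v : SSeq n) (hnu : nu = L + (presS n d).wt (a :: v)) (p : Poly d)
    (m : bimW d L (L + (presS n d).wt v) v) :
    Realizes (lay [] (.dot a) v) (cns (nu := nu) a v p m)
      (cns (nu := nu) a v (lv (L + (presS n d).wt v) a * p) m) := by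
  intro K _ _ z hz c hc ys hys
  obtain ⟨l, xv, rfl, h2, h3, e⟩ := rho_lay_cons z c (.dot a) v (ev z c L nu _ (cns a v p m)) hys
  obtain ⟨y, rfl⟩ := List.length_eq_one_iff.1 h3.length_eq
  rw [e, genop_dot]
  change ev z c L nu (a :: v) _ (y :: xv) = z y * ev z c L nu (a :: v) _ (y :: xv)
  have hys' : Valid c (a :: v) (y :: xv) := hys
  obtain ⟨τ, hs⟩ := hys'.hasWt_cons hc hnu
  obtain ⟨σ, h4, h5⟩ := hs.exists_perm (hc.col (D := d) h2) hys'.2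
  rw [cns, cns, ev_cnsB_of _ _ hys', ev_cnsB_of _ _ hys', hs.bv h4 h5 (col_cons c a v y xv),
    hs.bv h4 h5 (col_cons c a v y xv), ← mul_assoc]
  congr 1
  have h0 : toP (0 : bimB d (L + (presS n d).wt v) nu) = 0 := by rw [← toPL_eq, map_zero]
  have hlv := hs.lv_eq
  by_cases hp : ∀ σ, Young d (L + (presS n d).wt v) σ ∧ Young d nu σ → rename σ p = p
  · have hp' : ∀ ρ : Equiv.Perm (Fin d), std (L + (presS n d).wt v) ∘ ρ = std (L + (presS n d).wt v) →
        ρ τ = τ → rename ρ p = p := fun ρ h h' =>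
      hp ρ ⟨(young_iff hs.good ρ).2 h, (young_iff hs.good' ρ).2 ((hs.stab h).2 h')⟩
    rw [hs.toP_ofB hp', hs.toP_ofB (fun ρ h h' => by rw [hlv, map_mul, hp' ρ h h', rename_X, h'])]
    rw [hlv, map_mul, aeval_X, Function.comp_apply, h5]
  · have hp' : ¬ ∀ σ, Young d (L + (presS n d).wt v) σ ∧ Young d nu σ →
        rename σ (lv (L + (presS n d).wt v) a * p) = lv (L + (presS n d).wt v) a * p := by
      intro h; apply hp
      intro σ hσ
      have h6 := h σ hσ
      have h7 : σ τ = τ := (hs.stab ((young_iff hs.good σ).1 hσ.1)).1 ((young_iff hs.good' σ).1 hσ.2)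
      rw [hlv, map_mul, rename_X, h7] at h6
      exact mul_left_cancel₀ (X_ne_zero τ) h6
    have e1 : (ofB p : bimB d (L + (presS n d).wt v) nu) = 0 := dif_neg hp
    have e2 : (ofB (lv (L + (presS n d).wt v) a * p) : bimB d (L + (presS n d).wt v) nu) = 0 :=
      dif_neg hp'
    rw [e1, e2, h0]; simp

theorem ev_cns2 {K : Type} [Field K] [CharZero K] {z : Fin d → K} {c : Fin d → ℕ} (hc : HasWt c L)
    {p q : Letter n} {v : SSeq n} (hnu : nu = L + (presS n d).wt (p :: q :: v))
    (Q : MvPolynomial (Fin 2) ℚ) (m : bimW d L (L + (presS n d).wt v) v) {x y : Fin d}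
    {ys : List (Fin d)} (h : Valid c (p :: q :: v) (x :: y :: ys)) :
    ev z c L nu (p :: q :: v) (cns2 p q v Q m) (x :: y :: ys) =
      aeval ![z x, z y] Q * ev z c L (L + (presS n d).wt v) v m ys := by
  rw [cns2, map_sum, Finset.sum_apply, aeval_def, eval₂_eq', Finset.sum_mul]
  refine Finset.sum_congr rfl fun s _ => ?_
  rw [map_smul, Pi.smul_apply, ev_cns_lv hnu hc _ _ h, ev_cns_lv rfl hc _ _ h.1, Fin.prod_univ_two,
    Algebra.smul_def]
  simp only [Matrix.cons_val_zero, Matrix.cons_val_one]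
  ring

theorem aeval_crossPoly {K : Type} [Field K] [CharZero K] (b : Bool) {i j : Fin (n - 1)} (h : i ≠ j)
    (Q : MvPolynomial (Fin 2) ℚ) (p q : K) :
    aeval ![p, q] (crossPoly b i j Q) = kap b i j p q * aeval ![q, p] Q := by
  have hs : aeval ![p, q] (swp Q) = aeval ![q, p] Q := by
    rw [swp, aeval_rename]
    congr 2
    funext t; fin_cases t <;> rfl
  rw [crossPoly, if_neg h, kap]
  split_ifs <;> simp [hs] <;> ring

/-- A crossing. -/
theorem realizes_cross (b : Bool) (i j : Fin (n - 1)) (v : SSeq n)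
    (hnu : nu = L + (presS n d).wt ((b, i) :: (b, j) :: v)) (Q : MvPolynomial (Fin 2) ℚ)
    (m : bimW d L (L + (presS n d).wt v) v) :
    Realizes (lay [] (.cross b i j) v) (cns2 (nu := nu) (b, i) (b, j) v Q m)
      (cns2 (nu := nu) (b, j) (b, i) v (crossPoly b i j Q) m) := by
  have hnu' : nu = L + (presS n d).wt ((b, j) :: (b, i) :: v) := by
    rw [hnu, wt_cons d L (b, i), wt_cons d L (b, j) v, wt_cons d L (b, j) (_ :: v),
      wt_cons d L (b, i) v]
    abel
  intro K _ _ z hz c hc ys hys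
  obtain ⟨l, xv, rfl, h2, h3, e⟩ := rho_lay_cons z c (.cross b i j) v
    (ev z c L nu _ (cns2 (b, i) (b, j) v Q m)) hys
  obtain ⟨x, y, rfl⟩ := List.length_eq_two.1 h3.length_eq
  rw [e, genop_cross]
  change ev z c L nu ((b, j) :: (b, i) :: v) _ (x :: y :: xv) = _
  change Valid c ((b, j) :: (b, i) :: v) (x :: y :: xv) at hys
  rw [ev_cns2 hc hnu' _ _ hys]
  have hswap : x ≠ y → Valid c ((b, i) :: (b, j) :: v) (y :: x :: xv) := by
    intro hxy
    obtain ⟨⟨g1, g2⟩, g3⟩ := hys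
    rw [col_cons, Function.update_of_ne hxy] at g3
    exact ⟨⟨g1, g3⟩, by rw [col_cons, Function.update_of_ne hxy.symm]; exact g2⟩
  by_cases hij : i = j
  · subst hij
    have hxy : x ≠ y := by
      rintro rfl
      obtain ⟨⟨g1, g2⟩, g3⟩ := hys
      rw [col_cons, Function.update_self] at g3
      exact Letter.old_ne_new _ g3.symm
    rw [if_pos rfl]
    change _ = _ * ((ev z c L nu ((b, i) :: (b, i) :: v) _ (x :: y :: xv) -
      ev z c L nu ((b, i) :: (b, i) :: v) _ (y :: x :: xv)) / _)
    rw [ev_cns2 hc hnu _ _ hys, ev_cns2 hc hnu _ _ (hswap hxy), crossPoly, if_pos rfl]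
    have hs : (![z x, z y] : Fin 2 → K) ∘ Equiv.swap 0 1 = ![z y, z x] := by
      funext t; fin_cases t <;> rfl
    have hs' : (![z x, z y] : Fin 2 → K) ∘ Equiv.swap 1 0 = ![z y, z x] := by
      funext t; fin_cases t <;> rfl
    have hne := hz.ne hxy
    cases b
    · simp only [Bool.false_eq_true, if_false]
      rw [aeval_dd _ (by simpa using hne.symm), hs']
      simp only [Matrix.cons_val_zero, Matrix.cons_val_one]
      have g1 := sub_ne_zero.2 hne
      rw [show z y - z x = - (z x - z y) by ring]
      field_simp
    · simp only [if_true]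
      rw [aeval_dd _ (by simpa using hne), hs]
      simp only [Matrix.cons_val_zero, Matrix.cons_val_one]
      ring
  · rw [if_neg hij, aeval_crossPoly b hij]
    change _ = _ * ev z c L nu ((b, i) :: (b, j) :: v) _ (y :: x :: xv)
    by_cases hxy : x = y
    · subst hxy
      have : kap b i j (z x) (z x) = 0 := by
        obtain ⟨⟨g1, g2⟩, g3⟩ := hys
        rw [col_cons, Function.update_self] at g3
        cases b <;> simp [Letter.old, Letter.new, kap] at g3 ⊢ <;> omega
      rw [this]; ring
    · rw [ev_cns2 hc hnu _ _ (hswap hxy)]; ring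

/-- `∏ (a - z_t)` in terms of elementary symmetric functions. -/
theorem sum_coeff_eSer {K : Type} [Field K] (z : Fin d → K) (S : Finset (Fin d)) (a : K) :
    ∑ l ∈ Finset.range (S.card + 1), PowerSeries.coeff l (eSer z S) * a ^ (S.card - l) =
      ∏ t ∈ S, (a - z t) := by
  have h : ∀ t ∈ S, a - z t = - z t + a := fun t _ => by ring
  rw [Finset.prod_congr rfl h, Finset.prod_add, Finset.sum_powerset]
  refine Finset.sum_congr rfl fun l _ => ?_
  rw [coeff_eSer, mul_assoc, Finset.sum_mul, Finset.mul_sum]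
  refine Finset.sum_congr rfl fun T hT => ?_
  rw [Finset.mem_powersetCard] at hT
  rw [Finset.prod_const, Finset.card_sdiff_of_subset hT.1, hT.2, Finset.prod_neg, hT.2]
  ring

theorem bv_eB_right {K : Type} [Field K] [CharZero K] {z : Fin d → K} {lam mu : Fin n → ℤ}
    {a : Letter n} {τ : Fin d} (hs : IsStep lam mu a τ) {c c' : Fin d → ℕ} (hc : HasWt c lam)
    {y : Fin d} (hy : c y = Letter.old a) (hc' : c' = Function.update c y (Letter.new a)) (i l : ℕ) :
    bv z c c' lam mu (ofB (eB lam i l)) = (-1) ^ l * PowerSeries.coeff l (eSer z (blk c i)) := by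
  obtain ⟨σ, h1, h2⟩ := hs.exists_perm hc hy
  rw [hs.bv h1 h2 hc', hs.toP_ofB fun ρ h _ => eB_inv hs.good i l h, aeval_eB hs.good h1]

theorem bv_eB_left {K : Type} [Field K] [CharZero K] {z : Fin d → K} {lam mu mu' : Fin n → ℤ} (hmu : mu' = mu)
    {a : Letter n} {τ : Fin d} (hs : IsStep lam mu a τ) {c c' : Fin d → ℕ} (hc : HasWt c lam)
    {y : Fin d} (hy : c y = Letter.old a) (hc' : c' = Function.update c y (Letter.new a)) (i l : ℕ) :
    bv z c c' lam mu (ofB (eB mu' i l)) = (-1) ^ l * PowerSeries.coeff l (eSer z (blk c' i)) := by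
  subst hmu
  obtain ⟨σ, h1, h2⟩ := hs.exists_perm hc hy
  have h3 := hs.comp_upd h1 h2 hc'
  rw [bv_eq h1 h3, Schur.toP_ofB hs.good hs.good' fun ρ _ h => eB_inv hs.good' i l h,
    aeval_eB hs.good' h3]

end

end Realize

end Schur


namespace Schur

open CategoryTheory MvPolynomial

section CupCap

variable {n d : ℕ} {L nu nu' : Fin n → ℤ}

noncomputable section

theorem wt_pair (D : ℕ) (L : Fin n → ℤ) (b : Bool) (i : Fin (n - 1)) (v : SSeq n) :
    L + (presS n D).wt ((b, i) :: (!b, i) :: v) = L + (presS n D).wt v := by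
  rw [wt_cons D L (b, i), wt_cons D L (!b, i) v, wt_letter, wt_letter]
  cases b <;> simp

theorem wt_dn_up (D : ℕ) (L : Fin n → ℤ) (i : Fin (n - 1)) (v : SSeq n) :
    L + (presS n D).wt (dn i :: up i :: v) = L + (presS n D).wt v := wt_pair D L false i v

theorem wt_up_dn (D : ℕ) (L : Fin n → ℤ) (i : Fin (n - 1)) (v : SSeq n) :
    L + (presS n D).wt (up i :: dn i :: v) = L + (presS n D).wt v := wt_pair D L true i v

/-- The right cup. -/
theorem realizes_rcup (i : Fin (n - 1)) (v : SSeq n) (hnu : nu = L + (presS n d).wt v)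
    (m : bimW d L (L + (presS n d).wt v) v) :
    Realizes (lay [] (.rcup i) v) m
      (∑ l ∈ Finset.range ((en (L + (presS n d).wt v) i.val).toNat + 1), (-1 : ℚ) ^ l •
        cns (nu := nu) (dn i) (up i :: v) (eB (L + (presS n d).wt v) i.val l)
          (cns (up i) v (lv (L + (presS n d).wt v) (up i) ^
            ((en (L + (presS n d).wt v) i.val).toNat - l)) m)) := by
  have hnu' : nu = L + (presS n d).wt (dn i :: up i :: v) := by rw [hnu, wt_dn_up]
  have hi : i.val < n := by have := i.isLt; omega
  intro K _ _ z hz c hc ys hys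
  obtain ⟨l, xv, rfl, h2, h3, e⟩ := rho_lay_cons z c (.rcup i) v (ev z c L _ _ m) hys
  obtain ⟨x, y, rfl⟩ := List.length_eq_two.1 h3.length_eq
  rw [e, genop_rcup]
  change Valid c (dn i :: up i :: v) (x :: y :: xv) at hys
  have hw := hc.col (D := d) h2
  have hw2 := hc.col (D := d) hys
  have hw1 := hc.col (D := d) hys.1
  obtain ⟨τ, hs⟩ := hys.hasWt_cons hc hnu'
  set N := (en (L + (presS n d).wt v) i.val).toNat with hN
  have hcard : (blk (col c (dn i :: up i :: v) (x :: y :: xv)) i.val).card = N := by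
    rw [wt_dn_up] at hw2
    rw [hN, hw2.en hi]; simp
  rw [map_sum, Finset.sum_apply]
  have hterm : ∀ l, ev z c L nu (dn i :: up i :: v) ((-1 : ℚ) ^ l •
        cns (nu := nu) (dn i) (up i :: v) (eB (L + (presS n d).wt v) i.val l)
          (cns (up i) v (lv (L + (presS n d).wt v) (up i) ^ (N - l)) m)) (x :: y :: xv) =
      PowerSeries.coeff l (eSer z (blk (col c (dn i :: up i :: v) (x :: y :: xv)) i.val)) *
        z y ^ (N - l) * ev z c L (L + (presS n d).wt v) v m xv := by
    intro l
    rw [map_smul, Pi.smul_apply, cns, ev_cnsB_of _ _ hys, ev_cns_lv rfl hc _ _ hys.1,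
      bv_eB_left hnu.symm hs hw1 hys.2 (col_cons _ _ _ _ _), Algebra.smul_def, map_pow, map_neg, map_one]
    have : ((-1 : K) ^ l) * (-1) ^ l = 1 := by rw [← mul_pow]; simp
    rw [← mul_assoc, ← mul_assoc, ← mul_assoc, this]
    ring
  have hsum := sum_coeff_eSer z (blk (col c (dn i :: up i :: v) (x :: y :: xv)) i.val) (z y)
  rw [hcard] at hsum
  refine (Finset.sum_congr rfl fun l _ => hterm l).trans ?_
  rw [← Finset.sum_mul, hsum]
  obtain ⟨⟨g1, g2⟩, g3⟩ := hys
  by_cases hxy : x = y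
  · subst hxy
    have : col c (dn i :: up i :: v) (x :: x :: xv) = col c v xv := update_update_self g2
    rw [if_pos rfl, this]; rfl
  · rw [if_neg hxy, Finset.prod_eq_zero (i := y), zero_mul]
    · rw [mem_blk, col_cons, Function.update_of_ne (Ne.symm hxy), col_cons, Function.update_self]; rfl
    · simp

/-- The left cup. -/
theorem realizes_lcup (i : Fin (n - 1)) (v : SSeq n) (hnu : nu = L + (presS n d).wt v)
    (m : bimW d L (L + (presS n d).wt v) v) :
    Realizes (lay [] (.lcup i) v) m
      (∑ l ∈ Finset.range ((en (L + (presS n d).wt v) (i.val + 1)).toNat + 1), (-1 : ℚ) ^ l •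
        cns (nu := nu) (up i) (dn i :: v) (lv (L + (presS n d).wt (dn i :: v)) (up i) ^ l)
          (cns (dn i) v (eB (L + (presS n d).wt v) (i.val + 1)
            ((en (L + (presS n d).wt v) (i.val + 1)).toNat - l)) m)) := by
  have hnu' : nu = L + (presS n d).wt (up i :: dn i :: v) := by rw [hnu, wt_up_dn]
  have hi : i.val + 1 < n := by have := i.isLt; omega
  intro K _ _ z hz c hc ys hys
  obtain ⟨l, xv, rfl, h2, h3, e⟩ := rho_lay_cons z c (.lcup i) v (ev z c L _ _ m) hys
  obtain ⟨x, y, rfl⟩ := List.length_eq_two.1 h3.length_eq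
  rw [e, genop_lcup]
  change Valid c (up i :: dn i :: v) (x :: y :: xv) at hys
  have hw := hc.col (D := d) h2
  obtain ⟨τ, hs⟩ := hys.1.hasWt_cons hc rfl
  set N := (en (L + (presS n d).wt v) (i.val + 1)).toNat with hN
  have hcard : (blk (col c v xv) (i.val + 1)).card = N := by
    rw [hN, hw.en hi]; simp
  rw [map_sum, Finset.sum_apply]
  have hterm : ∀ l ∈ Finset.range (N + 1), ev z c L nu (up i :: dn i :: v) ((-1 : ℚ) ^ l •
        cns (nu := nu) (up i) (dn i :: v) (lv (L + (presS n d).wt (dn i :: v)) (up i) ^ l)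
          (cns (dn i) v (eB (L + (presS n d).wt v) (i.val + 1) (N - l)) m)) (x :: y :: xv) =
      PowerSeries.coeff (N - l) (eSer z (blk (col c v xv) (i.val + 1))) *
        z x ^ l * ((-1) ^ N * ev z c L (L + (presS n d).wt v) v m xv) := by
    intro l hl
    rw [map_smul, Pi.smul_apply, ev_cns_lv hnu' hc _ _ hys, cns, ev_cnsB_of _ _ hys.1,
      bv_eB_right hs hw hys.1.2 (col_cons _ _ _ _ _), Algebra.smul_def, map_pow, map_neg, map_one]
    have hN' : (-1 : K) ^ N = (-1) ^ l * (-1) ^ (N - l) := by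
      rw [← pow_add, Nat.add_sub_cancel' (by simp at hl; omega)]
    rw [hN']
    ring
  have hsum := sum_coeff_eSer z (blk (col c v xv) (i.val + 1)) (z x)
  rw [hcard, ← Finset.sum_range_reflect] at hsum
  refine (Finset.sum_congr rfl hterm).trans ?_
  rw [← Finset.sum_mul]
  have hsum' : ∑ l ∈ Finset.range (N + 1), PowerSeries.coeff (N - l)
      (eSer z (blk (col c v xv) (i.val + 1))) * z x ^ l = ∏ t ∈ blk (col c v xv) (i.val + 1), (z x - z t) := by
    rw [← hsum]
    refine Finset.sum_congr rfl fun l hl => ?_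
    have : l < N + 1 := Finset.mem_range.1 hl
    rw [show N + 1 - 1 - l = N - l by omega, show N - (N - l) = l by omega]
  rw [hsum', ← mul_assoc, mul_comm (∏ t ∈ _, _), ← hcard, ← Finset.prod_neg]
  simp only [neg_sub]
  obtain ⟨⟨g1, g2⟩, g3⟩ := hys
  by_cases hxy : x = y
  · subst hxy
    rw [if_pos rfl]; rfl
  · rw [if_neg hxy, Finset.prod_eq_zero (i := x), zero_mul]
    · rw [col_cons, Function.update_of_ne hxy] at g3
      rw [mem_blk, g3]; rfl
    · simp

theorem dd_zero {σ : Type} [DecidableEq σ] {x y : σ} (h : x ≠ y) :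
    dd x y (0 : MvPolynomial σ ℚ) = 0 := by
  have h1 := dd_mul x y (0 : MvPolynomial σ ℚ)
  rw [map_zero, sub_zero] at h1
  refine (mul_eq_zero.1 h1).resolve_right (sub_ne_zero.2 fun e => h (X_injective e))

theorem foldr_zero {α : Type} (D : α → Poly d → Poly d) (us : List α)
    (h : ∀ u ∈ us, D u 0 = 0) : us.foldr D 0 = 0 := by
  induction us with
  | nil => rfl
  | cons u us ih =>
    rw [List.foldr_cons, ih fun u hu => h u (by simp [hu]), h u (by simp)]

theorem tr_zero (mu : Fin n → ℤ) (a : Letter n) : tr (d := d) mu a 0 = 0 := by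
  obtain ⟨b, i⟩ := a
  cases b
  · change capR mu i.val 0 = 0
    unfold capR
    refine Finset.sum_eq_zero fun x _ => ?_
    split_ifs with hx
    · refine foldr_zero _ _ fun u hu => dd_zero ?_
      rintro rfl
      simp at hu; omega
    · rfl
  · change capL mu i.val 0 = 0
    unfold capL
    refine Finset.sum_eq_zero fun x _ => ?_
    split_ifs with hx
    · refine foldr_zero _ _ fun u hu => dd_zero ?_
      rintro rfl
      simp at hu; omega
    · rfl

theorem rv_ofR_tr {K : Type} [Field K] [CharZero K] {z : Fin d → K} (hz : Function.Injective z)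
    {lam mu : Fin n → ℤ} {c : Fin d → ℕ} (hc : HasWt c mu) (a : Letter n)
    (hlam : lam = mu + (presS n d).wt [a]) (b : bimB d lam mu) (b' : bimB d mu lam) :
    rv z c mu (ofR (tr mu a (toP b * toP b'))) = ∑ y ∈ blk c (Letter.old a),
      bv z (Function.update c y (Letter.new a)) c lam mu b *
        bv z c (Function.update c y (Letter.new a)) mu lam b' /
          ∏ u ∈ (blk c (Letter.old a)).erase y, (eps a * (z y - z u)) := by
  obtain ⟨σ, hσ⟩ := hc.exists_perm
  by_cases hl : Good d lam
  · obtain ⟨τ, hs⟩ := exists_step d a hlam hc.good hl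
    have hp : ∀ ρ : Equiv.Perm (Fin d), std mu ∘ ρ = std mu → ρ τ = τ →
        rename ρ (toP b * toP b') = toP b * toP b' := fun ρ h h' => by
      rw [map_mul, hs.toP_inv b' h h', toP_inv b ((hs.stab h).2 h') h]
    rw [rv_eq hσ, polR_ofR hc.good fun ρ hρ => tr_inv hc.good a hs.pos hs.old hp hρ]
    refine aeval_tr hc.good a hs.pos hs.old hp hz hσ (fun y =>
      bv z (Function.update c y (Letter.new a)) c lam mu b *
        bv z c (Function.update c y (Letter.new a)) mu lam b') fun y hy σ' h1 h2 => ?_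
    rw [map_mul, bv_eq (hs.comp_upd h1 h2 rfl) h1, bv_eq h1 (hs.comp_upd h1 h2 rfl)]
  · have hb : b' = 0 := toP_not (fun h => hl h.2) b'
    have h0 : toP (0 : bimB d mu lam) = 0 := by rw [← toPL_eq, map_zero]
    rw [hb, h0, mul_zero, tr_zero, rv_eq hσ, polR_ofR hc.good fun ρ _ => map_zero _, map_zero]
    simp

/-- The caps. -/
theorem ev_cap {K : Type} [Field K] [CharZero K] {z : Fin d → K} {c : Fin d → ℕ} {a a' : Letter n}
    {v : SSeq n} (h1 : Letter.old a' = Letter.new a) (h2 : Letter.new a' = Letter.old a)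
    (b : bimB d (L + (presS n d).wt (a :: v)) nu) (b' : bimB d (L + (presS n d).wt v) (L + (presS n d).wt (a :: v)))
    (m : bimW d L (L + (presS n d).wt v) v) {ys : List (Fin d)} (hys : Valid c v ys) {x : Fin d}
    (hx : x ∈ blk (col c v ys) (Letter.old a)) :
    ev z c L nu (a' :: a :: v) (cnsB a' (a :: v) b (cnsB a v b' m)) ([x, x] ++ ys) =
      bv z (Function.update (col c v ys) x (Letter.new a)) (col c v ys) (L + (presS n d).wt (a :: v)) nu b *
        bv z (col c v ys) (Function.update (col c v ys) x (Letter.new a)) (L + (presS n d).wt v)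
          (L + (presS n d).wt (a :: v)) b' * ev z c L (L + (presS n d).wt v) v m ys := by
  rw [mem_blk] at hx
  have hv1 : Valid c (a :: v) (x :: ys) := ⟨hys, hx⟩
  have hv : Valid c (a' :: a :: v) (x :: x :: ys) := ⟨hv1, by rw [col_cons, Function.update_self, h1]⟩
  change ev z c L nu (a' :: a :: v) _ (x :: x :: ys) = _
  rw [ev_cnsB_of _ _ hv, ev_cnsB_of _ _ hv1, ← mul_assoc]
  congr 3
  simp only [col_cons, h2]
  rw [update_update_self hx]

/-- The left cap. -/
theorem realizes_lcap (i : Fin (n - 1)) (v : SSeq n)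
    (b : bimB d (L + (presS n d).wt (up i :: v)) (L + (presS n d).wt v))
    (b' : bimB d (L + (presS n d).wt v) (L + (presS n d).wt (up i :: v)))
    (m : bimW d L (L + (presS n d).wt v) v) :
    Realizes (lay [] (.lcap i) v) (cnsB (dn i) (up i :: v) b (cnsB (up i) v b' m))
      ((bimW d L (L + (presS n d).wt v) v).l
        (ofR (capL (L + (presS n d).wt v) i.val (toP b * toP b'))) m) := by
  intro K _ _ z hz c hc ys hys
  obtain ⟨l, xv, rfl, h2, h3, e⟩ := rho_lay_cons z c (.lcap i) v
    (ev z c L _ _ (cnsB (dn i) (up i :: v) b (cnsB (up i) v b' m))) hys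
  obtain rfl := List.length_eq_zero_iff.1 h3.length_eq
  rw [e, genop_lcap]
  have hr := rv_ofR_tr hz (hc.col (D := d) h2) (up i) (wt_cons d L (up i) v) b b'
  refine (ev_l v _ m xv).trans ?_
  refine (congrArg (· * _) hr).trans ?_
  rw [Finset.sum_mul]
  refine Finset.sum_congr rfl fun x hx => ?_
  rw [div_mul_eq_mul_div]
  congr 1
  · exact (ev_cap rfl rfl b b' m h2 hx).symm
  · refine Finset.prod_congr rfl fun u _ => ?_
    simp [eps, up]

/-- The right cap. -/
theorem realizes_rcap (i : Fin (n - 1)) (v : SSeq n)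
    (b : bimB d (L + (presS n d).wt (dn i :: v)) (L + (presS n d).wt v))
    (b' : bimB d (L + (presS n d).wt v) (L + (presS n d).wt (dn i :: v)))
    (m : bimW d L (L + (presS n d).wt v) v) :
    Realizes (lay [] (.rcap i) v) (cnsB (up i) (dn i :: v) b (cnsB (dn i) v b' m))
      ((bimW d L (L + (presS n d).wt v) v).l
        (ofR (capR (L + (presS n d).wt v) i.val (toP b * toP b'))) m) := by
  intro K _ _ z hz c hc ys hys
  obtain ⟨l, xv, rfl, h2, h3, e⟩ := rho_lay_cons z c (.rcap i) v
    (ev z c L _ _ (cnsB (up i) (dn i :: v) b (cnsB (dn i) v b' m))) hys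
  obtain rfl := List.length_eq_zero_iff.1 h3.length_eq
  rw [e, genop_rcap]
  have hr := rv_ofR_tr hz (hc.col (D := d) h2) (dn i) (wt_cons d L (dn i) v) b b'
  refine (ev_l v _ m xv).trans ?_
  refine (congrArg (· * _) hr).trans ?_
  rw [Finset.sum_mul]
  refine Finset.sum_congr rfl fun x hx => ?_
  rw [div_mul_eq_mul_div]
  congr 1
  · exact (ev_cap rfl rfl b b' m h2 hx).symm
  · refine Finset.prod_congr rfl fun u _ => ?_
    simp [eps, dn]

end

end CupCap

end Schur


namespace Schur

open CategoryTheory MvPolynomial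

/-! ### The bimodule maps of diagrams -/

section Diagrams

variable {n d : ℕ} {L nu nu' : Fin n → ℤ}

noncomputable section

/-- The elements whose image under `x` exists. -/
def realSub (x : Alg n) (L nu nu' : Fin n → ℤ) (w w' : SSeq n) : Submodule ℚ (bimW d L nu w) where
  carrier := {t | ∃ t' : bimW d L nu' w', Realizes x t t'}
  zero_mem' := ⟨0, Realizes.zero x⟩
  add_mem' := by rintro _ _ ⟨s, hs⟩ ⟨t, ht⟩; exact ⟨_, hs.add ht⟩
  smul_mem' := by rintro q _ ⟨t, ht⟩; exact ⟨_, ht.smul q⟩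

theorem wt_src_tgt (P : Pres n) (g : Gen n) : P.wt g.src = P.wt g.tgt := by
  cases g with
  | dot a => rfl
  | cross b i j => simp only [Gen.src, Gen.tgt, Pres.wt]; abel
  | rcup i => simp [Gen.src, Gen.tgt, Pres.wt, up, dn]
  | lcup i => simp [Gen.src, Gen.tgt, Pres.wt, up, dn]
  | rcap i => simp [Gen.src, Gen.tgt, Pres.wt, up, dn]
  | lcap i => simp [Gen.src, Gen.tgt, Pres.wt, up, dn]

theorem ofB_toP {lam mu : Fin n → ℤ} (b : bimB d lam mu) : ofB (toP b) = b := by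
  by_cases h : Good d lam ∧ Good d mu
  · exact toP_ext (toP_ofB h.1 h.2 fun ρ h1 h2 => toP_inv b h1 h2)
  · rw [toP_not h b]; exact toP_not h _

theorem cns2_monomial (p q : Letter n) (v : SSeq n) (k l : ℕ) (m : bimW d L (L + (presS n d).wt v) v) :
    cns2 (nu := nu) p q v (X 0 ^ k * X 1 ^ l) m = mon p q v k l m := by
  have hs : (X 0 ^ k * X 1 ^ l : MvPolynomial (Fin 2) ℚ) =
      monomial (Finsupp.single 0 k + Finsupp.single 1 l) 1 := by
    rw [X_pow_eq_monomial, X_pow_eq_monomial, monomial_mul, one_mul]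
  rw [cns2, hs, support_monomial, if_neg one_ne_zero, Finset.sum_singleton, coeff_monomial, if_pos rfl,
    one_smul]
  simp [mon]

/-- Two letters: every element is a combination of monomials in the variables of the thin edges. -/
theorem bimW_span_two {p q : Letter n} {v : SSeq n} (hnu : nu = L + (presS n d).wt (p :: q :: v))
    (S : Submodule ℚ (bimW d L nu (p :: q :: v))) (hS : ∀ k l m, mon p q v k l m ∈ S)
    (t : bimW d L nu (p :: q :: v)) : t ∈ S := by
  by_cases h2 : Good d nu
  swap
  · rw [bimW_eq_zero_of_left h2 _ t]; exact S.zero_mem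
  by_cases h1 : Good d (L + (presS n d).wt (q :: v))
  swap
  · refine bimW_mem S (fun b m => ?_) t
    rw [bimW_eq_zero_of_left h1 _ m]
    have : cnsB p (q :: v) b 0 = (0 : bimW d L nu (p :: q :: v)) := map_zero (cnsL L nu p (q :: v) b)
    rw [this]; exact S.zero_mem
  obtain ⟨m, rfl⟩ := bimW_span hnu h1 h2 t
  refine S.sum_mem fun k _ => ?_
  by_cases h0 : Good d (L + (presS n d).wt v)
  swap
  · have : m k = 0 := by
      refine (Submodule.mem_bot ℚ).1 (bimW_mem ⊥ (fun b m => ?_) (m k))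
      rw [bimW_eq_zero_of_left h0 _ m]
      exact map_zero (cnsL L _ q v b)
    rw [this]
    have : cns p (q :: v) (lv (L + (presS n d).wt (q :: v)) p ^ k) 0 = (0 : bimW d L nu (p :: q :: v)) :=
      map_zero (cnsL L nu p (q :: v) _)
    rw [this]; exact S.zero_mem
  obtain ⟨m', hm'⟩ := bimW_span rfl h0 h1 (m k)
  rw [hm', cns, ← cnsL_apply, map_sum]
  exact S.sum_mem fun l _ => hS k l (m' l)

theorem exists_realizes_gen (g : Gen n) (v : SSeq n) (hnu : nu = L + (presS n d).wt (g.src ++ v))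
    (t : bimW d L nu (g.src ++ v)) : ∃ t' : bimW d L nu (g.tgt ++ v), Realizes (lay [] g v) t t' := by
  have hnu' : nu = L + (presS n d).wt (g.tgt ++ v) := by
    rw [hnu, Pres.wt_append, Pres.wt_append, wt_src_tgt]
  cases g with
  | dot a =>
    refine bimW_mem (realSub (lay [] (.dot a) v) L nu nu (a :: v) (a :: v)) (fun b m => ?_) t
    have := realizes_dot a v hnu (toP b) m
    refine ⟨cns a v (lv (L + (presS n d).wt v) a * toP b) m, ?_⟩
    rw [cns, ofB_toP] at this
    exact this
  | cross b i j =>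
    refine bimW_span_two hnu (realSub (lay [] (.cross b i j) v) L nu nu _ ((b, j) :: (b, i) :: v))
      (fun k l m => ?_) t
    rw [← cns2_monomial]
    exact ⟨_, realizes_cross b i j v hnu _ m⟩
  | rcup i =>
    replace hnu : nu = L + (presS n d).wt v := hnu
    subst hnu
    exact ⟨_, realizes_rcup i v rfl t⟩
  | lcup i =>
    replace hnu : nu = L + (presS n d).wt v := hnu
    subst hnu
    exact ⟨_, realizes_lcup i v rfl t⟩
  | rcap i =>
    replace hnu' : nu = L + (presS n d).wt v := hnu'
    subst hnu'
    refine bimW_mem (realSub (lay [] (.rcap i) v) L _ _ (up i :: dn i :: v) v) (fun b m => ?_) t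
    exact bimW_mem ((realSub (lay [] (.rcap i) v) L _ _ (up i :: dn i :: v) v).comap
      (cnsL L _ (up i) (dn i :: v) b)) (fun b' m => ⟨_, realizes_rcap i v b b' m⟩) m
  | lcap i =>
    replace hnu' : nu = L + (presS n d).wt v := hnu'
    subst hnu'
    refine bimW_mem (realSub (lay [] (.lcap i) v) L _ _ (dn i :: up i :: v) v) (fun b m => ?_) t
    exact bimW_mem ((realSub (lay [] (.lcap i) v) L _ _ (dn i :: up i :: v) v).comap
      (cnsL L _ (dn i) (up i :: v) b)) (fun b' m => ⟨_, realizes_lcap i v b b' m⟩) m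

attribute [local irreducible] bimW

theorem exists_realizes_cons {w w' : SSeq n} {x : Alg n} (hx : x ∈ (presS n d).dia L w w')
    (hw : (presS n d).wt w = (presS n d).wt w') (h : ∀ t : bimW d L (L + (presS n d).wt w) w,
      ∃ t' : bimW d L (L + (presS n d).wt w) w', Realizes x t t') (a : Letter n)
    (t : bimW d L nu (a :: w)) : ∃ t' : bimW d L nu (a :: w'), Realizes (whisk [a] [] x) t t' := by
  refine bimW_mem (realSub (whisk [a] [] x) L nu nu (a :: w) (a :: w')) (fun b m => ?_) t
  have he : L + (presS n d).wt w = L + (presS n d).wt w' := by rw [hw]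
  obtain ⟨b', hb⟩ := exists_same he rfl b
  have hex : ∀ mu, mu = L + (presS n d).wt w' → (∃ m' : bimW d L mu w', Realizes x m m') →
      ∃ m' : bimW d L (L + (presS n d).wt w') w', Realizes x m m' := by
    rintro _ rfl h; exact h
  obtain ⟨m', hm'⟩ := hex _ he (h m)
  exact ⟨_, Realizes.cons hx hm' a hb⟩

theorem exists_realizes_lay (g : Gen n) (v u : SSeq n) : ∀ {nu : Fin n → ℤ},
    nu = L + (presS n d).wt (u ++ g.src ++ v) → ∀ t : bimW d L nu (u ++ g.src ++ v),
    ∃ t' : bimW d L nu (u ++ g.tgt ++ v), Realizes (lay u g v) t t' := by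
  induction u with
  | nil => intro nu hnu t; exact exists_realizes_gen g v hnu t
  | cons a u ih =>
    intro nu hnu t
    have e : lay (a :: u) g v = whisk [a] [] (lay u g v) := by simp
    rw [e]
    exact exists_realizes_cons (layer_mem_dia L u g v) (by simp only [Pres.wt_append, wt_src_tgt])
      (fun t => ih rfl t) a t

theorem exists_realizes {w w' : SSeq n} {x : Alg n} (hx : x ∈ (presS n d).dia L w w')
    (hnu : nu = L + (presS n d).wt w) (hnu' : nu' = L + (presS n d).wt w') (t : bimW d L nu w) :
    ∃ t' : bimW d L nu' w', Realizes x t t' := by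
  revert nu
  refine dia_induction hx (fun w x => ∀ {nu : Fin n → ℤ}, nu = L + (presS n d).wt w →
    ∀ t : bimW d L nu w, ∃ t' : bimW d L nu' w', Realizes x t t') ?_ ?_ ?_ ?_ ?_
  · rintro nu rfl t
    subst hnu'
    exact ⟨t, .one t⟩
  · rintro u g v x ⟨k, hx⟩ ih nu hnu t
    obtain ⟨s, hs⟩ := exists_realizes_lay g v u hnu t
    obtain ⟨t', ht'⟩ := ih (by rw [hnu]; simp only [Pres.wt_append, wt_src_tgt]) s
    exact ⟨t', hs.mul (Submodule.subset_span ⟨k, hx⟩) ht'⟩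
  · intro nu _ t; exact ⟨0, .zero_diag t⟩
  · intro x y h1 h2 nu hnu t
    obtain ⟨s, hs⟩ := h1 hnu t
    obtain ⟨s', hs'⟩ := h2 hnu t
    exact ⟨_, hs.add_diag hs'⟩
  · intro q x h nu hnu t
    obtain ⟨s, hs⟩ := h hnu t
    exact ⟨_, hs.smul_diag q⟩

/-- The action of combinations of diagrams on the bimodules. -/
def omD {w w' : SSeq n} (hnu : nu = L + (presS n d).wt w) (hnu' : nu' = L + (presS n d).wt w') :
    (presS n d).dia L w w' →ₗ[ℚ] bimW d L nu w →ₗ[ℚ] bimW d L nu' w' :=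
  LinearMap.mk₂ ℚ (fun x t => (exists_realizes x.2 hnu hnu' t).choose)
    (fun x y t => (exists_realizes (x + y).2 hnu hnu' t).choose_spec.unique
      ((exists_realizes x.2 hnu hnu' t).choose_spec.add_diag
        (exists_realizes y.2 hnu hnu' t).choose_spec) (by simp) hnu')
    (fun q x t => (exists_realizes (q • x).2 hnu hnu' t).choose_spec.unique
      ((exists_realizes x.2 hnu hnu' t).choose_spec.smul_diag q) (by simp) hnu')
    (fun x s t => (exists_realizes x.2 hnu hnu' (s + t)).choose_spec.unique
      ((exists_realizes x.2 hnu hnu' s).choose_spec.add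
        (exists_realizes x.2 hnu hnu' t).choose_spec) (by simp) hnu')
    (fun q x t => (exists_realizes x.2 hnu hnu' (q • t)).choose_spec.unique
      ((exists_realizes x.2 hnu hnu' t).choose_spec.smul q) (by simp) hnu')

theorem omD_spec {w w' : SSeq n} (hnu : nu = L + (presS n d).wt w)
    (hnu' : nu' = L + (presS n d).wt w') (x : (presS n d).dia L w w') (t : bimW d L nu w) :
    Realizes x.1 t (omD hnu hnu' x t) := (exists_realizes x.2 hnu hnu' t).choose_spec

theorem omD_ker {w w' : SSeq n} (hnu : nu = L + (presS n d).wt w)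
    (hnu' : nu' = L + (presS n d).wt w') :
    ((presS n d).ker L w w').comap ((presS n d).dia L w w').subtype ≤ LinearMap.ker (omD hnu hnu') := by
  intro x hx
  refine LinearMap.ext fun t => (omD_spec hnu hnu' x t).unique (.zero_diag t) ?_ hnu'
  rw [sub_zero]; exact hx

/-- The action of 2-morphisms on the bimodules. -/
def omS {w w' : SSeq n} (hnu : nu = L + (presS n d).wt w) (hnu' : nu' = L + (presS n d).wt w') :
    Hom2 (presS n d) L w w' →ₗ[ℚ] bimW d L nu w →ₗ[ℚ] bimW d L nu' w' :=
  Submodule.liftQ (((presS n d).ker L w w').comap ((presS n d).dia L w w').subtype) (omD hnu hnu')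
    (omD_ker hnu hnu')

open scoped Classical in
/-- The action of 2-morphisms on the bimodules; it is zero where the regions do not fit. -/
def om : Real2 (presS n d) d id := fun L nu nu' w w' =>
  if h : nu = L + (presS n d).wt w ∧ nu' = L + (presS n d).wt w' then omS (L := L) h.1 h.2 else 0

theorem om_omS {w w' : SSeq n} (hnu : nu = L + (presS n d).wt w)
    (hnu' : nu' = L + (presS n d).wt w') : om L nu nu' w w' = omS (L := L) (d := d) hnu hnu' :=
  dif_pos ⟨hnu, hnu'⟩

theorem om_mk {w w' : SSeq n} (hnu : nu = L + (presS n d).wt w)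
    (hnu' : nu' = L + (presS n d).wt w') (x : (presS n d).dia L w w') (t : bimW d L nu w) :
    Realizes x.1 t (om L nu nu' w w' (Hom2.mk (presS n d) L x) t : bimW d L nu' w') := by
  rw [om_omS hnu hnu']; exact omD_spec hnu hnu' x t

theorem om_eq {w w' : SSeq n} {x : Alg n} (hx : x ∈ (presS n d).dia L w w')
    (hnu : nu = L + (presS n d).wt w) (hnu' : nu' = L + (presS n d).wt w') {t : bimW d L nu w}
    {t' : bimW d L nu' w'} (h : Realizes x t t') :
    om L nu nu' w w' (Hom2.mk (presS n d) L ⟨x, hx⟩) t = t' :=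
  (om_mk hnu hnu' ⟨x, hx⟩ t).unique h (by simp) hnu'

theorem cls_eq {P : Pres n} {lam : P.W} {w w' : SSeq n} {x : Alg n} (hx : x ∈ P.dia lam w w') :
    Hom2.cls P lam w w' x = Hom2.mk P lam ⟨x, hx⟩ := dif_pos hx

theorem om_cls {w w' : SSeq n} {x : Alg n} (hx : x ∈ (presS n d).dia L w w')
    (hnu : nu = L + (presS n d).wt w) (hnu' : nu' = L + (presS n d).wt w') {t : bimW d L nu w}
    {t' : bimW d L nu' w'} (h : Realizes x t t') :
    om L nu nu' w w' (Hom2.cls (presS n d) L w w' x) t = t' := by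
  rw [cls_eq hx]; exact om_eq hx hnu hnu' h

theorem IsDiag.wt_eq {P : Pres n} {lam : P.W} {w w' : SSeq n} {k : ℤ} {x : Alg n}
    (h : IsDiag P lam w w' k x) : P.wt w = P.wt w' := by
  induction h with
  | id w => rfl
  | cons u g v h ih => rw [← ih]; simp only [Pres.wt_append, wt_src_tgt]

theorem dia_eq_bot {P : Pres n} {lam : P.W} {w w' : SSeq n} (h : P.wt w ≠ P.wt w') :
    P.dia lam w w' = ⊥ := by
  rw [Pres.dia, Submodule.span_eq_bot]
  rintro x ⟨k, hx⟩; exact (h hx.wt_eq).elim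

theorem Hom2.eq_zero {P : Pres n} {lam : P.W} {w w' : SSeq n} (h : P.wt w ≠ P.wt w')
    (x : Hom2 P lam w w') : x = 0 := by
  induction x using Hom2.ind with
  | h x =>
    have hx : x = 0 := by
      have : x.1 ∈ (⊥ : Submodule ℚ _) := dia_eq_bot h ▸ x.2
      exact Subtype.ext this
    rw [hx, map_zero]

theorem om_fgen (lam : Fin n → ℤ) : FGen lam (genAct (om (n := n) (d := d)) lam) where
  dot a v p m := om_cls (layer_mem_dia lam [] (.dot a) v) rfl rfl (realizes_dot a v rfl p m)
  cross b i j v Q m := by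
    refine om_cls (layer_mem_dia lam [] (.cross b i j) v) rfl ?_ (realizes_cross b i j v rfl Q m)
    simp only [Gen.tgt, List.cons_append, List.nil_append, Pres.wt]; abel
  rcup i v mu m hmu := by
    subst hmu
    exact om_cls (layer_mem_dia lam [] (.rcup i) v) rfl (wt_dn_up d lam i v).symm
      (realizes_rcup i v rfl m)
  lcup i v mu m hmu := by
    subst hmu
    exact om_cls (layer_mem_dia lam [] (.lcup i) v) rfl (wt_up_dn d lam i v).symm
      (realizes_lcup i v rfl m)
  lcap i v mu b c m hmu := by
    subst hmu
    exact om_cls (layer_mem_dia lam [] (.lcap i) v) (wt_dn_up d lam i v).symm rfl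
      (realizes_lcap i v b c m)
  rcap i v mu b c m hmu := by
    subst hmu
    exact om_cls (layer_mem_dia lam [] (.rcap i) v) (wt_up_dn d lam i v).symm rfl
      (realizes_rcap i v b c m)

theorem om_leftStrand : LeftStrand (om (n := n) (d := d)) := by
  intro lam a w w' x p m
  by_cases h : (presS n d).wt w = (presS n d).wt w'
  · induction x using Hom2.ind with
    | h x =>
      have h1 : (id lam : Fin n → ℤ) + (presS n d).wt (a :: w) = id lam + (presS n d).wt (a :: w') := by
        rw [wt_cons d _ a w, wt_cons d _ a w', h]
      refine om_eq (by simpa using whisk_mem_dia (lam' := lam) [a] [] (by simp [Pres.wt]) x.2) rfl h1 ?_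
      refine Realizes.cons x.2 (om_mk rfl rfl x m) a (same_ofB ?_ rfl p)
      rw [h]
  · rw [Hom2.eq_zero h x, map_zero]
    have h2 : Hom2.whisk [a] [] (by simp [Pres.wt]) (0 : Hom2 (presS n d) lam w w') (by simp) (by simp) =
        (0 : Hom2 (presS n d) lam (a :: w) (a :: w')) := by
      refine Hom2.eq_zero (fun e => h ?_) _
      have e' : (presS n d).wt ([a] ++ w) = (presS n d).wt ([a] ++ w') := e
      rw [Pres.wt_append, Pres.wt_append] at e'
      exact add_left_cancel e'
    rw [h2, map_zero]
    exact (map_zero (cnsL _ _ a w' _)).symm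

end

end Diagrams

end Schur


namespace Schur

open CategoryTheory MvPolynomial

/-! ### Degrees -/

section Degrees

variable {n d : ℕ} {K : Type} [Field K] [CharZero K]

noncomputable section

theorem aeval_scale (f : Fin d → K) {p : Poly d} {k : ℤ}
    (h : IsWeightedHomogeneous (fun _ => (2 : ℤ)) p k) :
    aeval (fun t => 4 * f t) p = (2 : K) ^ k * aeval f p := by
  rw [aeval_def, eval₂_eq, aeval_def, eval₂_eq, Finset.mul_sum]
  refine Finset.sum_congr rfl fun s hs => ?_
  have hk : (2 * ∑ t, s t : ℕ) = k := by
    rw [← h (mem_support_iff.1 hs), Finsupp.weight_apply, Finsupp.sum_fintype _ _ (by simp)]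
    simp [Finset.mul_sum, mul_comm]
  have h4 : (2 : K) ^ k = ∏ t ∈ s.support, 4 ^ s t := by
    rw [← hk, zpow_natCast, pow_mul, Finset.prod_pow_eq_pow_sum]
    norm_num
    rw [Finset.sum_subset (Finset.subset_univ s.support) (by simp)]
  rw [h4]
  simp only [mul_pow, Finset.prod_mul_distrib]
  ring

theorem bv_scale (z : Fin d → K) (c c' : Fin d → ℕ) {lam mu : Fin n → ℤ} {k : ℤ} {b : bimB d lam mu}
    (hb : b ∈ (bimB d lam mu).gr k) :
    bv (fun t => 4 * z t) c c' lam mu b = (2 : K) ^ k * bv z c c' lam mu b := by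
  by_cases h : ∃ σ : Equiv.Perm (Fin d), c ∘ σ = std lam ∧ c' ∘ σ = std mu
  · obtain ⟨σ, h1, h2⟩ := h
    rw [bv_eq h1 h2, bv_eq h1 h2]
    refine aeval_scale (z ∘ σ) ?_
    unfold toP
    split_ifs with h
    · exact hb ⟨h⟩
    · exact isWeightedHomogeneous_zero _ _ _
  · rw [bv_none h, bv_none h, mul_zero]

/-- The thicknesses of the strands that are split by the letters of a signed sequence. -/
def thk (d : ℕ) (L : Fin n → ℤ) : SSeq n → ℤ
  | [] => 0
  | a :: w => en (L + (presS n d).wt w) a.old - 1 + thk d L w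

theorem thk_append (L : Fin n → ℤ) (u v : SSeq n) :
    thk d L (u ++ v) = thk d (L + (presS n d).wt v) u + thk d L v := by
  induction u with
  | nil => simp [thk]
  | cons a u ih =>
    rw [List.cons_append, thk, thk, ih, Pres.wt_append, add_assoc L, add_comm ((presS n d).wt v)]
    ring

theorem wt_indep (D D' : ℕ) (w : SSeq n) : (presS n D).wt w = (presS n D').wt w := by
  induction w with
  | nil => rfl
  | cons a w ih =>
    have h := fun E : ℕ => wt_cons (n := n) E 0 a w
    simp only [zero_add] at h
    rw [h, h, ih, wt_letter, wt_letter]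

theorem letterShift_eq (lam : Fin n → ℤ) (b : Bool) (i : Fin (n - 1)) :
    letterShift lam (b, i) = (if b then 1 else -1) * kk lam i.val - (en lam (Letter.old (b, i)) - 1) := by
  cases b
  · simp only [letterShift, Letter.old, kk_succ]; simp; ring
  · simp only [letterShift, Letter.old, kk_succ]; simp; ring

theorem ev_scale (z : Fin d → K) (c : Fin d → ℕ) (L : Fin n → ℤ) : ∀ (w : SSeq n) (nu : Fin n → ℤ)
    {k : ℤ} {t : bimW d L nu w}, t ∈ (bimW d L nu w).gr k → ∀ {ys}, Valid c w ys →
      ev (fun t => 4 * z t) c L nu w t ys =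
        (2 : K) ^ (k - regr L w + thk d L w) * ev z c L nu w t ys
  | [], nu, k, t, ht, [], _ => by
    rw [ev_nil, ev_nil]
    simpa [regr, thk] using bv_scale z c c ht
  | (b, i) :: w, nu, k, t, ht, y :: ys, hv => by
    set e := k - regr L ((b, i) :: w) + thk d L ((b, i) :: w) with he
    rw [← sub_eq_zero]
    refine (Submodule.mem_bot ℚ).1 (tgr_map (f := bimW d L (L + (presS n d).wt w) w)
      (g := (bimB d (L + (presS n d).wt w) nu).sh (letterShift (L + (presS n d).wt w) (b, i)))
      (LinearMap.proj (y :: ys) ∘ₗ ev (fun t => 4 * z t) c L nu ((b, i) :: w) -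
        (2 : K) ^ e • LinearMap.proj (y :: ys) ∘ₗ ev z c L nu ((b, i) :: w)) (W := ⊥)
      (fun k1 k2 x m hk hx hm => ?_) ht)
    have h1 := ev_cnsB_of (z := fun t => 4 * z t) (L := L) (nu := nu) x m hv
    have h2 := ev_cnsB_of (z := z) (L := L) (nu := nu) x m hv
    rw [Submodule.mem_bot]
    refine sub_eq_zero.2 (h1.trans (Eq.trans ?_ (congrArg (fun s => (2 : K) ^ e * s) h2.symm)))
    rw [bv_scale z _ _ hx, ev_scale z c L w _ hm hv.1, mul_mul_mul_comm, ← zpow_add₀ two_ne_zero]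
    congr 2
    rw [he, regr, thk, letterShift_eq, wt_indep 0 d, ← hk]
    ring

theorem mem_gr_of_eigen {V : Type} [AddCommGroup V] [Module ℚ V] {gr : ℤ → Submodule ℚ V}
    (hgr : DirectSum.IsInternal gr) {φ : Module.End ℚ V}
    (hφ : ∀ k, ∀ x ∈ gr k, φ x = (2 : ℚ) ^ k • x) {k : ℤ} {x : V} (hx : φ x = (2 : ℚ) ^ k • x) :
    x ∈ gr k := by
  classical
  obtain ⟨f, rfl⟩ := hgr.2 x
  have h1 : DirectSum.coeAddMonoidHom gr (DirectSum.map (fun j => ((2 : ℚ) ^ j - 2 ^ k) •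
      AddMonoidHom.id (gr j)) f) = 0 := by
    have e : ∀ f : DirectSum ℤ fun j => gr j, DirectSum.coeAddMonoidHom gr
        (DirectSum.map (fun j => ((2 : ℚ) ^ j - 2 ^ k) • AddMonoidHom.id (gr j)) f) =
          φ (DirectSum.coeAddMonoidHom gr f) - (2 : ℚ) ^ k • DirectSum.coeAddMonoidHom gr f := by
      intro f
      induction f using DirectSum.induction_on with
      | zero => simp
      | of j y =>
        rw [DirectSum.map_of, DirectSum.coeAddMonoidHom_of, DirectSum.coeAddMonoidHom_of, hφ j _ y.2,
          ← sub_smul]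
        rfl
      | add f g hf hg => simp only [map_add, smul_add, hf, hg]; abel
    rw [e, hx, sub_self]
  have h2 := hgr.1 (h1.trans (map_zero _).symm)
  have h3 : ∀ j, j ≠ k → f j = 0 := by
    intro j hj
    have := DFunLike.congr_fun h2 j
    rw [DirectSum.map_apply] at this
    have h4 : (2 : ℚ) ^ j - 2 ^ k ≠ 0 :=
      sub_ne_zero.2 fun e => hj (zpow_right_injective₀ (by norm_num) (by norm_num) e)
    exact (smul_eq_zero.1 (this : ((2 : ℚ) ^ j - 2 ^ k) • f j = 0)).resolve_left h4
  have h5 : f = DirectSum.of (fun j => gr j) k (f k) := by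
    refine DFinsupp.ext fun j => ?_
    by_cases hj : j = k
    · subst hj; exact (DirectSum.of_eq_same (β := fun j => gr j) j _).symm
    · rw [h3 j hj]; exact (DirectSum.of_eq_of_ne (β := fun j => gr j) _ _ _ (by tauto)).symm
  rw [h5, DirectSum.coeAddMonoidHom_of]
  exact (f k).2

theorem mem_gr_of_ev {L nu : Fin n → ℤ} {w : SSeq n} (hnu : nu = L + (presS n d).wt w) {k : ℤ}
    {t : bimW d L nu w} (h : ∀ {K : Type} [Field K] [CharZero K] (z : Fin d → K),
      Function.Injective z → ∀ c ys, HasWt c L → Valid c w ys → ev (fun t => 4 * z t) c L nu w t ys =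
        (2 : K) ^ (k - regr L w + thk d L w) * ev z c L nu w t ys) :
    t ∈ (bimW d L nu w).gr k := by
  obtain ⟨ht, φ, hφ⟩ := (isInternal_iff _).1 (bimW d L nu w).internal
  refine mem_gr_of_eigen (bimW d L nu w).internal hφ ?_
  obtain ⟨K, _, _, z, hz⟩ := exists_generic d
  refine ev_ext hz hnu fun c ys hc hv => ?_
  have h1 : LinearMap.proj ys ∘ₗ ev (fun t => 4 * z t) c L nu w =
      (2 : K) ^ (- regr L w + thk d L w) • LinearMap.proj ys ∘ₗ ev z c L nu w ∘ₗ φ := by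
    refine gr_ext ht fun j x hx => ?_
    refine (ev_scale z c L w nu hx hv).trans ?_
    simp only [LinearMap.smul_apply, LinearMap.comp_apply, LinearMap.proj_apply, hφ j x hx, map_smul,
      Pi.smul_apply]
    rw [smul_eq_mul, Algebra.smul_def, map_zpow₀, ← mul_assoc, map_ofNat, ← zpow_add₀ two_ne_zero]
    congr 2; ring
  have h2 := LinearMap.congr_fun h1 t
  have h3 : (2 : K) ^ (k - regr L w + thk d L w) * ev z c L nu w t ys =
      (2 : K) ^ (- regr L w + thk d L w) * ev z c L nu w (φ t) ys :=
    (h z hz.injective c ys hc hv).symm.trans h2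
  have e : k - regr L w + thk d L w = (- regr L w + thk d L w) + k := by ring
  rw [e, zpow_add₀ two_ne_zero, mul_assoc] at h3
  rw [← mul_left_cancel₀ (zpow_ne_zero _ two_ne_zero) h3, map_smul, Pi.smul_apply, Algebra.smul_def,
    map_zpow₀, map_ofNat]

theorem en_letter (D : ℕ) (lam : Fin n → ℤ) (a : Letter n) {m : ℕ} (hm : m < n) :
    en (lam + (presS n D).wt [a]) m =
      en lam m + if m = a.new then 1 else if m = a.old then -1 else 0 := by
  simp only [en, dif_pos hm, Pi.add_apply, wt_single]

theorem genop_scale {z : Fin d → K} {lam : Fin n → ℤ} {c : Fin d → ℕ} (hc : HasWt c lam) (g : Gen n)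
    (G : List (Fin d) → K) {ys : List (Fin d)} (hy : Valid c g.tgt ys) :
    genop (fun t => 4 * z t) g c G ys =
      (2 : K) ^ ((presS n d).gdeg lam g + thk d lam g.tgt - thk d lam g.src) * genop z g c G ys := by
  have hl := hy.length_eq
  have h4 : (4 : K) = 2 ^ (2 : ℤ) := by norm_num
  have hpow : ∀ m : ℕ, (4 : K) ^ m = 2 ^ (2 * m : ℤ) := by
    intro m; rw [h4, zpow_mul, zpow_natCast]
  have hprod : ∀ (s : Finset (Fin d)) (f f' : Fin d → Fin d),
      ∏ t ∈ s, (4 * z (f t) - 4 * z (f' t)) = 2 ^ (2 * s.card : ℤ) * ∏ t ∈ s, (z (f t) - z (f' t)) := by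
    intro s f f'
    rw [← hpow, ← Finset.prod_const, ← Finset.prod_mul_distrib]
    exact Finset.prod_congr rfl fun t _ => by ring
  have hpair : ∀ a b : Letter n, thk d lam [a, b] =
      en (lam + (presS n d).wt [b]) a.old - 1 + (en lam b.old - 1) := by
    intro a b; simp [thk, Pres.wt]
  have hdu : ∀ i : Fin (n - 1), thk d lam [dn i, up i] = en lam i.val + en lam (i.val + 1) - 1 := by
    intro i
    rw [hpair, en_letter d lam _ (Letter.old_lt _)]
    simp only [Letter.old, Letter.new, up, dn, if_true]; ring
  have hud : ∀ i : Fin (n - 1), thk d lam [up i, dn i] = en lam i.val + en lam (i.val + 1) - 1 := by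
    intro i
    rw [hpair, en_letter d lam _ (Letter.old_lt _)]
    simp only [Letter.old, Letter.new, up, dn, if_true]; ring
  have h0 : thk d lam [] = 0 := rfl
  cases g with
  | dot a =>
    obtain ⟨y, rfl⟩ := List.length_eq_one_iff.1 hl
    simp only [genop_dot, Gen.src, Gen.tgt, Pres.gdeg, add_sub_cancel_right]
    rw [h4]; ring
  | cross b i j =>
    obtain ⟨x, y, rfl⟩ := List.length_eq_two.1 hl
    have hi := i.isLt
    have hj := j.isLt
    simp only [genop_cross, Gen.src, Gen.tgt, Pres.gdeg, hpair]
    rw [en_letter d lam _ (Letter.old_lt _), en_letter d lam _ (Letter.old_lt _)]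
    by_cases hij : i = j
    · subst hij
      simp only [if_true]
      rw [add_sub_assoc, sub_self, add_zero, cartan, if_pos rfl, ← mul_sub, zpow_neg, ← h4]
      simp only [div_eq_mul_inv, mul_inv]; ring
    · rw [if_neg hij, if_neg hij, ← mul_assoc]
      congr 1
      have hij' : i.val ≠ j.val := fun h => hij (Fin.ext h)
      simp only [kap, cartan, if_neg hij]
      cases b
      · simp only [Letter.old, Letter.new, Bool.false_eq_true, false_and, if_false, true_and]
        by_cases h1 : j.val = i.val + 1
        · rw [if_pos h1, if_pos h1, ← mul_sub, h4]
          congr 2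
          split_ifs <;> omega
        · rw [if_neg h1, if_neg h1, mul_one, ← zpow_zero (2 : K)]
          congr 1
          split_ifs <;> omega
      · simp only [Letter.old, Letter.new, Bool.true_eq_false, false_and, if_false, true_and]
        by_cases h1 : i.val = j.val + 1
        · rw [if_pos h1, if_pos h1, ← mul_sub, h4]
          congr 2
          split_ifs <;> omega
        · rw [if_neg h1, if_neg h1, mul_one, ← zpow_zero (2 : K)]
          congr 1
          split_ifs <;> omega
  | rcup i =>
    obtain ⟨x, y, rfl⟩ := List.length_eq_two.1 hl
    have hi := i.isLt
    simp only [genop_rcup, Gen.src, Gen.tgt, Pres.gdeg, glBar, hdu, hud, h0, presS]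
    split_ifs with hxy
    · rw [hprod _ (fun _ => y) fun t => t, ← hc.en (i := i.val) (by omega), ← mul_assoc]
      congr 3
      ring
    · simp
  | lcup i =>
    obtain ⟨x, y, rfl⟩ := List.length_eq_two.1 hl
    have hi := i.isLt
    simp only [genop_lcup, Gen.src, Gen.tgt, Pres.gdeg, glBar, hdu, hud, h0, presS]
    split_ifs with hxy
    · rw [hprod _ (fun t => t) fun _ => x, ← hc.en (i := i.val + 1) (by omega), ← mul_assoc]
      congr 3
      ring
    · simp
  | lcap i =>
    obtain rfl := List.length_eq_zero_iff.1 hl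
    have hi := i.isLt
    simp only [genop_lcap, Gen.src, Gen.tgt, Pres.gdeg, glBar, hdu, hud, h0, presS]
    rw [Finset.mul_sum]
    refine Finset.sum_congr rfl fun x hx => ?_
    have hcard := hc.en (i := i.val + 1) (by omega)
    rw [← Finset.card_erase_add_one hx] at hcard
    rw [hprod _ (fun t => t) fun _ => x, div_mul_eq_div_div, mul_div_assoc', div_eq_mul_inv (G _),
      ← zpow_neg, mul_comm (G _)]
    congr 3
    rw [hcard]; push_cast; ring
  | rcap i =>
    obtain rfl := List.length_eq_zero_iff.1 hl
    have hi := i.isLt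
    simp only [genop_rcap, Gen.src, Gen.tgt, Pres.gdeg, glBar, hdu, hud, h0, presS]
    rw [Finset.mul_sum]
    refine Finset.sum_congr rfl fun x hx => ?_
    have hcard := hc.en (i := i.val) (by omega)
    rw [← Finset.card_erase_add_one hx] at hcard
    rw [hprod _ (fun _ => x) fun t => t, div_mul_eq_div_div, mul_div_assoc', div_eq_mul_inv (G _),
      ← zpow_neg, mul_comm (G _)]
    congr 3
    rw [hcard]; push_cast; ring

theorem rho_scale {z : Fin d → K} {L : Fin n → ℤ} {c : Fin d → ℕ} (hc : HasWt c L) {w w' : SSeq n}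
    {k : ℤ} {x : Alg n} (hx : IsDiag (presS n d) L w w' k x) {F F' : List (Fin d) → K} {a : K}
    (h : ∀ l, Valid c w l → F' l = a * F l) {ys : List (Fin d)} (hy : Valid c w' ys) :
    rho (fun t => 4 * z t) c x F' ys =
      a * 2 ^ (k + thk d L w' - thk d L w) * rho z c x F ys := by
  induction hx generalizing F F' a with
  | id w => simpa using h ys hy
  | @cons u g v w k x hx ih =>
    rw [rho_mul, rho_mul]
    rw [ih (F := rho z c (lay u g v) F) (a := a * 2 ^ ((presS n d).gdeg (L + (presS n d).wt v) g +
      thk d (L + (presS n d).wt v) g.tgt - thk d (L + (presS n d).wt v) g.src)) ?_ hy]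
    · congr 1
      rw [mul_assoc, ← zpow_add₀ two_ne_zero]
      congr 2
      simp only [thk_append, Pres.wt_append, List.append_assoc, wt_src_tgt]
      ring
    · intro l hl
      rw [List.append_assoc] at hl
      obtain ⟨xu, l, rfl, h1, hl, hu⟩ := hl.split
      obtain ⟨ys, xv, rfl, h2, hv, hy⟩ := hl.split
      rw [rho_lay_apply _ c g v _ xv h1 h2, rho_lay_apply _ c g v _ xv h1 h2,
        mul_assoc, ← genop_scale (hc.col (D := d) hv) g _ hy]
      refine genop_congr _ g hy fun l hl hcol => h _ ?_
      have hll := hl.length_eq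
      rw [col_append _ _ _ _ _ h2] at hu
      rw [List.append_assoc, valid_append _ _ _ _ _ h1, valid_append _ _ _ _ _ hll,
        col_append _ _ _ _ _ hll, hcol]
      exact ⟨⟨hv, hl⟩, hu⟩

end

end Degrees

end Schur


namespace Schur

open CategoryTheory MvPolynomial

/-! ### The maps of diagrams are homogeneous bimodule maps -/

section Maps

variable {n d : ℕ} {L nu nu' : Fin n → ℤ}

noncomputable section

attribute [local irreducible] bimW

theorem Realizes.l {w w' : SSeq n} {x : Alg n} (hx : x ∈ (presS n d).dia L w w') {t : bimW d L nu w}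
    {t' : bimW d L nu w'} (h : Realizes x t t') (r : ringR d nu) :
    Realizes x ((bimW d L nu w).l r t) ((bimW d L nu w').l r t') := by
  intro K _ _ z hz c hc ys hys
  rw [ev_l, h K _ hz c hc ys hys]
  refine (rho_congr z hx hys fun l hl hcol => ?_).symm
  rw [ev_l, hcol]

theorem Realizes.r {w w' : SSeq n} {x : Alg n} (hx : x ∈ (presS n d).dia L w w') {t : bimW d L nu w}
    {t' : bimW d L nu' w'} (h : Realizes x t t') (r : ringR d L) :
    Realizes x ((bimW d L nu w).r r t) ((bimW d L nu' w').r r t') := by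
  intro K _ _ z hz c hc ys hys
  rw [ev_r _ _ _ _ hys, h K _ hz c hc ys hys]
  exact (rho_congr z hx hys fun l hl hcol => ev_r _ _ _ _ hl).symm

theorem Realizes.mem_gr {w w' : SSeq n} {k : ℤ} {x : Alg n} (hx : IsDiag (presS n d) L w w' k x)
    (hnu' : nu' = L + (presS n d).wt w') {t : bimW d L nu w} {t' : bimW d L nu' w'}
    (h : Realizes x t t') {j : ℤ} (ht : t ∈ (bimW d L nu w).gr j) :
    t' ∈ (bimW d L nu' w').gr (j + (k + regr L w' - regr L w)) := by
  refine mem_gr_of_ev hnu' fun {K} _ _ z hz c ys hc hys => ?_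
  have hz' : Function.Injective fun t => 4 * z t :=
    fun s t e => hz (mul_left_cancel₀ (by norm_num) e)
  rw [h K _ hz' c hc ys hys, h K _ hz c hc ys hys, rho_scale hc hx (fun l hl => ev_scale z c L w nu ht hl) hys,
    ← zpow_add₀ two_ne_zero]
  congr 2; ring

theorem om_mem_homDeg {w w' : SSeq n} {k : ℤ} {x : Alg n} (hx : IsDiag (presS n d) L w w' k x)
    (hnu : nu = L + (presS n d).wt w) :
    om L nu nu w w' (Hom2.mk (presS n d) L ⟨x, Submodule.subset_span ⟨k, hx⟩⟩) ∈
      homDeg (bimW d L nu w) (bimW d L nu w') (k + regr L w' - regr L w) := by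
  have hx' : x ∈ (presS n d).dia L w w' := Submodule.subset_span ⟨k, hx⟩
  have hnu' : nu = L + (presS n d).wt w' := by rw [hnu, hx.wt_eq]
  have h := om_mk hnu hnu' ⟨x, hx'⟩
  exact ⟨fun b t => om_eq hx' hnu hnu' ((h t).l hx' b), fun b t => om_eq hx' hnu hnu' ((h t).r hx' b),
    fun i t ht => (h t).mem_gr hx hnu' ht⟩

theorem om_homog (L : Fin n → ℤ) : Homog (om (n := n) (d := d)) L := by
  intro w w' k x hx
  rw [cls_eq (Submodule.subset_span ⟨k, hx⟩)]
  exact om_mem_homDeg hx rfl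

theorem om_mem_bhom {w w' : SSeq n} (x : Hom2 (presS n d) L w w') (hnu : nu = L + (presS n d).wt w) :
    om L nu nu w w' x ∈ bhom (bimW d L nu w) (bimW d L nu w') := by
  induction x using Hom2.ind with
  | h x =>
    obtain ⟨x, hx⟩ := x
    have hx' := hx
    refine Submodule.span_induction (p := fun x hx => om L nu nu w w' (Hom2.mk (presS n d) L ⟨x, hx⟩) ∈
      bhom (bimW d L nu w) (bimW d L nu w')) ?_ ?_ ?_ ?_ hx'
    · rintro x ⟨k, hx⟩
      exact homDeg_le _ (om_mem_homDeg hx hnu)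
    · have : Hom2.mk (presS n d) L (⟨0, zero_mem _⟩ : (presS n d).dia L w w') = 0 := map_zero _
      rw [this, map_zero]; exact zero_mem _
    · intro x y hx hy h1 h2
      have : Hom2.mk (presS n d) L (⟨x + y, add_mem hx hy⟩ : (presS n d).dia L w w') =
        Hom2.mk (presS n d) L ⟨x, hx⟩ + Hom2.mk (presS n d) L ⟨y, hy⟩ :=
          map_add (Hom2.mk (presS n d) L) ⟨x, hx⟩ ⟨y, hy⟩
      rw [this, map_add]; exact add_mem h1 h2
    · intro q x hx h
      have : Hom2.mk (presS n d) L (⟨q • x, Submodule.smul_mem _ q hx⟩ : (presS n d).dia L w w') =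
        q • Hom2.mk (presS n d) L ⟨x, hx⟩ :=
          map_smul (Hom2.mk (presS n d) L) q ⟨x, hx⟩
      rw [this, map_smul]; exact Submodule.smul_mem _ _ h

end

end Maps

end Schur


namespace Schur

open CategoryTheory MvPolynomial

open GBim (fn)

/-! ### Juxtaposition of signed sequences -/

section Isos

variable {A B C : GAlg}

/-- An isomorphism of degree zero. -/
def Deg0 {M N : GBim A B} (e : M ≅ N) : Prop := fn e.hom ∈ homDeg M N 0 ∧ fn e.inv ∈ homDeg N M 0

theorem Deg0.refl (M : GBim A B) : Deg0 (Iso.refl M) := by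
  constructor <;>
  exact ⟨fun _ _ => rfl, fun _ _ => rfl, fun i x hx => by rw [add_zero]; exact hx⟩

theorem Deg0.symm {M N : GBim A B} {e : M ≅ N} (h : Deg0 e) : Deg0 e.symm := ⟨h.2, h.1⟩

theorem Deg0.trans {M N K : GBim A B} {e : M ≅ N} {e' : N ≅ K} (h : Deg0 e) (h' : Deg0 e') :
    Deg0 (e ≪≫ e') := by
  constructor
  · have := comp_mem_homDeg h.1 h'.1; rwa [add_zero] at this
  · have := comp_mem_homDeg h'.2 h.2; rwa [add_zero] at this

theorem deg0_mkIso {M N : GBim A B} (f : M →ₗ[ℚ] N) (g : N →ₗ[ℚ] M) (hf : f ∈ homDeg M N 0)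
    (hg : g ∈ homDeg N M 0) (h : g ∘ₗ f = LinearMap.id) (h' : f ∘ₗ g = LinearMap.id) :
    Deg0 (mkIso f g hf hg h h') := ⟨hf, hg⟩

theorem fn_hom_inv {M N : GBim A B} (e : M ≅ N) (x : N) : fn e.hom (fn e.inv x) = x :=
  LinearMap.congr_fun (congrArg fn e.inv_hom_id) x

theorem fn_inv_hom {M N : GBim A B} (e : M ≅ N) (x : M) : fn e.inv (fn e.hom x) = x :=
  LinearMap.congr_fun (congrArg fn e.hom_inv_id) x

theorem wL_id (f : GBim A B) (g : GBim B C) : wL f (𝟙 g) = 𝟙 (tens f g) :=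
  fn_tp_ext fun _ _ => wL_tp _ _ _ _

theorem wR_id (f : GBim A B) (g : GBim B C) : wR (𝟙 f) g = 𝟙 (tens f g) :=
  fn_tp_ext fun _ _ => wR_tp _ _ _ _

/-- Tensoring an isomorphism of the left factors. -/
def isoL (f : GBim A B) {g g' : GBim B C} (e : g ≅ g') : tens f g ≅ tens f g' where
  hom := wL f e.hom
  inv := wL f e.inv
  hom_inv_id := by rw [← wL_comp, e.hom_inv_id, wL_id]
  inv_hom_id := by rw [← wL_comp, e.inv_hom_id, wL_id]

/-- Tensoring an isomorphism of the right factors. -/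
def isoR {f f' : GBim A B} (e : f ≅ f') (g : GBim B C) : tens f g ≅ tens f' g where
  hom := wR e.hom g
  inv := wR e.inv g
  hom_inv_id := by rw [← wR_comp, e.hom_inv_id, wR_id]
  inv_hom_id := by rw [← wR_comp, e.inv_hom_id, wR_id]

theorem wL_homDeg (f : GBim A B) {g g' : GBim B C} {φ : g ⟶ g'} {k : ℤ} (h : fn φ ∈ homDeg g g' k) :
    fn (wL f φ) ∈ homDeg (tens f g) (tens f g') k := by
  refine mem_homDeg_tens _ (fun c x y => ?_) (fun a x y => ?_) fun i j x y hx hy => ?_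
  · simp [h.1]
  · simp
  · rw [wL_tp]; exact tp_mem (h.2.2 _ _ hx) hy (by omega)

theorem wR_homDeg {f f' : GBim A B} {φ : f ⟶ f'} (g : GBim B C) {k : ℤ} (h : fn φ ∈ homDeg f f' k) :
    fn (wR φ g) ∈ homDeg (tens f g) (tens f' g) k := by
  refine mem_homDeg_tens _ (fun c x y => ?_) (fun a x y => ?_) fun i j x y hx hy => ?_
  · simp
  · simp [h.2.1]
  · rw [wR_tp]; exact tp_mem hx (h.2.2 _ _ hy) (by omega)

theorem Deg0.isoL (f : GBim A B) {g g' : GBim B C} {e : g ≅ g'} (h : Deg0 e) : Deg0 (isoL f e) :=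
  ⟨wL_homDeg f h.1, wL_homDeg f h.2⟩

theorem Deg0.isoR {f f' : GBim A B} {e : f ≅ f'} (h : Deg0 e) (g : GBim B C) : Deg0 (isoR e g) :=
  ⟨wR_homDeg g h.1, wR_homDeg g h.2⟩

noncomputable section

/-- A linear map, between shifted bimodules. -/
def shMap {M N : GBim A B} (f : M →ₗ[ℚ] N) (s t : ℤ) : M.sh s →ₗ[ℚ] N.sh t := f

theorem shMap_apply {M N : GBim A B} (f : M →ₗ[ℚ] N) (s t : ℤ) (x : M) : shMap f s t x = f x := rfl

theorem fn_mkIso_hom {M N : GBim A B} (f : M →ₗ[ℚ] N) (g : N →ₗ[ℚ] M) (hf : f ∈ homDeg M N 0)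
    (hg : g ∈ homDeg N M 0) (h : g ∘ₗ f = LinearMap.id) (h' : f ∘ₗ g = LinearMap.id) :
    fn (mkIso f g hf hg h h').hom = f := rfl

theorem homDeg_sh {M N : GBim A B} {f : M →ₗ[ℚ] N} {k : ℤ} (h : f ∈ homDeg M N k) (s t : ℤ) :
    shMap f s t ∈ homDeg (M.sh s) (N.sh t) (k + t - s) := by
  refine ⟨h.1, h.2.1, fun i x hx => ?_⟩
  have := h.2.2 _ x hx
  have e : i + (k + t - s) - t = i - s + k := by ring
  change f x ∈ N.gr (i + (k + t - s) - t)
  rwa [e]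

theorem bhom_sh {M N : GBim A B} {f : M →ₗ[ℚ] N} (h : f ∈ bhom M N) (s t : ℤ) :
    shMap f s t ∈ bhom (M.sh s) (N.sh t) :=
  bhom_map (M := M) (N := N) (M' := M.sh s) (N' := N.sh t) (fun f => shMap f s t) rfl
    (fun _ _ _ _ => rfl) (fun k f hf => homDeg_le _ (homDeg_sh hf s t)) h

theorem shMap_comp {M N : GBim A B} {f : M →ₗ[ℚ] N} {g : N →ₗ[ℚ] M} (h : g ∘ₗ f = LinearMap.id)
    (s t : ℤ) : shMap g t s ∘ₗ shMap f s t = LinearMap.id := h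

/-- The shift of an isomorphism of degree zero. -/
def shIso {M N : GBim A B} (e : M ≅ N) (he : Deg0 e) (k : ℤ) : M.sh k ≅ N.sh k :=
  mkIso (shMap (fn e.hom) k k) (shMap (fn e.inv) k k)
    (by have := homDeg_sh he.1 k k; rwa [zero_add, sub_self] at this)
    (by have := homDeg_sh he.2 k k; rwa [zero_add, sub_self] at this)
    (shMap_comp (LinearMap.ext (fn_inv_hom e)) k k) (shMap_comp (LinearMap.ext (fn_hom_inv e)) k k)

theorem shIso_deg0 {M N : GBim A B} (e : M ≅ N) (he : Deg0 e) (k : ℤ) : Deg0 (shIso e he k) :=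
  deg0_mkIso _ _ _ _ _ _

theorem shIso_apply {M N : GBim A B} (e : M ≅ N) (he : Deg0 e) (k : ℤ) (x : M) :
    fn (shIso e he k).hom x = fn e.hom x :=
  (LinearMap.congr_fun (fn_mkIso_hom (M := M.sh k) (N := N.sh k) _ _ _ _ _ _) x).trans
    (shMap_apply (fn e.hom) k k x)

theorem mem_sh_zero (M : GBim A B) (i : ℤ) (x : M) : x ∈ (M.sh 0).gr i ↔ x ∈ M.gr i := by
  change x ∈ M.gr (i - 0) ↔ _
  rw [sub_zero]

/-- The shift by zero. -/
def shZero (M : GBim A B) : M.sh 0 ≅ M :=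
  mkIso (M := M.sh 0) (N := M) (LinearMap.id (M := M)) (LinearMap.id (M := M))
    ⟨fun _ _ => rfl, fun _ _ => rfl, fun i x hx => by rw [add_zero]; exact (mem_sh_zero M i x).1 hx⟩
    ⟨fun _ _ => rfl, fun _ _ => rfl, fun i x hx => by rw [add_zero]; exact (mem_sh_zero M i x).2 hx⟩
    rfl rfl

theorem shZero_deg0 (M : GBim A B) : Deg0 (shZero M) := deg0_mkIso _ _ _ _ _ _

section TensSh

variable (M : GBim A B) (N : GBim B C) (s t : ℤ)

/-- Shifting the factors of a tensor product. -/
def tensShFun : tens (M.sh s) (N.sh t) →ₗ[ℚ] tens M N :=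
  tlift (f := M.sh s) (g := N.sh t) (tpL M N) (fun b x y => tp_bal (f := M) (g := N) b x y)

theorem tensShFun_tp (y : N) (x : M) :
    tensShFun M N s t (tp (f := M.sh s) (g := N.sh t) y x) = tp (f := M) (g := N) y x :=
  tlift_tp (f := M.sh s) (g := N.sh t) (tpL M N) (fun b x y => tp_bal (f := M) (g := N) b x y) y x

/-- The inverse of `tensShFun`. -/
def tensShInv : tens M N →ₗ[ℚ] tens (M.sh s) (N.sh t) :=
  tlift (f := M) (g := N) (tpL (M.sh s) (N.sh t))
    (fun b x y => tp_bal (f := M.sh s) (g := N.sh t) b x y)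

theorem tensShInv_tp (y : N) (x : M) :
    tensShInv M N s t (tp (f := M) (g := N) y x) = tp (f := M.sh s) (g := N.sh t) y x :=
  tlift_tp (f := M) (g := N) (tpL (M.sh s) (N.sh t))
    (fun b x y => tp_bal (f := M.sh s) (g := N.sh t) b x y) y x

theorem tensShFun_mem : tensShFun M N s t ∈
    homDeg (tens (M.sh s) (N.sh t)) ((tens M N).sh (t + s)) 0 := by
  have h : tensShFun M N s t ∈ homDeg (tens (M.sh s) (N.sh t)) (tens M N) (-(t + s)) := by
    refine mem_homDeg_tens (f := M.sh s) (g := N.sh t) (M := tens M N) _ (fun c x y => ?_)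
      (fun a x y => ?_) fun i j x y hx hy => ?_
    · refine (tensShFun_tp M N s t _ _).trans (Eq.trans ?_
        (congrArg ((tens M N).l c) (tensShFun_tp M N s t x y)).symm)
      exact (tens_l (f := M) (g := N) c x y).symm
    · refine (tensShFun_tp M N s t _ _).trans (Eq.trans ?_
        (congrArg ((tens M N).r a) (tensShFun_tp M N s t x y)).symm)
      exact (tens_r (f := M) (g := N) a x y).symm
    · have := tp_mem (f := M) (g := N) hx hy rfl
      have e : i + j + -(t + s) = i - t + (j - s) := by ring
      rw [e]
      exact (tensShFun_tp M N s t x y).symm ▸ this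
  exact ⟨h.1, h.2.1, fun i x hx => by
    have := h.2.2 _ x hx
    have e : i + -(t + s) = i + 0 - (t + s) := by ring
    rw [e] at this; exact this⟩

theorem tensShInv_mem : tensShInv M N s t ∈
    homDeg ((tens M N).sh (t + s)) (tens (M.sh s) (N.sh t)) 0 := by
  have h : tensShInv M N s t ∈ homDeg (tens M N) (tens (M.sh s) (N.sh t)) (t + s) := by
    refine mem_homDeg_tens (f := M) (g := N) (M := tens (M.sh s) (N.sh t)) _ (fun c x y => ?_)
      (fun a x y => ?_) fun i j x y hx hy => ?_
    · refine (tensShInv_tp M N s t _ _).trans (Eq.trans ?_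
        (congrArg ((tens (M.sh s) (N.sh t)).l c) (tensShInv_tp M N s t x y)).symm)
      exact (tens_l (f := M.sh s) (g := N.sh t) c x y).symm
    · refine (tensShInv_tp M N s t _ _).trans (Eq.trans ?_
        (congrArg ((tens (M.sh s) (N.sh t)).r a) (tensShInv_tp M N s t x y)).symm)
      exact (tens_r (f := M.sh s) (g := N.sh t) a x y).symm
    · refine (tensShInv_tp M N s t x y).symm ▸ ?_
      refine tp_mem (f := M.sh s) (g := N.sh t) (i := i + t) (j := j + s) ?_ ?_ (by omega)
      · change x ∈ N.gr (i + t - t); rwa [add_sub_cancel_right]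
      · change y ∈ M.gr (j + s - s); rwa [add_sub_cancel_right]
  refine ⟨h.1, h.2.1, fun i x hx => ?_⟩
  have := h.2.2 _ x hx
  rwa [sub_add_cancel, ← add_zero i] at this

/-- Shifting the factors of a tensor product. -/
def tensSh : tens (M.sh s) (N.sh t) ≅ (tens M N).sh (t + s) :=
  mkIso (N := (tens M N).sh (t + s)) (tensShFun M N s t) (tensShInv M N s t) (tensShFun_mem M N s t)
    (tensShInv_mem M N s t)
    (tp_ext (f := M.sh s) (g := N.sh t) fun y x =>
      (congrArg _ (tensShFun_tp M N s t y x)).trans (tensShInv_tp M N s t y x))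
    (tp_ext (f := M) (g := N) fun y x =>
      (congrArg _ (tensShInv_tp M N s t y x)).trans (tensShFun_tp M N s t y x))

theorem tensSh_apply (y : N) (x : M) :
    fn (tensSh M N s t).hom (tp (f := M.sh s) (g := N.sh t) y x) = tp (f := M) (g := N) y x :=
  (LinearMap.congr_fun (fn_mkIso_hom (M := tens (M.sh s) (N.sh t)) (N := (tens M N).sh (t + s))
    _ _ _ _ _ _) _).trans (tensShFun_tp M N s t y x)

theorem tensSh_deg0 : Deg0 (tensSh M N s t) := deg0_mkIso _ _ _ _ _ _

end TensSh

theorem fn_trans_apply {M N K : GBim A B} (e : M ≅ N) (e' : N ≅ K) (x : M) :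
  fn (e ≪≫ e').hom x = fn e'.hom (fn e.hom x) := rfl

theorem tensShIso_apply {M : GBim A B} {N : GBim B C} {Q : GBim A C} {e : tens M N ≅ Q} (he : Deg0 e) (s t : ℤ) (y : N)
    (x : M) : fn (tensSh M N s t ≪≫ shIso e he (t + s)).hom (tp (f := M.sh s) (g := N.sh t) y x) =
      fn e.hom (tp (f := M) (g := N) y x) := by
  refine (fn_trans_apply _ _ _).trans ?_
  refine (congrArg (fn (shIso e he (t + s)).hom) (tensSh_apply M N s t y x)).trans ?_
  exact shIso_apply e he (t + s) _

end

end Isos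

section Join

variable {n d : ℕ} {L mu nu : Fin n → ℤ}

noncomputable section

/-- The regular bimodule. -/
def bimBId (mu : Fin n → ℤ) : bimB d mu mu ≅ idBim (ringR d mu) :=
  mkIso (M := bimB d mu mu) (N := idBim (ringR d mu))
    (invMap (d := d) (P := Good d mu ∧ Good d mu) (P' := Good d mu)
      (G := fun σ => Young d mu σ ∧ Young d mu σ) (G' := Young d mu) (fun h => ⟨h, h⟩)
      fun σ h => ⟨h, h⟩).toLinearMap
    (invMap (d := d) (P := Good d mu) (P' := Good d mu ∧ Good d mu) (G := Young d mu)
      (G' := fun σ => Young d mu σ ∧ Young d mu σ) (fun h => h.1) fun σ h => h.1).toLinearMap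
    ⟨fun b x => rfl, fun b x => rfl, fun i x hx h => by rw [add_zero]; exact hx ⟨h.down, h.down⟩⟩
    ⟨fun b x => rfl, fun b x => rfl, fun i x hx h => by rw [add_zero]; exact hx ⟨h.down.1⟩⟩
    rfl rfl

theorem bimBId_deg0 (mu : Fin n → ℤ) : Deg0 (bimBId (d := d) mu) := deg0_mkIso _ _ _ _ _ _

theorem rv_bimBId {K : Type} [Field K] [CharZero K] (z : Fin d → K) {c : Fin d → ℕ} (hc : HasWt c mu)
    (y : bimB d mu mu) : rv z c mu (fn (bimBId mu).hom y) = bv z c c mu mu y := by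
  obtain ⟨σ, hσ⟩ := hc.exists_perm
  refine (rv_eq hσ _).trans (Eq.trans ?_ (bv_eq hσ hσ y).symm)
  rw [toP_eq, pol_of _ ⟨hc.good, hc.good⟩]
  exact congrArg _ (pol_of _ hc.good)

/-- `t` is the juxtaposition of `y` and `m`. -/
def Joins {u v : SSeq n} (y : bimW d mu nu u) (m : bimW d L mu v) (t : bimW d L nu (u ++ v)) : Prop :=
  ∀ (K : Type) [Field K] [CharZero K] (z : Fin d → K) (c : Fin d → ℕ), HasWt c L →
    ∀ xu xv, Valid c v xv → Valid (col c v xv) u xu →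
      ev z c L nu (u ++ v) t (xu ++ xv) = ev z (col c v xv) mu nu u y xu * ev z c L mu v m xv

theorem exists_cons_iso (a : Letter n) (u : SSeq n) : ∀ ρ : Fin n → ℤ, ρ = mu + (presS n d).wt u →
    ∃ i : bimW d mu nu (a :: u) ≅ tens (bimW d mu ρ u) ((bimB d ρ nu).sh (letterShift ρ a)), Deg0 i ∧
      ∀ (b : bimB d ρ nu) (y : bimW d mu ρ u) (K : Type) [Field K] [CharZero K] (z : Fin d → K)
        (c : Fin d → ℕ) x xs, Valid c (a :: u) (x :: xs) →
        ev z c mu nu (a :: u) (fn i.inv (tp (f := bimW d mu ρ u)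
          (g := (bimB d ρ nu).sh (letterShift ρ a)) b y)) (x :: xs) =
          bv z (col c u xs) (col c (a :: u) (x :: xs)) ρ nu b * ev z c mu ρ u y xs := by
  rintro _ rfl
  exact ⟨Iso.refl _, Deg0.refl _, fun b y K _ _ z c x xs h => ev_cnsB_of b y h⟩

theorem exists_join {v : SSeq n} (hmu : mu = L + (presS n d).wt v) : ∀ (u : SSeq n) (nu : Fin n → ℤ),
    nu = mu + (presS n d).wt u → ∃ e : tens (bimW d L mu v) (bimW d mu nu u) ≅ bimW d L nu (u ++ v),
      Deg0 e ∧ ∀ y m, Joins y m (fn e.hom (tp y m))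
  | [], nu, hnu => by
    obtain rfl : nu = mu := by rw [hnu]; exact add_zero mu
    refine ⟨isoL (bimW d L nu v) (bimBId nu) ≪≫ runitB (bimW d L nu v),
      ((bimBId_deg0 nu).isoL _).trans (deg0_mkIso _ _ _ _ _ _), fun y m K _ _ z c hc xu xv hv hu => ?_⟩
    obtain rfl : xu = [] := List.length_eq_zero_iff.1 hu.length_eq
    have h1 : fn (isoL (bimW d L nu v) (bimBId nu) ≪≫ runitB (bimW d L nu v)).hom (tp y m) =
        (bimW d L nu v).l (fn (bimBId nu).hom y) m :=
      (congrArg _ (wL_tp (bimW d L nu v) (bimBId nu).hom y m)).trans (runitB_hom _ _ _)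
    have h2 := ev_l (z := z) (c := c) v (fn (bimBId nu).hom y) m xv
    have h3 := rv_bimBId z (hmu ▸ hc.col (D := d) hv) y
    refine (congrFun (congrArg (ev z c L nu v) h1) xv).trans (h2.trans ?_)
    rw [h3]
    exact congrArg (· * _) (ev_nil (z := z) (c := col c v xv) (L := nu) y).symm
  | a :: u, nu, hnu => by
    have hρ : L + (presS n d).wt (u ++ v) = mu + (presS n d).wt u := by
      rw [hmu, Pres.wt_append]; abel
    obtain ⟨e, he, hj⟩ := exists_join hmu u _ hρ
    obtain ⟨i, hi, hev⟩ := exists_cons_iso (nu := nu) a u _ hρ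
    let V := bimW d L mu v
    let U := bimW d mu (L + (presS n d).wt (u ++ v)) u
    let B := (bimB d (L + (presS n d).wt (u ++ v)) nu).sh (letterShift (L + (presS n d).wt (u ++ v)) a)
    let E : tens V (bimW d mu nu (a :: u)) ≅ bimW d L nu (a :: u ++ v) :=
      isoL V i ≪≫ (assocB V U B).symm ≪≫ isoR e B
    refine ⟨E, (hi.isoL V).trans ((deg0_mkIso _ _ _ _ _ _ : Deg0 (assocB V U B)).symm.trans
      (he.isoR B)), fun y m K _ _ z c hc xu xv hv hu => ?_⟩
    obtain ⟨x, xs, rfl⟩ : ∃ x xs, xu = x :: xs :=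
      List.exists_cons_of_length_eq_add_one hu.length_eq
    have hvv : Valid c (a :: (u ++ v)) (x :: (xs ++ xv)) := by
      have := (valid_append c (a :: u) v (x :: xs) xv hu.length_eq).2 ⟨hv, hu⟩
      exact this
    have hE : ∀ (b : B) (y : U), fn E.hom (tp (fn i.inv (tp b y)) m) =
        cnsB a (u ++ v) b (fn e.hom (tp y m)) := by
      intro b y
      have h1 : fn (wL V i.hom) (tp (fn i.inv (tp b y)) m) = tp (tp b y) m := by
        rw [wL_tp, fn_hom_inv]
      have h2 : fn (assocB V U B).inv (tp (tp b y) m) = tp b (tp y m) := assocB_inv V U B b y m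
      have h3 : fn (wR e.hom B) (tp b (tp y m)) = tp b (fn e.hom (tp y m)) := wR_tp _ _ _ _
      exact (congrArg (fun t => fn (wR e.hom B) (fn (assocB V U B).inv t)) h1).trans
        ((congrArg (fn (wR e.hom B)) h2).trans h3)
    have key : LinearMap.proj (x :: (xs ++ xv)) ∘ₗ ev z c L nu (a :: (u ++ v)) ∘ₗ fn E.hom ∘ₗ
        (tpL V (bimW d mu nu (a :: u))).flip m ∘ₗ fn i.inv =
        ev z c L mu v m xv • LinearMap.proj (x :: xs) ∘ₗ ev z (col c v xv) mu nu (a :: u) ∘ₗ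
          fn i.inv := by
      refine tp_ext (f := U) (g := B) fun b y => ?_
      have h1 := ev_cnsB_of (z := z) (L := L) (nu := nu) b (fn e.hom (tp y m)) hvv
      have h2 := hev b y K z (col c v xv) x xs hu
      have h3 := hj y m K z c hc xs xv hv hu.1
      refine (congrFun (congrArg (ev z c L nu (a :: (u ++ v))) (hE b y)) (x :: (xs ++ xv))).trans
        (h1.trans ?_)
      refine Eq.trans ?_ (congrArg (fun s => ev z c L mu v m xv * s) h2.symm)
      have h4 : col c (a :: (u ++ v)) (x :: (xs ++ xv)) = col (col c v xv) (a :: u) (x :: xs) :=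
        col_append c (a :: u) v (x :: xs) xv hu.length_eq
      rw [h3, h4, col_append c u v xs xv hu.1.length_eq]
      ring
    have := LinearMap.congr_fun key (fn i.hom y)
    have h5 : fn i.inv (fn i.hom y) = y := fn_inv_hom i y
    simp only [LinearMap.comp_apply, LinearMap.smul_apply, h5] at this
    exact this.trans (mul_comm _ _)

end

end Join

end Schur


namespace Schur

open CategoryTheory MvPolynomial

open GBim (fn)

/-! ### The bimodules of shifted signed sequences -/

section OneMorphisms

variable {n d : ℕ}

noncomputable section

variable {a b c e : Obj (presS n d)}

/-- The bimodule of a shifted signed sequence. -/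
def gm (f : a ⟶ b) : GBim (ringR d a.wt) (ringR d b.wt) :=
  (bimW d a.wt b.wt (OneMor.word f)).sh (OneMor.shift f)

/-- The bimodule of an identity 1-morphism. -/
def gmUnit (a : Obj (presS n d)) : gm (𝟙 a) ≅ idBim (ringR d a.wt) :=
  (shZero (bimB d a.wt a.wt) : gm (𝟙 a) ≅ bimB d a.wt a.wt) ≪≫ bimBId a.wt

theorem gmUnit_deg0 (a : Obj (presS n d)) : Deg0 (gmUnit a) :=
  (shZero_deg0 (bimB d a.wt a.wt)).trans (bimBId_deg0 a.wt)

theorem ev_gmUnit {K : Type} [Field K] [CharZero K] (z : Fin d → K) {a : Obj (presS n d)}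
    {c : Fin d → ℕ} (hc : HasWt c a.wt) (x : gm (𝟙 a)) :
    ev z c a.wt a.wt [] x [] = rv z c a.wt (fn (gmUnit a).hom x) :=
  (ev_nil (z := z) (c := c) (L := a.wt) (nu := a.wt) x).trans (rv_bimBId z hc x).symm

attribute [local irreducible] bimW

/-- The bimodule map of a 2-morphism. -/
def gm₂ {f g : a ⟶ b} (η : f ⟶ g) : gm f →ₗ[ℚ] gm g :=
  om a.wt b.wt b.wt (OneMor.word f) (OneMor.word g) η

theorem gm₂_mem {f g : a ⟶ b} (η : f ⟶ g) : gm₂ η ∈ bhom (gm f) (gm g) :=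
  bhom_sh (om_mem_bhom (L := a.wt) (nu := b.wt) η (OneMor.eq f).symm) _ _

theorem gm₂_add {f g : a ⟶ b} (η θ : f ⟶ g) : gm₂ (η + θ) = gm₂ η + gm₂ θ :=
  map_add (om a.wt b.wt b.wt (OneMor.word f) (OneMor.word g)) η θ

theorem gm₂_spec {f g : a ⟶ b} {x : Alg n} (hx : x ∈ (presS n d).dia a.wt (OneMor.word f) (OneMor.word g))
    (t : gm f) : Realizes (L := a.wt) (nu := b.wt) (nu' := b.wt) x t (gm₂ (f := f) (g := g) (Hom2.mk (presS n d) a.wt ⟨x, hx⟩) t) :=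
  om_mk (OneMor.eq f).symm (OneMor.eq g).symm ⟨x, hx⟩ t

theorem gm₂_eq {f g : a ⟶ b} {x : Alg n} (hx : x ∈ (presS n d).dia a.wt (OneMor.word f) (OneMor.word g))
    {t : gm f} {t' : gm g} (h : Realizes (L := a.wt) (nu := b.wt) (nu' := b.wt) x t t') :
    gm₂ (f := f) (g := g) (Hom2.mk (presS n d) a.wt ⟨x, hx⟩) t = t' :=
  om_eq hx (OneMor.eq f).symm (OneMor.eq g).symm h

theorem gm₂_id (f : a ⟶ b) (t : gm f) : gm₂ (𝟙 f) t = t := gm₂_eq (one_mem_dia _ rfl) (Realizes.one _)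

theorem gm₂_comp {f g h : a ⟶ b} (η : f ⟶ g) (θ : g ⟶ h) (t : gm f) :
    gm₂ (η ≫ θ) t = gm₂ θ (gm₂ η t) := by
  induction η using Hom2.ind with | h x => ?_
  induction θ using Hom2.ind with | h y => ?_
  exact gm₂_eq (mul_mem_dia x.2 y.2) ((gm₂_spec x.2 t).mul y.2 (gm₂_spec y.2 _))

theorem exists_gj (f : a ⟶ b) (g : b ⟶ c) : ∃ e : tens (gm f) (gm g) ≅ gm (f ≫ g), Deg0 e ∧
    ∀ (y : gm g) (m : gm f), Joins (L := a.wt) (mu := b.wt) (nu := c.wt) y m (fn e.hom (tp y m)) := by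
  obtain ⟨e, he, hj⟩ := exists_join (L := a.wt) (mu := b.wt) (OneMor.eq f).symm (OneMor.word g) c.wt
    (OneMor.eq g).symm
  refine ⟨tensSh _ _ (OneMor.shift f) (OneMor.shift g) ≪≫ shIso e he _,
    (tensSh_deg0 _ _ _ _).trans (shIso_deg0 e he _), fun y m => ?_⟩
  have := hj y m
  rw [← tensShIso_apply he (OneMor.shift f) (OneMor.shift g) y m] at this
  exact this

/-- The tensor product of the bimodules of two signed sequences. -/
def gj (f : a ⟶ b) (g : b ⟶ c) : tens (gm f) (gm g) ≅ gm (f ≫ g) := (exists_gj f g).choose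

theorem gj_deg0 (f : a ⟶ b) (g : b ⟶ c) : Deg0 (gj f g) := (exists_gj f g).choose_spec.1

theorem gj_spec (f : a ⟶ b) (g : b ⟶ c) (y : gm g) (m : gm f) :
    Joins (L := a.wt) (mu := b.wt) (nu := c.wt) y m (fn (gj f g).hom (tp y m)) :=
  (exists_gj f g).choose_spec.2 y m

theorem Valid.exists_split {c : Fin d → ℕ} {u v : SSeq n} {xs : List (Fin d)} (h : Valid c (u ++ v) xs) :
    ∃ xu xv, xs = xu ++ xv ∧ Valid c v xv ∧ Valid (col c v xv) u xu := by
  obtain ⟨xu, xv, h1, _, h2, h3⟩ := h.split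
  exact ⟨xu, xv, h1, h2, h3⟩

theorem Joins.whiskerLeft {L mu nu : Fin n → ℤ} {u u' v : SSeq n} {y : bimW d mu nu u}
    {y' : bimW d mu nu u'} {m : bimW d L mu v} {t : bimW d L nu (u ++ v)} {t' : bimW d L nu (u' ++ v)}
    (hmu : mu = L + (presS n d).wt v) {x : Alg n} (hx : x ∈ (presS n d).dia mu u u')
    (h : Joins y m t) (h' : Joins y' m t') (hy : Realizes x y y') : Realizes (whisk [] v x) t t' := by
  intro K _ _ z hz c hc ys hys
  obtain ⟨xu, xv, rfl, hv, hu⟩ := hys.exists_split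
  have hc' : HasWt (col c v xv) mu := hmu ▸ hc.col (D := d) hv
  have hr := rho_whisk z (c := c) hx (u := []) (v := v) (xu := []) (ys := xu) (xv := xv) rfl hu.length_eq
    hv.length_eq (ev z c L nu (u ++ v) t)
  refine (h' K z c hc xu xv hv hu).trans (Eq.trans ?_ hr.symm)
  rw [hy K z hz _ hc' xu hu, mul_comm]
  exact (rho_congr z hx hu fun l hl hcol => (h K z c hc l xv hv hl).trans (mul_comm _ _)).symm

theorem Joins.whiskerRight {L mu nu : Fin n → ℤ} {u v v' : SSeq n} {y : bimW d mu nu u}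
    {m : bimW d L mu v} {m' : bimW d L mu v'} {t : bimW d L nu (u ++ v)} {t' : bimW d L nu (u ++ v')}
    {x : Alg n} (hx : x ∈ (presS n d).dia L v v')
    (h : Joins y m t) (h' : Joins y m' t') (hm : Realizes x m m') : Realizes (whisk u [] x) t t' := by
  intro K _ _ z hz c hc ys hys
  obtain ⟨xu, xv, rfl, hv, hu⟩ := hys.exists_split
  have hr := rho_whisk z (c := c) hx (u := u) (v := []) (xu := xu) (ys := xv) (xv := []) hu.length_eq
    hv.length_eq rfl (ev z c L nu (u ++ v) t)
  simp only [List.append_nil, col_nil] at hr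
  refine (h' K z c hc xu xv hv hu).trans (Eq.trans ?_ hr.symm)
  rw [hm K z hz _ hc xv hv]
  refine (rho_congr z hx hv fun l hl hcol => ?_).symm
  rw [h K z c hc xu l hl (hcol ▸ hu), hcol]

theorem gm₂_whiskerLeft (f : a ⟶ b) {g h : b ⟶ c} (η : g ⟶ h) (y : gm g) (x : gm f) :
    gm₂ (Bicategory.whiskerLeft f η) (fn (gj f g).hom (tp y x)) = fn (gj f h).hom (tp (gm₂ η y) x) := by
  induction η using Hom2.ind with | h ξ => ?_
  exact gm₂_eq (f := f ≫ g) (g := f ≫ h) (whisk_mem_dia [] (OneMor.word f) (OneMor.eq f) ξ.2)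
    (Joins.whiskerLeft (OneMor.eq f).symm ξ.2 (gj_spec f g y x) (gj_spec f h _ x) (gm₂_spec ξ.2 y))

theorem gm₂_whiskerRight {f g : a ⟶ b} (η : f ⟶ g) (h : b ⟶ c) (y : gm h) (x : gm f) :
    gm₂ (Bicategory.whiskerRight η h) (fn (gj f h).hom (tp y x)) = fn (gj g h).hom (tp y (gm₂ η x)) := by
  induction η using Hom2.ind with | h ξ => ?_
  have hm : whisk (OneMor.word h) [] ξ.1 ∈ (presS n d).dia a.wt (OneMor.word h ++ OneMor.word f)
      (OneMor.word h ++ OneMor.word g) := by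
    have := whisk_mem_dia (lam' := a.wt) (OneMor.word h) [] (by simp [Pres.wt]) ξ.2
    simpa only [List.append_nil] using this
  exact gm₂_eq (f := f ≫ h) (g := g ≫ h) hm
    (Joins.whiskerRight ξ.2 (gj_spec f h y x) (gj_spec g h y _) (gm₂_spec ξ.2 x))

open Bicategory in
theorem gm₂_hc {f f' : a ⟶ b} {g g' : b ⟶ c} (α : f ⟶ f') (β : g ⟶ g') (y : gm g) (x : gm f) :
    gm₂ (AddEnv.hc α β) (fn (gj f g).hom (tp y x)) = fn (gj f' g').hom (tp (gm₂ β y) (gm₂ α x)) := by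
  rw [AddEnv.hc, gm₂_comp, gm₂_whiskerRight, gm₂_whiskerLeft]

theorem gm₂_associator (f : a ⟶ b) (g : b ⟶ c) (h : c ⟶ e) (z : gm h) (y : gm g) (x : gm f) :
    gm₂ (Bicategory.associator f g h).hom (fn (gj (f ≫ g) h).hom (tp z (fn (gj f g).hom (tp y x)))) =
      fn (gj f (g ≫ h)).hom (tp (fn (gj g h).hom (tp z y)) x) := by
  refine gm₂_eq (f := (f ≫ g) ≫ h) (g := f ≫ g ≫ h)
    (one_mem_dia _ (List.append_assoc _ _ _).symm) ?_
  intro K _ _ ζ hζ c hc ys hys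
  obtain ⟨xu, xf, rfl, hv, hu⟩ := (hys : Valid c ((OneMor.word h ++ OneMor.word g) ++ OneMor.word f) ys).exists_split
  obtain ⟨xh, xg, rfl, hg, hh⟩ := hu.exists_split
  have hc' : HasWt (col c (OneMor.word f) xf) b.wt := OneMor.eq f ▸ hc.col (D := d) hv
  have e1 := gj_spec f (g ≫ h) (fn (gj g h).hom (tp z y)) x K ζ c hc (xh ++ xg) xf hv hu
  have e2 := gj_spec g h z y K ζ (col c (OneMor.word f) xf) hc' xh xg hg hh
  have e3 := gj_spec f g y x K ζ c hc xg xf hv hg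
  have hfg : Valid c (OneMor.word g ++ OneMor.word f) (xg ++ xf) :=
    (valid_append c _ _ _ _ hg.length_eq).2 ⟨hv, hg⟩
  have hcol := col_append c (OneMor.word g) (OneMor.word f) xg xf hg.length_eq
  have e4 := gj_spec (f ≫ g) h z (fn (gj f g).hom (tp y x)) K ζ c hc xh (xg ++ xf) hfg
    (hcol.symm ▸ hh)
  refine e1.trans ?_
  rw [rho_one, Module.End.one_apply, List.append_assoc]
  refine Eq.trans ?_ e4.symm
  refine (congrArg (· * _) e2).trans (Eq.trans ?_ (congrArg (_ * ·) e3.symm))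
  rw [← mul_assoc]
  refine congrArg (· * _) (congrArg (· * _) ?_)
  exact congrArg (fun cc => ev ζ cc _ _ _ z xh) hcol.symm

theorem gm₂_leftUnitor (f : a ⟶ b) (y : gm f) (x : gm (𝟙 a)) :
    gm₂ (Bicategory.leftUnitor f).hom (fn (gj (𝟙 a) f).hom (tp y x)) =
      (gm f).r (fn (gmUnit a).hom x) y := by
  refine gm₂_eq (f := 𝟙 a ≫ f) (g := f) (one_mem_dia _ (List.append_nil _)) ?_
  intro K _ _ ζ hζ c hc ys hys
  have e1 := gj_spec (𝟙 a) f y x K ζ c hc ys [] trivial hys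
  have e2 := ev_r (z := ζ) (OneMor.word f) b.wt (fn (gmUnit a).hom x) y hys
  rw [rho_one, Module.End.one_apply]
  refine e2.trans (Eq.trans ?_ ((congrArg _ (List.append_nil ys).symm).trans e1).symm)
  exact (mul_comm _ _).trans (congrArg (_ * ·) (ev_gmUnit ζ hc x).symm)

theorem gm₂_rightUnitor (f : a ⟶ b) (y : gm (𝟙 b)) (x : gm f) :
    gm₂ (Bicategory.rightUnitor f).hom (fn (gj f (𝟙 b)).hom (tp y x)) =
      (gm f).l (fn (gmUnit b).hom y) x := by
  refine gm₂_eq (f := f ≫ 𝟙 b) (g := f) (one_mem_dia _ rfl) ?_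
  intro K _ _ ζ hζ c hc ys hys
  have hc' : HasWt (col c (OneMor.word f) ys) b.wt := OneMor.eq f ▸ hc.col (D := d) hys
  have e1 := gj_spec f (𝟙 b) y x K ζ c hc [] ys hys trivial
  have e2 := ev_l (z := ζ) (c := c) (OneMor.word f) (fn (gmUnit b).hom y) x ys
  rw [rho_one, Module.End.one_apply]
  refine e2.trans (Eq.trans ?_ e1.symm)
  exact congrArg (· * _) (ev_gmUnit ζ hc' y).symm

end

end OneMorphisms

end Schur


namespace Schur

open CategoryTheory

open GBim (fn)

/-! ### Direct sums of bimodules -/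

section DirectSums

variable {A B : GAlg} {ι κ : Type} [Fintype ι] [Fintype κ]

noncomputable section

/-- The projection to a summand. -/
def dproj (M : ι → GBim A B) (i : ι) : dirSum M ⟶ M i :=
  mkHom (LinearMap.proj i) (homDeg_le 0 ⟨fun _ _ => rfl, fun _ _ => rfl, fun k x hx => by
    rw [add_zero]; exact hx i trivial⟩)

open scoped Classical in
/-- The inclusion of a summand, as a linear map. -/
def dsingle (M : ι → GBim A B) (i : ι) : M i →ₗ[ℚ] dirSum M :=
  LinearMap.single ℚ (fun i => (M i).carrier) i

theorem dsingle_same (M : ι → GBim A B) (i : ι) (x : M i) :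
    (show ∀ i, M i from dsingle M i x) i = x := by
  classical exact Pi.single_eq_same (M := fun i => (M i).carrier) i x

theorem dsingle_ne (M : ι → GBim A B) {i j : ι} (h : i ≠ j) (x : M i) :
    (show ∀ i, M i from dsingle M i x) j = 0 := by
  classical exact Pi.single_eq_of_ne' (M := fun i => (M i).carrier) h x

theorem dsingle_mem (M : ι → GBim A B) (i : ι) : dsingle M i ∈ homDeg (M i) (dirSum M) 0 := by
  refine ⟨fun b x => ?_, fun b x => ?_, fun k x hx => ?_⟩
  · funext j
    by_cases h : i = j
    · subst h
      exact (dsingle_same M i _).trans (congrArg ((M i).l b) (dsingle_same M i x).symm)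
    · exact (dsingle_ne M h _).trans ((map_zero ((M j).l b)).symm.trans
        (congrArg ((M j).l b) (dsingle_ne M h x).symm))
  · funext j
    by_cases h : i = j
    · subst h
      exact (dsingle_same M i _).trans (congrArg ((M i).r b) (dsingle_same M i x).symm)
    · exact (dsingle_ne M h _).trans ((map_zero ((M j).r b)).symm.trans
        (congrArg ((M j).r b) (dsingle_ne M h x).symm))
  · intro j _
    by_cases h : i = j
    · subst h
      rw [add_zero]
      exact (congrArg (· ∈ (M i).gr k) (dsingle_same M i x)).mpr hx
    · exact (congrArg (· ∈ (M j).gr (k + 0)) (dsingle_ne M h x)).mpr (zero_mem _)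

/-- The inclusion of a summand. -/
def dinc (M : ι → GBim A B) (i : ι) : M i ⟶ dirSum M :=
  mkHom (dsingle M i) (homDeg_le 0 (dsingle_mem M i))

theorem dproj_mem (M : ι → GBim A B) (i : ι) : fn (dproj M i) ∈ homDeg (dirSum M) (M i) 0 :=
  ⟨fun _ _ => rfl, fun _ _ => rfl, fun k x hx => by rw [add_zero]; exact hx i trivial⟩

theorem dinc_mem (M : ι → GBim A B) (i : ι) : fn (dinc M i) ∈ homDeg (M i) (dirSum M) 0 :=
  dsingle_mem M i

theorem dproj_dinc (M : ι → GBim A B) (i : ι) (x : M i) : fn (dproj M i) (fn (dinc M i) x) = x :=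
  dsingle_same M i x

theorem dproj_dinc_of_ne (M : ι → GBim A B) {i j : ι} (h : i ≠ j) (x : M i) :
    fn (dproj M j) (fn (dinc M i) x) = 0 :=
  dsingle_ne M h x

theorem dproj_ext {M : ι → GBim A B} {x y : dirSum M} (h : ∀ i, fn (dproj M i) x = fn (dproj M i) y) :
    x = y := funext h

theorem sum_dinc (M : ι → GBim A B) (x : dirSum M) :
    ∑ i, fn (dinc M i) (fn (dproj M i) x) = x := by
  refine dproj_ext fun j => ?_
  rw [map_sum, Finset.sum_eq_single j, dproj_dinc]
  · exact fun i _ h => dproj_dinc_of_ne M h _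
  · simp

/-- The map of direct sums with a given matrix. -/
def dmap {M : ι → GBim A B} {N : κ → GBim A B} (φ : ∀ i j, M i ⟶ N j) : dirSum M ⟶ dirSum N :=
  mkHom (∑ i, ∑ j, fn (dinc N j) ∘ₗ fn (φ i j) ∘ₗ fn (dproj M i))
    (sum_mem fun i _ => sum_mem fun j _ =>
      comp_mem_bhom (comp_mem_bhom (fn_mem (dproj M i)) (fn_mem (φ i j))) (fn_mem (dinc N j)))

theorem dmap_apply {M : ι → GBim A B} {N : κ → GBim A B} (φ : ∀ i j, M i ⟶ N j) (x : dirSum M)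
    (j : κ) : fn (dproj N j) (fn (dmap φ) x) = ∑ i, fn (φ i j) (fn (dproj M i) x) := by
  rw [dmap, fn_mkHom]
  simp only [LinearMap.sum_apply, LinearMap.comp_apply, map_sum]
  refine Finset.sum_congr rfl fun i _ => ?_
  rw [Finset.sum_eq_single j, dproj_dinc]
  · exact fun k _ h => dproj_dinc_of_ne N h _
  · simp

theorem dirSum_hom_ext {M : ι → GBim A B} {V : Type*} [AddCommGroup V] [Module ℚ V]
    {φ ψ : dirSum M →ₗ[ℚ] V} (h : ∀ i x, φ (fn (dinc M i) x) = ψ (fn (dinc M i) x)) : φ = ψ := by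
  refine LinearMap.ext fun x => ?_
  rw [← sum_dinc M x, map_sum, map_sum]
  exact Finset.sum_congr rfl fun i _ => h i _

end

end DirectSums

/-! ### Representations of a bicategory by bimodules -/

universe w v u

/-- The data of an additive pseudofunctor to bimodules, in terms of elements. -/
structure BimRep (B : Type u) [Bicategory.{w, v} B] [AdditiveBicategory B] where
  R : B → GAlg
  m : ∀ {a b : B}, (a ⟶ b) → GBim (R a) (R b)
  m₂ : ∀ {a b : B} {f g : a ⟶ b}, (f ⟶ g) → (m f ⟶ m g)
  m₂_add : ∀ {a b : B} {f g : a ⟶ b} (η θ : f ⟶ g), m₂ (η + θ) = m₂ η + m₂ θ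
  m₂_id : ∀ {a b : B} (f : a ⟶ b), m₂ (𝟙 f) = 𝟙 (m f)
  m₂_comp : ∀ {a b : B} {f g h : a ⟶ b} (η : f ⟶ g) (θ : g ⟶ h), m₂ (η ≫ θ) = m₂ η ≫ m₂ θ
  j : ∀ {a b c : B} (f : a ⟶ b) (g : b ⟶ c), tens (m f) (m g) ≅ m (f ≫ g)
  j_deg : ∀ {a b c : B} (f : a ⟶ b) (g : b ⟶ c), Deg0 (j f g)
  u : ∀ a : B, m (𝟙 a) ≅ idBim (R a)
  u_deg : ∀ a : B, Deg0 (u a)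
  hc : ∀ {a b c : B} {f f' : a ⟶ b} {g g' : b ⟶ c} (α : f ⟶ f') (β : g ⟶ g') (y : m g) (x : m f),
    fn (m₂ (AddEnv.hc α β)) (fn (j f g).hom (tp y x)) = fn (j f' g').hom (tp (fn (m₂ β) y) (fn (m₂ α) x))
  assoc : ∀ {a b c d : B} (f : a ⟶ b) (g : b ⟶ c) (h : c ⟶ d) (z : m h) (y : m g) (x : m f),
    fn (m₂ (Bicategory.associator f g h).hom)
      (fn (j (f ≫ g) h).hom (tp z (fn (j f g).hom (tp y x)))) =
      fn (j f (g ≫ h)).hom (tp (fn (j g h).hom (tp z y)) x)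
  lu : ∀ {a b : B} (f : a ⟶ b) (y : m f) (x : m (𝟙 a)),
    fn (m₂ (Bicategory.leftUnitor f).hom) (fn (j (𝟙 a) f).hom (tp y x)) = (m f).r (fn (u a).hom x) y
  ru : ∀ {a b : B} (f : a ⟶ b) (y : m (𝟙 b)) (x : m f),
    fn (m₂ (Bicategory.rightUnitor f).hom) (fn (j f (𝟙 b)).hom (tp y x)) = (m f).l (fn (u b).hom y) x

namespace BimRep

variable {B : Type u} [Bicategory.{w, v} B] [AdditiveBicategory B] (D : BimRep B)

noncomputable section

/-- The bimodule of a formal direct sum. -/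
abbrev M {a b : B} (f : Mat_ (a ⟶ b)) : GBim (D.R a) (D.R b) := dirSum fun i => D.m (f.X i)

/-- The projection to a summand. -/
def pr {a b : B} (f : Mat_ (a ⟶ b)) (i : f.ι) : D.M f ⟶ D.m (f.X i) := dproj (fun i => D.m (f.X i)) i

/-- The inclusion of a summand. -/
def inc {a b : B} (f : Mat_ (a ⟶ b)) (i : f.ι) : D.m (f.X i) ⟶ D.M f := dinc (fun i => D.m (f.X i)) i

theorem pr_mem {a b : B} (f : Mat_ (a ⟶ b)) (i : f.ι) :
    fn (D.pr f i) ∈ homDeg (D.M f) (D.m (f.X i)) 0 := dproj_mem (fun i => D.m (f.X i)) i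

theorem inc_mem {a b : B} (f : Mat_ (a ⟶ b)) (i : f.ι) :
    fn (D.inc f i) ∈ homDeg (D.m (f.X i)) (D.M f) 0 := dinc_mem (fun i => D.m (f.X i)) i

theorem pr_ext {a b : B} {f : Mat_ (a ⟶ b)} {x y : D.M f} (h : ∀ i, fn (D.pr f i) x = fn (D.pr f i) y) :
    x = y := dproj_ext h

theorem pr_inc {a b : B} (f : Mat_ (a ⟶ b)) (i : f.ι) (x : D.m (f.X i)) :
    fn (D.pr f i) (fn (D.inc f i) x) = x := dproj_dinc (fun i => D.m (f.X i)) i x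

theorem pr_inc_of_ne {a b : B} (f : Mat_ (a ⟶ b)) {i j : f.ι} (h : i ≠ j) (x : D.m (f.X i)) :
    fn (D.pr f j) (fn (D.inc f i) x) = 0 := dproj_dinc_of_ne (fun i => D.m (f.X i)) h x

theorem sum_inc {a b : B} (f : Mat_ (a ⟶ b)) (x : D.M f) :
    ∑ i, fn (D.inc f i) (fn (D.pr f i) x) = x := sum_dinc _ x

/-- The map of a matrix of 2-morphisms. -/
def M₂ {a b : B} {f g : Mat_ (a ⟶ b)} (A : f ⟶ g) : D.M f ⟶ D.M g :=
  dmap fun i j => D.m₂ (AddEnv.ent A i j)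

theorem M₂_apply {a b : B} {f g : Mat_ (a ⟶ b)} (A : f ⟶ g) (x : D.M f) (j : g.ι) :
    fn (D.pr g j) (fn (D.M₂ A) x) = ∑ i, fn (D.m₂ (AddEnv.ent A i j)) (fn (D.pr f i) x) :=
  dmap_apply _ x j

theorem M₂_ext {a b : B} {f g : Mat_ (a ⟶ b)} {φ ψ : D.M f ⟶ D.M g}
    (h : ∀ x j, fn (D.pr g j) (fn φ x) = fn (D.pr g j) (fn ψ x)) : φ = ψ :=
  fn_ext (LinearMap.ext fun x => D.pr_ext (h x))

theorem m₂_zero {a b : B} (f g : a ⟶ b) : D.m₂ (0 : f ⟶ g) = 0 := by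
  have := D.m₂_add (0 : f ⟶ g) 0
  rwa [add_zero, left_eq_add] at this

theorem m₂_sum {a b : B} {f g : a ⟶ b} {ι : Type*} (s : Finset ι) (η : ι → (f ⟶ g)) :
    D.m₂ (∑ i ∈ s, η i) = ∑ i ∈ s, D.m₂ (η i) := by
  classical
  induction s using Finset.induction_on with
  | empty => exact D.m₂_zero f g
  | insert i s hi ih => rw [Finset.sum_insert hi, Finset.sum_insert hi, D.m₂_add, ih]

theorem fn_zero {A C : GAlg} (M N : GBim A C) : fn (0 : M ⟶ N) = 0 := rfl

theorem fn_sum {A C : GAlg} {M N : GBim A C} {ι : Type*} (s : Finset ι) (η : ι → (M ⟶ N)) :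
    fn (∑ i ∈ s, η i) = ∑ i ∈ s, fn (η i) := by
  classical
  induction s using Finset.induction_on with
  | empty => rfl
  | insert i s hi ih => rw [Finset.sum_insert hi, Finset.sum_insert hi, fn_add, ih]

theorem M₂_add {a b : B} {f g : Mat_ (a ⟶ b)} (A A' : f ⟶ g) : D.M₂ (A + A') = D.M₂ A + D.M₂ A' := by
  refine D.M₂_ext fun x j => ?_
  rw [fn_add, LinearMap.add_apply, map_add, M₂_apply, M₂_apply, M₂_apply, ← Finset.sum_add_distrib]
  refine Finset.sum_congr rfl fun i _ => ?_
  have : AddEnv.ent (A + A') i j = AddEnv.ent A i j + AddEnv.ent A' i j := rfl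
  rw [this, D.m₂_add]; rfl

theorem M₂_perm {a b : B} {f g : Mat_ (a ⟶ b)} {A : f ⟶ g} {e : f.ι → g.ι}
    {φ : ∀ i, f.X i ⟶ g.X (e i)} (h : AddEnv.IsPerm A e φ) (he : Function.Injective e) (x : D.M f)
    (i : f.ι) : fn (D.pr g (e i)) (fn (D.M₂ A) x) = fn (D.m₂ (φ i)) (fn (D.pr f i) x) := by
  rw [M₂_apply, Finset.sum_eq_single i, h.1]
  · intro k _ hk
    rw [h.2 k (e i) fun h' => hk (he h'), D.m₂_zero, fn_zero, LinearMap.zero_apply]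
  · simp

theorem M₂_id {a b : B} (f : Mat_ (a ⟶ b)) : D.M₂ (𝟙 f) = 𝟙 (D.M f) := by
  refine D.M₂_ext fun x j => ?_
  refine (D.M₂_perm (AddEnv.isPerm_id f) (fun _ _ h => h) x j).trans ?_
  rw [D.m₂_id]; rfl

theorem M₂_comp {a b : B} {f g h : Mat_ (a ⟶ b)} (A : f ⟶ g) (A' : g ⟶ h) :
    D.M₂ (A ≫ A') = D.M₂ A ≫ D.M₂ A' := by
  refine D.M₂_ext fun x k => ?_
  rw [fn_comp, LinearMap.comp_apply, M₂_apply, M₂_apply]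
  simp only [M₂_apply, map_sum]
  rw [Finset.sum_comm]
  refine Finset.sum_congr rfl fun i _ => ?_
  rw [AddEnv.ent_comp, D.m₂_sum, fn_sum, LinearMap.sum_apply]
  exact Finset.sum_congr rfl fun j _ => by rw [D.m₂_comp]; rfl

variable {a b c d : B}

/-- The tensor product of direct sums. -/
def JF (f : Mat_ (a ⟶ b)) (g : Mat_ (b ⟶ c)) : tens (D.M f) (D.M g) →ₗ[ℚ] D.M (AddEnv.comp1 f g) :=
  ∑ p : f.ι × g.ι, fn (D.inc (AddEnv.comp1 f g) p) ∘ₗ fn (D.j (f.X p.1) (g.X p.2)).hom ∘ₗ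
    fn (wR (D.pr f p.1) (D.m (g.X p.2))) ∘ₗ fn (wL (D.M f) (D.pr g p.2))

theorem JF_tp (f : Mat_ (a ⟶ b)) (g : Mat_ (b ⟶ c)) (y : D.M g) (x : D.M f) (p : f.ι × g.ι) :
    fn (D.pr (AddEnv.comp1 f g) p) (D.JF f g (tp y x)) =
      fn (D.j (f.X p.1) (g.X p.2)).hom (tp (fn (D.pr g p.2) y) (fn (D.pr f p.1) x)) := by
  rw [JF]
  simp only [LinearMap.sum_apply, LinearMap.comp_apply, map_sum]
  refine (Finset.sum_eq_single p ?_ (by simp)).trans ?_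
  · exact fun q _ h => D.pr_inc_of_ne (AddEnv.comp1 f g) h _
  · refine (D.pr_inc (AddEnv.comp1 f g) p _).trans ?_
    rw [wL_tp, wR_tp]

/-- The inverse of `JF`. -/
def JI (f : Mat_ (a ⟶ b)) (g : Mat_ (b ⟶ c)) : D.M (AddEnv.comp1 f g) →ₗ[ℚ] tens (D.M f) (D.M g) :=
  ∑ p : f.ι × g.ι, fn (wL (D.M f) (D.inc g p.2)) ∘ₗ fn (wR (D.inc f p.1) (D.m (g.X p.2))) ∘ₗ
    fn (D.j (f.X p.1) (g.X p.2)).inv ∘ₗ fn (D.pr (AddEnv.comp1 f g) p)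

theorem JF_mem (f : Mat_ (a ⟶ b)) (g : Mat_ (b ⟶ c)) :
    D.JF f g ∈ homDeg (tens (D.M f) (D.M g)) (D.M (AddEnv.comp1 f g)) 0 := by
  refine sum_mem fun p _ => ?_
  have h1 : fn (wL (D.M f) (D.pr g p.2)) ∈ homDeg _ _ 0 := wL_homDeg (D.M f) (D.pr_mem g p.2)
  have h2 : fn (wR (D.pr f p.1) (D.m (g.X p.2))) ∈ homDeg _ _ 0 :=
    wR_homDeg (D.m (g.X p.2)) (D.pr_mem f p.1)
  have h3 : fn (D.inc (AddEnv.comp1 f g) p) ∈ homDeg (D.m (f.X p.1 ≫ g.X p.2)) _ 0 :=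
    D.inc_mem (AddEnv.comp1 f g) p
  have := comp_mem_homDeg (comp_mem_homDeg (comp_mem_homDeg h1 h2)
    (D.j_deg (f.X p.1) (g.X p.2)).1) h3
  simpa only [add_zero] using this

theorem JI_mem (f : Mat_ (a ⟶ b)) (g : Mat_ (b ⟶ c)) :
    D.JI f g ∈ homDeg (D.M (AddEnv.comp1 f g)) (tens (D.M f) (D.M g)) 0 := by
  refine sum_mem fun p _ => ?_
  have h1 : fn (wL (D.M f) (D.inc g p.2)) ∈ homDeg _ _ 0 := wL_homDeg (D.M f) (D.inc_mem g p.2)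
  have h2 : fn (wR (D.inc f p.1) (D.m (g.X p.2))) ∈ homDeg _ _ 0 :=
    wR_homDeg (D.m (g.X p.2)) (D.inc_mem f p.1)
  have h3 : fn (D.pr (AddEnv.comp1 f g) p) ∈ homDeg _ (D.m (f.X p.1 ≫ g.X p.2)) 0 :=
    D.pr_mem (AddEnv.comp1 f g) p
  have := comp_mem_homDeg (comp_mem_homDeg (comp_mem_homDeg h3
    (D.j_deg (f.X p.1) (g.X p.2)).2) h2) h1
  simpa only [add_zero] using this

theorem JI_JF (f : Mat_ (a ⟶ b)) (g : Mat_ (b ⟶ c)) : D.JI f g ∘ₗ D.JF f g = LinearMap.id := by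
  refine tp_ext fun y x => ?_
  rw [LinearMap.comp_apply, JI, LinearMap.sum_apply]
  have h : ∀ p : f.ι × g.ι, (fn (wL (D.M f) (D.inc g p.2)) ∘ₗ
      fn (wR (D.inc f p.1) (D.m (g.X p.2))) ∘ₗ fn (D.j (f.X p.1) (g.X p.2)).inv ∘ₗ
      fn (D.pr (AddEnv.comp1 f g) p)) (D.JF f g (tp y x)) =
      tp (fn (D.inc g p.2) (fn (D.pr g p.2) y)) (fn (D.inc f p.1) (fn (D.pr f p.1) x)) := by
    intro p
    rw [LinearMap.comp_apply, LinearMap.comp_apply, LinearMap.comp_apply, JF_tp, fn_inv_hom, wR_tp, wL_tp]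
  rw [Finset.sum_congr rfl fun p _ => h p, Fintype.sum_prod_type]
  conv_rhs => rw [LinearMap.id_apply, ← D.sum_inc f x, ← D.sum_inc g y]
  simp only [← tpL_apply, map_sum, LinearMap.sum_apply]

theorem inc_j (f : Mat_ (a ⟶ b)) (g : Mat_ (b ⟶ c)) (p : f.ι × g.ι) (y : D.m (g.X p.2))
    (x : D.m (f.X p.1)) : fn (D.inc (AddEnv.comp1 f g) p) (fn (D.j (f.X p.1) (g.X p.2)).hom (tp y x)) =
      D.JF f g (tp (fn (D.inc g p.2) y) (fn (D.inc f p.1) x)) := by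
  refine D.pr_ext fun q => ?_
  rw [JF_tp]
  by_cases h : p = q
  · subst h
    refine (D.pr_inc (AddEnv.comp1 f g) p _).trans ?_
    rw [D.pr_inc g p.2, D.pr_inc f p.1]
  · refine (D.pr_inc_of_ne (AddEnv.comp1 f g) h _).trans ?_
    by_cases h1 : p.1 = q.1
    · have h2 : p.2 ≠ q.2 := fun h2 => h (Prod.ext h1 h2)
      rw [D.pr_inc_of_ne g h2, ← tpL_apply, map_zero, LinearMap.zero_apply, map_zero]
    · rw [D.pr_inc_of_ne f h1, ← tpL_apply, map_zero, map_zero]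

theorem JF_JI (f : Mat_ (a ⟶ b)) (g : Mat_ (b ⟶ c)) : D.JF f g ∘ₗ D.JI f g = LinearMap.id := by
  refine dirSum_hom_ext fun p t => ?_
  have key : D.JF f g ∘ₗ D.JI f g ∘ₗ fn (D.inc (AddEnv.comp1 f g) p) ∘ₗ
      fn (D.j (f.X p.1) (g.X p.2)).hom =
      fn (D.inc (AddEnv.comp1 f g) p) ∘ₗ fn (D.j (f.X p.1) (g.X p.2)).hom := by
    refine tp_ext fun y x => ?_
    have h := D.inc_j f g p y x
    have h2 := LinearMap.congr_fun (D.JI_JF f g) (tp (fn (D.inc g p.2) y) (fn (D.inc f p.1) x))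
    refine (congrArg (fun s => D.JF f g (D.JI f g s)) h).trans (Eq.trans ?_ h.symm)
    exact congrArg (D.JF f g) h2
  have := LinearMap.congr_fun key (fn (D.j (f.X p.1) (g.X p.2)).inv t)
  simp only [LinearMap.comp_apply] at this
  have h3 : fn (D.j (f.X p.1) (g.X p.2)).hom (fn (D.j (f.X p.1) (g.X p.2)).inv t) = t := fn_hom_inv _ _
  rw [h3] at this
  exact this

/-- The compatibility with composition of 1-morphisms. -/
def J (f : Mat_ (a ⟶ b)) (g : Mat_ (b ⟶ c)) : tens (D.M f) (D.M g) ≅ D.M (AddEnv.comp1 f g) :=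
  mkIso (D.JF f g) (D.JI f g) (D.JF_mem f g) (D.JI_mem f g) (D.JI_JF f g) (D.JF_JI f g)

theorem J_tp (f : Mat_ (a ⟶ b)) (g : Mat_ (b ⟶ c)) (y : D.M g) (x : D.M f) (p : f.ι × g.ι) :
    fn (D.pr (AddEnv.comp1 f g) p) (fn (D.J f g).hom (tp y x)) =
      fn (D.j (f.X p.1) (g.X p.2)).hom (tp (fn (D.pr g p.2) y) (fn (D.pr f p.1) x)) :=
  D.JF_tp f g y x p

theorem M₂_hcM {f f' : Mat_ (a ⟶ b)} {g g' : Mat_ (b ⟶ c)} (A : f ⟶ f') (A' : g ⟶ g') (y : D.M g)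
    (x : D.M f) : fn (D.M₂ (AddEnv.hcM A A')) (fn (D.J f g).hom (tp y x)) =
      fn (D.J f' g').hom (tp (fn (D.M₂ A') y) (fn (D.M₂ A) x)) := by
  refine D.pr_ext fun q => ?_
  rw [J_tp, D.M₂_apply A', D.M₂_apply A]
  refine (D.M₂_apply (AddEnv.hcM A A') _ q).trans ?_
  have h : ∀ p : f.ι × g.ι, fn (D.m₂ (AddEnv.ent (AddEnv.hcM A A') p q))
      (fn (D.pr (AddEnv.comp1 f g) p) (fn (D.J f g).hom (tp y x))) =
      fn (D.j (f'.X q.1) (g'.X q.2)).hom (tp (fn (D.m₂ (AddEnv.ent A' p.2 q.2)) (fn (D.pr g p.2) y))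
        (fn (D.m₂ (AddEnv.ent A p.1 q.1)) (fn (D.pr f p.1) x))) := by
    intro p
    rw [J_tp]
    exact D.hc _ _ _ _
  refine (Finset.sum_congr rfl fun p _ => h p).trans ?_
  rw [Fintype.sum_prod_type]
  simp only [← tpL_apply, map_sum, LinearMap.sum_apply]

/-- The compatibility with identities. -/
def U (a : B) : D.M (AddEnv.one1 a) ≅ idBim (D.R a) where
  hom := D.pr (AddEnv.one1 a) () ≫ (D.u a).hom
  inv := (D.u a).inv ≫ D.inc (AddEnv.one1 a) ()
  hom_inv_id := by
    refine D.M₂_ext fun x j => ?_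
    simp only [fn_comp, LinearMap.comp_apply]
    have h : fn (D.u a).inv (fn (D.u a).hom (fn (D.pr (AddEnv.one1 a) ()) x)) =
      fn (D.pr (AddEnv.one1 a) ()) x := fn_inv_hom _ _
    refine (congrArg (fun s => fn (D.pr (AddEnv.one1 a) ()) (fn (D.inc (AddEnv.one1 a) ()) s)) h).trans ?_
    exact D.pr_inc (AddEnv.one1 a) () _
  inv_hom_id := by
    refine fn_ext (LinearMap.ext fun x => ?_)
    simp only [fn_comp, LinearMap.comp_apply]
    refine (congrArg (fn (D.u a).hom) (D.pr_inc (AddEnv.one1 a) () (fn (D.u a).inv x))).trans ?_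
    exact fn_hom_inv _ _

theorem U_mem (a : B) : fn (D.U a).hom ∈ homDeg (D.M (AddEnv.one1 a)) (idBim (D.R a)) 0 := by
  have := comp_mem_homDeg (dproj_mem (fun i => D.m ((AddEnv.one1 a).X i)) ()) (D.u_deg a).1
  rw [add_zero] at this; exact this

theorem J_whiskerLeft (f : Mat_ (a ⟶ b)) {g h : Mat_ (b ⟶ c)} (A : g ⟶ h) :
    (D.J f g).hom ≫ D.M₂ (AddEnv.wl f A) = wL (D.M f) (D.M₂ A) ≫ (D.J f h).hom := by
  refine fn_tp_ext fun y x => ?_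
  rw [fn_comp, fn_comp, LinearMap.comp_apply, LinearMap.comp_apply, wL_tp]
  refine (D.M₂_hcM (𝟙 f) A y x).trans ?_
  rw [M₂_id]; rfl

theorem J_whiskerRight {f g : Mat_ (a ⟶ b)} (A : f ⟶ g) (h : Mat_ (b ⟶ c)) :
    (D.J f h).hom ≫ D.M₂ (AddEnv.wr A h) = wR (D.M₂ A) (D.M h) ≫ (D.J g h).hom := by
  refine fn_tp_ext fun y x => ?_
  rw [fn_comp, fn_comp, LinearMap.comp_apply, LinearMap.comp_apply, wR_tp]
  refine (D.M₂_hcM A (𝟙 h) y x).trans ?_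
  rw [M₂_id]; rfl

theorem M₂_assoc (f : Mat_ (a ⟶ b)) (g : Mat_ (b ⟶ c)) (h : Mat_ (c ⟶ d))
    (x : D.M (AddEnv.comp1 (AddEnv.comp1 f g) h)) (p : f.ι) (q : g.ι) (r : h.ι) :
    fn (D.pr (AddEnv.comp1 f (AddEnv.comp1 g h)) (p, (q, r))) (fn (D.M₂ (AddEnv.assoc f g h).hom) x) =
      fn (D.m₂ (Bicategory.associator (f.X p) (g.X q) (h.X r)).hom)
        (fn (D.pr (AddEnv.comp1 (AddEnv.comp1 f g) h) ((p, q), r)) x) :=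
  D.M₂_perm (f := AddEnv.comp1 (AddEnv.comp1 f g) h) (g := AddEnv.comp1 f (AddEnv.comp1 g h))
    (A := (AddEnv.assoc f g h).hom) (e := fun p => (p.1.1, (p.1.2, p.2)))
    (φ := fun p => (Bicategory.associator (f.X p.1.1) (g.X p.1.2) (h.X p.2)).hom)
    (AddEnv.isPerm_perm _ _)
    (fun s t e => Prod.ext (Prod.ext (Prod.ext_iff.1 e).1 (Prod.ext_iff.1 (Prod.ext_iff.1 e).2).1)
      (Prod.ext_iff.1 (Prod.ext_iff.1 e).2).2) x ((p, q), r)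

theorem M₂_lunit (f : Mat_ (a ⟶ b)) (x : D.M (AddEnv.comp1 (AddEnv.one1 a) f)) (i : f.ι) :
    fn (D.pr f i) (fn (D.M₂ (AddEnv.lunit f).hom) x) =
      fn (D.m₂ (Bicategory.leftUnitor (f.X i)).hom)
        (fn (D.pr (AddEnv.comp1 (AddEnv.one1 a) f) ((), i)) x) :=
  D.M₂_perm (f := AddEnv.comp1 (AddEnv.one1 a) f) (g := f)
    (A := (AddEnv.lunit f).hom) (e := fun p => p.2)
    (φ := fun p => (Bicategory.leftUnitor (f.X p.2)).hom) (AddEnv.isPerm_perm _ _)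
    (fun s t e => Prod.ext rfl e) x ((), i)

theorem M₂_runit (f : Mat_ (a ⟶ b)) (x : D.M (AddEnv.comp1 f (AddEnv.one1 b))) (i : f.ι) :
    fn (D.pr f i) (fn (D.M₂ (AddEnv.runit f).hom) x) =
      fn (D.m₂ (Bicategory.rightUnitor (f.X i)).hom)
        (fn (D.pr (AddEnv.comp1 f (AddEnv.one1 b)) (i, ())) x) :=
  D.M₂_perm (f := AddEnv.comp1 f (AddEnv.one1 b)) (g := f)
    (A := (AddEnv.runit f).hom) (e := fun p => p.1)
    (φ := fun p => (Bicategory.rightUnitor (f.X p.1)).hom) (AddEnv.isPerm_perm _ _)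
    (fun s t e => Prod.ext e rfl) x (i, ())

theorem J_assoc (f : Mat_ (a ⟶ b)) (g : Mat_ (b ⟶ c)) (h : Mat_ (c ⟶ d)) :
    wR (D.J f g).hom (D.M h) ≫ (D.J (AddEnv.comp1 f g) h).hom ≫ D.M₂ (AddEnv.assoc f g h).hom =
      (assocB (D.M f) (D.M g) (D.M h)).hom ≫ wL (D.M f) (D.J g h).hom ≫
        (D.J f (AddEnv.comp1 g h)).hom := by
  refine fn_ext (tp_ext3 fun z y x => ?_)
  simp only [fn_comp, LinearMap.comp_apply, assocB_hom, wR_tp, wL_tp]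
  refine D.pr_ext fun q => ?_
  obtain ⟨i, k, l⟩ := q
  refine (D.M₂_assoc f g h _ i k l).trans ?_
  refine (congrArg (fn (D.m₂ (Bicategory.associator (f.X i) (g.X k) (h.X l)).hom))
    (D.J_tp (AddEnv.comp1 f g) h z _ ((i, k), l))).trans ?_
  refine (congrArg (fun s => fn (D.m₂ (Bicategory.associator (f.X i) (g.X k) (h.X l)).hom)
    (fn (D.j (f.X i ≫ g.X k) (h.X l)).hom (tp (fn (D.pr h l) z) s))) (D.J_tp f g y x (i, k))).trans ?_
  refine (D.assoc (f.X i) (g.X k) (h.X l) _ _ _).trans ?_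
  refine (congrArg (fun s => fn (D.j (f.X i) (g.X k ≫ h.X l)).hom (tp s (fn (D.pr f i) x)))
    (D.J_tp g h z y (k, l)).symm).trans ?_
  exact (D.J_tp f (AddEnv.comp1 g h) _ x (i, (k, l))).symm

theorem J_lunit (f : Mat_ (a ⟶ b)) :
    (D.J (AddEnv.one1 a) f).hom ≫ D.M₂ (AddEnv.lunit f).hom =
      wR (D.U a).hom (D.M f) ≫ (lunitB (D.M f)).hom := by
  refine fn_tp_ext fun y x => ?_
  simp only [fn_comp, LinearMap.comp_apply, wR_tp, lunitB_hom]
  refine D.pr_ext fun i => ?_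
  refine (D.M₂_lunit f _ i).trans ?_
  refine (congrArg (fn (D.m₂ (Bicategory.leftUnitor (f.X i)).hom))
    (D.J_tp (AddEnv.one1 a) f y x ((), i))).trans ?_
  exact D.lu (f.X i) _ _

theorem J_runit (f : Mat_ (a ⟶ b)) :
    (D.J f (AddEnv.one1 b)).hom ≫ D.M₂ (AddEnv.runit f).hom =
      wL (D.M f) (D.U b).hom ≫ (runitB (D.M f)).hom := by
  refine fn_tp_ext fun y x => ?_
  simp only [fn_comp, LinearMap.comp_apply, wL_tp, runitB_hom]
  refine D.pr_ext fun i => ?_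
  refine (D.M₂_runit f _ i).trans ?_
  refine (congrArg (fn (D.m₂ (Bicategory.rightUnitor (f.X i)).hom))
    (D.J_tp f (AddEnv.one1 b) y x (i, ()))).trans ?_
  exact D.ru (f.X i) _ _

/-- The pseudofunctor on the additive envelope. -/
def toPseudofunctor : Pseudofunctor (AddEnv B) GAlg where
  obj a := D.R a.obj
  map f := D.M f
  map₂ η := D.M₂ η
  map₂_id f := D.M₂_id f
  map₂_comp η θ := D.M₂_comp η θ
  mapId a := D.U a.obj
  mapComp f g := (D.J f g).symm
  map₂_whisker_left f g h η := (Iso.eq_inv_comp _).2 (D.J_whiskerLeft f η)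
  map₂_whisker_right η h := (Iso.eq_inv_comp _).2 (D.J_whiskerRight η h)
  map₂_associator f g h := by
    have := D.J_assoc f g h
    refine (Iso.eq_inv_comp (D.J (AddEnv.comp1 f g) h)).2 ?_
    refine (Iso.eq_inv_comp (isoR (D.J f g) (D.M h))).2 ?_
    exact this
  map₂_left_unitor f := (Iso.eq_inv_comp _).2 (D.J_lunit f)
  map₂_right_unitor f := (Iso.eq_inv_comp _).2 (D.J_runit f)

end

end BimRep

end Schur


namespace Schur

open CategoryTheory MvPolynomial

open GBim (fn)

section Functor

variable {n d : ℕ}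

noncomputable section

/-- The representation of the 2-category of signed sequences by bimodules. -/
def bimRep (n d : ℕ) : BimRep (Obj (presS n d)) where
  R a := ringR d a.wt
  m f := gm f
  m₂ η := mkHom (gm₂ η) (gm₂_mem η)
  m₂_add η θ := fn_ext (gm₂_add η θ)
  m₂_id f := fn_ext (LinearMap.ext fun t => gm₂_id f t)
  m₂_comp η θ := fn_ext (LinearMap.ext fun t => gm₂_comp η θ t)
  j f g := gj f g
  j_deg f g := gj_deg0 f g
  u a := gmUnit a
  u_deg a := gmUnit_deg0 a
  hc α β y x := gm₂_hc α β y x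
  assoc f g h z y x := gm₂_associator f g h z y x
  lu f y x := gm₂_leftUnitor f y x
  ru f y x := gm₂_rightUnitor f y x

/-- The pseudofunctor to bimodules. -/
def bimFunctor (n d : ℕ) : Pseudofunctor (AddEnv (Obj (presS n d))) GAlg :=
  (bimRep n d).toPseudofunctor

/-- The bimodule map of a matrix of 2-morphisms. -/
def bimFunctor₂ {a b : AddEnv (Obj (presS n d))} {f g : a ⟶ b} (η : f ⟶ g) :
    (fbim n d).map f ⟶ (fbim n d).map g := (bimRep n d).M₂ η

theorem bimFunctor_eq (n d : ℕ) :
    (bimFunctor n d).toPrelaxFunctorStruct = ⟨fbim n d, bimFunctor₂⟩ := rfl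

theorem bimFunctor₂_add {a b : AddEnv (Obj (presS n d))} {f g : a ⟶ b} (η θ : f ⟶ g) :
    bimFunctor₂ (η + θ) = bimFunctor₂ η + bimFunctor₂ θ := (bimRep n d).M₂_add η θ

theorem bimFunctor_mapComp_mem {a b c : AddEnv (Obj (presS n d))} (f : a ⟶ b) (g : b ⟶ c) :
    fn ((bimFunctor n d).mapComp f g).hom ∈ homDeg _ _ 0 := (bimRep n d).JI_mem f g

theorem bimFunctor_mapId_mem (a : AddEnv (Obj (presS n d))) :
    fn ((bimFunctor n d).mapId a).hom ∈ homDeg _ _ 0 := (bimRep n d).U_mem a.obj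

theorem bimFunctor₂_isMat : IsMat (P := presS n d) (d := d) (e := id) bimFunctor₂ om :=
  fun A x j => (bimRep n d).M₂_apply A x j

end

end Functor

end Schur


namespace Schur

open CategoryTheory MvPolynomial

section SpecialValues

variable {n d : ℕ} {L nu : Fin n → ℤ} {K : Type} [Field K] [CharZero K] {z : Fin d → K} {c : Fin d → ℕ}

theorem crossL_mem_dia {P : Pres n} (lam : P.W) (j i : Fin (n - 1)) :
    crossL j i ∈ P.dia lam [up j, dn i] [dn i, up j] :=
  mul_mem_dia (mul_mem_dia (layer_mem_dia lam [] (.rcup i) [up j, dn i])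
    (layer_mem_dia lam [dn i] (crU i j) [dn i])) (layer_mem_dia lam [dn i, up j] (.rcap i) [])

theorem crossR_mem_dia {P : Pres n} (lam : P.W) (j i : Fin (n - 1)) :
    crossR j i ∈ P.dia lam [dn j, up i] [up i, dn j] :=
  mul_mem_dia (mul_mem_dia (layer_mem_dia lam [dn j, up i] (.lcup j) [])
    (layer_mem_dia lam [dn j] (crU i j) [dn j])) (layer_mem_dia lam [] (.lcap j) [up i, dn j])

/-- Lagrange interpolation of a power. -/
theorem sum_lagrange {ι : Type*} [DecidableEq ι] {z : ι → K} (hz : Function.Injective z) {S : Finset ι}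
    {x : ι} (hx : x ∉ S) {r : ℕ} (hr : r < S.card) :
    (∏ u ∈ S, (z x - z u)) * ∑ y ∈ S, z y ^ r / ((z x - z y) * ∏ u ∈ S.erase y, (z y - z u)) =
      z x ^ r := by
  have h := sum_div_eq_cz_hSer z (insert x S) hz.injOn r
  rw [cz_of_neg _ (by rw [Finset.card_insert_of_notMem hx]; push_cast; omega), Finset.sum_insert hx,
    Finset.erase_insert hx] at h
  have h2 : ∑ y ∈ S, z y ^ r / ∏ u ∈ (insert x S).erase y, (z y - z u) =
      - ∑ y ∈ S, z y ^ r / ((z x - z y) * ∏ u ∈ S.erase y, (z y - z u)) := by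
    rw [← Finset.sum_neg_distrib]
    refine Finset.sum_congr rfl fun y hy => ?_
    have hxy : x ≠ y := fun e => hx (e ▸ hy)
    rw [Finset.erase_insert_of_ne hxy, Finset.prod_insert (by simp [hx]), ← neg_sub (z x) (z y), neg_mul,
      div_neg]
  rw [h2, ← sub_eq_add_neg, sub_eq_zero] at h
  rw [← h, mul_div_cancel₀]
  exact Finset.prod_ne_zero_iff.2 fun u hu => sub_ne_zero.2 (hz.ne fun e => hx (e ▸ hu))

theorem sum_lagrange' {ι : Type*} [DecidableEq ι] {z : ι → K} (hz : Function.Injective z) {S : Finset ι}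
    {x : ι} (hx : x ∉ S) {r : ℕ} (hr : r < S.card) :
    (∏ u ∈ S, (z u - z x)) * ∑ y ∈ S, z y ^ r / ((z y - z x) * ∏ u ∈ S.erase y, (z u - z y)) =
      z x ^ r := by
  rw [← sum_lagrange hz hx hr, Finset.mul_sum, Finset.mul_sum]
  refine Finset.sum_congr rfl fun y hy => ?_
  have e1 : ∀ (T : Finset ι) (t : ι), ∏ u ∈ T, (z u - z t) = (-1) ^ T.card * ∏ u ∈ T, (z t - z u) :=
    fun T t => by
      rw [← Finset.prod_const, ← Finset.prod_mul_distrib]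
      exact Finset.prod_congr rfl fun u _ => by ring
  have h1 := Finset.card_erase_add_one hy
  rw [e1, e1, ← h1, pow_succ, ← neg_sub (z x) (z y)]
  have h2 : ((-1 : K) ^ (S.erase y).card) ≠ 0 := pow_ne_zero _ (by norm_num)
  have h3 : z x - z y ≠ 0 := sub_ne_zero.2 (hz.ne fun e => hx (e ▸ hy))
  have h4 : ∏ u ∈ S.erase y, (z y - z u) ≠ 0 := Finset.prod_ne_zero_iff.2 fun u hu =>
    sub_ne_zero.2 (hz.ne (Finset.ne_of_mem_erase hu).symm)
  field_simp

theorem ev_mon (hc : HasWt c L) {p q : Letter n} {v : SSeq n} (hnu : nu = L + (presS n d).wt (p :: q :: v))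
    (k l : ℕ) (m : bimW d L (L + (presS n d).wt v) v) {x y : Fin d} {ys : List (Fin d)}
    (h : Valid c (p :: q :: v) (x :: y :: ys)) :
    ev z c L nu (p :: q :: v) (mon p q v k l m) (x :: y :: ys) =
      z x ^ k * z y ^ l * ev z c L (L + (presS n d).wt v) v m ys := by
  rw [← cns2_monomial, ev_cns2 hc hnu _ _ h]
  simp

theorem realizes_crossL (i j : Fin (n - 1)) (v : SSeq n) (a b : ℕ) (m : bimW d L (L + (presS n d).wt v) v)
    (hab : i = j → (a + b : ℤ) < en (L + (presS n d).wt v) i.val)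
    (hnu : nu = L + (presS n d).wt (up j :: dn i :: v))
    (hnu' : nu = L + (presS n d).wt (dn i :: up j :: v)) :
    Realizes (nu := nu) (nu' := nu) (whisk [] v (crossL j i)) (mon (up j) (dn i) v a b m)
      (mon (dn i) (up j) v b a m) := by
  intro K _ _ z hz c hc ys hys
  obtain ⟨xu, xv, rfl, hv, hu⟩ := Valid.exists_split (u := [dn i, up j]) hys
  obtain ⟨x, y, rfl⟩ := List.length_eq_two.1 hu.length_eq
  have hw : HasWt (col c v xv) (L + (presS n d).wt v) := hc.col (D := d) hv
  have hr := rho_whisk z (c := c) (crossL_mem_dia (P := presS n d) L j i) (u := []) (v := v) (xu := [])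
    (ys := [x, y]) (xv := xv) rfl rfl hv.length_eq
    (ev z c L nu (up j :: dn i :: v) (mon (up j) (dn i) v a b m))
  refine (ev_mon (x := x) (y := y) (ys := xv) hc hnu' b a m hys).trans (Eq.trans ?_ hr.symm)
  by_cases hxy : x = y
  · subst hxy
    have h := hu
    simp [Letter.old, Letter.new] at h
    have hij : i = j := Fin.ext h.2.symm
    subst hij
    have hab := hab rfl
    rw [(hw.bar i).1] at hab
    have hxS : x ∉ blk (col c v xv) i.val := by rw [mem_blk]; omega
    rw [rho_crossL_self hz i h.1, ← pow_add, wtB, Finset.erase_eq_of_notMem hxS,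
      ← sum_lagrange hz hxS (r := b + a) (by omega), mul_assoc, Finset.sum_mul]
    refine congrArg _ (Finset.sum_congr rfl fun t ht => ?_)
    rw [mem_blk] at ht
    have := ev_mon (z := z) hc hnu a b m (x := t) (y := t) (ys := xv) (by simp [hv, Letter.old, Letter.new, ht])
    refine Eq.trans ?_ (congrArg (· / _) this.symm)
    rw [wtB, ← pow_add, add_comm a b, div_mul_eq_mul_div]
  · rw [rho_crossL_ne hz j i hxy hu]
    have h := hu
    simp [Letter.old, Letter.new] at h
    rw [Function.update_of_ne hxy] at h
    have := ev_mon (z := z) hc hnu a b m (x := y) (y := x) (ys := xv) (by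
      simp [hv, Letter.old, Letter.new, h, Function.update_of_ne (Ne.symm hxy)])
    refine Eq.trans ?_ this.symm
    ring

theorem realizes_crossR (i j : Fin (n - 1)) (v : SSeq n) (a b : ℕ) (m : bimW d L (L + (presS n d).wt v) v)
    (hab : i = j → (a + b : ℤ) < en (L + (presS n d).wt v) (i.val + 1))
    (hnu : nu = L + (presS n d).wt (dn j :: up i :: v))
    (hnu' : nu = L + (presS n d).wt (up i :: dn j :: v)) :
    Realizes (nu := nu) (nu' := nu) (whisk [] v (crossR j i)) (mon (dn j) (up i) v a b m)
      (mon (up i) (dn j) v b a m) := by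
  intro K _ _ z hz c hc ys hys
  obtain ⟨xu, xv, rfl, hv, hu⟩ := Valid.exists_split (u := [up i, dn j]) hys
  obtain ⟨x, y, rfl⟩ := List.length_eq_two.1 hu.length_eq
  have hw : HasWt (col c v xv) (L + (presS n d).wt v) := hc.col (D := d) hv
  have hr := rho_whisk z (c := c) (crossR_mem_dia (P := presS n d) L j i) (u := []) (v := v) (xu := [])
    (ys := [x, y]) (xv := xv) rfl rfl hv.length_eq
    (ev z c L nu (dn j :: up i :: v) (mon (dn j) (up i) v a b m))
  refine (ev_mon (x := x) (y := y) (ys := xv) hc hnu' b a m hys).trans (Eq.trans ?_ hr.symm)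
  by_cases hxy : x = y
  · subst hxy
    have h := hu
    simp [Letter.old, Letter.new] at h
    have hij : i = j := Fin.ext h.2.symm
    subst hij
    have hab := hab rfl
    rw [(hw.bar i).2.1] at hab
    have hxS : x ∉ blk (col c v xv) (i.val + 1) := by rw [mem_blk]; omega
    rw [rho_crossR_self hz i h.1, ← pow_add, wtA, Finset.erase_eq_of_notMem hxS,
      ← sum_lagrange' hz hxS (r := b + a) (by omega), mul_assoc, Finset.sum_mul]
    refine congrArg _ (Finset.sum_congr rfl fun t ht => ?_)
    rw [mem_blk] at ht
    have := ev_mon (z := z) hc hnu a b m (x := t) (y := t) (ys := xv) (by simp [hv, Letter.old, Letter.new, ht])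
    refine Eq.trans ?_ (congrArg (· / _) this.symm)
    rw [wtA, ← pow_add, add_comm a b, div_mul_eq_mul_div]
  · rw [rho_crossR_ne hz j i hxy hu]
    have h := hu
    simp [Letter.old, Letter.new] at h
    rw [Function.update_of_ne hxy] at h
    have := ev_mon (z := z) hc hnu a b m (x := y) (y := x) (ys := xv) (by
      simp [hv, Letter.old, Letter.new, h, Function.update_of_ne (Ne.symm hxy)])
    refine Eq.trans ?_ this.symm
    ring

theorem wt_swap (D : ℕ) (L : Fin n → ℤ) (p q : Letter n) (v : SSeq n) :
    L + (presS n D).wt (p :: q :: v) = L + (presS n D).wt (q :: p :: v) := by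
  simp only [Pres.wt]; abel

theorem om_sideways (L : Fin n → ℤ) : Sideways (om (n := n) (d := d)) L where
  left i j v a b m hab := om_cls (whisk_mem_dia [] v rfl (crossL_mem_dia (P := presS n d) _ j i)) rfl
    (wt_swap d L _ _ v) (realizes_crossL i j v a b m hab rfl (wt_swap d L _ _ v))
  right i j v a b m hab := om_cls (whisk_mem_dia [] v rfl (crossR_mem_dia (P := presS n d) _ j i)) rfl
    (wt_swap d L _ _ v) (realizes_crossR i j v a b m hab rfl (wt_swap d L _ _ v))

theorem rv_ofR {mu : Fin n → ℤ} {p : Poly d} (hmu : Good d mu)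
    (hp : ∀ ρ : Equiv.Perm (Fin d), std mu ∘ ρ = std mu → rename ρ p = p) {σ : Equiv.Perm (Fin d)}
    (hσ : c ∘ σ = std mu) : rv z c mu (ofR p) = aeval (z ∘ σ) p :=
  (rv_eq hσ _).trans (congrArg _ (polR_ofR hmu hp))

theorem superH_inv {mu : Fin n → ℤ} (hmu : Good d mu) (i j : ℕ) (k : ℤ) {ρ : Equiv.Perm (Fin d)}
    (hρ : std mu ∘ ρ = std mu) : rename ρ (superH (d := d) mu i j k) = superH mu i j k := by
  rw [superH]
  split_ifs
  · simp only [map_sum, map_smul, map_mul, eB_inv hmu _ _ hρ, hB_inv hmu _ _ hρ]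
  · exact map_zero _

theorem aeval_superH {mu : Fin n → ℤ} (hmu : Good d mu) {σ : Equiv.Perm (Fin d)} (hσ : c ∘ σ = std mu)
    (i j : ℕ) (k : ℤ) : aeval (z ∘ σ) (superH mu i j k) =
      cz (eSer z (blk c i) * hSer z (blk c j)) k := by
  rw [superH, cz]
  split_ifs
  · rw [PowerSeries.coeff_mul, Finset.Nat.sum_antidiagonal_eq_sum_range_succ
      (fun a b => PowerSeries.coeff a (eSer z (blk c i)) * PowerSeries.coeff b (hSer z (blk c j))), map_sum]
    refine Finset.sum_congr rfl fun l _ => ?_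
    rw [map_smul, map_mul, aeval_eB hmu hσ, aeval_hB hmu hσ, Algebra.smul_def]
    have : ((-1 : K) ^ l) * (-1) ^ l = 1 := by rw [← mul_pow]; norm_num
    simp only [map_pow, map_neg, map_one]
    rw [← mul_assoc, ← mul_assoc, this, one_mul]
  · exact map_zero _

/-- A diagram without boundary acts by a scalar. -/
theorem realizes_scalar {v : SSeq n} {x : Alg n} {p : Poly d} (hx : x ∈ (presS n d).dia (L + (presS n d).wt v) [] [])
    (hp : ∀ ρ : Equiv.Perm (Fin d), std (L + (presS n d).wt v) ∘ ρ = std (L + (presS n d).wt v) →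
      Good d (L + (presS n d).wt v) → rename ρ p = p)
    (h : ∀ (K : Type) [Field K] [CharZero K] (z : Fin d → K), Function.Injective z →
      ∀ (c : Fin d → ℕ) (σ : Equiv.Perm (Fin d)), HasWt c (L + (presS n d).wt v) →
      c ∘ σ = std (L + (presS n d).wt v) → ∀ F, rho z c x F [] = aeval (z ∘ σ) p * F [])
    (m : bimW d L (L + (presS n d).wt v) v) :
    Realizes (whisk [] v x) m ((bimW d L (L + (presS n d).wt v) v).l (ofR p) m) := by
  intro K _ _ z hz c hc ys hys
  have hw : HasWt (col c v ys) (L + (presS n d).wt v) := hc.col (D := d) hys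
  obtain ⟨σ, hσ⟩ := hw.exists_perm
  have hr := rho_whisk z (c := c) hx (u := []) (v := v) (xu := []) (ys := []) (xv := ys) rfl rfl
    hys.length_eq (ev z c L _ v m)
  refine (ev_l v (ofR p) m ys).trans (Eq.trans ?_ hr.symm)
  rw [h K z hz _ σ hw hσ, rv_ofR hw.good (fun ρ hρ => hp ρ hρ hw.good) hσ]
  rfl

theorem aeval_sg_smul (k : ℤ) (p : Poly d) (y : Fin d → K) :
    aeval y (sg k • p) = (sg k : K) * aeval y p := by
  rw [map_smul, Algebra.smul_def]; rfl

theorem sg_cast (k : ℕ) : ((sg (k : ℤ) : ℚ) : K) = (-1) ^ k := by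
  rw [sg_eq]; push_cast; rfl

theorem sg_cast_succ (k : ℕ) : ((sg ((k : ℤ) + 1) : ℚ) : K) = -(-1) ^ k := by
  have := sg_cast (K := K) (k + 1)
  rw [pow_succ] at this
  push_cast at this
  rw [this]; ring

theorem om_bubbleVal (L : Fin n → ℤ) : BubbleVal (om (n := n) (d := d)) L where
  cw i r v mu m hmu := by
    subst hmu
    refine om_cls (whisk_mem_dia [] v rfl (cw_mem_dia (P := presS n d) _ _ i r)) rfl rfl
      (realizes_scalar (cw_mem_dia (P := presS n d) _ _ i r) (fun ρ hρ hg => ?_)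
        (fun K _ _ z hz c σ hc hσ F => ?_) m)
    · rw [map_smul, superH_inv hg _ _ _ hρ]
    · obtain ⟨h1, h2, h3⟩ := hc.bar i
      rw [rho_cw hz hc, aeval_sg_smul, aeval_superH hc.good hσ, h1, h2, sg_cast, cwS, cz_C_mul, h3]
      congr 3; ring
  cc i r v mu m hmu := by
    subst hmu
    refine om_cls (whisk_mem_dia [] v rfl (cc_mem_dia (P := presS n d) _ _ i r)) rfl rfl
      (realizes_scalar (cc_mem_dia (P := presS n d) _ _ i r) (fun ρ hρ hg => ?_)
        (fun K _ _ z hz c σ hc hσ F => ?_) m)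
    · rw [map_smul, superH_inv hg _ _ _ hρ]
    · obtain ⟨h1, h2, h3⟩ := hc.bar i
      rw [rho_cc hz hc, aeval_sg_smul, aeval_superH hc.good hσ, h1, h2, sg_cast_succ, ccS, cz_C_mul, h3]
      congr 3; ring

end SpecialValues

end Schur


namespace Schur

open CategoryTheory

section Signs

variable {n : ℕ}

noncomputable section

theorem en_add (lam mu : Fin n → ℤ) (i : ℕ) : en (lam + mu) i = en lam i + en mu i := by
  unfold en; split_ifs <;> simp

theorem sg_mul_self (k : ℤ) : sg k * sg k = 1 := by unfold sg; split_ifs <;> norm_num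

theorem sg_add (k l : ℤ) : sg (k + l) = sg k * sg l := by
  unfold sg
  by_cases hk : Even k <;> by_cases hl : Even l <;> simp [Int.even_add, hk, hl]

theorem sg_sub (k l : ℤ) : sg (k - l) = sg k * sg l := by
  unfold sg
  by_cases hk : Even k <;> by_cases hl : Even l <;> simp [Int.even_sub, hk, hl]

/-- The sign `s` for each left cup or cap. -/
def genSign (s : ℚ) : Gen n → ℚ
  | .lcap _ => s
  | .lcup _ => s
  | _ => 1

/-- Multiply left cups and left caps by `s`. -/
def flip (s : ℚ) : Alg n →ₐ[ℚ] Alg n := FreeAlgebra.lift ℚ fun l => genSign s l.gen • FreeAlgebra.ι ℚ l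

theorem flip_lay (s : ℚ) (u : SSeq n) (g : Gen n) (v : SSeq n) :
    flip s (lay u g v) = genSign s g • lay u g v := by simp [flip, lay]

theorem twist_lay (lam : Fin n → ℤ) (u : SSeq n) (g : Gen n) (v : SSeq n) :
    twist lam (lay u g v) = layerSign lam ⟨u, g, v⟩ • lay u g v := by simp [twist, lay]

theorem flip_whisk (s : ℚ) (u v : SSeq n) (x : Alg n) : flip s (whisk u v x) = whisk u v (flip s x) := by
  have : (flip s).comp (whisk u v) = (whisk u v).comp (flip (n := n) s) := by
    ext l; simp [flip, whisk, lay]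
  exact DFunLike.congr_fun this x

theorem layerSign_whisk (d : ℕ) (lam : Fin n → ℤ) (u v a b : SSeq n) (g : Gen n) :
    layerSign lam ⟨u ++ a, g, b ++ v⟩ = layerSign (lam + (presS n d).wt v) ⟨a, g, b⟩ := by
  have e : lam + (presS n 0).wt (b ++ v) = lam + (presS n d).wt v + (presS n 0).wt b := by
    have hv : (presS n d).wt v = (presS n 0).wt v := by
      induction v with
      | nil => rfl
      | cons a v ih => obtain ⟨s, i⟩ := a; simp only [Pres.wt]; rw [ih]
    rw [hv, Pres.wt_append]; abel
  cases g <;> simp only [layerSign, e]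

theorem twist_whisk (d : ℕ) (lam : Fin n → ℤ) (u v : SSeq n) (x : Alg n) :
    twist lam (whisk u v x) = whisk u v (twist (lam + (presS n d).wt v) x) := by
  have : (twist lam).comp (whisk u v) = (whisk u v).comp (twist (lam + (presS n d).wt v)) := by
    ext l
    obtain ⟨a, g, b⟩ := l
    have := twist_lay lam (u ++ a) g (b ++ v)
    rw [layerSign_whisk d] at this
    simp only [AlgHom.comp_apply, Function.comp_apply, AlgHom.coe_comp]
    change twist lam (whisk u v (lay a g b)) = whisk u v (twist _ (lay a g b))
    rw [whisk_lay, this, twist_lay, map_smul, whisk_lay]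
  exact DFunLike.congr_fun this x

/-- Two lifts of the same weight differ by a constant. -/
theorem exists_shift {lam mu : Fin n → ℤ} (h : ∀ i, glBar lam i = glBar mu i) :
    ∃ k : ℤ, ∀ j < n, en mu j = en lam j + k := by
  refine ⟨en mu 0 - en lam 0, fun j => ?_⟩
  induction j with
  | zero => intro _; ring
  | succ j ih =>
    intro hj
    have h1 := ih (by omega)
    have h2 := h ⟨j, by omega⟩
    simp only [glBar] at h2
    linarith

theorem twist_twist {lam mu : Fin n → ℤ} {k : ℤ} (h : ∀ j < n, en mu j = en lam j + k) (x : Alg n) :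
    twist mu (twist lam x) = flip (sg k) x := by
  have : (twist mu).comp (twist lam) = flip (n := n) (sg k) := by
    ext l
    obtain ⟨a, g, b⟩ := l
    change twist mu (twist lam (lay a g b)) = flip _ (lay a g b)
    rw [twist_lay, map_smul, twist_lay, flip_lay, smul_smul]
    congr 1
    cases g with
    | lcap i =>
      have hi := i.isLt
      simp only [layerSign, genSign, en_add]
      rw [h (i.val + 1) (by omega)]
      simp only [sg_add]
      linear_combination (sg k) * (sg (en ((presS n 0).wt b) (i.val + 1)) ^ 2 * sg 1 ^ 2) * sg_mul_self (en lam (i.val + 1)) +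
        sg k * sg 1 ^ 2 * sg_mul_self (en ((presS n 0).wt b) (i.val + 1)) + sg k * sg_mul_self 1
    | lcup i =>
      have hi := i.isLt
      simp only [layerSign, genSign, en_add]
      rw [h (i.val + 1) (by omega)]
      simp only [sg_add]
      linear_combination (sg k) * (sg (en ((presS n 0).wt b) (i.val + 1)) ^ 2) * sg_mul_self (en lam (i.val + 1)) +
        sg k * sg_mul_self (en ((presS n 0).wt b) (i.val + 1))
    | _ => simp [layerSign, genSign]
  exact DFunLike.congr_fun this x

/-! ### Signs and the relations -/

variable {s : ℚ} {lam mu : Fin n → ℤ}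

theorem flip_dots (u : SSeq n) (a : Letter n) (v : SSeq n) (k : ℕ) : flip s (dots u a v k) = dots u a v k := by
  rw [dots, map_pow, flip_lay, show genSign s (.dot a) = 1 from rfl, one_smul]

theorem flip_cwReal (i : Fin (n - 1)) (r : ℕ) : flip s (cwReal i r) = s • cwReal i r := by
  simp only [cwReal, map_mul, flip_lay, flip_dots, genSign, one_smul, smul_mul_assoc]

theorem flip_ccReal (i : Fin (n - 1)) (r : ℕ) : flip s (ccReal i r) = s • ccReal i r := by
  simp only [ccReal, map_mul, flip_lay, flip_dots, genSign, one_smul, mul_smul_comm]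

theorem glBar_eq_of_shift {k : ℤ} (h : ∀ j < n, en mu j = en lam j + k) (i : Fin (n - 1)) :
    glBar mu i = glBar lam i := by
  have hi := i.isLt
  rw [glBar, glBar, h _ (by omega), h _ (by omega)]; ring

theorem flip_cwBub {k : ℤ} (h : ∀ j < n, en mu j = en lam j + k) (i : Fin (n - 1)) (m : ℕ) :
    flip (sg k) (cwBub lam i m) = sg k • cwBub mu i m := by
  have hi := i.isLt
  induction m using Nat.strong_induction_on with
  | _ m ih =>
    rw [cwBub, cwBub, glBar_eq_of_shift h, h _ (by omega : i.val + 1 < n), sg_add]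
    split_ifs
    · exact flip_cwReal i _
    · rw [AlgHom.commutes, Algebra.smul_def, ← map_mul, mul_left_comm, sg_mul_self, mul_one]
    · simp only [map_smul, map_sum, map_mul, flip_ccReal]
      rw [smul_smul, mul_left_comm, sg_mul_self, mul_one]
      congr 1
      refine Finset.sum_congr rfl fun j _ => ?_
      rw [ih j.val j.isLt, smul_mul_smul_comm, sg_mul_self, one_smul]

theorem flip_ccBub {k : ℤ} (h : ∀ j < n, en mu j = en lam j + k) (i : Fin (n - 1)) (m : ℕ) :
    flip (sg k) (ccBub lam i m) = sg k • ccBub mu i m := by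
  have hi := i.isLt
  induction m using Nat.strong_induction_on with
  | _ m ih =>
    rw [ccBub, ccBub, glBar_eq_of_shift h, h _ (by omega : i.val + 1 < n), sg_add]
    split_ifs
    · exact flip_ccReal i _
    · rw [AlgHom.commutes, Algebra.smul_def, ← map_mul]
      congr 1
      linear_combination sg (en lam (i.val + 1)) * sg_mul_self k
    · simp only [map_smul, map_sum, map_mul, flip_cwReal]
      rw [smul_smul]
      congr 1
      · linear_combination sg (en lam (i.val + 1)) * sg_mul_self k
      refine Finset.sum_congr rfl fun j _ => ?_
      rw [ih j.val j.isLt, smul_mul_smul_comm, sg_mul_self, one_smul]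

theorem flip_cw {k : ℤ} (h : ∀ j < n, en mu j = en lam j + k) (i : Fin (n - 1)) (r : ℤ) :
    flip (sg k) (cw lam i r) = sg k • cw mu i r := by
  rw [cw, cw, glBar_eq_of_shift h]
  split_ifs
  · exact flip_cwReal i _
  · exact flip_cwBub h i _
  · rw [map_zero, smul_zero]

theorem flip_cc {k : ℤ} (h : ∀ j < n, en mu j = en lam j + k) (i : Fin (n - 1)) (r : ℤ) :
    flip (sg k) (cc lam i r) = sg k • cc mu i r := by
  rw [cc, cc, glBar_eq_of_shift h]
  split_ifs
  · exact flip_ccReal i _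
  · exact flip_ccBub h i _
  · rw [map_zero, smul_zero]

theorem flip_crossL (j i : Fin (n - 1)) : flip s (crossL j i) = crossL j i := by
  simp only [crossL, map_mul, flip_lay, genSign, one_smul]

theorem flip_crossR (hs : s * s = 1) (j i : Fin (n - 1)) : flip s (crossR j i) = crossR j i := by
  simp only [crossR, map_mul, flip_lay, genSign, one_smul, smul_mul_assoc, mul_smul_comm, smul_smul, hs]

/-- The relations for two lifts of the same weight agree up to signs. -/
theorem RelGL.shift {k : ℤ} (h : ∀ j < n, en mu j = en lam j + k) {w w' : SSeq n} {x : Alg n}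
    (hx : RelGL lam w w' x) : ∃ (e : ℚ) (y : Alg n), e ≠ 0 ∧ RelGL mu w w' y ∧ flip (sg k) x = e • y := by
  have hs := sg_mul_self k
  have hs0 : sg k ≠ 0 := fun h0 => by rw [h0] at hs; norm_num at hs
  have hb := glBar_eq_of_shift h
  cases hx with
  | biadj1 i => exact ⟨1, _, one_ne_zero, .biadj1 i, by simp [flip_lay, genSign]⟩
  | biadj2 i => exact ⟨1, _, one_ne_zero, .biadj2 i, by simp [flip_lay, genSign, smul_smul, hs]⟩
  | biadj3 i => exact ⟨1, _, one_ne_zero, .biadj3 i, by simp [flip_lay, genSign, smul_smul, hs]⟩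
  | biadj4 i => exact ⟨1, _, one_ne_zero, .biadj4 i, by simp [flip_lay, genSign]⟩
  | cycDot1 i => exact ⟨1, _, one_ne_zero, .cycDot1 i, by simp [flip_lay, genSign, smul_smul, hs]⟩
  | cycDot2 i => exact ⟨1, _, one_ne_zero, .cycDot2 i, by simp [flip_lay, genSign]⟩
  | cycCross1 i j =>
    refine ⟨1, _, one_ne_zero, .cycCross1 i j, ?_⟩
    have h4 : sg k * (sg k * (sg k * sg k)) = 1 := by rw [hs, mul_one, hs]
    simp [flip_lay, genSign, smul_smul, hs, h4]
  | cycCross2 i j => exact ⟨1, _, one_ne_zero, .cycCross2 i j, by simp [flip_lay, genSign]⟩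
  | posCw i r hr => exact ⟨_, _, hs0, .posCw i r (by rw [hb]; exact hr), flip_cwReal i r⟩
  | posCc i r hr => exact ⟨_, _, hs0, .posCc i r (by rw [hb]; exact hr), flip_ccReal i r⟩
  | zeroCw i hi =>
    refine ⟨_, _, hs0, .zeroCw i (by rw [hb]; exact hi), ?_⟩
    have := i.isLt
    rw [map_sub, flip_cwReal, AlgHom.commutes, hb, h _ (by omega : i.val + 1 < n), sg_add, smul_sub,
      Algebra.smul_def (sg k) (algebraMap ℚ _ _), ← map_mul, mul_left_comm, hs, mul_one]
  | zeroCc i hi =>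
    refine ⟨_, _, hs0, .zeroCc i (by rw [hb]; exact hi), ?_⟩
    have := i.isLt
    rw [map_sub, flip_ccReal, AlgHom.commutes, hb, h _ (by omega : i.val + 1 < n), smul_sub,
      Algebra.smul_def (sg k) (algebraMap ℚ _ _), ← map_mul]
    congr 2
    rw [sg_sub, sg_sub, sg_add]
    linear_combination -sg (en lam (i.val + 1)) * sg 1 * hs
  | grass i m =>
    refine ⟨1, _, one_ne_zero, .grass i m, ?_⟩
    rw [one_smul, map_add, map_sum]
    congr 1
    · refine Finset.sum_congr rfl fun j _ => ?_
      rw [map_mul, flip_ccBub h, flip_cwBub h, smul_mul_smul_comm, hs, one_smul]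
    · split_ifs <;> simp
  | curlR i =>
    refine ⟨_, _, hs0, .curlR i, ?_⟩
    rw [map_add, map_sum, smul_add, Finset.smul_sum, hb]
    congr 1
    · simp [flip_lay, genSign]
    · refine Finset.sum_congr rfl fun f _ => ?_
      rw [map_mul, flip_whisk, flip_cw h, flip_dots, map_smul, smul_mul_assoc]
  | curlL i nu hnu =>
    have h' : ∀ j < n, en (mu + glRoot i) j = en nu j + k := fun j hj => by
      rw [hnu, en_add, en_add, h j hj]; ring
    refine ⟨_, _, hs0, .curlL i (mu + glRoot i) rfl, ?_⟩
    rw [map_sub, map_sum, smul_sub, Finset.smul_sum, glBar_eq_of_shift h']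
    congr 1
    · simp [flip_lay, genSign]
    · refine Finset.sum_congr rfl fun f _ => ?_
      rw [map_mul, flip_whisk, flip_cc h', flip_dots, map_smul, smul_mul_assoc]
  | decEF i =>
    refine ⟨1, _, one_ne_zero, .decEF i, ?_⟩
    rw [one_smul, map_add, map_sum, map_sub, map_mul, flip_crossL, flip_crossR hs, map_one, hb]
    congr 1
    refine Finset.sum_congr rfl fun f _ => ?_
    rw [map_sum]
    refine Finset.sum_congr rfl fun g _ => ?_
    simp only [map_mul, flip_dots, flip_lay, flip_cc h, genSign, one_smul, smul_mul_assoc, mul_smul_comm,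
      smul_smul, hs]
  | decFE i =>
    refine ⟨1, _, one_ne_zero, .decFE i, ?_⟩
    rw [one_smul, map_add, map_sum, map_sub, map_mul, flip_crossL, flip_crossR hs, map_one, hb]
    congr 1
    refine Finset.sum_congr rfl fun f _ => ?_
    rw [map_sum]
    refine Finset.sum_congr rfl fun g _ => ?_
    simp only [map_mul, flip_dots, flip_lay, flip_cw h, genSign, one_smul, smul_mul_assoc, mul_smul_comm,
      smul_smul, hs]
  | nil i => exact ⟨1, _, one_ne_zero, .nil i, by simp [flip_lay, genSign]⟩
  | nilDot1 i => exact ⟨1, _, one_ne_zero, .nilDot1 i, by simp [flip_lay, genSign]⟩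
  | nilDot2 i => exact ⟨1, _, one_ne_zero, .nilDot2 i, by simp [flip_lay, genSign]⟩
  | sideLR i j hij =>
    exact ⟨1, _, one_ne_zero, .sideLR i j hij, by simp [flip_crossL, flip_crossR hs]⟩
  | sideRL i j hij =>
    exact ⟨1, _, one_ne_zero, .sideRL i j hij, by simp [flip_crossL, flip_crossR hs]⟩
  | far i j hij => exact ⟨1, _, one_ne_zero, .far i j hij, by simp [flip_lay, genSign]⟩
  | near i j hij => exact ⟨1, _, one_ne_zero, .near i j hij, by simp [flip_lay, genSign]⟩
  | slide1 i j hij => exact ⟨1, _, one_ne_zero, .slide1 i j hij, by simp [flip_lay, genSign]⟩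
  | slide2 i j hij => exact ⟨1, _, one_ne_zero, .slide2 i j hij, by simp [flip_lay, genSign]⟩
  | triple i j l hij => exact ⟨1, _, one_ne_zero, .triple i j l hij, by simp [flip_lay, genSign]⟩
  | tripleIJI i j hij => exact ⟨1, _, one_ne_zero, .tripleIJI i j hij, by simp [flip_lay, genSign]⟩

/-! ### The change of sign conventions on 2-morphisms -/

variable {d : ℕ}

theorem twist_mem_dia {P Q : Pres n} {mu : P.W} (nu : Q.W) (lam : Fin n → ℤ) {w w' : SSeq n} {x : Alg n}
    (hx : x ∈ P.dia mu w w') : twist lam x ∈ Q.dia nu w w' := by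
  refine Submodule.span_induction (p := fun x _ => twist lam x ∈ Q.dia nu w w') ?_ ?_ ?_ ?_ hx
  · rintro y ⟨k, hy⟩
    clear hx
    induction hy with
    | id w => rw [map_one]; exact one_mem_dia nu rfl
    | cons u g v h ih =>
      rw [map_mul, twist_lay, smul_mul_assoc]
      exact Submodule.smul_mem _ _ (mul_mem_dia (layer_mem_dia nu u g v) ih)
  · rw [map_zero]; exact zero_mem _
  · intro x y _ _ h1 h2; rw [map_add]; exact add_mem h1 h2
  · intro q x _ h1; rw [map_smul]; exact Submodule.smul_mem _ _ h1

theorem glBar_psiObj (mu : Fin (n - 1) → ℤ) (i : Fin (n - 1)) : glBar (psiObj n d mu) i = mu i := by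
  have hi := i.isLt
  have h1 : i.val < n := by omega
  have h2 : i.val + 1 < n := by omega
  rw [glBar, en, en, dif_pos h1, dif_pos h2, psiObj, psiObj, sub_sub_sub_cancel_right,
    ← Finset.sum_sub_distrib, Finset.sum_eq_single i]
  · simp
  · intro k _ hk
    have : k.val ≠ i.val := fun e => hk (Fin.ext e)
    change (if i.val ≤ k.val then mu k else 0) - (if i.val + 1 ≤ k.val then mu k else 0) = 0
    split_ifs <;> first | omega | simp
  · simp

theorem layerSign_congr (lam : Fin n → ℤ) {u u' v v' : SSeq n} (g : Gen n)
    (h : (presS n 0).wt v = (presS n 0).wt v') : layerSign lam ⟨u, g, v⟩ = layerSign lam ⟨u', g, v'⟩ := by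
  cases g <;> simp only [layerSign, h]

theorem twist_localRel {mu : Fin (n - 1) → ℤ} {lam : Fin n → ℤ} (hlam : ∀ i, glBar lam i = mu i)
    {w w' : SSeq n} {r : Alg n} (hr : LocalRel (presSL n) mu w w' r) :
    ∃ (e : ℚ) (y : Alg n), LocalRel (presS n d) lam w w' y ∧ twist lam r = e • y := by
  cases hr with
  | rel h hd =>
    obtain ⟨nu, y, hnu, hy, rfl⟩ := h
    obtain ⟨k, hk⟩ := exists_shift (lam := nu) (mu := lam) fun i => (hnu i).trans (hlam i).symm
    obtain ⟨e, y', he, hy', e1⟩ := hy.shift hk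
    have e2 := (twist_twist hk y).trans e1
    refine ⟨e, y', .rel hy' ?_, e2⟩
    have := twist_mem_dia (Q := presS n d) lam lam hd
    rw [e2] at this
    simpa [smul_smul, he] using Submodule.smul_mem _ e⁻¹ this
  | exchange g v g' =>
    refine ⟨layerSign lam ⟨[], g, v ++ g'.src⟩ * layerSign lam ⟨g.tgt ++ v, g', []⟩, _, .exchange g v g', ?_⟩
    rw [map_sub, map_mul, map_mul, twist_lay, twist_lay, twist_lay, twist_lay, smul_mul_smul_comm,
      smul_mul_smul_comm, smul_sub]
    congr 2
    rw [mul_comm, layerSign_congr lam (u := g.src ++ v) (u' := g.tgt ++ v) g' rfl,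
      layerSign_congr lam (u := []) (u' := []) (v := v ++ g'.tgt) (v' := v ++ g'.src) g
        (by rw [Pres.wt_append, Pres.wt_append, wt_src_tgt])]

theorem twist_mem_ker {mu : Fin (n - 1) → ℤ} {w w' : SSeq n} {x : Alg n}
    (hx : x ∈ (presSL n).ker mu w w') :
    twist (psiObj n d mu) x ∈ (presS n d).ker (psiObj n d mu) w w' := by
  refine Submodule.span_induction
    (p := fun x _ => twist (psiObj n d mu) x ∈ (presS n d).ker (psiObj n d mu) w w') ?_ ?_ ?_ ?_ hx
  · rintro x (⟨u, s, t, v, a, r, b, ha, hr, hb, rfl⟩ | ⟨y, a, b, ⟨u, v, _, h⟩, _⟩)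
    · obtain ⟨e, y, hy, e1⟩ := twist_localRel (d := d) (glBar_psiObj (d := d) _) hr
      have hr' : twist (psiObj n d mu) (a * whisk u v r * b) =
          e • (twist (psiObj n d mu) a * whisk u v y * twist (psiObj n d mu) b) := by
        rw [map_mul, map_mul, twist_whisk d, ← psiObj_wt]
        have e1' : twist (psiObj n d (mu + (presSL n).wt v)) r = e • y := e1
        rw [e1', map_smul, mul_smul_comm, smul_mul_assoc]
      rw [hr']
      have hy' : LocalRel (presS n d) (psiObj n d mu + (presS n d).wt v) s t y := psiObj_wt n d mu v ▸ hy
      exact Submodule.smul_mem _ _ (Submodule.subset_span (Or.inl ⟨u, s, t, v, _, y, _,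
        twist_mem_dia _ _ ha, hy', twist_mem_dia _ _ hb, rfl⟩))
    · exact h.elim
  · rw [map_zero]; exact zero_mem _
  · intro x y _ _ h1 h2; rw [map_add]; exact add_mem h1 h2
  · intro q x _ h1; rw [map_smul]; exact Submodule.smul_mem _ _ h1

/-- The change of sign conventions on diagrams. -/
def twistD (d : ℕ) (mu : Fin (n - 1) → ℤ) (w w' : SSeq n) :
    (presSL n).dia mu w w' →ₗ[ℚ] (presS n d).dia (psiObj n d mu) w w' :=
  (twist (psiObj n d mu)).toLinearMap.restrict fun x hx =>
    twist_mem_dia (P := presSL n) (Q := presS n d) (mu := mu) (psiObj n d mu) _ hx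

/-- The functor from `U(sl_n)` to `S(n,d)` on 2-morphisms between signed sequences. -/
def psiHom (d : ℕ) (mu : Fin (n - 1) → ℤ) (w w' : SSeq n) :
    Hom2 (presSL n) mu w w' →ₗ[ℚ] Hom2 (presS n d) (psiObj n d mu) w w' :=
  Submodule.mapQ _ _ (twistD d mu w w') fun x hx => twist_mem_ker hx

theorem psiHom_mk (mu : Fin (n - 1) → ℤ) {w w' : SSeq n} (x : (presSL n).dia mu w w') :
    psiHom d mu w w' (Hom2.mk (presSL n) mu x) = Hom2.mk (presS n d) (psiObj n d mu) (twistD d mu w w' x) := rfl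

end

end Signs

end Schur


namespace Schur

open CategoryTheory Bicategory

section Coherence

variable {B : Type*} [Bicategory B] {a b c e : B}

theorem comp_assoc_of_id (f : a ⟶ b) (g : b ⟶ c) (h : c ⟶ e) (x : (f ≫ g) ≫ h ⟶ f ≫ g ≫ h) :
    𝟙 ((f ≫ g) ≫ h) ≫ 𝟙 (f ≫ g) ▷ h ≫ x ≫ f ◁ 𝟙 (g ≫ h) ≫ 𝟙 (f ≫ g ≫ h) = x := by simp

theorem comp_lunit_of_id (f : a ⟶ b) (x : 𝟙 a ≫ f ⟶ f) : 𝟙 (𝟙 a ≫ f) ≫ 𝟙 (𝟙 a) ▷ f ≫ x = x := by simp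

theorem comp_runit_of_id (f : a ⟶ b) (x : f ≫ 𝟙 b ⟶ f) : 𝟙 (f ≫ 𝟙 b) ≫ f ◁ 𝟙 (𝟙 b) ≫ x = x := by simp

end Coherence

section Psi

variable {n d : ℕ}

noncomputable section

variable {a b c e : Obj (presSL n)}

/-- The object assigned to a weight. -/
abbrev po (n d : ℕ) (a : Obj (presSL n)) : Obj (presS n d) := ⟨psiObj n d a.wt⟩

/-- The 1-morphism assigned to a shifted signed sequence. -/
def pf (d : ℕ) (f : a ⟶ b) : po n d a ⟶ po n d b :=
  ⟨OneMor.word f, OneMor.shift f, (psiObj_wt n d a.wt (OneMor.word f)).symm.trans (congrArg (psiObj n d) (OneMor.eq f))⟩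

/-- The 2-morphism assigned to a 2-morphism between signed sequences. -/
def pf₂ (d : ℕ) {f g : a ⟶ b} (η : f ⟶ g) : pf d f ⟶ pf d g :=
  psiHom d a.wt (OneMor.word f) (OneMor.word g) η

theorem pf₂_add {f g : a ⟶ b} (η θ : f ⟶ g) : pf₂ d (η + θ) = pf₂ d η + pf₂ d θ :=
  map_add (psiHom d a.wt (OneMor.word f) (OneMor.word g)) η θ

theorem pf₂_zero (f g : a ⟶ b) : pf₂ d (0 : f ⟶ g) = 0 :=
  map_zero (psiHom d a.wt (OneMor.word f) (OneMor.word g))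

theorem pf₂_sum {f g : a ⟶ b} {ι : Type*} (s : Finset ι) (η : ι → (f ⟶ g)) :
    pf₂ d (∑ i ∈ s, η i) = ∑ i ∈ s, pf₂ d (η i) :=
  map_sum (AddMonoidHom.mk' (pf₂ d) pf₂_add) η s

theorem pf₂_id (f : a ⟶ b) : pf₂ d (𝟙 f) = 𝟙 (pf d f) :=
  Hom2.mk_eq (P := presS n d) (map_one (twist _))

theorem pf₂_comp {f g h : a ⟶ b} (η : f ⟶ g) (θ : g ⟶ h) : pf₂ d (η ≫ θ) = pf₂ d η ≫ pf₂ d θ := by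
  induction η using Hom2.ind with | h x => ?_
  induction θ using Hom2.ind with | h y => ?_
  exact Hom2.mk_eq (P := presS n d) (map_mul (twist _) _ _)

theorem pf₂_whiskerRight {f g : a ⟶ b} (η : f ⟶ g) (h : b ⟶ c) : pf₂ d (η ▷ h) = pf₂ d η ▷ pf d h := by
  induction η using Hom2.ind with | h x => ?_
  refine Hom2.mk_eq (P := presS n d) ?_
  have := twist_whisk d (psiObj n d a.wt) (OneMor.word h) [] x.1
  rw [Pres.wt, add_zero] at this
  exact this

theorem pf₂_whiskerLeft (f : a ⟶ b) {g h : b ⟶ c} (η : g ⟶ h) : pf₂ d (f ◁ η) = pf d f ◁ pf₂ d η := by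
  induction η using Hom2.ind with | h x => ?_
  refine Hom2.mk_eq (P := presS n d) ?_
  have := twist_whisk d (psiObj n d a.wt) [] (OneMor.word f) x.1
  rw [← psiObj_wt, OneMor.eq f] at this
  exact this

theorem pf₂_hc {f f' : a ⟶ b} {g g' : b ⟶ c} (α : f ⟶ f') (β : g ⟶ g') :
    pf₂ d (AddEnv.hc α β) = AddEnv.hc (pf₂ d α) (pf₂ d β) := by
  rw [AddEnv.hc]
  refine (pf₂_comp _ _).trans ?_
  rw [pf₂_whiskerRight, pf₂_whiskerLeft]; rfl

theorem pf₂_associator (f : a ⟶ b) (g : b ⟶ c) (h : c ⟶ e) :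
    pf₂ d (α_ f g h).hom = (α_ (pf d f) (pf d g) (pf d h)).hom :=
  Hom2.mk_eq (P := presS n d) (map_one (twist _))

theorem pf₂_leftUnitor (f : a ⟶ b) : pf₂ d (λ_ f).hom = (λ_ (pf d f)).hom :=
  Hom2.mk_eq (P := presS n d) (map_one (twist _))

theorem pf₂_rightUnitor (f : a ⟶ b) : pf₂ d (ρ_ f).hom = (ρ_ (pf d f)).hom :=
  Hom2.mk_eq (P := presS n d) (map_one (twist _))

/-- The formal direct sum assigned to a formal direct sum. -/
abbrev PM (d : ℕ) (f : Mat_ (a ⟶ b)) : Mat_ (po n d a ⟶ po n d b) where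
  ι := f.ι
  X i := pf d (f.X i)

/-- The matrix assigned to a matrix of 2-morphisms. -/
def PM₂ (d : ℕ) {f g : Mat_ (a ⟶ b)} (A : f ⟶ g) : PM d f ⟶ PM d g :=
  AddEnv.ofEnt (F := PM d f) (G := PM d g) fun i j => pf₂ d (AddEnv.ent A i j)

theorem PM₂_perm {f g : Mat_ (a ⟶ b)} {A : f ⟶ g} {e : f.ι → g.ι} {φ : ∀ i, f.X i ⟶ g.X (e i)}
    (h : AddEnv.IsPerm A e φ) :
    AddEnv.IsPerm (F := PM d f) (G := PM d g) (PM₂ d A) e fun i => pf₂ d (φ i) :=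
  ⟨fun i => congrArg (pf₂ d) (h.1 i), fun i j hij => (congrArg (pf₂ d) (h.2 i j hij)).trans (pf₂_zero _ _)⟩

theorem PM₂_id (f : Mat_ (a ⟶ b)) : PM₂ d (𝟙 f) = 𝟙 (PM d f) :=
  (PM₂_perm (AddEnv.isPerm_id f)).ext (AddEnv.isPerm_id (PM d f)) fun i => pf₂_id (f.X i)

theorem PM₂_comp {f g h : Mat_ (a ⟶ b)} (A : f ⟶ g) (A' : g ⟶ h) :
    PM₂ d (A ≫ A') = PM₂ d A ≫ PM₂ d A' := by
  refine AddEnv.ent_ext (F := PM d f) (G := PM d h) fun i k => ?_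
  refine Eq.trans ?_ (AddEnv.ent_comp (PM₂ d A) (PM₂ d A') i k).symm
  refine (congrArg (pf₂ d) (AddEnv.ent_comp A A' i k)).trans ?_
  rw [pf₂_sum]
  exact Finset.sum_congr rfl fun j _ => pf₂_comp _ _

theorem PM₂_hcM {f f' : Mat_ (a ⟶ b)} {g g' : Mat_ (b ⟶ c)} (A : f ⟶ f') (A' : g ⟶ g') :
    PM₂ d (AddEnv.hcM A A') = AddEnv.hcM (PM₂ d A) (PM₂ d A') :=
  AddEnv.ent_ext (F := AddEnv.comp1 (PM d f) (PM d g)) (G := AddEnv.comp1 (PM d f') (PM d g'))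
    fun p q => pf₂_hc (AddEnv.ent A p.1 q.1) (AddEnv.ent A' p.2 q.2)

theorem PM₂_wl (f : Mat_ (a ⟶ b)) {g h : Mat_ (b ⟶ c)} (A : g ⟶ h) :
    PM₂ d (AddEnv.wl f A) = AddEnv.wl (PM d f) (PM₂ d A) :=
  (PM₂_hcM (𝟙 f) A).trans (congrArg (fun s => AddEnv.hcM s (PM₂ d A)) (PM₂_id f))

theorem PM₂_wr {f g : Mat_ (a ⟶ b)} (A : f ⟶ g) (h : Mat_ (b ⟶ c)) :
    PM₂ d (AddEnv.wr A h) = AddEnv.wr (PM₂ d A) (PM d h) :=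
  (PM₂_hcM A (𝟙 h)).trans (congrArg (fun s => AddEnv.hcM (PM₂ d A) s) (PM₂_id h))

theorem PM₂_assoc (f : Mat_ (a ⟶ b)) (g : Mat_ (b ⟶ c)) (h : Mat_ (c ⟶ e)) :
    PM₂ d (AddEnv.assoc f g h).hom = (AddEnv.assoc (PM d f) (PM d g) (PM d h)).hom :=
  AddEnv.IsPerm.ext (F := AddEnv.comp1 (AddEnv.comp1 (PM d f) (PM d g)) (PM d h))
    (G := AddEnv.comp1 (PM d f) (AddEnv.comp1 (PM d g) (PM d h)))
    (PM₂_perm (f := AddEnv.comp1 (AddEnv.comp1 f g) h) (g := AddEnv.comp1 f (AddEnv.comp1 g h))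
      (AddEnv.isPerm_perm _ _)) (AddEnv.isPerm_perm _ _) fun p => pf₂_associator _ _ _

theorem PM₂_lunit (f : Mat_ (a ⟶ b)) : PM₂ d (AddEnv.lunit f).hom = (AddEnv.lunit (PM d f)).hom :=
  AddEnv.IsPerm.ext (F := AddEnv.comp1 (AddEnv.one1 (po n d a)) (PM d f)) (G := PM d f)
    (PM₂_perm (f := AddEnv.comp1 (AddEnv.one1 a) f) (g := f) (AddEnv.isPerm_perm _ _))
    (AddEnv.isPerm_perm _ _) fun p => pf₂_leftUnitor _

theorem PM₂_runit (f : Mat_ (a ⟶ b)) : PM₂ d (AddEnv.runit f).hom = (AddEnv.runit (PM d f)).hom :=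
  AddEnv.IsPerm.ext (F := AddEnv.comp1 (PM d f) (AddEnv.one1 (po n d b))) (G := PM d f)
    (PM₂_perm (f := AddEnv.comp1 f (AddEnv.one1 b)) (g := f) (AddEnv.isPerm_perm _ _))
    (AddEnv.isPerm_perm _ _) fun p => pf₂_rightUnitor _

/-- The pseudofunctor from `U(sl_n)` to `S(n,d)`. -/
def psiFunctor (n d : ℕ) : Pseudofunctor (AddEnv (Obj (presSL n))) (AddEnv (Obj (presS n d))) where
  obj a := ⟨po n d a.obj⟩
  map f := PM d f
  map₂ η := PM₂ d η
  map₂_id f := PM₂_id f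
  map₂_comp η θ := PM₂_comp η θ
  mapId a := Iso.refl (AddEnv.one1 (po n d a.obj))
  mapComp f g := Iso.refl (AddEnv.comp1 (PM d f) (PM d g))
  map₂_whisker_left f g h η :=
    (PM₂_wl f η).trans ((Category.id_comp _).trans (Category.comp_id _)).symm
  map₂_whisker_right η h :=
    (PM₂_wr η h).trans ((Category.id_comp _).trans (Category.comp_id _)).symm
  map₂_associator {a b c e} f g h := (PM₂_assoc f g h).trans
    (comp_assoc_of_id (B := AddEnv (Obj (presS n d))) (a := ⟨po n d a.obj⟩) (b := ⟨po n d b.obj⟩)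
      (c := ⟨po n d c.obj⟩) (e := ⟨po n d e.obj⟩) (PM d f) (PM d g) (PM d h) _).symm
  map₂_left_unitor {a b} f := (PM₂_lunit f).trans
    (comp_lunit_of_id (B := AddEnv (Obj (presS n d))) (a := ⟨po n d a.obj⟩) (b := ⟨po n d b.obj⟩)
      (PM d f) _).symm
  map₂_right_unitor {a b} f := (PM₂_runit f).trans
    (comp_runit_of_id (B := AddEnv (Obj (presS n d))) (a := ⟨po n d a.obj⟩) (b := ⟨po n d b.obj⟩)
      (PM d f) _).symm

/-- The matrix assigned to a matrix of 2-morphisms. -/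
def psiFunctor₂ {a b : AddEnv (Obj (presSL n))} {f g : a ⟶ b} (η : f ⟶ g) :
    (psi n d).map f ⟶ (psi n d).map g := PM₂ d η

theorem psiFunctor_eq (n d : ℕ) :
    (psiFunctor n d).toPrelaxFunctorStruct = ⟨psi n d, psiFunctor₂⟩ := rfl

theorem psiFunctor₂_isPsi : IsPsi (n := n) (d := d) psiFunctor₂ := by
  intro a b f g M i j x hx
  have h := cls_eq (P := presS n d) (twistD d a.obj.wt (f.X i).word (g.X j).word x).2
  refine Eq.trans ?_ h.symm
  exact congrArg (psiHom d a.obj.wt (f.X i).word (g.X j).word) hx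

end

end Psi

end Schur


namespace Schur

open CategoryTheory MvPolynomial

section Gamma

variable {n d : ℕ}

noncomputable section

/-! ### Crossings on monomials -/

theorem sum_pow_mul_sub {R : Type*} [CommRing R] (x y : R) (N : ℕ) : ∀ m ≤ N,
    (∑ f ∈ Finset.range m, x ^ (N - 1 - f) * y ^ f) * (x - y) = x ^ N - x ^ (N - m) * y ^ m := by
  intro m
  induction m with
  | zero => simp
  | succ m ih =>
    intro hm
    obtain ⟨k, rfl⟩ : ∃ k, N = m + 1 + k := ⟨N - (m + 1), by omega⟩
    rw [Finset.sum_range_succ, add_mul, ih (by omega), show m + 1 + k - 1 - m = k by omega,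
      show m + 1 + k - m = k + 1 by omega, show m + 1 + k - (m + 1) = k by omega]
    ring

theorem X_sub_X_ne_zero : (X 0 - X 1 : MvPolynomial (Fin 2) ℚ) ≠ 0 :=
  sub_ne_zero.2 (X_injective.ne (by decide))

theorem swp_monomial (a b : ℕ) : swp (X 0 ^ a * X 1 ^ b) = X 0 ^ b * X 1 ^ a := by
  simp [swp, mul_comm]

theorem dd_monomial (a b : ℕ) : dd 0 1 (X 0 ^ a * X 1 ^ b : MvPolynomial (Fin 2) ℚ) =
    ∑ f ∈ Finset.range a, X 0 ^ (a + b - 1 - f) * X 1 ^ f -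
      ∑ g ∈ Finset.range b, X 0 ^ (a + b - 1 - g) * X 1 ^ g := by
  refine mul_right_cancel₀ X_sub_X_ne_zero ?_
  rw [dd_mul, sub_mul, sum_pow_mul_sub _ _ _ _ (Nat.le_add_right a b),
    sum_pow_mul_sub _ _ _ _ (Nat.le_add_left b a)]
  have := swp_monomial a b
  rw [swp] at this
  rw [this, Nat.add_sub_cancel_left, Nat.add_sub_cancel]
  ring

theorem dd_swap (Q : MvPolynomial (Fin 2) ℚ) : dd 1 0 Q = - dd 0 1 Q := by
  refine mul_right_cancel₀ X_sub_X_ne_zero ?_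
  have h := dd_mul 1 0 Q
  rw [Equiv.swap_comm, ← dd_mul 0 1 Q] at h
  linear_combination -h

theorem klCross_eq {L nu : Fin n → ℤ} (s : Bool) (i j : Fin (n - 1)) (v : SSeq n)
    (hnu : nu = L + (presS n d).wt ((s, j) :: (s, i) :: v)) (a b : ℕ)
    (m : bimW d L (L + (presS n d).wt v) v) :
    cns2 (nu := nu) (s, j) (s, i) v (crossPoly s i j (X 0 ^ a * X 1 ^ b)) m = klCross s i j v a b m := by
  obtain ⟨K, _, _, z, hz⟩ := exists_generic d
  refine ev_ext hz hnu fun c ys hc hys => ?_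
  obtain ⟨xu, xv, rfl, hv, hu⟩ := Valid.exists_split (u := [(s, j), (s, i)]) hys
  obtain ⟨x, y, rfl⟩ := List.length_eq_two.1 hu.length_eq
  have hys' : Valid c ((s, j) :: (s, i) :: v) (x :: y :: xv) := hys
  have e1 := ev_cns2 (z := z) hc hnu (crossPoly s i j (X 0 ^ a * X 1 ^ b)) m hys'
  have e2 := fun k l => ev_mon (z := z) hc hnu k l m hys'
  refine e1.trans ?_
  change _ = ev z c L nu ((s, j) :: (s, i) :: v) (klCross s i j v a b m) (x :: y :: xv)
  rw [klCross, crossPoly]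
  split_ifs with h1 h2
  · simp only [one_smul, dd_monomial, map_sub, map_sum, Pi.sub_apply, Finset.sum_apply, e2, map_mul, map_pow,
      aeval_X, sub_mul, Finset.sum_mul]
    rfl
  · simp only [dd_swap, dd_monomial, map_sub, map_sum, Pi.sub_apply, Finset.sum_apply, e2, map_mul, map_pow,
      aeval_X, sub_mul, Finset.sum_mul, neg_smul, one_smul, map_neg, Pi.neg_apply, neg_mul]
    rfl
  · rw [swp_monomial]
    simp only [map_sub, Pi.sub_apply, e2, map_mul, map_pow, aeval_X]
    simp only [Matrix.cons_val_zero, Matrix.cons_val_one]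
    ring
  · rw [swp_monomial]
    simp only [map_sub, Pi.sub_apply, e2, map_mul, map_pow, aeval_X]
    simp only [Matrix.cons_val_zero, Matrix.cons_val_one]
    ring
  · rw [swp_monomial]
    simp only [e2, map_mul, map_pow, aeval_X]
    rfl

/-! ### Caps on monomials -/

theorem hZ_inv {mu : Fin n → ℤ} (hmu : Good d mu) (i : ℕ) (k : ℤ) {ρ : Equiv.Perm (Fin d)}
    (hρ : std mu ∘ ρ = std mu) : rename ρ (hZ (d := d) mu i k) = hZ mu i k := by
  rw [hZ]
  split_ifs
  · exact hB_inv hmu i _ hρ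
  · exact map_zero _

theorem aeval_hZ {K : Type} [Field K] [CharZero K] {z : Fin d → K} {c : Fin d → ℕ} {mu : Fin n → ℤ}
    (hmu : Good d mu) {σ : Equiv.Perm (Fin d)} (hσ : c ∘ σ = std mu) (i : ℕ) (k : ℤ) :
    aeval (z ∘ σ) (hZ mu i k) = cz (hSer z (blk c i)) k := by
  rw [hZ, cz]
  split_ifs
  · exact aeval_hB hmu hσ i _
  · exact map_zero _

variable {L : Fin n → ℤ}

theorem realizes_lcap_mon (i : Fin (n - 1)) (v : SSeq n) (a b : ℕ)
    (m : bimW d L (L + (presS n d).wt v) v) :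
    Realizes (sg (en (L + (presS n d).wt v) (i.val + 1) + 1) • lay [] (.lcap i) v)
      (mon (nu := L + (presS n d).wt v) (dn i) (up i) v a b m)
      ((bimW d L (L + (presS n d).wt v) v).l (ofR (hZ (L + (presS n d).wt v) (i.val + 1)
        (a + b + 1 - en (L + (presS n d).wt v) (i.val + 1)))) m) := by
  intro K _ _ z hz c hc ys hys
  obtain ⟨l, xv, rfl, h2, h3, e⟩ := rho_lay_cons z c (.lcap i) v
    (ev z c L _ _ (mon (nu := L + (presS n d).wt v) (dn i) (up i) v a b m)) hys
  obtain rfl := List.length_eq_zero_iff.1 h3.length_eq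
  have hw : HasWt (col c v xv) (L + (presS n d).wt v) := hc.col (D := d) h2
  obtain ⟨σ, hσ⟩ := hw.exists_perm
  rw [rho_smul, LinearMap.smul_apply, Pi.smul_apply, e, genop_lcap]
  refine (ev_l v _ m xv).trans ?_
  rw [rv_ofR hw.good (fun ρ hρ => hZ_inv hw.good _ _ hρ) hσ, aeval_hZ hw.good hσ, (hw.bar i).2.1]
  have hs := sum_div_eq_cz_hSer z (blk (col c v xv) (i.val + 1)) hz.injOn (a + b)
  rw [Nat.cast_add] at hs
  rw [← hs, Finset.sum_mul, Algebra.smul_def, Finset.mul_sum]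
  refine Finset.sum_congr rfl fun x hx => ?_
  have hx' := hx
  rw [mem_blk] at hx
  have e3 := ev_mon (z := z) hc (wt_dn_up d L i v).symm a b m (x := x) (y := x) (ys := xv)
    (by simp [h2, Letter.old, Letter.new, hx])
  refine Eq.trans ?_ (congrArg (fun s => algebraMap ℚ K _ * (s / _)) e3.symm)
  have e4 : ∏ u ∈ (blk (col c v xv) (i.val + 1)).erase x, (z u - z x) =
      (-1) ^ ((blk (col c v xv) (i.val + 1)).erase x).card *
        ∏ u ∈ (blk (col c v xv) (i.val + 1)).erase x, (z x - z u) := by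
    rw [← Finset.prod_const, ← Finset.prod_mul_distrib]
    exact Finset.prod_congr rfl fun u _ => by ring
  have e5 : algebraMap ℚ K (sg (((blk (col c v xv) (i.val + 1)).card : ℤ) + 1)) =
      (-1) ^ ((blk (col c v xv) (i.val + 1)).erase x).card := by
    rw [← Finset.card_erase_add_one hx']
    refine (sg_cast_succ _).trans ?_
    rw [pow_succ]; ring
  rw [e4, e5, pow_add]
  have e6 : ((-1 : K) ^ ((blk (col c v xv) (i.val + 1)).erase x).card) ≠ 0 := pow_ne_zero _ (by norm_num)
  field_simp

theorem realizes_rcap_mon (i : Fin (n - 1)) (v : SSeq n) (a b : ℕ)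
    (m : bimW d L (L + (presS n d).wt v) v) :
    Realizes (lay [] (.rcap i) v) (mon (nu := L + (presS n d).wt v) (up i) (dn i) v a b m)
      ((bimW d L (L + (presS n d).wt v) v).l (ofR (hZ (L + (presS n d).wt v) i.val
        (a + b + 1 - en (L + (presS n d).wt v) i.val))) m) := by
  intro K _ _ z hz c hc ys hys
  obtain ⟨l, xv, rfl, h2, h3, e⟩ := rho_lay_cons z c (.rcap i) v
    (ev z c L _ _ (mon (nu := L + (presS n d).wt v) (up i) (dn i) v a b m)) hys
  obtain rfl := List.length_eq_zero_iff.1 h3.length_eq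
  have hw : HasWt (col c v xv) (L + (presS n d).wt v) := hc.col (D := d) h2
  obtain ⟨σ, hσ⟩ := hw.exists_perm
  rw [e, genop_rcap]
  refine (ev_l v _ m xv).trans ?_
  rw [rv_ofR hw.good (fun ρ hρ => hZ_inv hw.good _ _ hρ) hσ, aeval_hZ hw.good hσ, (hw.bar i).1]
  have hs := sum_div_eq_cz_hSer z (blk (col c v xv) i.val) hz.injOn (a + b)
  rw [Nat.cast_add] at hs
  rw [← hs, Finset.sum_mul]
  refine Finset.sum_congr rfl fun x hx => ?_
  rw [mem_blk] at hx
  have e3 := ev_mon (z := z) hc (wt_up_dn d L i v).symm a b m (x := x) (y := x) (ys := xv)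
    (by simp [h2, Letter.old, Letter.new, hx])
  refine Eq.trans ?_ (congrArg (fun s => s / _) e3.symm)
  rw [pow_add, div_mul_eq_mul_div]

/-! ### The functor on `U(sl_n)` -/

/-- The bimodule maps of the 2-morphisms of `U(sl_n)`. -/
def omSL (n d : ℕ) : Real2 (presSL n) d (psiObj n d) := fun lam nu nu' w w' =>
  om (psiObj n d lam) nu nu' w w' ∘ₗ psiHom d lam w w'

theorem psiHom_cls (lam : Fin (n - 1) → ℤ) {w w' : SSeq n} {x : Alg n}
    (hx : x ∈ (presSL n).dia lam w w') :
    psiHom d lam w w' (Hom2.cls (presSL n) lam w w' x) =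
      Hom2.cls (presS n d) (psiObj n d lam) w w' (twist (psiObj n d lam) x) := by
  rw [cls_eq hx, psiHom_mk]
  exact (cls_eq (P := presS n d) (twistD d lam w w' ⟨x, hx⟩).2).symm

theorem genAct_omSL (lam : Fin (n - 1) → ℤ) (g : Gen n) (v : SSeq n) (nu : Fin n → ℤ) :
    genAct (omSL n d) lam g v nu = om (psiObj n d lam) nu nu (g.src ++ v) (g.tgt ++ v)
      (Hom2.cls (presS n d) (psiObj n d lam) (g.src ++ v) (g.tgt ++ v)
        (layerSign (psiObj n d lam) ⟨[], g, v⟩ • lay [] g v)) := by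
  refine (congrArg (om (psiObj n d lam) nu nu (g.src ++ v) (g.tgt ++ v))
    (psiHom_cls (d := d) lam (layer_mem_dia (P := presSL n) lam [] g v))).trans ?_
  rw [twist_lay]

theorem cls_smul {P : Pres n} (lam : P.W) {w w' : SSeq n} {x : Alg n} (hx : x ∈ P.dia lam w w') (q : ℚ) :
    Hom2.cls P lam w w' (q • x) = q • Hom2.cls P lam w w' x := by
  rw [cls_eq hx, cls_eq (Submodule.smul_mem _ q hx)]
  exact map_smul (Hom2.mk P lam) q ⟨x, hx⟩

theorem genAct_omSL_smul (lam : Fin (n - 1) → ℤ) (g : Gen n) (v : SSeq n) (nu : Fin n → ℤ) :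
    genAct (omSL n d) lam g v nu =
      layerSign (psiObj n d lam) ⟨[], g, v⟩ • genAct (om (n := n) (d := d)) (psiObj n d lam) g v nu := by
  have h : lay [] g v ∈ (presS n d).dia (psiObj n d lam) (g.src ++ v) (g.tgt ++ v) :=
    layer_mem_dia (P := presS n d) (psiObj n d lam) [] g v
  rw [genAct_omSL, cls_smul (P := presS n d) (psiObj n d lam) h]
  exact map_smul (om (psiObj n d lam) nu nu (g.src ++ v) (g.tgt ++ v)) _ _

theorem omSL_leftStrand : LeftStrand (omSL n d) := by
  intro lam a w w' x p m
  refine Eq.trans ?_ (om_leftStrand (psiObj n d lam) a w w' (psiHom d lam w w' x) p m)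
  have : psiHom d lam (a :: w) (a :: w') (Hom2.whisk [a] [] (by simp [Pres.wt]) x (by simp) (by simp)) =
      Hom2.whisk [a] [] (by simp [Pres.wt]) (psiHom d lam w w' x) (by simp) (by simp) := by
    induction x using Hom2.ind with | h x => ?_
    refine Hom2.mk_eq (P := presS n d) ?_
    have := twist_whisk d (psiObj n d lam) [a] [] x.1
    rw [Pres.wt, add_zero] at this
    exact this
  exact congrArg (fun s => om (psiObj n d lam) _ _ (a :: w) (a :: w') s (cns a w p m)) this

theorem neg_one_pow_sub {N l : ℕ} (h : l ≤ N) : (-1 : ℚ) ^ (N - l) = (-1) ^ N * (-1) ^ l := by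
  obtain ⟨k, rfl⟩ := Nat.exists_eq_add_of_le h
  have : ((-1 : ℚ) ^ l) * (-1) ^ l = 1 := by rw [← mul_pow]; norm_num
  rw [Nat.add_sub_cancel_left, pow_add]
  linear_combination -((-1 : ℚ) ^ k) * this

theorem neg_one_pow_smul_sum {V : Type*} [AddCommGroup V] [Module ℚ V] (N : ℕ) (f : ℕ → V) :
    (-1 : ℚ) ^ N • ∑ l ∈ Finset.range (N + 1), (-1 : ℚ) ^ l • f l =
      ∑ l ∈ Finset.range (N + 1), (-1 : ℚ) ^ (N - l) • f l := by
  rw [Finset.smul_sum]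
  refine Finset.sum_congr rfl fun l hl => ?_
  rw [smul_smul, neg_one_pow_sub (by simpa [Nat.lt_succ_iff] using hl)]

theorem omSL_klGen (lam : Fin (n - 1) → ℤ) : KLGen (psiObj n d lam) (genAct (omSL n d) lam) := by
  have hF := om_fgen (d := d) (psiObj n d lam)
  constructor
  · intro a v k m
    rw [genAct_omSL_smul, show layerSign (psiObj n d lam) ⟨[], .dot a, v⟩ = 1 from rfl, one_smul]
    refine (hF.dot a v _ m).trans ?_
    rw [pow_succ']
  · intro s i j v a b m
    rw [genAct_omSL_smul, show layerSign (psiObj n d lam) ⟨[], .cross s i j, v⟩ = 1 from rfl, one_smul,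
      ← cns2_monomial]
    exact (hF.cross s i j v _ m).trans (klCross_eq s i j v (wt_swap d _ _ _ v) a b m)
  · intro i v mu m hmu
    rw [genAct_omSL_smul, show layerSign (psiObj n d lam) ⟨[], .rcup i, v⟩ = 1 from rfl, one_smul]
    refine (hF.rcup i v mu m hmu).trans ?_
    rw [← Finset.sum_range_reflect]
    refine Finset.sum_congr rfl fun l hl => ?_
    have hl' : l ≤ (en mu i.val).toNat := by simpa [Nat.lt_succ_iff] using hl
    rw [show (en mu i.val).toNat + 1 - 1 - l = (en mu i.val).toNat - l by omega, Nat.sub_sub_self hl']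
  · intro i v mu m hmu
    by_cases hg : Good d mu
    · rw [genAct_omSL_smul]
      refine (congrArg (layerSign (psiObj n d lam) ⟨[], .lcup i, v⟩ • ·) (hF.lcup i v mu m hmu)).trans ?_
      have hs : layerSign (psiObj n d lam) ⟨[], .lcup i, v⟩ = (-1) ^ (en mu (i.val + 1)).toNat := by
        have h0 := en_nonneg hg (i.val + 1)
        rw [← sg_eq, Int.toNat_of_nonneg h0, hmu, wt_indep d 0]
        rfl
      rw [hs]
      exact neg_one_pow_smul_sum (V := bimW d (psiObj n d lam) (psiObj n d lam + (presS n d).wt v)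
        (up i :: dn i :: v)) _ _
    · have hg' : ¬ Good d (psiObj n d lam + (presS n d).wt v) := hmu ▸ hg
      exact (bimW_eq_zero_of_left hg' (up i :: dn i :: v) _).trans
        (bimW_eq_zero_of_left hg' (up i :: dn i :: v) _).symm
  · intro i v mu a b m hmu
    subst hmu
    rw [genAct_omSL]
    have hs : layerSign (psiObj n d lam) ⟨[], .lcap i, v⟩ =
        sg (en (psiObj n d lam + (presS n d).wt v) (i.val + 1) + 1) := by
      rw [wt_indep d 0]; rfl
    rw [hs]
    exact om_cls (Submodule.smul_mem _ _ (layer_mem_dia (P := presS n d) _ [] (.lcap i) v))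
      (wt_dn_up d _ i v).symm rfl (realizes_lcap_mon i v a b m)
  · intro i v mu a b m hmu
    subst hmu
    rw [genAct_omSL_smul, show layerSign (psiObj n d lam) ⟨[], .rcap i, v⟩ = 1 from rfl, one_smul]
    exact om_cls (layer_mem_dia (P := presS n d) _ [] (.rcap i) v) (wt_up_dn d _ i v).symm rfl
      (realizes_rcap_mon i v a b m)

/-- The pseudofunctor from `U(sl_n)` to bimodules. -/
def gamFunctor (n d : ℕ) : Pseudofunctor (AddEnv (Obj (presSL n))) GAlg :=
  (psiFunctor n d).comp (bimFunctor n d)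

/-- The bimodule map of a matrix of 2-morphisms of `U(sl_n)`. -/
def gamFunctor₂ {a b : AddEnv (Obj (presSL n))} {f g : a ⟶ b} (η : f ⟶ g) :
    (gam n d).map f ⟶ (gam n d).map g := bimFunctor₂ (psiFunctor₂ (d := d) η)

theorem gamFunctor_eq (n d : ℕ) :
    (gamFunctor n d).toPrelaxFunctorStruct = ⟨gam n d, gamFunctor₂⟩ := rfl

theorem gamFunctor₂_isMat : IsMat (P := presSL n) (d := d) (e := psiObj n d) gamFunctor₂ (omSL n d) :=
  fun M x j => bimFunctor₂_isMat (psiFunctor₂ (d := d) M) x j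

end

end Gamma

end Schur

open CategoryTheory Schur in
theorem mainTheorem5 (n d : ℕ) (hn : 1 < n) (hd : 0 < d) :
    ∃ (F : Pseudofunctor (AddEnv (Obj (presS n d))) GAlg)
      (F₂ : ∀ {a b : AddEnv (Obj (presS n d))} {f g : a ⟶ b}, (f ⟶ g) →
        ((fbim n d).map f ⟶ (fbim n d).map g)),
      F.toPrelaxFunctorStruct = ⟨fbim n d, F₂⟩ ∧
      (∀ {a b : AddEnv (Obj (presS n d))} {f g : a ⟶ b} (η θ : f ⟶ g), F₂ (η + θ) = F₂ η + F₂ θ) ∧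
      (∀ {a b c : AddEnv (Obj (presS n d))} (f : a ⟶ b) (g : b ⟶ c),
        GBim.fn (F.mapComp f g).hom ∈ homDeg _ _ 0) ∧
      (∀ a : AddEnv (Obj (presS n d)), GBim.fn (F.mapId a).hom ∈ homDeg _ _ 0) ∧
      (∃ om : Real2 (presS n d) d id, IsMat F₂ om ∧ LeftStrand om ∧
        ∀ lam : Fin n → ℤ, FGen lam (genAct om lam) ∧ Sideways om lam ∧ BubbleVal om lam ∧
          Homog om lam) ∧
      ∃ (Ps : Pseudofunctor (AddEnv (Obj (presSL n))) (AddEnv (Obj (presS n d))))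
        (Ps₂ : ∀ {a b : AddEnv (Obj (presSL n))} {f g : a ⟶ b}, (f ⟶ g) →
          ((psi n d).map f ⟶ (psi n d).map g))
        (Ga : Pseudofunctor (AddEnv (Obj (presSL n))) GAlg)
        (Ga₂ : ∀ {a b : AddEnv (Obj (presSL n))} {f g : a ⟶ b}, (f ⟶ g) →
          ((gam n d).map f ⟶ (gam n d).map g)),
        Ps.toPrelaxFunctorStruct = ⟨psi n d, Ps₂⟩ ∧ IsPsi Ps₂ ∧
        Ga.toPrelaxFunctorStruct = ⟨gam n d, Ga₂⟩ ∧
        (∃ om : Real2 (presSL n) d (psiObj n d), IsMat Ga₂ om ∧ LeftStrand om ∧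
          ∀ lam : Fin (n - 1) → ℤ, KLGen (psiObj n d lam) (genAct om lam)) ∧
        ∀ {a b : AddEnv (Obj (presSL n))} {f g : a ⟶ b} (η : f ⟶ g), Ga₂ η = F₂ (Ps₂ η) :=
  ⟨bimFunctor n d, bimFunctor₂, bimFunctor_eq n d, bimFunctor₂_add, bimFunctor_mapComp_mem,
    bimFunctor_mapId_mem,
    ⟨om, bimFunctor₂_isMat, om_leftStrand, fun lam => ⟨om_fgen lam, om_sideways lam, om_bubbleVal lam,
      om_homog lam⟩⟩,
    psiFunctor n d, psiFunctor₂, gamFunctor n d, gamFunctor₂, psiFunctor_eq n d, psiFunctor₂_isPsi,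
    gamFunctor_eq n d, ⟨omSL n d, gamFunctor₂_isMat, omSL_leftStrand, omSL_klGen⟩, fun _ => rfl⟩
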